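/- **Setting.** Let $\mathbb H=L^2[0,1]$ with its usual inner product, let $\psi_1=1$, $\psi_{2i}(t)=\sqrt2\cos(2\pi i t)$, $\psi_{2i+1}(t)=\sqrt2\sin(2\pi i t)$ $(i\ge 1)$ and $[f]_j=\langle f,\psi_j\rangle$. For a positive sequence $w=(w_j)_{j\ge1}$ let $\mathcal F_w$ be the completion of $\mathbb H$ under $\|f\|_w^2=\sum_j w_j[f]_j^2$ (its elements are identified with their coefficient sequences) and $\mathcal F_w^r=\{\|f\|_w^2\le r\}$. For $h\in\mathcal F_{1/\gamma}$ and $\beta\in\mathcal F_\gamma$ put $\ell_h(\beta)=\sum_j[h]_j[\beta]_j$. Write $u_j\asymp v_j$ if $v_j/C\le u_j\le Cv_j$ for all $j\ge1$ and some $C\ge 1$, and $u_n\sim v_n$ if such bounds hold for all large $n$. *Model.* One observes an i.i.d. sample $(Y_i,X_i)_{1\le i\le n}$ of $Y=\langle\beta,X\rangle+\sigma\epsilon$, $\sigma>0$, where $X$ is a centered random element of $\mathbb H$ with $E\|X\|^2<\infty$ and covariance operator $T=E[\langle\cdot,X\rangle X]$, and $\epsilon$ is real, centered, of variance one and uncorrelated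 with $X$. Fix $d,\eta\ge1$, $\rho,\tau>0$ and an integer $k\ge3$. Let $\gamma,\upsilon$ be positive sequences with $\gamma_1=\upsilon_1=1$, $\gamma$ non-decreasing, $\upsilon$ non-increasing. Assume that * $T$ is strictly positive and nuclear, and $d^{-2}\sum_j\upsilon_j^2[f]_j^2\le\|Tf\|^2\le d^2\sum_j\upsilon_j^2[f]_j^2$ for all $f\in\mathbb H$; * with $[T]_m=(\langle T\psi_l,\psi_j\rangle)_{1\le j,l\le m}$ and $[X]_m=([X]_1,\dots,[X]_m)^t$: $E\big|[X]_j/\langle T\psi_j,\psi_j\rangle^{1/2}\big|^{4k}\le\eta$ for all $j$, and $E\big|z^t[T]_m^{-1/2}[X]_m\big|^{4k}\le\eta$ for all $m\ge 1$ and all unit vectors $z\in\mathbb R^m$; * $E|\epsilon|^{4k}\le\eta$. *Rates.* For $n\ge1$ let $k_n^*$ be any maximizer over $m\ge1$ of $\min\{\upsilon_m/\gamma_m,n^{-1}\}/\max\{\upsilon_m/\gamma_m,n^{-1}\}$, and let $\alpha_n^*=\max\{\upsilon_{k_n^*}/\gamma_{k_n^*},n^{-1}\}$, $\kappa=\inf_{n\ge1}(\alpha_n^*)^{-1}\min\{\upsilon_{k_n^*}/\gamma_{k_n^*},n^{-1}\}$,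 $$\delta_n^*=\max\Big\{\alpha_n^*\sum_{j\le k_n^*}\frac{[h]_j^2}{\upsilon_j},\ \sum_{j>k_n^*}\frac{[h]_j^2}{\gamma_j}\Big\},\qquad \Delta_n^*=\alpha_n^*\max_{1\le j\le k_n^*}\frac1{\upsilon_j\omega_j}.$$ *Estimator.* Let $[\hat T]_m=\frac1n\sum_i[X_i]_m[X_i]_m^t$, $[\hat g]_m=\frac1n\sum_iY_i[X_i]_m$, $m=k_n^*$ and, when $\kappa>0$, $\alpha=\max(8d^3/(\kappa\gamma_{k_n^*}),1)$. Put $\hat\ell_h=[h]_m^t[\hat T]_m^{-1}[\hat g]_m$ if $[\hat T]_m$ is non-singular with $\|[\hat T]_m^{-1}\|\le\alpha n$ (spectral norm), and $\hat\ell_h=0$ otherwise. **Meaning of "attains the optimal rate".** For a fixed $h$: $h\in\mathcal F_{1/\gamma}$; there is a constant $C$, independent of $n$ and of the law of $(X,\epsilon)$ in the above class, with $\sup_{\beta\in\mathcal F_\gamma^\rho}E|\hat\ell_h-\ell_h(\beta)|^2\le C\,\delta_n^*$ for all $n\ge1$; and there is $c>0$, independent of $n$ and of the law of $X$, such that, when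 $\epsilon\sim N(0,1)$ is independent of $X$, every estimator $\breve\ell$ (measurable function of the sample) satisfies $\sup_{\beta\in\mathcal F_\gamma^\rho}E|\breve\ell-\ell_h(\beta)|^2\ge c\,\delta_n^*$ for all $n\ge1$. Uniformly over representers: $\mathcal F_\omega^\tau\subset\mathcal F_{1/\gamma}$ and the same holds with $\sup_{\beta\in\mathcal F_\gamma^\rho}\sup_{h\in\mathcal F_\omega^\tau}$ and $\Delta_n^*$ in place of $\sup_{\beta\in\mathcal F_\gamma^\rho}$ and $\delta_n^*$ (estimators may depend on $h$). **Proposition.** In each of the following cases, (i) for every $h$ as indicated $\hat\ell_h$ attains the optimal rate $\delta_n^*$, and (ii) for every positive sequence $\omega$ with $\omega_1=1$ as indicated $\hat\ell_h$ attains the optimal rate $\Delta_n^*$ uniformly over $\mathcal F_\omega^\tau$, where $k_n^*,\delta_n^*,\Delta_n^*$ have the stated orders. In (pep) and (epp) it is assumed that $\kappa>0$; this holds automatically if $a\le1/2$ in (pep) and if $p\le1/2$ in (epp). In (ppp) and (ppe) $\kappa>0$ always holds. * **(ppp)** $\gamma_j\asymp j^{2p}$, $p\ge0$, $\upsilon_j\asymp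 j^{-2a}$, $a>1/2$, $k\ge12$, $p+a\ge3/2$: $k_n^*\sim n^{1/(2p+2a)}$. (i) $[h]_j^2\asymp j^{-2s}$, $s>1/2-p$: $\delta_n^*\sim n^{-(2p+2s-1)/(2p+2a)}$ if $s-a<1/2$, $\sim n^{-1}\log n$ if $s-a=1/2$, $\sim n^{-1}$ if $s-a>1/2$. (ii) $\omega_j\asymp j^{2s}$, $s>-p$: $\Delta_n^*\sim\max(n^{-(p+s)/(p+a)},n^{-1})$. * **(pep)** $\gamma_j\asymp j^{2p}$, $p\ge0$, $\upsilon_j\asymp\exp(-j^{2a})$, $a>0$: $k_n^*\sim[\log(n(\log n)^{-p/a})]^{1/(2a)}$. (i) $[h]_j^2\asymp j^{-2s}$, $s>1/2-p$: $\delta_n^*\sim(\log n)^{-(2p+2s-1)/(2a)}$. (ii) $\omega_j\asymp j^{2s}$, $s>-p$: $\Delta_n^*\sim(\log n)^{-(p+s)/a}$. * **(epp)** $\gamma_j\asymp\exp(j^{2p})$, $p>0$, $\upsilon_j\asymp j^{-2a}$, $a>0$: $k_n^*\sim[\log(n(\log n)^{-a/p})]^{1/(2p)}$. (i) $[h]_j^2\asymp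 j^{-2s}$, $s\in\mathbb R$: $\delta_n^*\sim n^{-1}(\log n)^{(2a-2s+1)/(2p)}$ if $s-a<1/2$, $\sim n^{-1}\log\log n$ if $s-a=1/2$, $\sim n^{-1}$ if $s-a>1/2$. (ii) $\omega_j\asymp j^{2s}$, $s\in\mathbb R$: $\Delta_n^*\sim\max(n^{-1}(\log n)^{(a-s)/p},n^{-1})$. * **(ppe)** $\gamma_j\asymp j^{2p}$, $p\ge0$, $\upsilon_j\asymp j^{-2a}$, $a>1/2$, $k\ge12$, $p+a\ge3/2$: $k_n^*\sim n^{1/(2p+2a)}$. (i) $[h]_j^2\asymp\exp(-j^{2s})$, $s>0$: $\delta_n^*\sim n^{-1}$. (ii) $\omega_j\asymp\exp(j^{2s})$, $s>0$: $\Delta_n^*\sim n^{-1}$. *Point evaluation.* Let $t_0\in[0,1]$ and $[h]_j=\psi_j(t_0)$; in (ppp) and (pep) let also $p>1/2$. Then every $\beta\in\mathcal F_\gamma$ has a continuous version on $[0,1]$, $\ell_h(\beta)$ is its value at $t_0$, and $\hat\ell_h$ attains the optimal rate $\delta_n^*$, which is $\sim n^{-(2p-1)/(2p+2a)}$ in (ppp),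 $\sim(\log n)^{-(2p-1)/(2a)}$ in (pep) and $\sim n^{-1}(\log n)^{(2a+1)/(2p)}$ in (epp). *Averages.* Let $b\in(0,1)$ and $h=\mathbf 1_{[0,b]}$; in (epp) let also $a>1/2$. Then $\ell_h(\beta)=\int_0^b\beta(t)\,dt$ and $\hat\ell_h$ attains the optimal rate $\delta_n^*$, which is $\sim n^{-(2p+1)/(2p+2a)}$ in (ppp), $\sim(\log n)^{-(2p+1)/(2a)}$ in (pep) and $\sim n^{-1}(\log n)^{(2a-1)/(2p)}$ in (epp). -/

import Mathlib

open MeasureTheory ProbabilityTheory Set Filter Asymptotics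
open scoped ENNReal RealInnerProductSpace

noncomputable section

namespace FunctionalLinearModel

/-! ### The Hilbert space `L²[0,1]` and the trigonometric basis

All sequences are indexed by `j = 1, 2, 3, …`; the value of a sequence at `0` is never used. -/

/-- Lebesgue measure on `[0,1]`. -/
abbrev unitVolume : Measure ℝ := volume.restrict (Icc (0 : ℝ) 1)

/-- The real Hilbert space `L²[0,1]`. -/
abbrev L2 : Type := Lp ℝ 2 unitVolume

instance : MeasurableSpace L2 := borel L2

instance : BorelSpace L2 := ⟨rfl⟩

/-- `ψ₁ = 1`, `ψ_{2i}(t) = √2 cos(2π i t)`, `ψ_{2i+1}(t) = √2 sin(2π i t)` for `i ≥ 1`. -/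
def trig (j : ℕ) (t : ℝ) : ℝ :=
  if j ≤ 1 then 1
  else if Even j then √2 * Real.cos (2 * Real.pi * ((j / 2 : ℕ) : ℝ) * t)
  else √2 * Real.sin (2 * Real.pi * ((j / 2 : ℕ) : ℝ) * t)

lemma continuous_trig (j : ℕ) : Continuous (trig j) := by
  unfold trig
  split_ifs <;> fun_prop

lemma abs_trig_le (j : ℕ) (t : ℝ) : |trig j t| ≤ √2 := by
  have h2 : (1 : ℝ) ≤ √2 := Real.one_le_sqrt.2 (by norm_num)
  have h0 : (0 : ℝ) ≤ √2 := Real.sqrt_nonneg 2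
  unfold trig
  split_ifs
  · simp [h2]
  · rw [abs_mul, abs_of_nonneg h0]
    exact mul_le_of_le_one_right h0 (Real.abs_cos_le_one _)
  · rw [abs_mul, abs_of_nonneg h0]
    exact mul_le_of_le_one_right h0 (Real.abs_sin_le_one _)

lemma memLp_trig (j : ℕ) : MemLp (trig j) 2 unitVolume :=
  MemLp.of_bound (continuous_trig j).aestronglyMeasurable (√2)
    (Filter.Eventually.of_forall fun t => by simpa using abs_trig_le j t)

/-- The basis function `ψ_j` as an element of `L²[0,1]`. -/
def psi (j : ℕ) : L2 := (memLp_trig j).toLp (trig j)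

/-- The generalized Fourier coefficient `[f]_j = ⟪f, ψ_j⟫`. -/
def coef (f : L2) (j : ℕ) : ℝ := ⟪f, psi j⟫

/-- The ellipsoid `{c : ∑_{j ≥ 1} w_j c_j² ≤ r}` of coefficient sequences.  An element of the
completion of `L²[0,1]` with respect to `‖·‖_w` is identified with its sequence of coefficients. -/
def ellipsoid (w : ℕ → ℝ) (r : ℝ) : Set (ℕ → ℝ) :=
  {c | Summable (fun j => w (j + 1) * c (j + 1) ^ 2) ∧ ∑' j, w (j + 1) * c (j + 1) ^ 2 ≤ r}

/-- The ellipsoid `F_w^r` of functions in `L²[0,1]` (for weights `w` bounded away from `0`). -/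
def slopes (w : ℕ → ℝ) (r : ℝ) : Set L2 := {f | coef f ∈ ellipsoid w r}

/-- The coefficient sequence `h` belongs to `F_{1/γ}`. -/
def IsRepresenter (γ h : ℕ → ℝ) : Prop := Summable (fun j => h (j + 1) ^ 2 / γ (j + 1))

/-- The value `ℓ_h(f) = ∑_{j ≥ 1} [h]_j [f]_j` of the linear functional with representer `h`. -/
def functional (h : ℕ → ℝ) (f : L2) : ℝ := ∑' j, h (j + 1) * coef f (j + 1)

/-! ### Regressors, errors and the sample -/

/-- The matrix `[T]_m = (⟪T ψ_l, ψ_j⟫)_{1 ≤ j, l ≤ m}`. -/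
def opMatrix (T : L2 →L[ℝ] L2) (m : ℕ) : Matrix (Fin m) (Fin m) ℝ :=
  Matrix.of fun j l => ⟪T (psi (l + 1)), psi (j + 1)⟫

/-- The class `N_υ^d` of strictly positive nuclear operators with
`‖f‖²_{υ²} / d² ≤ ‖T f‖² ≤ d² ‖f‖²_{υ²}` for all `f`.  (A positive operator is nuclear if and only
if its diagonal in an orthonormal basis is summable.) -/
def linkClass (υ : ℕ → ℝ) (d : ℝ) : Set (L2 →L[ℝ] L2) :=
  {T | T.IsPositive ∧ (∀ f, f ≠ 0 → 0 < ⟪T f, f⟫) ∧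
    Summable (fun j => ⟪T (psi (j + 1)), psi (j + 1)⟫) ∧
    ∀ f : L2,
      (∑' j, υ (j + 1) ^ 2 * coef f (j + 1) ^ 2) / d ^ 2 ≤ ‖T f‖ ^ 2 ∧
      ‖T f‖ ^ 2 ≤ d ^ 2 * ∑' j, υ (j + 1) ^ 2 * coef f (j + 1) ^ 2}

/-- The class `X_η^q` of (laws of) centered random functions `X` with finite second moment such that
`E |[X]_j / [T]_{jj}^{1/2}|^q ≤ η` for all `j` and `E |∑_j z_j ([T]_m^{-1/2} [X]_m)_j|^q ≤ η` for
all `m` and all `z` with `zᵗz = 1`; `T` is the covariance operator `f ↦ E[⟪f, X⟫ X]`.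
Below `S` is the matrix `[T]_m^{-1/2}`, the positive definite one with `S² [T]_m = 1`. -/
def regressorClass (q : ℕ) (η : ℝ) : Set (Measure L2) :=
  {ν | IsProbabilityMeasure ν ∧ MemLp id 2 ν ∧ ∫ x, x ∂ν = 0 ∧
    (∀ j : ℕ, 1 ≤ j →
      ∫⁻ x, ENNReal.ofReal (|coef x j / √⟪covarianceOperator ν (psi j), psi j⟫| ^ q) ∂ν
        ≤ ENNReal.ofReal η) ∧
    (∀ (m : ℕ) (S : Matrix (Fin m) (Fin m) ℝ), S.PosDef →
      S * S * opMatrix (covarianceOperator ν) m = 1 →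
      ∀ z : Fin m → ℝ, z ⬝ᵥ z = 1 →
      ∫⁻ x, ENNReal.ofReal (|z ⬝ᵥ S.mulVec (fun j => coef x (j + 1))| ^ q) ∂ν
        ≤ ENNReal.ofReal η)}

/-- The class `E_η^q` of (laws of) centered errors with variance one and `E |ε|^q ≤ η`. -/
def errorClass (q : ℕ) (η : ℝ) : Set (Measure ℝ) :=
  {ξ | IsProbabilityMeasure ξ ∧ MemLp id 2 ξ ∧ ∫ e, e ∂ξ = 0 ∧ ∫ e, e ^ 2 ∂ξ = 1 ∧
    ∫⁻ e, ENNReal.ofReal (|e| ^ q) ∂ξ ≤ ENNReal.ofReal η}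

/-- The regressor laws in `X_η^q` whose covariance operator belongs to `N_υ^d`. -/
def linkedRegressors (υ : ℕ → ℝ) (d : ℝ) (q : ℕ) (η : ℝ) : Set (Measure L2) :=
  {ν | ν ∈ regressorClass q η ∧ covarianceOperator ν ∈ linkClass υ d}

/-- The joint laws of `(X, ε)` with `X ∈ X_η^q`, covariance operator in `N_υ^d`, `ε ∈ E_η^q`, and
`X` and `ε` uncorrelated. -/
def modelClass (υ : ℕ → ℝ) (d : ℝ) (q : ℕ) (η : ℝ) : Set (Measure (L2 × ℝ)) :=
  {μ | μ.map Prod.fst ∈ linkedRegressors υ d q η ∧ μ.map Prod.snd ∈ errorClass q η ∧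
    ∫ z, z.2 • z.1 ∂μ = 0}

/-- The observation `(X, Y)` with `Y = ⟪β, X⟫ + σ ε`. -/
def observe (β : L2) (σ : ℝ) (z : L2 × ℝ) : L2 × ℝ := (z.1, ⟪β, z.1⟫ + σ * z.2)

/-- Mean squared error `E |est - v|²` of an estimator `est` of the number `v`, computed from an
i.i.d. sample `(X₁, Y₁), …, (X_n, Y_n)` of the model with slope `β`; `μ` is the law of `(X, ε)`. -/
def mse (n : ℕ) (μ : Measure (L2 × ℝ)) (σ : ℝ) (β : L2)
    (est : (Fin n → L2 × ℝ) → ℝ) (v : ℝ) : ℝ≥0∞ :=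
  ∫⁻ z, ENNReal.ofReal (|est (fun i => observe β σ (z i)) - v| ^ 2)
    ∂(Measure.pi fun _ : Fin n => μ)

/-! ### The estimator -/

/-- `[T̂]_m`, with entries `n⁻¹ ∑_i [X_i]_j [X_i]_l`. -/
def empMatrix {n : ℕ} (m : ℕ) (x : Fin n → L2 × ℝ) : Matrix (Fin m) (Fin m) ℝ :=
  Matrix.of fun j l => (n : ℝ)⁻¹ * ∑ i, coef (x i).1 (j + 1) * coef (x i).1 (l + 1)

/-- `[ĝ]_m`, with entries `n⁻¹ ∑_i Y_i [X_i]_j`. -/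
def empVector {n : ℕ} (m : ℕ) (x : Fin n → L2 × ℝ) : Fin m → ℝ :=
  fun j => (n : ℝ)⁻¹ * ∑ i, (x i).2 * coef (x i).1 (j + 1)

/-- The spectral norm of a matrix. -/
def spectralNorm {m : ℕ} (A : Matrix (Fin m) (Fin m) ℝ) : ℝ := ‖Matrix.toEuclideanCLM (𝕜 := ℝ) A‖

open Classical in
/-- The thresholded plug-in estimator with dimension `m` and threshold coefficient `α`:
`[h]_mᵗ [T̂]_m⁻¹ [ĝ]_m` if `[T̂]_m` is non-singular and `‖[T̂]_m⁻¹‖ ≤ α n`, and `0` otherwise. -/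
def plugIn {n : ℕ} (h : ℕ → ℝ) (m : ℕ) (α : ℝ) (x : Fin n → L2 × ℝ) : ℝ :=
  if IsUnit (empMatrix m x).det ∧ spectralNorm (empMatrix m x)⁻¹ ≤ α * n then
    (fun j : Fin m => h (j + 1)) ⬝ᵥ (empMatrix m x)⁻¹.mulVec (empVector m x)
  else 0

/-! ### The optimal dimension and the rates -/

/-- `min{υ_m/γ_m, n⁻¹} / max{υ_m/γ_m, n⁻¹}`. -/
def balance (γ υ : ℕ → ℝ) (n m : ℕ) : ℝ :=
  min (υ m / γ m) (n : ℝ)⁻¹ / max (υ m / γ m) (n : ℝ)⁻¹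

/-- `k n` is a maximizer of `m ↦ balance γ υ n m` over `m ≥ 1`, for every `n ≥ 1`. -/
def IsOptimalDim (γ υ : ℕ → ℝ) (k : ℕ → ℕ) : Prop :=
  ∀ n, 1 ≤ n → 1 ≤ k n ∧ ∀ m, 1 ≤ m → balance γ υ n m ≤ balance γ υ n (k n)

/-- `α_n^* = max{υ_k/γ_k, n⁻¹}` with `k = k_n^*`. -/
def alphaStar (γ υ : ℕ → ℝ) (k : ℕ → ℕ) (n : ℕ) : ℝ := max (υ (k n) / γ (k n)) (n : ℝ)⁻¹

/-- `κ = inf_{n ≥ 1} (α_n^*)⁻¹ min{υ_k/γ_k, n⁻¹}` with `k = k_n^*`. -/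
def kappa (γ υ : ℕ → ℝ) (k : ℕ → ℕ) : ℝ :=
  sInf ((fun n : ℕ => (alphaStar γ υ k n)⁻¹ * min (υ (k n) / γ (k n)) (n : ℝ)⁻¹) '' Ici 1)

/-- `δ_n^* = max{α_n^* ∑_{j ≤ k} [h]_j²/υ_j, ∑_{j > k} [h]_j²/γ_j}` with `k = k_n^*`. -/
def deltaStar (γ υ : ℕ → ℝ) (k : ℕ → ℕ) (h : ℕ → ℝ) (n : ℕ) : ℝ :=
  max (alphaStar γ υ k n * ∑ j ∈ Finset.Icc 1 (k n), h j ^ 2 / υ j)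
    (∑' j, h (k n + 1 + j) ^ 2 / γ (k n + 1 + j))

/-- `Δ_n^* = max_{1 ≤ j ≤ k} (1/(υ_j ω_j)) α_n^*` with `k = k_n^*`. -/
def DeltaStar (γ υ : ℕ → ℝ) (k : ℕ → ℕ) (ω : ℕ → ℝ) (n : ℕ) : ℝ :=
  sSup ((fun j => 1 / (υ j * ω j)) '' Icc 1 (k n)) * alphaStar γ υ k n

/-- The threshold coefficient `max{8 d³/(κ γ_k), 1}` with `k = k_n^*`. -/
def threshold (γ υ : ℕ → ℝ) (k : ℕ → ℕ) (d : ℝ) (n : ℕ) : ℝ :=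
  max (8 * d ^ 3 / (kappa γ υ k * γ (k n))) 1

/-- `u_j ≍ v_j`: there is `C ≥ 1` with `v_j / C ≤ u_j ≤ C v_j` for all `j ≥ 1`. -/
def SameOrder (u v : ℕ → ℝ) : Prop :=
  ∃ C : ℝ, 1 ≤ C ∧ ∀ j, 1 ≤ j → v j / C ≤ u j ∧ u j ≤ C * v j

/-- `w` is a strictly positive sequence of weights with `w₁ = 1`. -/
def IsWeight (w : ℕ → ℝ) : Prop := w 1 = 1 ∧ ∀ j, 1 ≤ j → 0 < w j

/-- For the representer `h`, the plug-in estimator with dimension `k_n^*` attains the optimal rate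
`δ_n^*`, and `δ_n^*` has the order `rate n`: its maximal mean squared error over the ellipsoid
`F_γ^ρ` is at most a constant times `δ_n^*`, uniformly over the model; no estimator has, for
standard normal errors independent of the regressor, a maximal mean squared error of smaller
order than `δ_n^*`. Here `q` is the order of the moment conditions. -/
def AttainsPointwise (γ υ : ℕ → ℝ) (k : ℕ → ℕ) (d η ρ σ : ℝ) (q : ℕ)
    (h : ℕ → ℝ) (rate : ℕ → ℝ) : Prop :=
  IsRepresenter γ h ∧
  (∃ C : ℝ, 0 < C ∧ ∀ n, 1 ≤ n → ∀ μ ∈ modelClass υ d q η,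
    ⨆ β ∈ slopes γ ρ, mse n μ σ β (plugIn h (k n) (threshold γ υ k d n)) (functional h β)
      ≤ ENNReal.ofReal (C * deltaStar γ υ k h n)) ∧
  (∃ c : ℝ, 0 < c ∧ ∀ n, 1 ≤ n → ∀ ν ∈ linkedRegressors υ d q η,
    ∀ est : (Fin n → L2 × ℝ) → ℝ, Measurable est →
    ENNReal.ofReal (c * deltaStar γ υ k h n)
      ≤ ⨆ β ∈ slopes γ ρ, mse n (ν.prod (gaussianReal 0 1)) σ β est (functional h β)) ∧
  (fun n => deltaStar γ υ k h n) =Θ[atTop] rate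

/-- The same uniformly over all representers `h ∈ F_ω^τ`, with the rate `Δ_n^*`. -/
def AttainsUniform (γ υ : ℕ → ℝ) (k : ℕ → ℕ) (d η ρ σ τ : ℝ) (q : ℕ)
    (ω : ℕ → ℝ) (rate : ℕ → ℝ) : Prop :=
  (∀ h ∈ ellipsoid ω τ, IsRepresenter γ h) ∧
  (∃ C : ℝ, 0 < C ∧ ∀ n, 1 ≤ n → ∀ μ ∈ modelClass υ d q η,
    ⨆ β ∈ slopes γ ρ, ⨆ h ∈ ellipsoid ω τ,
        mse n μ σ β (plugIn h (k n) (threshold γ υ k d n)) (functional h β)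
      ≤ ENNReal.ofReal (C * DeltaStar γ υ k ω n)) ∧
  (∃ c : ℝ, 0 < c ∧ ∀ n, 1 ≤ n → ∀ ν ∈ linkedRegressors υ d q η,
    ∀ est : (ℕ → ℝ) → (Fin n → L2 × ℝ) → ℝ, (∀ h, Measurable (est h)) →
    ENNReal.ofReal (c * DeltaStar γ υ k ω n)
      ≤ ⨆ β ∈ slopes γ ρ, ⨆ h ∈ ellipsoid ω τ,
          mse n (ν.prod (gaussianReal 0 1)) σ β (est h) (functional h β)) ∧
  (fun n => DeltaStar γ υ k ω n) =Θ[atTop] rate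

/-! ### Point evaluation and averages over an interval -/

/-- The coefficients `[h]_j = ψ_j(t₀)` of the representer of point evaluation at `t₀`. -/
def pointRep (t₀ : ℝ) (j : ℕ) : ℝ := trig j t₀

/-- The coefficients of the indicator function of `[0, b]`. -/
def averageRep (b : ℝ) (j : ℕ) : ℝ := ∫ t in (0 : ℝ)..b, trig j t

/-- Every `β ∈ F_γ` has a version `f` that is continuous on `[0,1]`, and the functional with
representer `pointRep t₀` maps `β` to `f t₀`. -/
def RepresentsPointEval (γ : ℕ → ℝ) (t₀ : ℝ) : Prop :=
  ∀ β : L2, Summable (fun j => γ (j + 1) * coef β (j + 1) ^ 2) →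
    ∃ f : ℝ → ℝ, ContinuousOn f (Icc 0 1) ∧ β =ᵐ[unitVolume] f ∧ functional (pointRep t₀) β = f t₀

/-- The functional with representer `averageRep b` is `β ↦ ∫_0^b β(t) dt`. -/
def RepresentsAverage (b : ℝ) : Prop :=
  ∀ β : L2, functional (averageRep b) β = ∫ t in (0 : ℝ)..b, β t

/-! ### The explicit orders -/

open Classical in
/-- Order of `δ_n^*` for polynomial `γ`, `υ` and `h`. -/
def ratePPP (p a s : ℝ) (n : ℕ) : ℝ :=
  if s - a < 1 / 2 then (n : ℝ) ^ (-(2 * p + 2 * s - 1) / (2 * p + 2 * a))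
  else if s - a = 1 / 2 then (n : ℝ)⁻¹ * Real.log n
  else (n : ℝ)⁻¹

open Classical in
/-- Order of `δ_n^*` for exponential `γ` and polynomial `υ` and `h`. -/
def rateEPP (p a s : ℝ) (n : ℕ) : ℝ :=
  if s - a < 1 / 2 then (n : ℝ)⁻¹ * Real.log n ^ ((2 * a - 2 * s + 1) / (2 * p))
  else if s - a = 1 / 2 then (n : ℝ)⁻¹ * Real.log (Real.log n)
  else (n : ℝ)⁻¹

end FunctionalLinearModel

end

/-!
The trigonometric system is a Hilbert basis (`trigBasis`), so slopes and representers can be treated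
as coefficient sequences.  The link condition `‖T f‖ ≍ ‖D f‖`, with `D` the diagonal operator of the
weights `υ`, compares the squares of two positive operators.  Since the square root is operator
monotone (`inner_le_inner_of_norm_le`), it also compares the forms `⟪T f, f⟫` and `⟪D f, f⟫`
(`sum_le_inner_of_link`, `inner_le_of_link`).  This is all that is used about `T`.

*Upper bound.*  Let `m = k_n^*`, and let `b` be the Galerkin approximation of the slope in the span
of the first `m` basis functions (`exists_galerkin`).  Its bias is at most of the order `δ_n^*`, and
the residual `Y - ⟪b, X⟫` is uncorrelated with the first `m` coefficients of `X`.  After whitening by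
`[T]_m^{-1/2}` (`isotropicMoment_whitened`), the error of the estimator consists of this bias, a
centered empirical mean, and a remainder that is smaller by a factor `m² / n`, as long as the
empirical second moment matrix is close to the identity; otherwise the threshold limits the error
(`plugIn_error_sq_le`).  A moment inequality for sums of independent centered variables
(`integral_sum_pow_le`) bounds all expectations, and high moments make the exceptional event
unlikely enough (`exists_mse_plugIn_le`).

*Lower bound.*  Given the regressors, changing the slope shifts the Gaussian errors.  The likelihood
ratios of the slopes `f` and `-f` have a common minorant of mass bounded below as long as
`n ⟪T f, f⟫` is bounded, so the error is at least of the order `ℓ_h(f)²` for one of the two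
(`two_point_le`).  The best `f` in the span of the first `m` basis functions and the best one
orthogonal to it yield the two parts of `δ_n^*` (`exists_le_iSup_mse`).  The uniform statements
follow, because `δ_n^*` is at most of the order `Δ_n^*` over the ellipsoid
(`deltaStar_le_DeltaStar`), with equality up to a constant for a representer that is supported on
one coordinate.

*Orders.*  The condition `κ > 0` means that `υ_m / γ_m` is of the order `1 / n` at `m = k_n^*`
(`ratio_isTheta`), which determines the order of `k_n^*`.  The orders of `δ_n^*` and `Δ_n^*` are then
those of sums of powers, tails of sums of powers, and functions `x ^ r exp (x ^ q)`, which are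
monotone up to a constant (`exists_rpow_mul_exp_le`).  Single coefficients of point evaluation and
of averages can vanish; therefore the lower bounds on `h_j²` are only assumed for sums over five
consecutive indices (`WindowOrder`).
-/

noncomputable section

namespace FunctionalLinearModel

/-! ### The trigonometric system is a Hilbert basis of `L²[0,1]` -/

lemma integral_unitVolume (f : ℝ → ℝ) : ∫ t, f t ∂unitVolume = ∫ t in (0 : ℝ)..1, f t := by
  rw [intervalIntegral.integral_of_le zero_le_one, integral_Icc_eq_integral_Ioc]

lemma inner_eq_intervalIntegral (f g : L2) : ⟪f, g⟫ = ∫ t in (0 : ℝ)..1, g t * f t := by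
  rw [L2.inner_def, integral_unitVolume]
  rfl

lemma psi_ae (j : ℕ) : psi j =ᵐ[unitVolume] trig j := (memLp_trig j).coeFn_toLp

lemma coef_eq_integral (f : L2) (j : ℕ) : coef f j = ∫ t in (0 : ℝ)..1, trig j t * f t := by
  rw [coef, L2.inner_def, ← integral_unitVolume]
  refine integral_congr_ae ?_
  filter_upwards [psi_ae j] with t ht
  simp [ht]

lemma inner_psi (i j : ℕ) : ⟪psi i, psi j⟫ = ∫ t in (0 : ℝ)..1, trig j t * trig i t := by
  change coef (psi i) j = _
  rw [coef_eq_integral, ← integral_unitVolume, ← integral_unitVolume]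
  refine integral_congr_ae ?_
  filter_upwards [psi_ae i] with t ht
  simp [ht]

lemma integral_cos_two_pi (n : ℤ) :
    ∫ t in (0 : ℝ)..1, Real.cos (2 * Real.pi * n * t) = if n = 0 then 1 else 0 := by
  split_ifs with h
  · simp [h]
  · have hn : (2 * Real.pi * n : ℝ) ≠ 0 := by simp [h, Real.pi_ne_zero]
    rw [intervalIntegral.integral_comp_mul_left (fun x => Real.cos x) hn, integral_cos]
    have : Real.sin (2 * Real.pi * n * 1) = 0 := by
      rw [show 2 * Real.pi * n * 1 = ((2 * n : ℤ) : ℝ) * Real.pi by push_cast; ring]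
      exact Real.sin_int_mul_pi _
    rw [this]
    simp

lemma integral_sin_two_pi (n : ℤ) : ∫ t in (0 : ℝ)..1, Real.sin (2 * Real.pi * n * t) = 0 := by
  by_cases h : n = 0
  · simp [h]
  · have hn : (2 * Real.pi * n : ℝ) ≠ 0 := by simp [h, Real.pi_ne_zero]
    rw [intervalIntegral.integral_comp_mul_left (fun x => Real.sin x) hn, integral_sin]
    have : Real.cos (2 * Real.pi * n * 1) = 1 := by
      rw [show 2 * Real.pi * n * 1 = n * (2 * Real.pi) by ring]
      exact Real.cos_int_mul_two_pi _
    rw [this]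
    simp

lemma trig_even {i : ℕ} (hi : 1 ≤ i) (t : ℝ) :
    trig (2 * i) t = √2 * Real.cos (2 * Real.pi * i * t) := by
  have h1 : ¬ 2 * i ≤ 1 := by omega
  simp [trig, h1]

lemma trig_odd {i : ℕ} (hi : 1 ≤ i) (t : ℝ) :
    trig (2 * i + 1) t = √2 * Real.sin (2 * Real.pi * i * t) := by
  have h1 : ¬ 2 * i + 1 ≤ 1 := by omega
  have h2 : (2 * i + 1) / 2 = i := by omega
  have h3 : i ≠ 0 := by omega
  simp [trig, h2, h3]

lemma trig_one (t : ℝ) : trig 1 t = 1 := by simp [trig]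

lemma integral_cos_mul_cos (m n : ℕ) (hn : 1 ≤ n) :
    ∫ t in (0 : ℝ)..1, (√2 * Real.cos (2 * Real.pi * m * t)) * (√2 * Real.cos (2 * Real.pi * n * t))
      = if m = n then 1 else 0 := by
  have : ∀ t : ℝ, (√2 * Real.cos (2 * Real.pi * m * t)) * (√2 * Real.cos (2 * Real.pi * n * t))
      = Real.cos (2 * Real.pi * ((m - n : ℤ) : ℝ) * t)
        + Real.cos (2 * Real.pi * ((m + n : ℤ) : ℝ) * t) := by
    intro t
    push_cast
    rw [show 2 * Real.pi * ((m : ℝ) - n) * t = 2 * Real.pi * m * t - 2 * Real.pi * n * t by ring,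
      show 2 * Real.pi * ((m : ℝ) + n) * t = 2 * Real.pi * m * t + 2 * Real.pi * n * t by ring,
      Real.cos_sub, Real.cos_add]
    linear_combination (Real.cos (2 * Real.pi * m * t) * Real.cos (2 * Real.pi * n * t)) *
      Real.mul_self_sqrt (show (0 : ℝ) ≤ 2 by norm_num)
  simp_rw [this]
  rw [intervalIntegral.integral_add (by apply Continuous.intervalIntegrable; fun_prop)
    (by apply Continuous.intervalIntegrable; fun_prop), integral_cos_two_pi, integral_cos_two_pi]
  have h2 : ¬ ((m : ℤ) + n = 0) := by omega
  have h1 : ((m : ℤ) - n = 0) ↔ m = n := by omega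
  simp [h2, h1]

lemma integral_sin_mul_sin (m n : ℕ) (hn : 1 ≤ n) :
    ∫ t in (0 : ℝ)..1, (√2 * Real.sin (2 * Real.pi * m * t)) * (√2 * Real.sin (2 * Real.pi * n * t))
      = if m = n then 1 else 0 := by
  have : ∀ t : ℝ, (√2 * Real.sin (2 * Real.pi * m * t)) * (√2 * Real.sin (2 * Real.pi * n * t))
      = Real.cos (2 * Real.pi * ((m - n : ℤ) : ℝ) * t)
        - Real.cos (2 * Real.pi * ((m + n : ℤ) : ℝ) * t) := by
    intro t
    push_cast
    rw [show 2 * Real.pi * ((m : ℝ) - n) * t = 2 * Real.pi * m * t - 2 * Real.pi * n * t by ring,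
      show 2 * Real.pi * ((m : ℝ) + n) * t = 2 * Real.pi * m * t + 2 * Real.pi * n * t by ring,
      Real.cos_sub, Real.cos_add]
    linear_combination (Real.sin (2 * Real.pi * m * t) * Real.sin (2 * Real.pi * n * t)) *
      Real.mul_self_sqrt (show (0 : ℝ) ≤ 2 by norm_num)
  simp_rw [this]
  rw [intervalIntegral.integral_sub (by apply Continuous.intervalIntegrable; fun_prop)
    (by apply Continuous.intervalIntegrable; fun_prop), integral_cos_two_pi, integral_cos_two_pi]
  have h2 : ¬ ((m : ℤ) + n = 0) := by omega
  have h1 : ((m : ℤ) - n = 0) ↔ m = n := by omega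
  simp [h2, h1]

lemma integral_sin_mul_cos (m n : ℕ) :
    ∫ t in (0 : ℝ)..1, (√2 * Real.sin (2 * Real.pi * m * t)) * (√2 * Real.cos (2 * Real.pi * n * t))
      = 0 := by
  have : ∀ t : ℝ, (√2 * Real.sin (2 * Real.pi * m * t)) * (√2 * Real.cos (2 * Real.pi * n * t))
      = Real.sin (2 * Real.pi * ((m - n : ℤ) : ℝ) * t)
        + Real.sin (2 * Real.pi * ((m + n : ℤ) : ℝ) * t) := by
    intro t
    push_cast
    rw [show 2 * Real.pi * ((m : ℝ) - n) * t = 2 * Real.pi * m * t - 2 * Real.pi * n * t by ring,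
      show 2 * Real.pi * ((m : ℝ) + n) * t = 2 * Real.pi * m * t + 2 * Real.pi * n * t by ring,
      Real.sin_sub, Real.sin_add]
    linear_combination (Real.sin (2 * Real.pi * m * t) * Real.cos (2 * Real.pi * n * t)) *
      Real.mul_self_sqrt (show (0 : ℝ) ≤ 2 by norm_num)
  simp_rw [this]
  rw [intervalIntegral.integral_add (by apply Continuous.intervalIntegrable; fun_prop)
    (by apply Continuous.intervalIntegrable; fun_prop), integral_sin_two_pi, integral_sin_two_pi]
  simp

/-- Every index `j ≥ 1` is `1`, `2 i` or `2 i + 1` with `i ≥ 1`. -/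
lemma index_cases {j : ℕ} (hj : 1 ≤ j) :
    j = 1 ∨ (∃ i, 1 ≤ i ∧ j = 2 * i) ∨ ∃ i, 1 ≤ i ∧ j = 2 * i + 1 := by
  rcases Nat.even_or_odd' j with ⟨i, h | h⟩
  · exact Or.inr (Or.inl ⟨i, by omega, h⟩)
  · rcases Nat.eq_zero_or_pos i with h0 | h0
    · left; omega
    · exact Or.inr (Or.inr ⟨i, h0, h⟩)

lemma inner_psi_eq_ite {i j : ℕ} (hi : 1 ≤ i) (hj : 1 ≤ j) :
    ⟪psi i, psi j⟫ = if i = j then (1 : ℝ) else 0 := by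
  rw [inner_psi]
  have hc : ∀ n : ℕ, 1 ≤ n → ∫ t in (0 : ℝ)..1, √2 * Real.cos (2 * Real.pi * n * t) = 0 := by
    intro n hn
    rw [intervalIntegral.integral_const_mul]
    have := integral_cos_two_pi (n : ℤ)
    have h0 : n ≠ 0 := by omega
    simp only [Int.cast_natCast] at this
    rw [this]
    simp [h0]
  have hs : ∀ n : ℕ, ∫ t in (0 : ℝ)..1, √2 * Real.sin (2 * Real.pi * n * t) = 0 := by
    intro n
    rw [intervalIntegral.integral_const_mul]
    have := integral_sin_two_pi (n : ℤ)
    simp only [Int.cast_natCast] at this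
    rw [this]
    simp
  rcases index_cases hi with rfl | ⟨m, hm, rfl⟩ | ⟨m, hm, rfl⟩ <;>
  rcases index_cases hj with rfl | ⟨n, hn, rfl⟩ | ⟨n, hn, rfl⟩
  · simp [trig_one]
  · simp_rw [trig_one, mul_one, trig_even hn, hc n hn]
    rw [if_neg (by omega)]
  · simp_rw [trig_one, mul_one, trig_odd hn, hs n]
    rw [if_neg (by omega)]
  · simp_rw [trig_one, one_mul, trig_even hm, hc m hm]
    rw [if_neg (by omega)]
  · simp_rw [trig_even hm, trig_even hn, integral_cos_mul_cos n m hm]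
    congr 1
    simp only [eq_iff_iff]; omega
  · simp_rw [trig_even hm, trig_odd hn, integral_sin_mul_cos n m]
    rw [if_neg (by omega)]
  · simp_rw [trig_one, one_mul, trig_odd hm, hs m]
    rw [if_neg (by omega)]
  · simp_rw [trig_odd hm, trig_even hn, mul_comm (√2 * Real.cos _), integral_sin_mul_cos m n]
    rw [if_neg (by omega)]
  · simp_rw [trig_odd hm, trig_odd hn, integral_sin_mul_sin n m hm]
    congr 1
    simp only [eq_iff_iff]; omega

lemma orthonormal_psi : Orthonormal ℝ (fun j : ℕ => psi (j + 1)) := by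
  rw [orthonormal_iff_ite]
  intro i j
  rw [inner_psi_eq_ite (by omega) (by omega)]
  simp

lemma intervalIntegrable_continuous_mul (f : L2) {g : ℝ → ℝ} (hg : Continuous g) :
    IntervalIntegrable (fun t => g t * f t) volume 0 1 := by
  have h1 : Integrable (fun t => f t) unitVolume := (Lp.memLp f).integrable (by norm_num)
  rw [intervalIntegrable_iff_integrableOn_Icc_of_le zero_le_one]
  exact IntegrableOn.continuousOn_mul hg.continuousOn h1 isCompact_Icc

/-- Completeness of the trigonometric system.  If all real coefficients of `f` vanish, so do its
complex Fourier coefficients, and Parseval's identity gives `f = 0`. -/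
lemma eq_zero_of_coef_eq_zero (f : L2) (hf : ∀ j, 1 ≤ j → coef f j = 0) : f = 0 := by
  have hcos : ∀ n : ℕ, ∫ t in (0 : ℝ)..1, Real.cos (2 * Real.pi * n * t) * f t = 0 := by
    intro n
    rcases Nat.eq_zero_or_pos n with rfl | hn
    · have := hf 1 le_rfl
      rw [coef_eq_integral] at this
      simpa [trig_one] using this
    · have := hf (2 * n) (by omega)
      rw [coef_eq_integral] at this
      simp_rw [trig_even hn, mul_assoc (√2)] at this
      rw [intervalIntegral.integral_const_mul] at this
      simpa using this
  have hsin : ∀ n : ℕ, ∫ t in (0 : ℝ)..1, Real.sin (2 * Real.pi * n * t) * f t = 0 := by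
    intro n
    rcases Nat.eq_zero_or_pos n with rfl | hn
    · simp
    · have := hf (2 * n + 1) (by omega)
      rw [coef_eq_integral] at this
      simp_rw [trig_odd hn, mul_assoc (√2)] at this
      rw [intervalIntegral.integral_const_mul] at this
      simpa using this
  have hcosZ : ∀ n : ℤ, ∫ t in (0 : ℝ)..1, Real.cos (2 * Real.pi * n * t) * f t = 0 := by
    intro n
    rcases Int.eq_nat_or_neg n with ⟨k, rfl | rfl⟩
    · simpa using hcos k
    · simpa using hcos k
  have hsinZ : ∀ n : ℤ, ∫ t in (0 : ℝ)..1, Real.sin (2 * Real.pi * n * t) * f t = 0 := by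
    intro n
    rcases Int.eq_nat_or_neg n with ⟨k, rfl | rfl⟩
    · simpa using hsin k
    · simpa using hsin k
  have hmem : MemLp (fun t => ((f t : ℝ) : ℂ)) 2 (volume.restrict (Ioc (0 : ℝ) 1)) := by
    have h1 : MemLp (fun t => ((f t : ℝ) : ℂ)) 2 unitVolume := (Lp.memLp f).ofReal
    exact h1.mono_measure (Measure.restrict_mono Ioc_subset_Icc_self le_rfl)
  have hco : ∀ n : ℤ, fourierCoeffOn (zero_lt_one' ℝ) (fun t => ((f t : ℝ) : ℂ)) n = 0 := by
    intro n
    rw [fourierCoeffOn_eq_integral]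
    have : ∀ t : ℝ, (fourier (-n) (t : AddCircle ((1 : ℝ) - 0))) • ((f t : ℝ) : ℂ)
        = ((Real.cos (2 * Real.pi * ((-n : ℤ) : ℝ) * t) * f t : ℝ) : ℂ)
          + ((Real.sin (2 * Real.pi * ((-n : ℤ) : ℝ) * t) * f t : ℝ) : ℂ) * Complex.I := by
      intro t
      rw [fourier_coe_apply]
      push_cast
      rw [show (2 * Real.pi * Complex.I * (-n : ℂ) * t / ((1 : ℂ) - 0))
        = (2 * Real.pi * (-n : ℂ) * t) * Complex.I by ring, Complex.exp_mul_I, smul_eq_mul]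
      ring
    simp_rw [this]
    rw [intervalIntegral.integral_add, intervalIntegral.integral_mul_const,
      intervalIntegral.integral_ofReal, intervalIntegral.integral_ofReal, hcosZ, hsinZ]
    · simp
    · exact ⟨(intervalIntegrable_continuous_mul f (by fun_prop)).1.ofReal,
        (intervalIntegrable_continuous_mul f (by fun_prop)).2.ofReal⟩
    · exact IntervalIntegrable.mul_const ⟨(intervalIntegrable_continuous_mul f (by fun_prop)).1.ofReal,
        (intervalIntegrable_continuous_mul f (by fun_prop)).2.ofReal⟩ _
  have hp := tsum_sq_fourierCoeffOn (zero_lt_one' ℝ) hmem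
  simp only [hco] at hp
  have h0 : ⟪f, f⟫ = (0 : ℝ) := by
    rw [inner_eq_intervalIntegral]
    simp only [norm_zero, ne_eq, OfNat.ofNat_ne_zero, not_false_eq_true, zero_pow, tsum_zero,
      sub_zero, inv_one, one_smul, Complex.norm_real, Real.norm_eq_abs, sq_abs] at hp
    refine Eq.trans ?_ hp.symm
    refine intervalIntegral.integral_congr fun t _ => ?_
    ring
  exact inner_self_eq_zero.1 h0

/-- The trigonometric Hilbert basis; its vectors are `ψ₁, ψ₂, …`, indexed from `0`. -/
def trigBasis : HilbertBasis ℕ ℝ L2 :=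
  HilbertBasis.mkOfOrthogonalEqBot orthonormal_psi <| by
    rw [Submodule.eq_bot_iff]
    intro f hf
    refine eq_zero_of_coef_eq_zero f fun j hj => ?_
    have := (Submodule.mem_orthogonal' _ _).1 hf (psi j)
      (Submodule.subset_span ⟨j - 1, by simp [Nat.sub_add_cancel hj]⟩)
    exact this

lemma trigBasis_apply (j : ℕ) : trigBasis j = psi (j + 1) := by
  simp [trigBasis]

lemma coef_eq_repr (f : L2) (j : ℕ) : coef f (j + 1) = trigBasis.repr f j := by
  rw [HilbertBasis.repr_apply_apply, trigBasis_apply, real_inner_comm]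
  rfl

lemma hasSum_coef_mul (f g : L2) : HasSum (fun j => coef f (j + 1) * coef g (j + 1)) ⟪f, g⟫ := by
  have := trigBasis.hasSum_inner_mul_inner f g
  simp only [trigBasis_apply] at this
  refine this.congr_fun fun j => ?_
  rw [coef, coef, real_inner_comm (psi (j + 1)) g]

lemma hasSum_coef_sq (f : L2) : HasSum (fun j => coef f (j + 1) ^ 2) (‖f‖ ^ 2) := by
  have := hasSum_coef_mul f f
  rw [real_inner_self_eq_norm_sq] at this
  refine this.congr_fun fun j => sq _

lemma summable_coef_sq (f : L2) : Summable (fun j => coef f (j + 1) ^ 2) := (hasSum_coef_sq f).summable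

/-- Every square-summable sequence is the coefficient sequence of a function. -/
lemma exists_coef_eq (a : ℕ → ℝ) (ha : Summable (fun j => a (j + 1) ^ 2)) :
    ∃ f : L2, ∀ j, coef f (j + 1) = a (j + 1) := by
  have hm : Memℓp (fun j => a (j + 1)) 2 := by
    rw [memℓp_gen_iff (by norm_num)]
    simpa using ha
  refine ⟨trigBasis.repr.symm ⟨_, hm⟩, fun j => ?_⟩
  rw [coef_eq_repr]
  simp

lemma coef_psi {i j : ℕ} (hi : 1 ≤ i) (hj : 1 ≤ j) : coef (psi i) j = if i = j then 1 else 0 :=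
  inner_psi_eq_ite hi hj

lemma coef_add (f g : L2) (j : ℕ) : coef (f + g) j = coef f j + coef g j := inner_add_left _ _ _
lemma coef_sub (f g : L2) (j : ℕ) : coef (f - g) j = coef f j - coef g j := inner_sub_left _ _ _
lemma coef_neg (f : L2) (j : ℕ) : coef (-f) j = -coef f j := inner_neg_left _ _
lemma coef_smul (c : ℝ) (f : L2) (j : ℕ) : coef (c • f) j = c * coef f j :=
  real_inner_smul_left _ _ _
lemma coef_sum {ι : Type*} (s : Finset ι) (f : ι → L2) (j : ℕ) :
    coef (∑ i ∈ s, f i) j = ∑ i ∈ s, coef (f i) j := sum_inner _ _ _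

lemma eq_of_coef_eq {f g : L2} (h : ∀ j, coef f (j + 1) = coef g (j + 1)) : f = g := by
  rw [← sub_eq_zero]
  refine eq_zero_of_coef_eq_zero _ fun j hj => ?_
  obtain ⟨i, rfl⟩ : ∃ i, j = i + 1 := ⟨j - 1, by omega⟩
  rw [coef_sub, h, sub_self]

/-- The trigonometric polynomial with coefficients `v`. -/
def poly {m : ℕ} (v : Fin m → ℝ) : L2 := ∑ j : Fin m, v j • psi (j + 1)

lemma coef_poly {m : ℕ} (v : Fin m → ℝ) (i : Fin m) : coef (poly v) (i + 1) = v i := by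
  rw [poly, coef_sum, Finset.sum_eq_single i]
  · rw [coef_smul, coef_psi (by omega) (by omega), if_pos rfl, mul_one]
  · intro j _ hj
    rw [coef_smul, coef_psi (by omega) (by omega), if_neg, mul_zero]
    intro h; apply hj; ext; omega
  · simp

lemma coef_poly_of_le {m : ℕ} (v : Fin m → ℝ) {i : ℕ} (hi : m ≤ i) : coef (poly v) (i + 1) = 0 := by
  rw [poly, coef_sum]
  refine Finset.sum_eq_zero fun j _ => ?_
  rw [coef_smul, coef_psi (by omega) (by omega), if_neg, mul_zero]
  have := j.2; omega

lemma inner_poly {m : ℕ} (v : Fin m → ℝ) (f : L2) :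
    ⟪poly v, f⟫ = v ⬝ᵥ fun j => coef f (j + 1) := by
  rw [poly, sum_inner]
  refine Finset.sum_congr rfl fun j _ => ?_
  rw [real_inner_smul_left, real_inner_comm]
  rfl

/-! ### Operator monotonicity of the square root and the link condition -/

section Heinz

variable {E : Type*} [NormedAddCommGroup E] [InnerProductSpace ℝ E]

/-- The Cauchy–Schwarz inequality for the form of a positive operator. -/
lemma inner_sq_le_of_isPositive {D : E →L[ℝ] E} (hD : D.IsPositive) (x y : E) :
    ⟪D x, y⟫ ^ 2 ≤ ⟪D x, x⟫ * ⟪D y, y⟫ := by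
  have key : ∀ t : ℝ, 0 ≤ ⟪D y, y⟫ * (t * t) + (2 * ⟪D x, y⟫) * t + ⟪D x, x⟫ := by
    intro t
    have h := hD.inner_nonneg_left (x + t • y)
    have hs : ⟪D y, x⟫ = ⟪D x, y⟫ := by
      rw [hD.inner_left_eq_inner_right, real_inner_comm]
    rw [map_add, map_smul, inner_add_left, inner_add_right, inner_add_right, real_inner_smul_left,
      real_inner_smul_left, real_inner_smul_right, real_inner_smul_right, hs] at h
    linarith
  have := discrim_le_zero key
  rw [discrim] at this
  nlinarith

lemma norm_sq_le_of_isPositive {D : E →L[ℝ] E} (hD : D.IsPositive) (x : E) :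
    ‖D x‖ ^ 2 ≤ ‖D‖ * ⟪D x, x⟫ := by
  have h := inner_sq_le_of_isPositive hD x (D x)
  rw [real_inner_self_eq_norm_sq] at h
  have h2 : ⟪D (D x), D x⟫ ≤ ‖D‖ * ‖D x‖ ^ 2 := by
    calc ⟪D (D x), D x⟫ ≤ ‖D (D x)‖ * ‖D x‖ := real_inner_le_norm _ _
      _ ≤ (‖D‖ * ‖D x‖) * ‖D x‖ := by gcongr; exact D.le_opNorm _
      _ = _ := by ring
  have h0 := hD.inner_nonneg_left x
  rcases eq_or_lt_of_le (sq_nonneg ‖D x‖) with h3 | h3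
  · rw [← h3]; positivity
  · refine le_of_mul_le_mul_right ?_ h3
    nlinarith [mul_le_mul_of_nonneg_left h2 h0]

/-- The square root is operator monotone: for positive operators, `‖A x‖ ≤ ‖B x‖` for all `x`
(that is, `A² ≤ B²`) implies `A ≤ B`.  If the form of `A - B` had a supremum `M > 0` on the unit
sphere, then on approximate maximizers `x` one would have `(A - B) x ≈ M x`, and
`0 ≥ ‖A x‖² - ‖B x‖² = ⟪(A - B) x, (A + B) x⟫ ≈ M ⟪x, (A + B) x⟫ ≥ M ⟪x, (A - B) x⟫ ≈ M²`. -/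
theorem inner_le_inner_of_norm_le {A B : E →L[ℝ] E} (hA : A.IsPositive) (hB : B.IsPositive)
    (h : ∀ x, ‖A x‖ ≤ ‖B x‖) (x : E) : ⟪A x, x⟫ ≤ ⟪B x, x⟫ := by
  by_contra hcon
  push Not at hcon
  set S : Set ℝ := {r | ∃ y : E, ‖y‖ = 1 ∧ r = ⟪(A - B) y, y⟫} with hS
  have hx0 : x ≠ 0 := by rintro rfl; simp at hcon
  have hxn : 0 < ‖x‖ := norm_pos_iff.2 hx0
  have hbdd : BddAbove S := by
    refine ⟨‖A - B‖, ?_⟩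
    rintro r ⟨y, hy, rfl⟩
    calc ⟪(A - B) y, y⟫ ≤ ‖(A - B) y‖ * ‖y‖ := real_inner_le_norm _ _
      _ ≤ (‖A - B‖ * ‖y‖) * ‖y‖ := by gcongr; exact (A - B).le_opNorm _
      _ = ‖A - B‖ := by rw [hy]; ring
  have hscale : ∀ y : E, y ≠ 0 → ⟪(A - B) y, y⟫ / ‖y‖ ^ 2 ∈ S := by
    intro y hy
    have hyn : ‖y‖ ≠ 0 := norm_ne_zero_iff.2 hy
    refine ⟨‖y‖⁻¹ • y, by rw [norm_smul, norm_inv, norm_norm, inv_mul_cancel₀ hyn], ?_⟩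
    rw [map_smul, real_inner_smul_left, real_inner_smul_right]
    field_simp
  set M := sSup S with hM
  have hle : ∀ y : E, ⟪(A - B) y, y⟫ ≤ M * ‖y‖ ^ 2 := by
    intro y
    by_cases hy : y = 0
    · simp [hy]
    · have hyn : 0 < ‖y‖ ^ 2 := by have := norm_pos_iff.2 hy; positivity
      have := le_csSup hbdd (hscale y hy)
      rwa [div_le_iff₀ hyn] at this
  have hMpos : 0 < M := by
    have := le_csSup hbdd (hscale x hx0)
    refine lt_of_lt_of_le ?_ this
    rw [sub_apply, inner_sub_left]
    have : 0 < ⟪A x, x⟫ - ⟪B x, x⟫ := by linarith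
    positivity
  -- `D = M - (A - B)` is positive, so near-maximizers `y` of the form satisfy `D y ≈ 0`
  set D : E →L[ℝ] E := M • ContinuousLinearMap.id ℝ E - (A - B) with hD
  have hDapp : ∀ y, D y = M • y - (A - B) y := fun y => rfl
  have hDpos : D.IsPositive := by
    rw [ContinuousLinearMap.isPositive_iff]
    refine ⟨?_, fun y => ?_⟩
    · intro y z
      have h1 := hA.inner_left_eq_inner_right y z
      have h2 := hB.inner_left_eq_inner_right y z
      simp only [ContinuousLinearMap.coe_coe, hDapp, sub_apply, inner_sub_left,
        inner_sub_right, real_inner_smul_left, real_inner_smul_right, h1, h2]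
    · rw [hDapp, inner_sub_left, real_inner_smul_left, real_inner_self_eq_norm_sq]
      linarith [hle y]
  set L := ‖D‖ * ‖A + B‖ ^ 2 with hL
  have hL0 : 0 ≤ L := by positivity
  -- so small that `M² / 2 ≤ M (M - ε) ≤ ‖D y‖ ‖A + B‖` is incompatible with `‖D y‖² ≤ ‖D‖ ε`
  set ε := min (M / 2) (M ^ 4 / (8 * (L + 1))) with hε
  have hεpos : 0 < ε := by positivity
  obtain ⟨r, ⟨y, hy, rfl⟩, hr⟩ := exists_lt_of_lt_csSup ⟨_, hscale x hx0⟩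
    (show M - ε < sSup S by linarith)
  have h1 : ‖D y‖ ^ 2 ≤ ‖D‖ * ε := by
    refine (norm_sq_le_of_isPositive hDpos y).trans ?_
    gcongr
    rw [hDapp, inner_sub_left, real_inner_smul_left, real_inner_self_eq_norm_sq, hy]
    linarith
  have h2 : ⟪(A - B) y, (A + B) y⟫ ≤ 0 := by
    have hab : ⟪(A - B) y, (A + B) y⟫ = ‖A y‖ ^ 2 - ‖B y‖ ^ 2 := by
      simp only [sub_apply, add_apply, inner_sub_left,
        inner_add_right, real_inner_self_eq_norm_sq, real_inner_comm (A y) (B y)]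
      ring
    rw [hab]
    have := pow_le_pow_left₀ (norm_nonneg _) (h y) 2
    linarith
  have h3 : M - ε ≤ ⟪y, (A + B) y⟫ := by
    have := hB.inner_nonneg_right y
    simp only [sub_apply, inner_sub_left] at hr
    simp only [add_apply, inner_add_right]
    rw [real_inner_comm y (A y)] at hr
    rw [real_inner_comm y (B y)] at hr
    linarith
  have h4 : M * (M - ε) ≤ ‖D y‖ * ‖A + B‖ := by
    have e : (A - B) y = M • y - D y := by rw [hDapp]; abel
    rw [e, inner_sub_left, real_inner_smul_left] at h2
    have h5 : ⟪D y, (A + B) y⟫ ≤ ‖D y‖ * ‖A + B‖ := by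
      refine (real_inner_le_norm _ _).trans ?_
      gcongr
      simpa [hy] using (A + B).le_opNorm y
    nlinarith [mul_le_mul_of_nonneg_left h3 hMpos.le]
  have h6 : M ^ 2 / 2 ≤ ‖D y‖ * ‖A + B‖ := by
    refine le_trans ?_ h4
    have : ε ≤ M / 2 := min_le_left _ _
    nlinarith
  have h7 : (M ^ 2 / 2) ^ 2 ≤ L * ε := by
    calc (M ^ 2 / 2) ^ 2 ≤ (‖D y‖ * ‖A + B‖) ^ 2 := by gcongr
      _ = ‖D y‖ ^ 2 * ‖A + B‖ ^ 2 := by ring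
      _ ≤ (‖D‖ * ε) * ‖A + B‖ ^ 2 := by gcongr
      _ = L * ε := by rw [hL]; ring
  have h8 : L * ε ≤ M ^ 4 / 8 := by
    calc L * ε ≤ (L + 1) * (M ^ 4 / (8 * (L + 1))) := by
          gcongr
          · linarith
          · exact min_le_right _ _
      _ = M ^ 4 / 8 := by field_simp
  have : 0 < M ^ 4 := by positivity
  nlinarith

end Heinz

/-- The operator that is diagonal in the trigonometric basis, with eigenvalue `w (j + 1)` on
`ψ_{j+1}` for `j < N` and `c` on all the others. -/
def diagOp (w : ℕ → ℝ) (N : ℕ) (c : ℝ) : L2 →L[ℝ] L2 :=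
  c • ContinuousLinearMap.id ℝ L2 +
    ∑ j ∈ Finset.range N, (w (j + 1) - c) • (innerSL ℝ (psi (j + 1))).smulRight (psi (j + 1))

lemma coef_diagOp (w : ℕ → ℝ) (N : ℕ) (c : ℝ) (f : L2) (i : ℕ) :
    coef (diagOp w N c f) (i + 1) = (if i < N then w (i + 1) else c) * coef f (i + 1) := by
  have : diagOp w N c f
      = c • f + ∑ j ∈ Finset.range N, ((w (j + 1) - c) * coef f (j + 1)) • psi (j + 1) := by
    simp only [diagOp, add_apply, smul_apply,
      sum_apply, ContinuousLinearMap.smulRight_apply, innerSL_apply_apply,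
      ContinuousLinearMap.id_apply, smul_smul]
    congr 1
    refine Finset.sum_congr rfl fun j _ => ?_
    rw [real_inner_comm]
    rfl
  rw [this, coef_add, coef_smul, coef_sum]
  split_ifs with h
  · rw [Finset.sum_eq_single i]
    · rw [coef_smul, coef_psi (by omega) (by omega), if_pos rfl]; ring
    · intro j _ hj
      rw [coef_smul, coef_psi (by omega) (by omega), if_neg (by omega), mul_zero]
    · intro hi; simp [h] at hi
  · rw [Finset.sum_eq_zero, add_zero]
    intro j hj
    rw [Finset.mem_range] at hj
    rw [coef_smul, coef_psi (by omega) (by omega), if_neg (by omega), mul_zero]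

lemma hasSum_inner_diagOp (w : ℕ → ℝ) (N : ℕ) (c : ℝ) (f g : L2) :
    HasSum (fun i => (if i < N then w (i + 1) else c) * (coef f (i + 1) * coef g (i + 1)))
      ⟪diagOp w N c f, g⟫ := by
  refine (hasSum_coef_mul (diagOp w N c f) g).congr_fun fun i => ?_
  rw [coef_diagOp]; ring

lemma diagOp_isPositive {w : ℕ → ℝ} {N : ℕ} {c : ℝ} (hw : ∀ j, 1 ≤ j → 0 ≤ w j) (hc : 0 ≤ c) :
    (diagOp w N c).IsPositive := by
  rw [ContinuousLinearMap.isPositive_iff]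
  refine ⟨fun f g => ?_, fun f => ?_⟩
  · change ⟪diagOp w N c f, g⟫ = ⟪f, diagOp w N c g⟫
    rw [real_inner_comm (diagOp w N c g)]
    refine (hasSum_inner_diagOp w N c f g).unique ?_
    simpa only [mul_comm (coef g _)] using hasSum_inner_diagOp w N c g f
  · refine (hasSum_inner_diagOp w N c f f).nonneg fun i => ?_
    refine mul_nonneg ?_ (mul_self_nonneg _)
    split_ifs
    · exact hw _ (by omega)
    · exact hc

lemma hasSum_norm_diagOp (w : ℕ → ℝ) (N : ℕ) (c : ℝ) (f : L2) :
    HasSum (fun i => (if i < N then w (i + 1) else c) ^ 2 * coef f (i + 1) ^ 2)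
      (‖diagOp w N c f‖ ^ 2) := by
  refine (hasSum_coef_sq (diagOp w N c f)).congr_fun fun i => ?_
  rw [coef_diagOp]; ring

lemma IsWeight.le_one {υ : ℕ → ℝ} (hυ : IsWeight υ) (hanti : AntitoneOn υ (Set.Ici 1)) {j : ℕ}
    (hj : 1 ≤ j) : υ j ≤ 1 := hυ.1 ▸ hanti (Set.mem_Ici.2 le_rfl) hj hj

lemma IsWeight.one_le {γ : ℕ → ℝ} (hγ : IsWeight γ) (hmono : MonotoneOn γ (Set.Ici 1)) {j : ℕ}
    (hj : 1 ≤ j) : 1 ≤ γ j := hγ.1 ▸ hmono (Set.mem_Ici.2 le_rfl) hj hj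

section Link

variable {υ : ℕ → ℝ} {d : ℝ} {T : L2 →L[ℝ] L2}

lemma summable_sq_mul_coef (hυ : IsWeight υ) (hanti : AntitoneOn υ (Set.Ici 1)) (f : L2) :
    Summable (fun j => υ (j + 1) ^ 2 * coef f (j + 1) ^ 2) := by
  refine Summable.of_nonneg_of_le (fun j => by positivity) (fun j => ?_) (summable_coef_sq f)
  have h1 := hυ.le_one hanti (Nat.le_add_left 1 j)
  have h0 := hυ.2 (j + 1) (by omega)
  have : υ (j + 1) ^ 2 ≤ 1 := pow_le_one₀ h0.le h1
  nlinarith [sq_nonneg (coef f (j + 1))]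

/-- The link condition in form sense, lower bound: `D_υ ≤ d T`. -/
lemma sum_le_inner_of_link (hd : 1 ≤ d) (hυ : IsWeight υ) (hanti : AntitoneOn υ (Set.Ici 1))
    (hT : T ∈ linkClass υ d) (m : ℕ) (f : L2) :
    ∑ j ∈ Finset.range m, υ (j + 1) * coef f (j + 1) ^ 2 ≤ d * ⟪T f, f⟫ := by
  have hd0 : (0 : ℝ) < d := by linarith
  have key := inner_le_inner_of_norm_le (A := diagOp υ m 0) (B := d • T)
    (diagOp_isPositive (fun j hj => (hυ.2 j hj).le) le_rfl) (hT.1.smul_of_nonneg hd0.le) (fun x => ?_) f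
  · have h1 := (hasSum_inner_diagOp υ m 0 f f).unique
      (hasSum_sum_of_ne_finset_zero (s := Finset.range m) fun i hi => by
        simp only [Finset.mem_range] at hi; simp [hi])
    rw [h1, smul_apply, real_inner_smul_left] at key
    refine le_trans (le_of_eq (Finset.sum_congr rfl fun j hj => ?_)) key
    rw [if_pos (Finset.mem_range.1 hj)]; ring
  · rw [← abs_of_nonneg (norm_nonneg (diagOp υ m 0 x)), ← abs_of_nonneg (norm_nonneg ((d • T) x))]
    rw [← sq_le_sq, smul_apply, norm_smul, mul_pow, Real.norm_eq_abs, sq_abs]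
    have h2 := (hT.2.2.2 x).1
    rw [div_le_iff₀ (by positivity)] at h2
    have h3 := hasSum_norm_diagOp υ m 0 x
    rw [← h3.tsum_eq]
    refine le_trans (h3.summable.tsum_le_tsum (fun j => ?_) (summable_sq_mul_coef hυ hanti x))
      (by linarith)
    split_ifs
    · exact le_rfl
    · simpa using (by positivity : 0 ≤ υ (j + 1) ^ 2 * coef x (j + 1) ^ 2)

/-- The link condition in form sense, upper bound: `T ≤ d D` for every diagonal operator `D` that
agrees with `D_υ` on the first `N` basis vectors and is `υ_{N+1}` on the others. -/
lemma inner_le_of_link (hd : 1 ≤ d) (hυ : IsWeight υ) (hanti : AntitoneOn υ (Set.Ici 1))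
    (hT : T ∈ linkClass υ d) (N : ℕ) (f : L2) :
    ⟪T f, f⟫ ≤ d * ⟪diagOp υ N (υ (N + 1)) f, f⟫ := by
  have hd0 : (0 : ℝ) < d := by linarith
  have hc := hυ.2 (N + 1) (by omega)
  have key := inner_le_inner_of_norm_le (A := T) (B := d • diagOp υ N (υ (N + 1))) hT.1
    ((diagOp_isPositive (fun j hj => (hυ.2 j hj).le) hc.le).smul_of_nonneg hd0.le) (fun x => ?_) f
  · rwa [smul_apply, real_inner_smul_left] at key
  · rw [← abs_of_nonneg (norm_nonneg (T x)), ← abs_of_nonneg (norm_nonneg ((d • _ : L2 →L[ℝ] L2) x))]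
    rw [← sq_le_sq, smul_apply, norm_smul, mul_pow, Real.norm_eq_abs, sq_abs]
    refine (hT.2.2.2 x).2.trans ?_
    have h3 := hasSum_norm_diagOp υ N (υ (N + 1)) x
    rw [← h3.tsum_eq]
    refine mul_le_mul_of_nonneg_left ?_ (sq_nonneg d)
    refine (summable_sq_mul_coef hυ hanti x).tsum_le_tsum (fun j => ?_) h3.summable
    have h0 := hυ.2 (j + 1) (by omega)
    split_ifs with h
    · exact le_rfl
    · gcongr
      exact hanti (Set.mem_Ici.2 (by omega)) (Set.mem_Ici.2 (by omega)) (by omega)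

lemma inner_poly_le_of_link (hd : 1 ≤ d) (hυ : IsWeight υ) (hanti : AntitoneOn υ (Set.Ici 1))
    (hT : T ∈ linkClass υ d) {m : ℕ} (v : Fin m → ℝ) :
    ⟪T (poly v), poly v⟫ ≤ d * ∑ j : Fin m, υ (j + 1) * v j ^ 2 := by
  refine (inner_le_of_link hd hυ hanti hT m (poly v)).trans (le_of_eq ?_)
  congr 1
  have h1 := (hasSum_inner_diagOp υ m (υ (m + 1)) (poly v) (poly v)).unique
    (hasSum_sum_of_ne_finset_zero (s := Finset.range m) fun i hi => by
      simp only [Finset.mem_range, not_lt] at hi; simp [coef_poly_of_le v hi])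
  rw [h1, Finset.sum_range]
  refine Finset.sum_congr rfl fun j _ => ?_
  rw [coef_poly, if_pos j.2]; ring

/-- On functions without frequencies `1, …, m`, the form of `T` is at most `d υ_m / γ_m` times the
squared `γ`-norm. -/
lemma inner_tail_le_of_link {γ : ℕ → ℝ} (hd : 1 ≤ d) (hυ : IsWeight υ)
    (hanti : AntitoneOn υ (Set.Ici 1)) (hγ : IsWeight γ) (hmono : MonotoneOn γ (Set.Ici 1))
    (hT : T ∈ linkClass υ d) {m : ℕ} (hm : 1 ≤ m) {f : L2} (hf : ∀ j < m, coef f (j + 1) = 0)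
    (hs : Summable (fun j => γ (j + 1) * coef f (j + 1) ^ 2)) :
    ⟪T f, f⟫ ≤ d * (υ m / γ m) * ∑' j, γ (j + 1) * coef f (j + 1) ^ 2 := by
  refine (inner_le_of_link hd hυ hanti hT m f).trans ?_
  have h3 := hasSum_inner_diagOp υ m (υ (m + 1)) f f
  rw [mul_assoc, ← tsum_mul_left, ← h3.tsum_eq]
  refine mul_le_mul_of_nonneg_left ?_ (by linarith)
  refine h3.summable.tsum_le_tsum (fun j => ?_) (hs.mul_left _)
  split_ifs with h
  · simp [hf j h]
  · have h1 : υ (m + 1) ≤ υ m := hanti (Set.mem_Ici.2 hm) (Set.mem_Ici.2 (by omega)) (by omega)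
    have h2 : γ m ≤ γ (j + 1) := hmono (Set.mem_Ici.2 hm) (Set.mem_Ici.2 (by omega)) (by omega)
    have h4 := hγ.2 m hm
    have h5 := hυ.2 m hm
    have h6 : υ (m + 1) ≤ υ m / γ m * γ (j + 1) := by
      rw [div_mul_eq_mul_div, le_div_iff₀ h4]
      nlinarith
    calc υ (m + 1) * (coef f (j + 1) * coef f (j + 1)) = υ (m + 1) * coef f (j + 1) ^ 2 := by ring
      _ ≤ (υ m / γ m * γ (j + 1)) * coef f (j + 1) ^ 2 := by gcongr
      _ = _ := by ring

end Link

/-! ### Moments of sums of independent centered random variables -/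

/-- The maps `Fin (2 q) → Fin n` none of whose fibres is a singleton. -/
def pairedMaps (q n : ℕ) : Finset (Fin (2 * q) → Fin n) :=
  {f | ∀ t, (Finset.univ.filter fun i => f i = t).card ≠ 1}

/-- A map without singleton fibres has at most `q` values, so it factors through `Fin q`. -/
lemma card_pairedMaps_le (q n : ℕ) : (pairedMaps q n).card ≤ n ^ q * q ^ (2 * q) := by
  classical
  rcases Nat.eq_zero_or_pos q with rfl | hq
  · refine (Finset.card_le_univ _).trans ?_
    simp
  have hsub : pairedMaps q n ⊆ (Finset.univ : Finset ((Fin q → Fin n) × (Fin (2 * q) → Fin q))).image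
      (fun p => p.1 ∘ p.2) := by
    intro f hf
    simp only [pairedMaps, Finset.mem_filter, Finset.mem_univ, true_and] at hf
    have hcard : (Finset.univ.image f).card ≤ q := by
      have := Finset.mul_card_image_le_card (f := f) Finset.univ 2 (fun t ht => by
        obtain ⟨i, -, rfl⟩ := Finset.mem_image.1 ht
        have h1 : 0 < (Finset.univ.filter fun j => f j = f i).card :=
          Finset.card_pos.2 ⟨i, by simp⟩
        have h2 := hf (f i)
        omega)
      simp only [Finset.card_univ, Fintype.card_fin] at this
      omega
    obtain ⟨emb⟩ : Nonempty ((Finset.univ.image f) ↪ Fin q) := by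
      apply Function.Embedding.nonempty_of_card_le
      rwa [Fintype.card_coe, Fintype.card_fin]
    refine Finset.mem_image.2 ⟨(Function.extend emb Subtype.val (fun _ => f ⟨0, by omega⟩),
      fun i => emb ⟨f i, by simp⟩), Finset.mem_univ _, ?_⟩
    funext i
    simp only [Function.comp_apply]
    rw [emb.injective.extend_apply]
  refine (Finset.card_le_card hsub).trans (Finset.card_image_le.trans ?_)
  simp

lemma prod_abs_le_sum_pow {N : ℕ} (hN : N ≠ 0) (a : Fin N → ℝ) :
    ∏ k, |a k| ≤ ∑ k, |a k| ^ N := by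
  have : Nonempty (Fin N) := ⟨⟨0, by omega⟩⟩
  obtain ⟨k0, -, hk0⟩ := Finset.exists_max_image Finset.univ (fun k => |a k|) Finset.univ_nonempty
  calc ∏ k, |a k| ≤ ∏ _k : Fin N, |a k0| :=
        Finset.prod_le_prod (fun k _ => abs_nonneg _) (fun k hk => hk0 k hk)
    _ = |a k0| ^ N := by simp
    _ ≤ ∑ k, |a k| ^ N :=
        Finset.single_le_sum (f := fun k => |a k| ^ N) (fun k _ => by positivity) (Finset.mem_univ k0)

/-- The constant in the moment inequality for sums of independent centered variables. -/
def momentConst (q : ℕ) : ℝ := 2 * q * q ^ (2 * q)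

lemma momentConst_nonneg (q : ℕ) : 0 ≤ momentConst q := by unfold momentConst; positivity

section Moments

variable {Ω : Type*} [MeasurableSpace Ω] {μ : Measure Ω} [IsProbabilityMeasure μ]

lemma integrable_pow_of_le {Z : Ω → ℝ} {N c : ℕ} (hm : AEStronglyMeasurable Z μ) (hN : Even N)
    (hZ : Integrable (fun ω => Z ω ^ N) μ) (hc : c ≤ N) : Integrable (fun ω => Z ω ^ c) μ := by
  refine Integrable.mono' (hZ.add (integrable_const 1)) (hm.pow c) (Eventually.of_forall fun ω => ?_)
  rw [Real.norm_eq_abs, abs_pow, Pi.add_apply, ← hN.pow_abs]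
  rcases le_total |Z ω| 1 with h | h
  · have := pow_le_one₀ (n := c) (abs_nonneg (Z ω)) h
    have : 0 ≤ |Z ω| ^ N := by positivity
    linarith
  · have := pow_le_pow_right₀ h hc
    linarith

variable (μ) in
/-- The moment inequality of Marcinkiewicz–Zygmund type: the `2q`-th moment of a sum of `n`
independent centered variables grows like `n ^ q`.  In the expansion of the power, products with a
factor that occurs exactly once have mean zero. -/
theorem integral_sum_pow_le {Z : Ω → ℝ} {q : ℕ} (hq : 1 ≤ q) (hm : AEStronglyMeasurable Z μ)
    (hZ : Integrable (fun ω => Z ω ^ (2 * q)) μ) (h0 : ∫ ω, Z ω ∂μ = 0) (n : ℕ) :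
    Integrable (fun ω : Fin n → Ω => (∑ i, Z (ω i)) ^ (2 * q)) (Measure.pi fun _ => μ) ∧
    ∫ ω : Fin n → Ω, (∑ i, Z (ω i)) ^ (2 * q) ∂(Measure.pi fun _ => μ)
      ≤ momentConst q * n ^ q * ∫ ω, Z ω ^ (2 * q) ∂μ := by
  classical
  set A := ∫ ω, Z ω ^ (2 * q) ∂μ with hA
  have hA0 : 0 ≤ A := integral_nonneg fun ω => (even_two_mul q).pow_nonneg _
  set c : (Fin (2 * q) → Fin n) → Fin n → ℕ := fun f t => (Finset.univ.filter fun i => f i = t).card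
    with hc
  have hcle : ∀ f t, c f t ≤ 2 * q := fun f t => (Finset.card_le_univ _).trans (by simp)
  have hprod : ∀ (f : Fin (2 * q) → Fin n) (ω : Fin n → Ω),
      ∏ k, Z (ω (f k)) = ∏ t, Z (ω t) ^ c f t := by
    intro f ω
    rw [← Finset.prod_fiberwise Finset.univ f]
    refine Finset.prod_congr rfl fun t _ => ?_
    rw [Finset.prod_congr rfl (g := fun _ => Z (ω t))
      (fun k hk => by rw [(Finset.mem_filter.1 hk).2]), Finset.prod_const]
  have hint : ∀ f : Fin (2 * q) → Fin n,
      Integrable (fun ω : Fin n → Ω => ∏ k, Z (ω (f k))) (Measure.pi fun _ => μ) := by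
    intro f
    simp_rw [hprod f]
    exact Integrable.fintype_prod (f := fun t ω => Z ω ^ c f t)
      (fun t => integrable_pow_of_le hm (even_two_mul q) hZ (hcle f t))
  have hexp : ∀ ω : Fin n → Ω, (∑ i, Z (ω i)) ^ (2 * q)
      = ∑ f : Fin (2 * q) → Fin n, ∏ k, Z (ω (f k)) := fun ω =>
    Fintype.sum_pow (fun i => Z (ω i)) (2 * q)
  -- a factor occurring exactly once makes the expectation of the product vanish
  have hzero : ∀ f : Fin (2 * q) → Fin n, f ∉ pairedMaps q n →
      ∫ ω : Fin n → Ω, ∏ k, Z (ω (f k)) ∂(Measure.pi fun _ => μ) = 0 := by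
    intro f hf
    simp only [pairedMaps, Finset.mem_filter, Finset.mem_univ, true_and, not_forall, not_not] at hf
    obtain ⟨t, ht⟩ := hf
    simp_rw [hprod f]
    rw [integral_fintype_prod_eq_prod (f := fun t ω => Z ω ^ c f t)]
    refine Finset.prod_eq_zero (Finset.mem_univ t) ?_
    have : c f t = 1 := ht
    simp [this, h0]
  have hcoord : ∀ t : Fin n, Integrable (fun ω : Fin n → Ω => |Z (ω t)| ^ (2 * q))
      (Measure.pi fun _ => μ) ∧
      ∫ ω : Fin n → Ω, |Z (ω t)| ^ (2 * q) ∂(Measure.pi fun _ => μ) = A := by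
    intro t
    have hmp := measurePreserving_eval (fun _ : Fin n => μ) t
    have e : ∀ x : ℝ, |x| ^ (2 * q) = x ^ (2 * q) := fun x => (even_two_mul q).pow_abs x
    simp_rw [e]
    refine ⟨hmp.integrable_comp_of_integrable hZ, ?_⟩
    have hZm : AEStronglyMeasurable (fun ω => Z ω ^ (2 * q)) (Measure.map (Function.eval t)
        (Measure.pi fun _ : Fin n => μ)) := by rw [hmp.map_eq]; exact hZ.1
    have := integral_map hmp.measurable.aemeasurable hZm
    rw [hmp.map_eq] at this
    exact this.symm
  -- every product is bounded by the sum of the `2q`-th powers of its `2q` factors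
  have hbd : ∀ f : Fin (2 * q) → Fin n,
      ∫ ω : Fin n → Ω, ∏ k, Z (ω (f k)) ∂(Measure.pi fun _ => μ) ≤ 2 * q * A := by
    intro f
    calc ∫ ω : Fin n → Ω, ∏ k, Z (ω (f k)) ∂(Measure.pi fun _ => μ)
        ≤ ∫ ω : Fin n → Ω, ∑ k, |Z (ω (f k))| ^ (2 * q) ∂(Measure.pi fun _ => μ) := by
          refine integral_mono (hint f) (integrable_finsetSum _ fun k _ => (hcoord (f k)).1) ?_
          intro ω
          refine (le_abs_self _).trans ?_
          rw [Finset.abs_prod]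
          exact prod_abs_le_sum_pow (by omega) _
      _ = 2 * q * A := by
          rw [integral_finsetSum _ fun k _ => (hcoord (f k)).1]
          simp [(hcoord _).2]
  refine ⟨?_, ?_⟩
  · simp_rw [hexp]
    exact integrable_finsetSum _ fun f _ => hint f
  · simp_rw [hexp]
    rw [integral_finsetSum _ fun f _ => hint f,
      ← Finset.sum_subset (Finset.subset_univ (pairedMaps q n)) (fun f _ hf => hzero f hf)]
    calc ∑ f ∈ pairedMaps q n, ∫ ω : Fin n → Ω, ∏ k, Z (ω (f k)) ∂(Measure.pi fun _ => μ)
        ≤ ∑ _f ∈ pairedMaps q n, 2 * q * A := Finset.sum_le_sum fun f _ => hbd f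
      _ = (pairedMaps q n).card * (2 * q * A) := by rw [Finset.sum_const, nsmul_eq_mul]
      _ ≤ ((n ^ q * q ^ (2 * q) : ℕ) : ℝ) * (2 * q * A) := by
          gcongr
          exact card_pairedMaps_le q n
      _ = momentConst q * n ^ q * A := by
          rw [momentConst]; push_cast; ring

variable (μ) in
/-- The moment inequality for empirical means. -/
lemma lintegral_mean_pow_le {Z : Ω → ℝ} {q : ℕ} (hq : 1 ≤ q) (hm : AEStronglyMeasurable Z μ)
    (hZ : Integrable (fun ω => Z ω ^ (2 * q)) μ) (h0 : ∫ ω, Z ω ∂μ = 0) {M : ℝ}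
    (hM : ∫ ω, Z ω ^ (2 * q) ∂μ ≤ M) {n : ℕ} (hn : 1 ≤ n) :
    ∫⁻ ω : Fin n → Ω, ENNReal.ofReal (((n : ℝ)⁻¹ * ∑ i, Z (ω i)) ^ (2 * q)) ∂(Measure.pi fun _ => μ)
      ≤ ENNReal.ofReal (momentConst q * M / n ^ q) := by
  have hn0 : (0 : ℝ) < n := by exact_mod_cast hn
  obtain ⟨h1, h2⟩ := integral_sum_pow_le μ hq hm hZ h0 n
  simp_rw [mul_pow]
  rw [← ofReal_integral_eq_lintegral_ofReal (h1.const_mul _)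
    (Eventually.of_forall fun ω => mul_nonneg (by positivity) ((even_two_mul q).pow_nonneg _)),
    integral_const_mul]
  refine ENNReal.ofReal_le_ofReal ?_
  calc (n : ℝ)⁻¹ ^ (2 * q) * ∫ ω : Fin n → Ω, (∑ i, Z (ω i)) ^ (2 * q) ∂(Measure.pi fun _ => μ)
      ≤ (n : ℝ)⁻¹ ^ (2 * q) * (momentConst q * n ^ q * M) := by
        gcongr
        refine h2.trans ?_
        have := momentConst_nonneg q
        gcongr
    _ = momentConst q * M / n ^ q := by
        rw [two_mul, pow_add, inv_pow]; field_simp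

end Moments

/-! ### Moments of linear functionals of the regressor -/

lemma measurable_coef (j : ℕ) : Measurable (fun x : L2 => coef x j) := by
  have : Continuous (fun x : L2 => coef x j) := by unfold coef; fun_prop
  exact this.measurable

lemma measurable_inner_const (f : L2) : Measurable (fun x : L2 => ⟪f, x⟫) := by
  have : Continuous (fun x : L2 => ⟪f, x⟫) := by fun_prop
  exact this.measurable

lemma dotProduct_opMatrix_mulVec (T : L2 →L[ℝ] L2) {m : ℕ} (v w : Fin m → ℝ) :
    w ⬝ᵥ (opMatrix T m).mulVec v = ⟪T (poly v), poly w⟫ := by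
  rw [real_inner_comm, inner_poly]
  refine congrArg (fun y => w ⬝ᵥ y) (funext fun j => ?_)
  simp only [poly, map_sum, map_smul, coef_sum, coef_smul]
  rw [Matrix.mulVec, dotProduct]
  exact Finset.sum_congr rfl fun l _ => mul_comm _ _

lemma poly_eq_zero_iff {m : ℕ} (v : Fin m → ℝ) : poly v = 0 ↔ v = 0 := by
  constructor
  · intro h
    funext i
    rw [← coef_poly v i, h]
    simp [coef]
  · rintro rfl; simp [poly]

lemma opMatrix_posDef {T : L2 →L[ℝ] L2} (hT : T.IsPositive)
    (hpos : ∀ f, f ≠ 0 → 0 < ⟪T f, f⟫) (m : ℕ) : (opMatrix T m).PosDef := by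
  refine Matrix.PosDef.of_dotProduct_mulVec_pos ?_ fun v hv => ?_
  · ext j l
    simp only [Matrix.conjTranspose_apply, opMatrix, Matrix.of_apply, star_trivial]
    rw [hT.inner_left_eq_inner_right, real_inner_comm]
  · rw [star_trivial, dotProduct_opMatrix_mulVec]
    exact hpos _ fun h => hv ((poly_eq_zero_iff v).1 h)

open scoped MatrixOrder in
/-- A positive definite matrix has a positive definite inverse square root. -/
lemma exists_posDef_inv_sqrt {m : ℕ} {A : Matrix (Fin m) (Fin m) ℝ} (hA : A.PosDef) :
    ∃ S : Matrix (Fin m) (Fin m) ℝ, S.PosDef ∧ S * S * A = 1 := by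
  have hi : A⁻¹.PosSemidef := hA.posSemidef.inv
  have hS : CFC.sqrt A⁻¹ * CFC.sqrt A⁻¹ = A⁻¹ := CFC.sqrt_mul_sqrt_self _ hi.nonneg
  have h1 : CFC.sqrt A⁻¹ * CFC.sqrt A⁻¹ * A = 1 := by
    rw [hS, Matrix.nonsing_inv_mul _ (isUnit_iff_ne_zero.2 hA.det_pos.ne')]
  refine ⟨CFC.sqrt A⁻¹, ?_, h1⟩
  rw [(Matrix.nonneg_iff_posSemidef.1 (CFC.sqrt_nonneg A⁻¹)).posDef_iff_det_ne_zero]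
  intro h0
  have := congrArg Matrix.det h1
  simp [h0] at this

lemma PosDef.mulVec_dotProduct {m : ℕ} {S : Matrix (Fin m) (Fin m) ℝ} (hS : S.PosDef)
    (v w : Fin m → ℝ) : S.mulVec v ⬝ᵥ w = v ⬝ᵥ S.mulVec w := by
  have h : S.transpose = S := by
    have := hS.isHermitian
    rwa [Matrix.IsHermitian, Matrix.conjTranspose_eq_transpose_of_trivial] at this
  rw [Matrix.dotProduct_mulVec, ← Matrix.mulVec_transpose, h]

/-- Partial sums of the expansion of `f`. -/
lemma tendsto_poly (f : L2) :
    Tendsto (fun N : ℕ => poly fun j : Fin N => coef f (j + 1)) atTop (nhds f) := by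
  have := (trigBasis.hasSum_repr f).tendsto_sum_nat
  refine this.congr fun N => ?_
  rw [poly, Finset.sum_range]
  refine Finset.sum_congr rfl fun j _ => ?_
  rw [coef_eq_repr, trigBasis_apply]

section Regressor

variable {υ : ℕ → ℝ} {d η : ℝ} {K : ℕ} {ν : Measure L2}

/-- The moment condition for trigonometric polynomials: `⟪poly w, X⟫` is a linear functional of the
whitened coefficients of `X` along a vector of squared length `⟪T (poly w), poly w⟫`. -/
lemma lintegral_inner_poly_pow_le (hK : 1 ≤ K) (hν : ν ∈ linkedRegressors υ d (4 * K) η) {m : ℕ}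
    (w : Fin m → ℝ) :
    ∫⁻ x, ENNReal.ofReal (|⟪poly w, x⟫| ^ (4 * K)) ∂ν
      ≤ ENNReal.ofReal (η * ⟪covarianceOperator ν (poly w), poly w⟫ ^ (2 * K)) := by
  obtain ⟨⟨hprob, hmem, hmean, hmom1, hmom2⟩, hT⟩ := hν
  set T := covarianceOperator ν with hTdef
  obtain ⟨S, hS, hSA⟩ := exists_posDef_inv_sqrt (opMatrix_posDef hT.1 hT.2.1 m)
  -- the direction `[T]_m^{1/2} w` in whitened coordinates
  set y := S.mulVec ((opMatrix T m).mulVec w) with hy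
  have hSy : S.mulVec y = w := by
    rw [hy, Matrix.mulVec_mulVec, Matrix.mulVec_mulVec, hSA, Matrix.one_mulVec]
  have hyy : y ⬝ᵥ y = ⟪T (poly w), poly w⟫ := by
    rw [hy, PosDef.mulVec_dotProduct hS, ← hy, hSy, dotProduct_comm, dotProduct_opMatrix_mulVec]
  have hinner : ∀ x, ⟪poly w, x⟫ = y ⬝ᵥ S.mulVec (fun j : Fin m => coef x (j + 1)) := by
    intro x
    rw [← PosDef.mulVec_dotProduct hS, hSy, inner_poly]
  by_cases hw : w = 0
  · subst hw
    have h0 : (poly (0 : Fin m → ℝ)) = 0 := (poly_eq_zero_iff _).2 rfl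
    have : 4 * K ≠ 0 := by omega
    simp [h0, this]
  have hpos : 0 < y ⬝ᵥ y := by
    rw [hyy]; exact hT.2.1 _ fun h => hw ((poly_eq_zero_iff w).1 h)
  set r := √(y ⬝ᵥ y) with hr
  have hr0 : 0 < r := Real.sqrt_pos.2 hpos
  have hrr : r ^ 2 = y ⬝ᵥ y := Real.sq_sqrt hpos.le
  have key := hmom2 m S hS hSA (r⁻¹ • y) (by
    rw [smul_dotProduct, dotProduct_smul, smul_eq_mul, smul_eq_mul, ← hrr]
    field_simp)
  calc ∫⁻ x, ENNReal.ofReal (|⟪poly w, x⟫| ^ (4 * K)) ∂ν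
      = ∫⁻ x, ENNReal.ofReal (r ^ (4 * K)) * ENNReal.ofReal
          (|(r⁻¹ • y) ⬝ᵥ S.mulVec (fun j : Fin m => coef x (j + 1))| ^ (4 * K)) ∂ν := by
        refine lintegral_congr fun x => ?_
        rw [← ENNReal.ofReal_mul (by positivity), ← mul_pow, smul_dotProduct, smul_eq_mul, abs_mul,
          abs_of_pos (inv_pos.2 hr0), ← mul_assoc, mul_inv_cancel₀ hr0.ne', one_mul, hinner]
    _ = ENNReal.ofReal (r ^ (4 * K)) * ∫⁻ x, ENNReal.ofReal
          (|(r⁻¹ • y) ⬝ᵥ S.mulVec (fun j : Fin m => coef x (j + 1))| ^ (4 * K)) ∂ν :=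
        lintegral_const_mul' _ _ ENNReal.ofReal_ne_top
    _ ≤ ENNReal.ofReal (r ^ (4 * K)) * ENNReal.ofReal η := by gcongr
    _ = _ := by
        rw [← ENNReal.ofReal_mul (by positivity), ← hyy, ← hrr, ← pow_mul, mul_comm η]
        congr 3
        ring

/-- The moment condition for linear functionals of arbitrary functions, which follows from the case
of trigonometric polynomials by the Fatou lemma. -/
lemma lintegral_inner_pow_le (hK : 1 ≤ K) (hν : ν ∈ linkedRegressors υ d (4 * K) η) (f : L2) :
    ∫⁻ x, ENNReal.ofReal (|⟪f, x⟫| ^ (4 * K)) ∂ν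
      ≤ ENNReal.ofReal (η * ⟪covarianceOperator ν f, f⟫ ^ (2 * K)) := by
  set g : ℕ → L2 := fun N => poly fun j : Fin N => coef f (j + 1) with hg
  have hgf : Tendsto g atTop (nhds f) := tendsto_poly f
  have h1 : ∀ x, Tendsto (fun N => ENNReal.ofReal (|⟪g N, x⟫| ^ (4 * K))) atTop
      (nhds (ENNReal.ofReal (|⟪f, x⟫| ^ (4 * K)))) := fun x =>
    ENNReal.tendsto_ofReal (((hgf.inner tendsto_const_nhds).abs).pow _)
  have h2 : Tendsto (fun N => ENNReal.ofReal (η * ⟪covarianceOperator ν (g N), g N⟫ ^ (2 * K))) atTop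
      (nhds (ENNReal.ofReal (η * ⟪covarianceOperator ν f, f⟫ ^ (2 * K)))) :=
    ENNReal.tendsto_ofReal
      (((((covarianceOperator ν).continuous.tendsto f).comp hgf).inner hgf).pow _ |>.const_mul _)
  calc ∫⁻ x, ENNReal.ofReal (|⟪f, x⟫| ^ (4 * K)) ∂ν
      = ∫⁻ x, liminf (fun N => ENNReal.ofReal (|⟪g N, x⟫| ^ (4 * K))) atTop ∂ν :=
        lintegral_congr fun x => (h1 x).liminf_eq.symm
    _ ≤ liminf (fun N => ∫⁻ x, ENNReal.ofReal (|⟪g N, x⟫| ^ (4 * K)) ∂ν) atTop :=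
        lintegral_liminf_le fun N => by
          have := measurable_inner_const (g N)
          fun_prop
    _ ≤ liminf (fun N => ENNReal.ofReal (η * ⟪covarianceOperator ν (g N), g N⟫ ^ (2 * K))) atTop :=
        liminf_le_liminf (Eventually.of_forall fun N => lintegral_inner_poly_pow_le hK hν _)
    _ = _ := h2.liminf_eq

end Regressor

/-- From a bound on a lower integral of an even power to integrability and a bound on the mean. -/
lemma integrable_pow_of_lintegral_le {Ω : Type*} [MeasurableSpace Ω] {μ : Measure Ω} {Z : Ω → ℝ}
    {N : ℕ} (hN : Even N) (hm : Measurable Z) {M : ℝ} (hM : 0 ≤ M)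
    (h : ∫⁻ ω, ENNReal.ofReal (|Z ω| ^ N) ∂μ ≤ ENNReal.ofReal M) :
    Integrable (fun ω => Z ω ^ N) μ ∧ ∫ ω, Z ω ^ N ∂μ ≤ M := by
  simp_rw [hN.pow_abs] at h
  have hnn : ∀ ω, 0 ≤ Z ω ^ N := fun ω => hN.pow_nonneg _
  have hm' : Measurable (fun ω => Z ω ^ N) := by fun_prop
  have hi : Integrable (fun ω => Z ω ^ N) μ :=
    (lintegral_ofReal_ne_top_iff_integrable hm'.aestronglyMeasurable (Eventually.of_forall hnn)).1
      (h.trans_lt ENNReal.ofReal_lt_top).ne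
  refine ⟨hi, ?_⟩
  rw [← ofReal_integral_eq_lintegral_ofReal hi (Eventually.of_forall hnn)] at h
  exact (ENNReal.ofReal_le_ofReal_iff hM).1 h

/-! ### Empirical moments of an isotropic vector -/

lemma pow_le_one_add_pow {a : ℝ} {c N : ℕ} (ha : 0 ≤ a) (hc : c ≤ N) : a ^ c ≤ 1 + a ^ N := by
  rcases le_total a 1 with h | h
  · have h1 := pow_le_one₀ (n := c) ha h
    have h2 : 0 ≤ a ^ N := by positivity
    linarith
  · have := pow_le_pow_right₀ h hc
    linarith

lemma abs_mul_sub_pow_le {x y c : ℝ} (hc : |c| ≤ 1) {q K : ℕ} (hqK : q ≤ K) :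
    (x * y - c) ^ (2 * q) ≤ 4 ^ q * (x ^ (4 * K) + y ^ (4 * K) + 3) := by
  have e1 : ∀ z : ℝ, |z| ^ (2 * q) = z ^ (2 * q) := fun z => (even_two_mul q).pow_abs z
  have e2 : ∀ z : ℝ, |z| ^ (4 * K) = z ^ (4 * K) := fun z =>
    (show Even (4 * K) from ⟨2 * K, by ring⟩).pow_abs z
  have h1 : |x * y| ^ (2 * q) ≤ |x| ^ (4 * q) + |y| ^ (4 * q) := by
    rw [abs_mul, mul_pow]
    have a1 : |x| ^ (4 * q) = (|x| ^ (2 * q)) ^ 2 := by rw [← pow_mul]; congr 1; ring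
    have a2 : |y| ^ (4 * q) = (|y| ^ (2 * q)) ^ 2 := by rw [← pow_mul]; congr 1; ring
    rw [a1, a2]
    nlinarith [sq_nonneg (|x| ^ (2 * q) - |y| ^ (2 * q)), sq_nonneg (|x| ^ (2 * q)),
      sq_nonneg (|y| ^ (2 * q))]
  have h2 : |x| ^ (4 * q) ≤ 1 + |x| ^ (4 * K) := pow_le_one_add_pow (abs_nonneg _) (by omega)
  have h3 : |y| ^ (4 * q) ≤ 1 + |y| ^ (4 * K) := pow_le_one_add_pow (abs_nonneg _) (by omega)
  have h4 : |c| ^ (2 * q) ≤ 1 := pow_le_one₀ (abs_nonneg _) hc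
  calc (x * y - c) ^ (2 * q) = |x * y - c| ^ (2 * q) := (e1 _).symm
    _ ≤ (|x * y| + |c|) ^ (2 * q) := by gcongr; exact abs_sub _ _
    _ ≤ 2 ^ (2 * q - 1) * (|x * y| ^ (2 * q) + |c| ^ (2 * q)) :=
        add_pow_le (abs_nonneg _) (abs_nonneg _) _
    _ ≤ 2 ^ (2 * q) * (|x * y| ^ (2 * q) + |c| ^ (2 * q)) := by
        gcongr
        · norm_num
        · omega
    _ ≤ 4 ^ q * (x ^ (4 * K) + y ^ (4 * K) + 3) := by
        rw [pow_mul, show (2 : ℝ) ^ 2 = 4 by norm_num, ← e2 x, ← e2 y]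
        exact mul_le_mul_of_nonneg_left (by linarith) (by positivity)

section Abstract

variable {Ω : Type*} [MeasurableSpace Ω] (μ : Measure Ω) {K : ℕ}

/-- `f` is measurable with `E f^{4K} ≤ M`. -/
structure HasMoment (K : ℕ) (M : ℝ) (f : Ω → ℝ) : Prop where
  measurable : Measurable f
  integrable : Integrable (fun ω => f ω ^ (4 * K)) μ
  integral_le : ∫ ω, f ω ^ (4 * K) ∂μ ≤ M

variable {μ}

lemma HasMoment.nonneg {M : ℝ} {f : Ω → ℝ} (h : HasMoment μ K M f) : 0 ≤ M :=
  (integral_nonneg fun _ => (show Even (4 * K) from ⟨2 * K, by ring⟩).pow_nonneg _).trans h.3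

/-- The empirical mean of a product of two variables concentrates around its expectation. -/
lemma lintegral_mean_mul_sub_pow_le [IsProbabilityMeasure μ] {M M' c : ℝ} {f g : Ω → ℝ} (hf : HasMoment μ K M f)
    (hg : HasMoment μ K M' g) (hc : |c| ≤ 1) (hfg : ∫ ω, f ω * g ω ∂μ = c) {q : ℕ} (hq : 1 ≤ q)
    (hqK : q ≤ K) {n : ℕ} (hn : 1 ≤ n) :
    ∫⁻ ω : Fin n → Ω, ENNReal.ofReal (((n : ℝ)⁻¹ * ∑ i, f (ω i) * g (ω i) - c) ^ (2 * q))
        ∂(Measure.pi fun _ => μ)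
      ≤ ENNReal.ofReal (momentConst q * (4 ^ q * (M + M' + 3)) / n ^ q) := by
  have hm : Measurable (fun ω => f ω * g ω - c) := (hf.1.mul hg.1).sub_const c
  have hbd : Integrable (fun ω => (4 : ℝ) ^ q * (f ω ^ (4 * K) + g ω ^ (4 * K) + 3)) μ :=
    ((hf.2.add hg.2).add (integrable_const 3)).const_mul _
  have hint : Integrable (fun ω => (f ω * g ω - c) ^ (2 * q)) μ := by
    refine hbd.mono' (hm.pow_const _).aestronglyMeasurable (Eventually.of_forall fun ω => ?_)
    rw [Real.norm_eq_abs, abs_of_nonneg ((even_two_mul q).pow_nonneg _)]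
    exact abs_mul_sub_pow_le hc hqK
  have hle : ∫ ω, (f ω * g ω - c) ^ (2 * q) ∂μ ≤ 4 ^ q * (M + M' + 3) := by
    refine (integral_mono hint hbd fun ω => abs_mul_sub_pow_le hc hqK).trans ?_
    have h1 : ∫ ω, (f ω ^ (4 * K) + g ω ^ (4 * K) + 3) ∂μ
        = ∫ ω, (f ω ^ (4 * K) + g ω ^ (4 * K)) ∂μ + ∫ _ω, 3 ∂μ :=
      integral_add (hf.2.add hg.2) (integrable_const 3)
    rw [integral_const_mul, h1, integral_add hf.2 hg.2]
    have := hf.3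
    have := hg.3
    simp only [integral_const, probReal_univ, smul_eq_mul, one_mul]
    gcongr
  have hfgi : Integrable (fun ω => f ω * g ω - c) μ := by
    have := integrable_pow_of_le (c := 1) hm.aestronglyMeasurable (even_two_mul q) hint (by omega)
    simpa using this
  have h0 : ∫ ω, (f ω * g ω - c) ∂μ = 0 := by
    have h1 : Integrable (fun ω => f ω * g ω) μ := by
      have := hfgi.add (integrable_const c)
      refine this.congr (Eventually.of_forall fun ω => ?_)
      simp
    rw [integral_sub h1 (integrable_const c), hfg]
    simp
  have := lintegral_mean_pow_le μ hq hm.aestronglyMeasurable hint h0 hle hn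
  refine le_trans (le_of_eq (lintegral_congr fun ω => ?_)) this
  congr 2
  have hn0 : (n : ℝ) ≠ 0 := by positivity
  rw [Finset.sum_sub_distrib, mul_sub]
  simp [hn0]

variable {m n : ℕ}

/-- The deviation `n⁻¹ ∑ X_i X_iᵗ - 1` of the empirical second moment matrix. -/
def devMatrix (X : Ω → Fin m → ℝ) (ω : Fin n → Ω) (j l : Fin m) : ℝ :=
  (n : ℝ)⁻¹ * ∑ i, X (ω i) j * X (ω i) l - if j = l then 1 else 0

/-- The empirical mean `n⁻¹ ∑ W_i X_i`. -/
def meanVector (X : Ω → Fin m → ℝ) (W : Ω → ℝ) (ω : Fin n → Ω) (l : Fin m) : ℝ :=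
  (n : ℝ)⁻¹ * ∑ i, W (ω i) * X (ω i) l

/-- A random vector with identity second moment matrix whose linear functionals along unit vectors
have `4K`-th moment at most `M`. -/
structure IsotropicMoment (μ : Measure Ω) (K : ℕ) (M : ℝ) (X : Ω → Fin m → ℝ) : Prop where
  moment : ∀ w : Fin m → ℝ, w ⬝ᵥ w = 1 → HasMoment μ K M (fun ω => w ⬝ᵥ X ω)
  isotropic : ∀ v w : Fin m → ℝ, ∫ ω, (v ⬝ᵥ X ω) * (w ⬝ᵥ X ω) ∂μ = v ⬝ᵥ w

variable {M : ℝ} {X : Ω → Fin m → ℝ}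

lemma single_dotProduct_self (j : Fin m) :
    (Pi.single j (1 : ℝ) : Fin m → ℝ) ⬝ᵥ Pi.single j 1 = 1 := by simp

lemma IsotropicMoment.coord (hX : IsotropicMoment μ K M X) (j : Fin m) :
    HasMoment μ K M (fun ω => X ω j) := by
  simpa using hX.moment _ (single_dotProduct_self j)

lemma abs_le_one_of_dotProduct {u : Fin m → ℝ} (hu : u ⬝ᵥ u = 1) (j : Fin m) : |u j| ≤ 1 := by
  rw [← sq_le_one_iff_abs_le_one, sq]
  calc u j * u j ≤ ∑ i, u i * u i :=
        Finset.single_le_sum (f := fun i => u i * u i) (fun i _ => mul_self_nonneg _)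
          (Finset.mem_univ j)
    _ = 1 := hu

/-- The Frobenius norm of the deviation matrix is of order `m / √n`. -/
lemma lintegral_devMatrix_pow_le [IsProbabilityMeasure μ] (hX : IsotropicMoment μ K M X) (hm : 1 ≤ m) {q : ℕ} (hq : 1 ≤ q)
    (hqK : q ≤ K) (hn : 1 ≤ n) :
    ∫⁻ ω : Fin n → Ω, ENNReal.ofReal ((∑ j, ∑ l, devMatrix X ω j l ^ 2) ^ q)
        ∂(Measure.pi fun _ => μ)
      ≤ ENNReal.ofReal (momentConst q * (4 ^ q * (M + M + 3)) * ((m : ℝ) ^ 2 / n) ^ q) := by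
  have hM0 : 0 ≤ M := (hX.coord ⟨0, by omega⟩).nonneg
  have hm0 : (0 : ℝ) < m := by exact_mod_cast hm
  have hmeas : ∀ j l, Measurable (fun ω : Fin n → Ω => devMatrix X ω j l) := by
    intro j l
    have h1 := (hX.coord j).measurable
    have h2 := (hX.coord l).measurable
    unfold devMatrix
    fun_prop
  have hc := momentConst_nonneg q
  obtain ⟨r, rfl⟩ : ∃ r, q = r + 1 := ⟨q - 1, by omega⟩
  -- power mean inequality for the `m²` entries
  have hpt : ∀ ω : Fin n → Ω, (∑ j, ∑ l, devMatrix X ω j l ^ 2) ^ (r + 1)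
      ≤ ((m : ℝ) ^ 2) ^ r * ∑ j, ∑ l, devMatrix X ω j l ^ (2 * (r + 1)) := by
    intro ω
    have h := pow_sum_div_card_le_sum_pow (s := (Finset.univ : Finset (Fin m × Fin m)))
      (f := fun p => devMatrix X ω p.1 p.2 ^ 2) (fun p _ => sq_nonneg _) r
    rw [div_le_iff₀ (by simp; positivity)] at h
    simp only [Fintype.sum_prod_type, Finset.card_univ, Fintype.card_prod, Fintype.card_fin,
      ← pow_mul] at h
    refine h.trans (le_of_eq ?_)
    push_cast
    ring
  calc ∫⁻ ω : Fin n → Ω, ENNReal.ofReal ((∑ j, ∑ l, devMatrix X ω j l ^ 2) ^ (r + 1))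
        ∂(Measure.pi fun _ => μ)
      ≤ ∫⁻ ω : Fin n → Ω, ENNReal.ofReal (((m : ℝ) ^ 2) ^ r) *
          ∑ j, ∑ l, ENNReal.ofReal (devMatrix X ω j l ^ (2 * (r + 1))) ∂(Measure.pi fun _ => μ) := by
        refine lintegral_mono fun ω => ?_
        refine (ENNReal.ofReal_le_ofReal (hpt ω)).trans (le_of_eq ?_)
        rw [ENNReal.ofReal_mul (by positivity), ENNReal.ofReal_sum_of_nonneg
          (fun j _ => Finset.sum_nonneg fun l _ => (even_two_mul _).pow_nonneg _)]
        congr 1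
        refine Finset.sum_congr rfl fun j _ => ?_
        rw [ENNReal.ofReal_sum_of_nonneg (fun l _ => (even_two_mul _).pow_nonneg _)]
    _ = ENNReal.ofReal (((m : ℝ) ^ 2) ^ r) * ∑ j, ∑ l, ∫⁻ ω : Fin n → Ω,
          ENNReal.ofReal (devMatrix X ω j l ^ (2 * (r + 1))) ∂(Measure.pi fun _ => μ) := by
        rw [lintegral_const_mul' _ _ ENNReal.ofReal_ne_top, lintegral_finsetSum]
        · congr 1
          refine Finset.sum_congr rfl fun j _ => ?_
          rw [lintegral_finsetSum]
          intro l _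
          exact ((hmeas j l).pow_const _).ennreal_ofReal
        · intro j _
          exact Finset.measurable_fun_sum _ fun l _ => ((hmeas j l).pow_const _).ennreal_ofReal
    _ ≤ ENNReal.ofReal (((m : ℝ) ^ 2) ^ r) * ∑ _j : Fin m, ∑ _l : Fin m,
          ENNReal.ofReal (momentConst (r + 1) * (4 ^ (r + 1) * (M + M + 3)) / n ^ (r + 1)) := by
        gcongr with j _ l _
        refine lintegral_mean_mul_sub_pow_le (hX.coord j) (hX.coord l) ?_ ?_ hq hqK hn
        · split_ifs <;> simp
        · have := hX.isotropic (Pi.single j 1) (Pi.single l 1)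
          simp only [single_one_dotProduct] at this
          rw [this, Pi.single_apply]
    _ = _ := by
        simp only [Finset.sum_const, Finset.card_univ, Fintype.card_fin, nsmul_eq_mul]
        rw [← mul_assoc (m : ℝ≥0∞), ← ENNReal.ofReal_natCast, ← ENNReal.ofReal_mul (by positivity),
          ← ENNReal.ofReal_mul (by positivity), ← ENNReal.ofReal_mul (by positivity)]
        congr 1
        rw [div_pow]
        ring

/-- The variance of the leading term of the plug-in estimator. -/
lemma lintegral_dotProduct_meanVector_sq_le [IsProbabilityMeasure μ] (hX : IsotropicMoment μ K M X) {W : Ω → ℝ} {M' : ℝ}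
    (hW : HasMoment μ K M' W) (hWX : ∀ w : Fin m → ℝ, ∫ ω, W ω * (w ⬝ᵥ X ω) ∂μ = 0) (hK : 1 ≤ K)
    (hn : 1 ≤ n) {u : Fin m → ℝ} (hu : u ⬝ᵥ u = 1) :
    ∫⁻ ω : Fin n → Ω, ENNReal.ofReal ((u ⬝ᵥ meanVector X W ω) ^ 2) ∂(Measure.pi fun _ => μ)
      ≤ ENNReal.ofReal (momentConst 1 * (4 ^ 1 * (M' + M + 3)) / n ^ 1) := by
  have := lintegral_mean_mul_sub_pow_le hW (hX.moment u hu) (c := 0) (by simp) (hWX u) le_rfl hK hn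
  refine le_trans (le_of_eq (lintegral_congr fun ω => ?_)) this
  congr 2
  simp only [sub_zero, dotProduct, meanVector, Finset.mul_sum]
  rw [Finset.sum_comm]
  refine Finset.sum_congr rfl fun i _ => Finset.sum_congr rfl fun l _ => ?_
  ring

/-- The remainder term of the plug-in estimator on the event that the deviation matrix is small.  It
is a product of two factors of mean square order `m / n`, hence smaller than the leading term by a
factor `m² / n`. -/
lemma lintegral_remainder_le [IsProbabilityMeasure μ] (hX : IsotropicMoment μ K M X) {W : Ω → ℝ} {M' : ℝ}
    (hW : HasMoment μ K M' W) (hWX : ∀ w : Fin m → ℝ, ∫ ω, W ω * (w ⬝ᵥ X ω) ∂μ = 0) (hK : 2 ≤ K)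
    (hm : 1 ≤ m) (hn : 1 ≤ n) {u : Fin m → ℝ} (hu : u ⬝ᵥ u = 1) :
    ∫⁻ ω : Fin n → Ω, ENNReal.ofReal ((∑ j, (∑ l, devMatrix X ω j l * u l) ^ 2) *
        ∑ l, meanVector X W ω l ^ 2) ∂(Measure.pi fun _ => μ)
      ≤ ENNReal.ofReal (momentConst 2 * (4 ^ 2 * (M' + 2 * M + 3)) * ((m : ℝ) ^ 2 / n ^ 2)) := by
  have hM0 : 0 ≤ M := (hX.coord ⟨0, by omega⟩).nonneg
  have hM'0 : 0 ≤ M' := hW.nonneg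
  set B : ℝ := momentConst 2 * (4 ^ 2 * (M' + 2 * M + 3)) / n ^ 2 with hB
  have hc := momentConst_nonneg 2
  have hB0 : 0 ≤ B := by positivity
  -- the entries of `D u` are centered empirical means of products of two variables
  have hrow : ∀ (ω : Fin n → Ω) (j : Fin m), ∑ l, devMatrix X ω j l * u l
      = (n : ℝ)⁻¹ * ∑ i, X (ω i) j * (u ⬝ᵥ X (ω i)) - u j := by
    intro ω j
    simp only [devMatrix, sub_mul, Finset.sum_sub_distrib, ite_mul, one_mul, zero_mul,
      Finset.sum_ite_eq, Finset.mem_univ, if_true]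
    congr 1
    simp only [dotProduct, Finset.mul_sum, Finset.sum_mul]
    rw [Finset.sum_comm]
    refine Finset.sum_congr rfl fun i _ => Finset.sum_congr rfl fun l _ => ?_
    ring
  have h1 : ∀ j, ∫⁻ ω : Fin n → Ω, ENNReal.ofReal ((∑ l, devMatrix X ω j l * u l) ^ 4)
      ∂(Measure.pi fun _ => μ) ≤ ENNReal.ofReal B := by
    intro j
    simp_rw [hrow]
    refine (lintegral_mean_mul_sub_pow_le (q := 2) (hX.coord j) (hX.moment u hu)
      (abs_le_one_of_dotProduct hu j) ?_ (by norm_num) hK hn).trans (ENNReal.ofReal_le_ofReal ?_)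
    · have := hX.isotropic (Pi.single j 1) u
      simpa only [single_one_dotProduct] using this
    · rw [hB]
      refine div_le_div_of_nonneg_right (mul_le_mul_of_nonneg_left ?_ hc) (by positivity)
      linarith
  have h2 : ∀ l, ∫⁻ ω : Fin n → Ω, ENNReal.ofReal (meanVector X W ω l ^ 4)
      ∂(Measure.pi fun _ => μ) ≤ ENNReal.ofReal B := by
    intro l
    have := lintegral_mean_mul_sub_pow_le (q := 2) hW (hX.coord l) (c := 0) (by simp)
      (by simpa using hWX (Pi.single l 1)) (by norm_num) hK hn
    simp only [sub_zero] at this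
    refine this.trans (ENNReal.ofReal_le_ofReal ?_)
    rw [hB]
    refine div_le_div_of_nonneg_right (mul_le_mul_of_nonneg_left ?_ hc) (by positivity)
    linarith
  have hmeas1 : ∀ j, Measurable (fun ω : Fin n → Ω => ∑ l, devMatrix X ω j l * u l) := by
    intro j
    have h1 := fun l => (hX.coord l).measurable
    unfold devMatrix
    fun_prop
  have hmeas2 : ∀ l, Measurable (fun ω : Fin n → Ω => meanVector X W ω l) := by
    intro l
    have h1 := (hX.coord l).measurable
    have h2 := hW.measurable
    unfold meanVector
    fun_prop
  -- `x² y² ≤ (x⁴ + y⁴) / 2` separates the two factors, which are not independent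
  have hpt : ∀ ω : Fin n → Ω, (∑ j, (∑ l, devMatrix X ω j l * u l) ^ 2) *
      ∑ l, meanVector X W ω l ^ 2
      ≤ ∑ j : Fin m, ∑ l : Fin m, ((∑ l, devMatrix X ω j l * u l) ^ 4 + meanVector X W ω l ^ 4) / 2 := by
    intro ω
    rw [Finset.sum_mul_sum]
    refine Finset.sum_le_sum fun j _ => Finset.sum_le_sum fun l _ => ?_
    nlinarith [sq_nonneg ((∑ l, devMatrix X ω j l * u l) ^ 2 - meanVector X W ω l ^ 2)]
  calc _ ≤ ∫⁻ ω : Fin n → Ω, ∑ j : Fin m, ∑ l : Fin m,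
          ENNReal.ofReal (1 / 2) * (ENNReal.ofReal ((∑ l, devMatrix X ω j l * u l) ^ 4) +
            ENNReal.ofReal (meanVector X W ω l ^ 4)) ∂(Measure.pi fun _ => μ) := by
        refine lintegral_mono fun ω => ?_
        refine (ENNReal.ofReal_le_ofReal (hpt ω)).trans (le_of_eq ?_)
        rw [ENNReal.ofReal_sum_of_nonneg (fun j _ => Finset.sum_nonneg fun l _ => by positivity)]
        refine Finset.sum_congr rfl fun j _ => ?_
        rw [ENNReal.ofReal_sum_of_nonneg (fun l _ => by positivity)]
        refine Finset.sum_congr rfl fun l _ => ?_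
        rw [← ENNReal.ofReal_add (by positivity) (by positivity),
          ← ENNReal.ofReal_mul (by norm_num)]
        congr 1; ring
    _ = ∑ j : Fin m, ∑ l : Fin m, ENNReal.ofReal (1 / 2) *
          (∫⁻ ω : Fin n → Ω, ENNReal.ofReal ((∑ l, devMatrix X ω j l * u l) ^ 4)
              ∂(Measure.pi fun _ => μ) +
            ∫⁻ ω : Fin n → Ω, ENNReal.ofReal (meanVector X W ω l ^ 4)
              ∂(Measure.pi fun _ => μ)) := by
        have hA : ∀ j, Measurable fun ω : Fin n → Ω =>
            ENNReal.ofReal ((∑ l, devMatrix X ω j l * u l) ^ 4) :=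
          fun j => ((hmeas1 j).pow_const 4).ennreal_ofReal
        have hA' : ∀ l, Measurable fun ω : Fin n → Ω => ENNReal.ofReal (meanVector X W ω l ^ 4) :=
          fun l => ((hmeas2 l).pow_const 4).ennreal_ofReal
        have hAA : ∀ j l, Measurable fun ω : Fin n → Ω => ENNReal.ofReal (1 / 2) *
            (ENNReal.ofReal ((∑ l, devMatrix X ω j l * u l) ^ 4) +
              ENNReal.ofReal (meanVector X W ω l ^ 4)) :=
          fun j l => ((hA j).add (hA' l)).const_mul _
        rw [lintegral_finsetSum _ fun j _ => Finset.measurable_fun_sum _ fun l _ => hAA j l]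
        refine Finset.sum_congr rfl fun j _ => ?_
        rw [lintegral_finsetSum _ fun l _ => hAA j l]
        refine Finset.sum_congr rfl fun l _ => ?_
        rw [lintegral_const_mul' _ _ ENNReal.ofReal_ne_top, lintegral_add_left (hA j)]
    _ ≤ ∑ _j : Fin m, ∑ _l : Fin m, ENNReal.ofReal (1 / 2) * (ENNReal.ofReal B + ENNReal.ofReal B) := by
        gcongr with j _ l _
        · exact h1 j
        · exact h2 l
    _ = _ := by
        simp only [Finset.sum_const, Finset.card_univ, Fintype.card_fin, nsmul_eq_mul]
        rw [← ENNReal.ofReal_natCast, ← ENNReal.ofReal_add hB0 hB0,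
          ← ENNReal.ofReal_mul (by positivity), ← ENNReal.ofReal_mul (by positivity),
          ← ENNReal.ofReal_mul (by positivity)]
        congr 1
        rw [hB]; ring

/-- The fifth moment of the empirical second moment of the residuals.  It involves moments of order
`10 ≤ 4 K`, hence `K ≥ 3`. -/
lemma lintegral_mean_sq_pow_le [IsProbabilityMeasure μ] {W : Ω → ℝ} {M' : ℝ} (hW : HasMoment μ K M' W) (hK : 3 ≤ K)
    (hn : 1 ≤ n) :
    ∫⁻ ω : Fin n → Ω, ENNReal.ofReal (((n : ℝ)⁻¹ * ∑ i, W (ω i) ^ 2) ^ 5) ∂(Measure.pi fun _ => μ)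
      ≤ ENNReal.ofReal (1 + M') := by
  have hn0 : (0 : ℝ) < n := by exact_mod_cast hn
  have hpt : ∀ ω : Fin n → Ω, ((n : ℝ)⁻¹ * ∑ i, W (ω i) ^ 2) ^ 5
      ≤ (n : ℝ)⁻¹ * ∑ i, (1 + W (ω i) ^ (4 * K)) := by
    intro ω
    have h := pow_sum_div_card_le_sum_pow (s := (Finset.univ : Finset (Fin n)))
      (f := fun i => W (ω i) ^ 2) (fun i _ => sq_nonneg _) 4
    simp only [Finset.card_univ, Fintype.card_fin, Nat.reduceAdd] at h
    have h2 : ∑ i, (W (ω i) ^ 2) ^ 5 ≤ ∑ i, (1 + W (ω i) ^ (4 * K)) := by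
      refine Finset.sum_le_sum fun i _ => ?_
      have := pow_le_one_add_pow (a := |W (ω i)|) (c := 10) (N := 4 * K) (abs_nonneg _) (by omega)
      rw [(show Even 10 by decide).pow_abs,
        (show Even (4 * K) from ⟨2 * K, by ring⟩).pow_abs] at this
      rw [← pow_mul]
      exact this
    calc ((n : ℝ)⁻¹ * ∑ i, W (ω i) ^ 2) ^ 5
        = (n : ℝ)⁻¹ * ((∑ i, W (ω i) ^ 2) ^ 5 / (n : ℝ) ^ 4) := by field_simp
      _ ≤ _ := by gcongr; exact h.trans h2
  have hmeas : ∀ i : Fin n, Measurable (fun ω : Fin n → Ω => ENNReal.ofReal (1 + W (ω i) ^ (4 * K))) := by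
    intro i
    have := hW.measurable
    fun_prop
  have hWnn : ∀ x, 0 ≤ 1 + W x ^ (4 * K) := fun x =>
    add_nonneg zero_le_one ((show Even (4 * K) from ⟨2 * K, by ring⟩).pow_nonneg _)
  calc _ ≤ ∫⁻ ω : Fin n → Ω, ENNReal.ofReal (n : ℝ)⁻¹ * ∑ i, ENNReal.ofReal (1 + W (ω i) ^ (4 * K))
          ∂(Measure.pi fun _ => μ) := by
        refine lintegral_mono fun ω => (ENNReal.ofReal_le_ofReal (hpt ω)).trans (le_of_eq ?_)
        rw [ENNReal.ofReal_mul (by positivity), ENNReal.ofReal_sum_of_nonneg fun i _ => hWnn _]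
    _ = ENNReal.ofReal (n : ℝ)⁻¹ * ∑ i : Fin n, ∫⁻ ω : Fin n → Ω,
          ENNReal.ofReal (1 + W (ω i) ^ (4 * K)) ∂(Measure.pi fun _ => μ) := by
        rw [lintegral_const_mul' _ _ ENNReal.ofReal_ne_top, lintegral_finsetSum _ fun i _ => hmeas i]
    _ ≤ ENNReal.ofReal (n : ℝ)⁻¹ * ∑ _i : Fin n, ENNReal.ofReal (1 + M') := by
        gcongr with i _
        have hm1 : Measurable (fun x => ENNReal.ofReal (1 + W x ^ (4 * K))) := by
          have := hW.measurable
          fun_prop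
        have := (measurePreserving_eval (fun _ : Fin n => μ) i).lintegral_comp hm1
        simp only [Function.eval] at this
        have hi : Integrable (fun x => 1 + W x ^ (4 * K)) μ := (integrable_const 1).add hW.2
        rw [this, ← ofReal_integral_eq_lintegral_ofReal hi (Eventually.of_forall hWnn)]
        refine ENNReal.ofReal_le_ofReal ?_
        rw [integral_add (integrable_const 1) hW.2]
        have := hW.3
        simpa using this
    _ = _ := by
        simp only [Finset.sum_const, Finset.card_univ, Fintype.card_fin, nsmul_eq_mul]
        rw [← ENNReal.ofReal_natCast, ← ENNReal.ofReal_mul (by positivity),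
          ← ENNReal.ofReal_mul (by positivity)]
        congr 1
        field_simp

end Abstract

/-! ### Deterministic bounds for the plug-in estimator -/

section MatrixBounds

variable {m : ℕ}

lemma dotProduct_sq_le (v w : Fin m → ℝ) : (v ⬝ᵥ w) ^ 2 ≤ (v ⬝ᵥ v) * (w ⬝ᵥ w) := by
  have := Finset.sum_mul_sq_le_sq_mul_sq Finset.univ v w
  simpa [dotProduct, sq] using this

lemma dotProduct_self_nonneg' (v : Fin m → ℝ) : 0 ≤ v ⬝ᵥ v :=
  Finset.sum_nonneg fun _ _ => mul_self_nonneg _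

/-- The operator norm is at most the Frobenius norm. -/
lemma mulVec_dotProduct_self_le (D : Matrix (Fin m) (Fin m) ℝ) (v : Fin m → ℝ) :
    D.mulVec v ⬝ᵥ D.mulVec v ≤ (∑ j, ∑ l, D j l ^ 2) * (v ⬝ᵥ v) := by
  rw [dotProduct, Finset.sum_mul]
  refine Finset.sum_le_sum fun j _ => ?_
  have := dotProduct_sq_le (D j) v
  simp only [Matrix.mulVec]
  calc D j ⬝ᵥ v * D j ⬝ᵥ v = (D j ⬝ᵥ v) ^ 2 := (sq _).symm
    _ ≤ _ := this
    _ = _ := by simp [dotProduct, sq]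

lemma abs_dotProduct_mulVec_le {D : Matrix (Fin m) (Fin m) ℝ} (hD : ∑ j, ∑ l, D j l ^ 2 ≤ 1 / 4)
    (v : Fin m → ℝ) : |v ⬝ᵥ D.mulVec v| ≤ (v ⬝ᵥ v) / 2 := by
  have h0 := dotProduct_self_nonneg' v
  refine abs_le_of_sq_le_sq ?_ (by positivity)
  have h1 := dotProduct_sq_le v (D.mulVec v)
  have h2 := mulVec_dotProduct_self_le D v
  have h3 : (∑ j, ∑ l, D j l ^ 2) * (v ⬝ᵥ v) ≤ 1 / 4 * (v ⬝ᵥ v) := by gcongr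
  nlinarith [mul_le_mul_of_nonneg_left (h2.trans h3) h0]

/-- If `D` is small, solutions of `(1 + D) v = w` are controlled by `w`. -/
lemma dotProduct_self_le_of_add_mulVec {D : Matrix (Fin m) (Fin m) ℝ}
    (hD : ∑ j, ∑ l, D j l ^ 2 ≤ 1 / 4) {v w : Fin m → ℝ} (h : v + D.mulVec v = w) :
    v ⬝ᵥ v ≤ 4 * (w ⬝ᵥ w) := by
  have h0 := dotProduct_self_nonneg' v
  have h1 := (abs_le.1 (abs_dotProduct_mulVec_le hD v)).1
  have h2 : v ⬝ᵥ w = v ⬝ᵥ v + v ⬝ᵥ D.mulVec v := by rw [← h, dotProduct_add]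
  have h3 := dotProduct_sq_le v w
  have h4 : (v ⬝ᵥ v) / 2 ≤ v ⬝ᵥ w := by linarith
  rcases eq_or_lt_of_le h0 with h5 | h5
  · rw [← h5]; exact mul_nonneg (by norm_num) (dotProduct_self_nonneg' w)
  · refine le_of_mul_le_mul_left ?_ h5
    nlinarith

lemma norm_sq_toLp (v : Fin m → ℝ) : ‖(WithLp.toLp 2 v : EuclideanSpace ℝ (Fin m))‖ ^ 2 = v ⬝ᵥ v := by
  rw [EuclideanSpace.norm_sq_eq]
  simp [dotProduct, sq]

lemma mulVec_dotProduct_self_le_spectralNorm (B : Matrix (Fin m) (Fin m) ℝ) (v : Fin m → ℝ) :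
    B.mulVec v ⬝ᵥ B.mulVec v ≤ spectralNorm B ^ 2 * (v ⬝ᵥ v) := by
  have := (Matrix.toEuclideanCLM (𝕜 := ℝ) B).le_opNorm (WithLp.toLp 2 v)
  rw [Matrix.toEuclideanCLM_toLp] at this
  have h2 := pow_le_pow_left₀ (norm_nonneg _) this 2
  rwa [mul_pow, norm_sq_toLp, norm_sq_toLp] at h2

lemma dotProduct_mulVec_le_spectralNorm (B : Matrix (Fin m) (Fin m) ℝ) (v : Fin m → ℝ) :
    v ⬝ᵥ B.mulVec v ≤ spectralNorm B * (v ⬝ᵥ v) := by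
  have h0 := dotProduct_self_nonneg' v
  have h1 := dotProduct_sq_le v (B.mulVec v)
  have h2 := mulVec_dotProduct_self_le_spectralNorm B v
  have h3 : 0 ≤ spectralNorm B := norm_nonneg _
  refine le_of_abs_le (abs_le_of_sq_le_sq ?_ (by positivity))
  nlinarith [mul_le_mul_of_nonneg_left h2 h0]

lemma spectralNorm_le {B : Matrix (Fin m) (Fin m) ℝ} {r : ℝ} (hr : 0 ≤ r)
    (h : ∀ v, B.mulVec v ⬝ᵥ B.mulVec v ≤ r ^ 2 * (v ⬝ᵥ v)) : spectralNorm B ≤ r := by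
  refine ContinuousLinearMap.opNorm_le_bound _ hr fun x => ?_
  have := h x.ofLp
  rw [← norm_sq_toLp, ← norm_sq_toLp, ← Matrix.toEuclideanCLM_toLp, ← mul_pow] at this
  simpa using abs_le_of_sq_le_sq' this (by positivity) |>.2

/-- A matrix with `vᵗ B v ≥ c |v|²` is non-singular and its inverse has norm at most `1 / c`. -/
lemma isUnit_det_and_spectralNorm_inv_le {B : Matrix (Fin m) (Fin m) ℝ} {c : ℝ} (hc : 0 < c)
    (h : ∀ v, c * (v ⬝ᵥ v) ≤ v ⬝ᵥ B.mulVec v) :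
    IsUnit B.det ∧ spectralNorm B⁻¹ ≤ 1 / c := by
  have hdet : B.det ≠ 0 := by
    intro h0
    obtain ⟨v, hv, hBv⟩ := Matrix.exists_mulVec_eq_zero_iff.2 h0
    have h1 := h v
    rw [hBv, dotProduct_zero] at h1
    have h2 : v ⬝ᵥ v = 0 := le_antisymm (by nlinarith [dotProduct_self_nonneg' v])
      (dotProduct_self_nonneg' v)
    exact hv (dotProduct_self_eq_zero.1 h2)
  have hu : IsUnit B.det := isUnit_iff_ne_zero.2 hdet
  refine ⟨hu, spectralNorm_le (by positivity) fun w => ?_⟩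
  set v := B⁻¹.mulVec w with hv
  have hBv : B.mulVec v = w := by
    rw [hv, Matrix.mulVec_mulVec, Matrix.mul_nonsing_inv _ hu, Matrix.one_mulVec]
  have h1 := h v
  rw [hBv] at h1
  have h2 := dotProduct_sq_le v w
  have h0 := dotProduct_self_nonneg' v
  rcases eq_or_lt_of_le h0 with h5 | h5
  · rw [← h5]; exact mul_nonneg (by positivity) (dotProduct_self_nonneg' w)
  · have h6 : c ^ 2 * (v ⬝ᵥ v) ≤ w ⬝ᵥ w := by
      refine le_of_mul_le_mul_left ?_ h5
      have : 0 ≤ c * (v ⬝ᵥ v) := by positivity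
      nlinarith [pow_le_pow_left₀ this h1 2]
    rw [one_div, inv_pow, inv_mul_eq_div, le_div_iff₀ (by positivity)]
    linarith

variable {S A B D : Matrix (Fin m) (Fin m) ℝ}

/-- The error of the plug-in estimator on the event that the whitened deviation matrix
`D = S B S - 1` is small: a linear leading term and a product of two small factors. -/
lemma dotProduct_sq_le_of_small (hS : S.PosDef) (hSA : S * S * A = 1) (hD : D = S * B * S - 1)
    (hDt : D.transpose = D) (hsmall : ∑ j, ∑ l, D j l ^ 2 ≤ 1 / 4) {θ V : Fin m → ℝ}
    (hθ : B.mulVec θ = V) (h : Fin m → ℝ) :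
    (h ⬝ᵥ θ) ^ 2 ≤ 2 * (S.mulVec h ⬝ᵥ S.mulVec V) ^ 2 +
      8 * ((D.mulVec (S.mulVec h) ⬝ᵥ D.mulVec (S.mulVec h)) * (S.mulVec V ⬝ᵥ S.mulVec V)) := by
  set y := S.mulVec (A.mulVec θ) with hy
  have hSy : S.mulVec y = θ := by
    rw [hy, Matrix.mulVec_mulVec, Matrix.mulVec_mulVec, hSA, Matrix.one_mulVec]
  have hyD : y + D.mulVec y = S.mulVec V := by
    rw [hD, Matrix.sub_mulVec, Matrix.one_mulVec, ← Matrix.mulVec_mulVec, ← Matrix.mulVec_mulVec,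
      hSy, hθ]
    abel
  have hyy := dotProduct_self_le_of_add_mulVec hsmall hyD
  set u := S.mulVec h with hu
  have h1 : h ⬝ᵥ θ = u ⬝ᵥ S.mulVec V - D.mulVec u ⬝ᵥ y := by
    have hsymm : u ⬝ᵥ D.mulVec y = D.mulVec u ⬝ᵥ y := by
      rw [Matrix.dotProduct_mulVec, ← Matrix.mulVec_transpose, hDt]
    rw [← hSy, ← PosDef.mulVec_dotProduct hS, ← hu, ← hyD, dotProduct_add, hsymm]
    ring
  have h2 := dotProduct_sq_le (D.mulVec u) y
  have h3 := mul_le_mul_of_nonneg_left hyy (dotProduct_self_nonneg' (D.mulVec u))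
  rw [h1]
  nlinarith [sq_nonneg (u ⬝ᵥ S.mulVec V + D.mulVec u ⬝ᵥ y)]

/-- If the whitened deviation matrix is small, `B` inherits half of the lower bound of `A`. -/
lemma dotProduct_mulVec_ge_of_small (hS : S.PosDef) (hSA : S * S * A = 1) (hD : D = S * B * S - 1)
    (hsmall : ∑ j, ∑ l, D j l ^ 2 ≤ 1 / 4) (v : Fin m → ℝ) :
    (v ⬝ᵥ A.mulVec v) / 2 ≤ v ⬝ᵥ B.mulVec v := by
  set y := S.mulVec (A.mulVec v) with hy
  have hSy : S.mulVec y = v := by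
    rw [hy, Matrix.mulVec_mulVec, Matrix.mulVec_mulVec, hSA, Matrix.one_mulVec]
  have h1 : y ⬝ᵥ y = v ⬝ᵥ A.mulVec v := by
    nth_rewrite 2 [hy]
    rw [← PosDef.mulVec_dotProduct hS, hSy]
  have h2 : v ⬝ᵥ B.mulVec v = y ⬝ᵥ y + y ⬝ᵥ D.mulVec y := by
    rw [hD, Matrix.sub_mulVec, Matrix.one_mulVec, ← Matrix.mulVec_mulVec, ← Matrix.mulVec_mulVec,
      hSy, dotProduct_sub, ← PosDef.mulVec_dotProduct hS y (B.mulVec v), hSy]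
    abel
  have := (abs_le.1 (abs_dotProduct_mulVec_le hsmall y)).1
  rw [h2, ← h1]
  linarith

/-- `|S h|² = hᵗ A⁻¹ h` is bounded by a weighted norm of `h` if `A` dominates the weights. -/
lemma mulVec_sqrt_dotProduct_self_le (hS : S.PosDef) (hSA : S * S * A = 1) {w : Fin m → ℝ} {d : ℝ}
    (hw : ∀ j, 0 < w j) (hd : 0 ≤ d) (hA : ∀ v : Fin m → ℝ, ∑ j, w j * v j ^ 2 ≤ d * (v ⬝ᵥ A.mulVec v))
    (h : Fin m → ℝ) : S.mulVec h ⬝ᵥ S.mulVec h ≤ d * ∑ j, h j ^ 2 / w j := by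
  set v := S.mulVec (S.mulVec h) with hv
  have hSS : A * (S * S) = 1 := mul_eq_one_comm.1 hSA
  have hAv : A.mulVec v = h := by
    rw [hv, Matrix.mulVec_mulVec, Matrix.mulVec_mulVec, mul_assoc, hSS, Matrix.one_mulVec]
  have h1 : S.mulVec h ⬝ᵥ S.mulVec h = h ⬝ᵥ v := by rw [PosDef.mulVec_dotProduct hS]
  have h2 : (h ⬝ᵥ v) ^ 2 ≤ (∑ j, h j ^ 2 / w j) * ∑ j, w j * v j ^ 2 := by
    have := Finset.sum_mul_sq_le_sq_mul_sq Finset.univ (fun j => h j / √(w j))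
      (fun j => √(w j) * v j)
    have e1 : ∀ j, (h j / √(w j)) * (√(w j) * v j) = h j * v j := fun j => by
      have := (Real.sqrt_pos.2 (hw j)).ne'
      field_simp
    simp only [e1, div_pow, mul_pow, Real.sq_sqrt (hw _).le] at this
    exact this
  have h3 := hA v
  rw [hAv, dotProduct_comm] at h3
  have h4 : 0 ≤ h ⬝ᵥ v := h1 ▸ dotProduct_self_nonneg' _
  have h5 : 0 ≤ ∑ j, h j ^ 2 / w j := Finset.sum_nonneg fun j _ => by
    have := hw j; positivity
  rw [h1]
  rcases eq_or_lt_of_le h4 with h6 | h6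
  · rw [← h6]; positivity
  · refine le_of_mul_le_mul_right ?_ h6
    nlinarith [mul_le_mul_of_nonneg_left h3 h5]

/-- The crude bound used on the exceptional event: for least squares, `B⁻¹ V` is controlled by the
mean square of the residuals `W` and by the norm of `B⁻¹`. -/
lemma dotProduct_inv_mulVec_sq_le {n : ℕ} (x : Fin n → Fin m → ℝ) (W : Fin n → ℝ)
    (hB : ∀ j l, B j l = (n : ℝ)⁻¹ * ∑ i, x i j * x i l) {V : Fin m → ℝ}
    (hV : ∀ j, V j = (n : ℝ)⁻¹ * ∑ i, W i * x i j) (hu : IsUnit B.det) (h : Fin m → ℝ) :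
    (h ⬝ᵥ B⁻¹.mulVec V) ^ 2
      ≤ ((n : ℝ)⁻¹ * ∑ i, W i ^ 2) * (spectralNorm B⁻¹ * (h ⬝ᵥ h)) := by
  have hBt : B.transpose = B := by
    ext j l
    rw [Matrix.transpose_apply, hB, hB]
    congr 1
    exact Finset.sum_congr rfl fun i _ => mul_comm _ _
  set w := B⁻¹.mulVec h with hw
  have hBw : B.mulVec w = h := by
    rw [hw, Matrix.mulVec_mulVec, Matrix.mul_nonsing_inv _ hu, Matrix.one_mulVec]
  have h1 : h ⬝ᵥ B⁻¹.mulVec V = w ⬝ᵥ V := by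
    rw [Matrix.dotProduct_mulVec, ← Matrix.mulVec_transpose, Matrix.transpose_nonsing_inv, hBt]
  have h2 : w ⬝ᵥ V = (n : ℝ)⁻¹ * ∑ i, W i * (w ⬝ᵥ x i) := by
    simp only [dotProduct, hV, Finset.mul_sum]
    rw [Finset.sum_comm]
    refine Finset.sum_congr rfl fun i _ => Finset.sum_congr rfl fun j _ => ?_
    ring
  have h3 : w ⬝ᵥ h = (n : ℝ)⁻¹ * ∑ i, (w ⬝ᵥ x i) ^ 2 := by
    rw [← hBw]
    simp only [dotProduct, Matrix.mulVec, hB, sq, Finset.sum_mul_sum]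
    simp only [Finset.mul_sum, Finset.sum_mul]
    rw [Finset.sum_congr rfl fun j _ => Finset.sum_comm, Finset.sum_comm]
    refine Finset.sum_congr rfl fun i _ => Finset.sum_congr rfl fun j _ =>
      Finset.sum_congr rfl fun l _ => ?_
    ring
  have h4 : h ⬝ᵥ w ≤ spectralNorm B⁻¹ * (h ⬝ᵥ h) := dotProduct_mulVec_le_spectralNorm B⁻¹ h
  have h5 := Finset.sum_mul_sq_le_sq_mul_sq Finset.univ W (fun i => w ⬝ᵥ x i)
  have hWnn : 0 ≤ (n : ℝ)⁻¹ * ∑ i, W i ^ 2 := by positivity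
  rw [h1, h2]
  calc ((n : ℝ)⁻¹ * ∑ i, W i * (w ⬝ᵥ x i)) ^ 2
      = (n : ℝ)⁻¹ ^ 2 * (∑ i, W i * (w ⬝ᵥ x i)) ^ 2 := by ring
    _ ≤ (n : ℝ)⁻¹ ^ 2 * ((∑ i, W i ^ 2) * ∑ i, (w ⬝ᵥ x i) ^ 2) := by gcongr
    _ = ((n : ℝ)⁻¹ * ∑ i, W i ^ 2) * (w ⬝ᵥ h) := by rw [h3]; ring
    _ ≤ _ := by rw [dotProduct_comm w h]; gcongr

end MatrixBounds

/-! ### Linear functionals and Galerkin approximation -/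

/-- Weighted Cauchy–Schwarz inequality for series. -/
lemma tsum_mul_sq_le {a b w : ℕ → ℝ} (hw : ∀ j, 0 < w j) (ha : Summable fun j => a j ^ 2 / w j)
    (hb : Summable fun j => w j * b j ^ 2) :
    Summable (fun j => a j * b j) ∧
      (∑' j, a j * b j) ^ 2 ≤ (∑' j, a j ^ 2 / w j) * ∑' j, w j * b j ^ 2 := by
  have hs : Summable (fun j => a j * b j) := by
    refine Summable.of_norm_bounded (ha.add hb) fun j => ?_
    have hj := hw j
    have hsq := Real.sqrt_pos.2 hj
    have e : a j * b j = (a j / √(w j)) * (√(w j) * b j) := by field_simp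
    have e1 : (a j / √(w j)) ^ 2 = a j ^ 2 / w j := by rw [div_pow, Real.sq_sqrt hj.le]
    have e2 : (√(w j) * b j) ^ 2 = w j * b j ^ 2 := by rw [mul_pow, Real.sq_sqrt hj.le]
    rw [Real.norm_eq_abs, e, ← e1, ← e2, abs_le]
    constructor <;> nlinarith [sq_nonneg (a j / √(w j) + √(w j) * b j),
      sq_nonneg (a j / √(w j) - √(w j) * b j), sq_nonneg (a j / √(w j)), sq_nonneg (√(w j) * b j)]
  refine ⟨hs, ?_⟩
  refine le_of_tendsto (hs.hasSum.tendsto_sum_nat.pow 2) (Eventually.of_forall fun N => ?_)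
  have h1 := Finset.sum_mul_sq_le_sq_mul_sq (Finset.range N) (fun j => a j / √(w j))
    (fun j => √(w j) * b j)
  have e1 : ∀ j, (a j / √(w j)) * (√(w j) * b j) = a j * b j := fun j => by
    have := (Real.sqrt_pos.2 (hw j)).ne'
    field_simp
  simp only [e1, div_pow, mul_pow, Real.sq_sqrt (hw _).le] at h1
  refine h1.trans ?_
  have p1 : ∀ j, 0 ≤ a j ^ 2 / w j := fun j => by have := hw j; positivity
  have p2 : ∀ j, 0 ≤ w j * b j ^ 2 := fun j => by have := hw j; positivity
  exact mul_le_mul (ha.sum_le_tsum _ fun j _ => p1 j) (hb.sum_le_tsum _ fun j _ => p2 j)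
    (Finset.sum_nonneg fun j _ => p2 j) (tsum_nonneg p1)

/-- The part `∑_{j ≤ m} [h]_j² / υ_j` of the rate. -/
def headSum (υ h : ℕ → ℝ) (m : ℕ) : ℝ := ∑ j ∈ Finset.Icc 1 m, h j ^ 2 / υ j

/-- The part `∑_{j > m} [h]_j² / γ_j` of the rate. -/
def tailSum (γ h : ℕ → ℝ) (m : ℕ) : ℝ := ∑' j, h (m + 1 + j) ^ 2 / γ (m + 1 + j)

lemma headSum_eq (υ h : ℕ → ℝ) (m : ℕ) : headSum υ h m = ∑ j : Fin m, h (j + 1) ^ 2 / υ (j + 1) := by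
  rw [headSum, ← Finset.sum_range (fun j => h (j + 1) ^ 2 / υ (j + 1)), Finset.range_eq_Ico,
    Finset.sum_Ico_add' (fun j => h j ^ 2 / υ j)]
  rfl

lemma headSum_nonneg {υ h : ℕ → ℝ} (hυ : IsWeight υ) (m : ℕ) : 0 ≤ headSum υ h m :=
  Finset.sum_nonneg fun j hj => by
    have := hυ.2 j (Finset.mem_Icc.1 hj).1
    positivity

lemma tailSum_nonneg {γ h : ℕ → ℝ} (hγ : IsWeight γ) (m : ℕ) : 0 ≤ tailSum γ h m :=
  tsum_nonneg fun j => by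
    have := hγ.2 (m + 1 + j) (by omega)
    positivity

lemma IsRepresenter.summable_tail {γ h : ℕ → ℝ} (hh : IsRepresenter γ h) (m : ℕ) :
    Summable fun j => h (m + 1 + j) ^ 2 / γ (m + 1 + j) := by
  have := (summable_nat_add_iff m).2 hh
  refine this.congr fun j => ?_
  rw [show j + m + 1 = m + 1 + j by ring]

section Functional

variable {γ υ h : ℕ → ℝ} {ρ d : ℝ} {β : L2} {m : ℕ}

lemma functional_split (hγ : IsWeight γ) (hh : IsRepresenter γ h) (hβ : β ∈ slopes γ ρ) (m : ℕ) :
    functional h β = ∑ j : Fin m, h (j + 1) * coef β (j + 1) +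
      ∑' j, h (m + 1 + j) * coef β (m + 1 + j) := by
  have hs := (tsum_mul_sq_le (fun j => hγ.2 (j + 1) (by omega)) hh hβ.1).1
  rw [functional, ← hs.sum_add_tsum_nat_add m, Finset.sum_range]
  congr 1
  refine tsum_congr fun j => ?_
  rw [show j + m + 1 = m + 1 + j by ring]

lemma functional_tail_sq_le (hγ : IsWeight γ) (hh : IsRepresenter γ h) (hβ : β ∈ slopes γ ρ)
    (m : ℕ) : (∑' j, h (m + 1 + j) * coef β (m + 1 + j)) ^ 2 ≤ tailSum γ h m * ρ := by
  have hs : Summable fun j => γ (m + 1 + j) * coef β (m + 1 + j) ^ 2 := by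
    have := (summable_nat_add_iff m).2 hβ.1
    refine this.congr fun j => ?_
    rw [show j + m + 1 = m + 1 + j by ring]
  refine (tsum_mul_sq_le (fun j => hγ.2 (m + 1 + j) (by omega)) (hh.summable_tail m) hs).2.trans ?_
  refine mul_le_mul_of_nonneg_left ?_ (tailSum_nonneg hγ m)
  refine le_trans ?_ hβ.2
  rw [← hβ.1.sum_add_tsum_nat_add m]
  have h1 : 0 ≤ ∑ j ∈ Finset.range m, γ (j + 1) * coef β (j + 1) ^ 2 :=
    Finset.sum_nonneg fun j _ => by have := hγ.2 (j + 1) (by omega); positivity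
  have h2 : ∑' j, γ (m + 1 + j) * coef β (m + 1 + j) ^ 2
      = ∑' j, γ (j + m + 1) * coef β (j + m + 1) ^ 2 :=
    tsum_congr fun j => by rw [show j + m + 1 = m + 1 + j by ring]
  linarith

/-- A bound on the functional itself, which is the error where the estimator is set to zero. -/
lemma functional_sq_le (hγ : IsWeight γ) (hmono : MonotoneOn γ (Set.Ici 1)) (hυ : IsWeight υ)
    (hanti : AntitoneOn υ (Set.Ici 1)) (hh : IsRepresenter γ h) (hβ : β ∈ slopes γ ρ)
    (m : ℕ) : functional h β ^ 2 ≤ ρ * (headSum υ h m + tailSum γ h m) := by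
  have h1 := (tsum_mul_sq_le (fun j => hγ.2 (j + 1) (by omega)) hh hβ.1).2
  refine h1.trans ?_
  have h2 : ∑' j, h (j + 1) ^ 2 / γ (j + 1) ≤ headSum υ h m + tailSum γ h m := by
    rw [← Summable.sum_add_tsum_nat_add m hh, headSum_eq, tailSum]
    refine add_le_add ?_ (le_of_eq (tsum_congr fun j => by rw [show j + m + 1 = m + 1 + j by ring]))
    rw [Finset.sum_range]
    refine Finset.sum_le_sum fun j _ => ?_
    have := hυ.le_one hanti (Nat.le_add_left 1 j)
    have := hγ.one_le hmono (Nat.le_add_left 1 j)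
    have := hυ.2 (j + 1) (by omega)
    gcongr
    linarith
  have h0 : 0 ≤ headSum υ h m + tailSum γ h m :=
    add_nonneg (headSum_nonneg hυ m) (tailSum_nonneg hγ m)
  calc _ ≤ (headSum υ h m + tailSum γ h m) * ρ := mul_le_mul h2 hβ.2
        (tsum_nonneg fun j => by have := hγ.2 (j + 1) (by omega); positivity) h0
    _ = _ := mul_comm _ _

/-- The Galerkin approximation `b` of `β` in the span of the first `m` basis functions: it solves
`[T]_m b = [T β]_m`.  By Pythagoras in the form of `T`, both its residual and its distance to the
projection of `β` are controlled by the tail of `β`. -/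
lemma exists_galerkin {T : L2 →L[ℝ] L2} (hd : 1 ≤ d) (hγ : IsWeight γ)
    (hmono : MonotoneOn γ (Set.Ici 1)) (hυ : IsWeight υ) (hanti : AntitoneOn υ (Set.Ici 1))
    (hT : T ∈ linkClass υ d) (hm : 1 ≤ m) (hβ : β ∈ slopes γ ρ) :
    ∃ b : Fin m → ℝ, (∀ w : Fin m → ℝ, ⟪T (β - poly b), poly w⟫ = 0) ∧
      ⟪T (β - poly b), β - poly b⟫ ≤ d * ρ * (υ m / γ m) ∧
      ∑ j : Fin m, υ (j + 1) * (b j - coef β (j + 1)) ^ 2 ≤ d ^ 2 * ρ * (υ m / γ m) := by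
  have hA := opMatrix_posDef hT.1 hT.2.1 m
  set A := opMatrix T m with hAdef
  set g : Fin m → ℝ := fun j => coef (T β) (j + 1) with hg
  set b := A⁻¹.mulVec g with hb
  have hAb : A.mulVec b = g := by
    rw [hb, Matrix.mulVec_mulVec, Matrix.mul_nonsing_inv _ (isUnit_iff_ne_zero.2 hA.det_pos.ne'),
      Matrix.one_mulVec]
  have horth : ∀ w : Fin m → ℝ, ⟪T (β - poly b), poly w⟫ = 0 := by
    intro w
    rw [map_sub, inner_sub_left, ← dotProduct_opMatrix_mulVec, hAb, real_inner_comm, inner_poly, hg,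
      sub_self]
  set βm : Fin m → ℝ := fun j => coef β (j + 1) with hβm
  -- the tail of `β`
  set e := β - poly βm with he
  have hce : ∀ j, coef e (j + 1) = if j < m then 0 else coef β (j + 1) := by
    intro j
    rw [he, coef_sub]
    split_ifs with hj
    · rw [coef_poly βm ⟨j, hj⟩]
      simp [hβm]
    · rw [coef_poly_of_le βm (not_lt.1 hj), sub_zero]
  have hsum : Summable (fun j => γ (j + 1) * coef e (j + 1) ^ 2) ∧
      ∑' j, γ (j + 1) * coef e (j + 1) ^ 2 ≤ ρ := by
    have hle : ∀ j, γ (j + 1) * coef e (j + 1) ^ 2 ≤ γ (j + 1) * coef β (j + 1) ^ 2 := by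
      intro j
      have := hγ.2 (j + 1) (by omega)
      rw [hce]
      split_ifs
      · simp; positivity
      · exact le_rfl
    have hs : Summable (fun j => γ (j + 1) * coef e (j + 1) ^ 2) :=
      Summable.of_nonneg_of_le (fun j => by have := hγ.2 (j + 1) (by omega); positivity) hle hβ.1
    exact ⟨hs, (hs.tsum_le_tsum hle hβ.1).trans hβ.2⟩
  have hTe : ⟪T e, e⟫ ≤ d * ρ * (υ m / γ m) := by
    refine (inner_tail_le_of_link hd hυ hanti hγ hmono hT hm (fun j hj => by rw [hce, if_pos hj])
      hsum.1).trans ?_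
    have := hυ.2 m hm
    have := hγ.2 m hm
    calc d * (υ m / γ m) * ∑' j, γ (j + 1) * coef e (j + 1) ^ 2 ≤ d * (υ m / γ m) * ρ := by
          refine mul_le_mul_of_nonneg_left hsum.2 ?_
          have : (0 : ℝ) ≤ d := by linarith
          positivity
      _ = _ := by ring
  set r := β - poly b with hr
  set c : Fin m → ℝ := fun j => b j - coef β (j + 1) with hc
  have hpc : poly c = poly b - poly βm := by
    simp only [poly, hc, hβm, sub_smul, Finset.sum_sub_distrib]
  have her : e = r + poly c := by rw [hpc, he, hr]; abel
  -- `r` and `poly c` are orthogonal in the form of `T`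
  have hpyth : ⟪T e, e⟫ = ⟪T r, r⟫ + ⟪T (poly c), poly c⟫ := by
    have h1 := horth c
    have h2 : ⟪T (poly c), r⟫ = 0 := by
      rw [hT.1.inner_left_eq_inner_right, real_inner_comm]; exact h1
    rw [her, map_add, inner_add_left, inner_add_right, inner_add_right, h1, h2]
    ring
  have h3 := hT.1.inner_nonneg_left r
  have h4 := hT.1.inner_nonneg_left (poly c)
  refine ⟨b, horth, by linarith, ?_⟩
  have h5 := sum_le_inner_of_link hd hυ hanti hT m (poly c)
  rw [Finset.sum_range] at h5
  simp only [coef_poly] at h5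
  refine h5.trans ?_
  have : d * ⟪T (poly c), poly c⟫ ≤ d * (d * ρ * (υ m / γ m)) := by
    have : (0 : ℝ) ≤ d := by linarith
    gcongr
    linarith
  linarith

/-- The bias of the Galerkin approximation. -/
lemma galerkin_bias_sq_le (hγ : IsWeight γ) (hυ : IsWeight υ) (hh : IsRepresenter γ h)
    (hβ : β ∈ slopes γ ρ) {b : Fin m → ℝ} {B : ℝ}
    (hb : ∑ j : Fin m, υ (j + 1) * (b j - coef β (j + 1)) ^ 2 ≤ B) :
    ((fun j : Fin m => h (j + 1)) ⬝ᵥ b - functional h β) ^ 2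
      ≤ 2 * (headSum υ h m * B) + 2 * (tailSum γ h m * ρ) := by
  have h1 := functional_tail_sq_le hγ hh hβ m
  have h2 : (∑ j : Fin m, h (j + 1) * (b j - coef β (j + 1))) ^ 2 ≤ headSum υ h m * B := by
    have := Finset.sum_mul_sq_le_sq_mul_sq Finset.univ (fun j : Fin m => h (j + 1) / √(υ (j + 1)))
      (fun j : Fin m => √(υ (j + 1)) * (b j - coef β (j + 1)))
    have hp : ∀ j : Fin m, 0 < υ (j + 1) := fun j => hυ.2 _ (by omega)
    have e1 : ∀ j : Fin m, (h (j + 1) / √(υ (j + 1))) * (√(υ (j + 1)) * (b j - coef β (j + 1)))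
        = h (j + 1) * (b j - coef β (j + 1)) := fun j => by
      have := (Real.sqrt_pos.2 (hp j)).ne'
      field_simp
    simp only [e1, div_pow, mul_pow, Real.sq_sqrt (hp _).le] at this
    refine this.trans ?_
    rw [← headSum_eq]
    exact mul_le_mul_of_nonneg_left hb (headSum_nonneg hυ m)
  rw [functional_split hγ hh hβ m]
  have e : (fun j : Fin m => h (j + 1)) ⬝ᵥ b - (∑ j : Fin m, h (j + 1) * coef β (j + 1) +
      ∑' j, h (m + 1 + j) * coef β (m + 1 + j))
      = ∑ j : Fin m, h (j + 1) * (b j - coef β (j + 1)) -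
        ∑' j, h (m + 1 + j) * coef β (m + 1 + j) := by
    simp only [dotProduct, mul_sub, Finset.sum_sub_distrib]
    ring
  rw [e]
  set s := ∑ j : Fin m, h (j + 1) * (b j - coef β (j + 1))
  set t := ∑' j, h (m + 1 + j) * coef β (m + 1 + j)
  nlinarith [sq_nonneg (s + t)]

end Functional

/-! ### The regression model in whitened coordinates -/

section Model

variable {υ : ℕ → ℝ} {d η σ : ℝ} {K m : ℕ} {μ : Measure (L2 × ℝ)}

lemma modelClass.isProbabilityMeasure (hμ : μ ∈ modelClass υ d (4 * K) η) :
    IsProbabilityMeasure μ := by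
  have := hμ.1.1.1
  have h1 := this.measure_univ
  rw [Measure.map_apply measurable_fst MeasurableSet.univ] at h1
  exact ⟨h1⟩

lemma map_fst_lintegral (f : L2 → ℝ≥0∞) (hf : Measurable f) :
    ∫⁻ z, f z.1 ∂μ = ∫⁻ x, f x ∂(μ.map Prod.fst) :=
  (lintegral_map hf measurable_fst).symm

/-- Linear functionals of the regressor have bounded moments. -/
lemma hasMoment_inner (hK : 1 ≤ K) (hη : 0 ≤ η) (hμ : μ ∈ modelClass υ d (4 * K) η) (f : L2) :
    HasMoment μ K (η * ⟪covarianceOperator (μ.map Prod.fst) f, f⟫ ^ (2 * K))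
      (fun z => ⟪f, z.1⟫) := by
  have hm : Measurable (fun z : L2 × ℝ => ⟪f, z.1⟫) := (measurable_inner_const f).comp measurable_fst
  have h1 := lintegral_inner_pow_le hK hμ.1 f
  have hmf := measurable_inner_const f
  rw [← map_fst_lintegral (fun x => ENNReal.ofReal (|⟪f, x⟫| ^ (4 * K))) (by fun_prop)] at h1
  have hp := hμ.1.2.1.inner_nonneg_left f
  obtain ⟨h2, h3⟩ := integrable_pow_of_lintegral_le (Z := fun z : L2 × ℝ => ⟪f, z.1⟫)
    (show Even (4 * K) from ⟨2 * K, by ring⟩) hm (by positivity) h1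
  exact ⟨hm, h2, h3⟩

lemma hasMoment_error (hη : 0 ≤ η) (hμ : μ ∈ modelClass υ d (4 * K) η) :
    HasMoment μ K η (fun z => z.2) := by
  have h1 := hμ.2.1.2.2.2.2
  rw [lintegral_map (by fun_prop) measurable_snd] at h1
  obtain ⟨h2, h3⟩ := integrable_pow_of_lintegral_le (Z := fun z : L2 × ℝ => z.2)
    (show Even (4 * K) from ⟨2 * K, by ring⟩) measurable_snd hη h1
  exact ⟨measurable_snd, h2, h3⟩

lemma memLp_fst (hμ : μ ∈ modelClass υ d (4 * K) η) : MemLp (fun z : L2 × ℝ => z.1) 2 μ := by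
  have := hμ.1.1.2.1
  exact this.comp_measurePreserving ⟨measurable_fst, rfl⟩

lemma memLp_snd (hμ : μ ∈ modelClass υ d (4 * K) η) : MemLp (fun z : L2 × ℝ => z.2) 2 μ := by
  have := hμ.2.1.2.1
  exact this.comp_measurePreserving ⟨measurable_snd, rfl⟩

lemma integral_inner_mul_inner (hμ : μ ∈ modelClass υ d (4 * K) η) (f g : L2) :
    ∫ z, ⟪f, z.1⟫ * ⟪g, z.1⟫ ∂μ = ⟪covarianceOperator (μ.map Prod.fst) f, g⟫ := by
  rw [covarianceOperator_inner hμ.1.1.2.1, integral_map measurable_fst.aemeasurable]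
  exact ((measurable_inner_const f).mul (measurable_inner_const g)).aestronglyMeasurable

lemma integrable_inner_mul_inner (hμ : μ ∈ modelClass υ d (4 * K) η) (f g : L2) :
    Integrable (fun z => ⟪f, z.1⟫ * ⟪g, z.1⟫) μ :=
  MemLp.integrable_mul ((memLp_fst hμ).const_inner f) ((memLp_fst hμ).const_inner g)

/-- Regressor and error are uncorrelated. -/
lemma integral_error_mul_inner (hμ : μ ∈ modelClass υ d (4 * K) η) (f : L2) :
    Integrable (fun z => z.2 * ⟪f, z.1⟫) μ ∧ ∫ z, z.2 * ⟪f, z.1⟫ ∂μ = 0 := by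
  have hi : Integrable (fun z : L2 × ℝ => z.2 • z.1) μ :=
    memLp_one_iff_integrable.1 ((memLp_fst hμ).smul (memLp_snd hμ))
  have h1 := integral_inner (𝕜 := ℝ) hi f
  rw [hμ.2.2, inner_zero_right] at h1
  simp only [real_inner_smul_right] at h1
  exact ⟨MemLp.integrable_mul (memLp_snd hμ) ((memLp_fst hμ).const_inner f), h1⟩

/-- The residual `⟪r, X⟫ + σ ε` that is left after subtracting an approximation from the slope. -/
def residual (r : L2) (σ : ℝ) (z : L2 × ℝ) : ℝ := ⟪r, z.1⟫ + σ * z.2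

lemma hasMoment_residual (hK : 1 ≤ K) (hη : 0 ≤ η) (hμ : μ ∈ modelClass υ d (4 * K) η) {r : L2}
    {B : ℝ} (hr : ⟪covarianceOperator (μ.map Prod.fst) r, r⟫ ≤ B) :
    HasMoment μ K (2 ^ (4 * K) * (η * B ^ (2 * K) + σ ^ (4 * K) * η)) (residual r σ) := by
  have hev : Even (4 * K) := ⟨2 * K, by ring⟩
  obtain ⟨a1, a2, a3⟩ := hasMoment_inner hK hη hμ r
  obtain ⟨b1, b2, b3⟩ := hasMoment_error hη hμ
  have hm : Measurable (residual r σ) := a1.add (b1.const_mul σ)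
  have hpt : ∀ z, residual r σ z ^ (4 * K)
      ≤ 2 ^ (4 * K) * (⟪r, z.1⟫ ^ (4 * K) + σ ^ (4 * K) * z.2 ^ (4 * K)) := by
    intro z
    rw [← hev.pow_abs (residual r σ z), ← hev.pow_abs ⟪r, z.1⟫, ← mul_pow, ← hev.pow_abs (σ * z.2)]
    calc |residual r σ z| ^ (4 * K) ≤ (|⟪r, z.1⟫| + |σ * z.2|) ^ (4 * K) := by
          gcongr; exact abs_add_le _ _
      _ ≤ 2 ^ (4 * K - 1) * (|⟪r, z.1⟫| ^ (4 * K) + |σ * z.2| ^ (4 * K)) :=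
          add_pow_le (abs_nonneg _) (abs_nonneg _) _
      _ ≤ _ := by
          gcongr
          · norm_num
          · omega
  have hbd : Integrable (fun z : L2 × ℝ =>
      2 ^ (4 * K) * (⟪r, z.1⟫ ^ (4 * K) + σ ^ (4 * K) * z.2 ^ (4 * K))) μ :=
    (a2.add (b2.const_mul _)).const_mul _
  have hi : Integrable (fun z => residual r σ z ^ (4 * K)) μ := by
    refine hbd.mono' (hm.pow_const _).aestronglyMeasurable (Eventually.of_forall fun z => ?_)
    rw [Real.norm_eq_abs, abs_of_nonneg (hev.pow_nonneg _)]
    exact hpt z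
  refine ⟨hm, hi, (integral_mono hi hbd hpt).trans ?_⟩
  rw [integral_const_mul, integral_add a2 (b2.const_mul _), integral_const_mul]
  have hp := hμ.1.2.1.inner_nonneg_left r
  have h5 : η * ⟪covarianceOperator (μ.map Prod.fst) r, r⟫ ^ (2 * K) ≤ η * B ^ (2 * K) := by gcongr
  have h6 : 0 ≤ σ ^ (4 * K) := hev.pow_nonneg _
  gcongr
  exact a3.trans h5

/-- The whitened vector of the first `m` coefficients of the regressor. -/
def whitened {m : ℕ} (S : Matrix (Fin m) (Fin m) ℝ) (z : L2 × ℝ) : Fin m → ℝ :=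
  S.mulVec fun j => coef z.1 (j + 1)

lemma dotProduct_whitened {S : Matrix (Fin m) (Fin m) ℝ} (hS : S.PosDef) (w : Fin m → ℝ)
    (z : L2 × ℝ) : w ⬝ᵥ whitened S z = ⟪poly (S.mulVec w), z.1⟫ := by
  rw [whitened, ← PosDef.mulVec_dotProduct hS, inner_poly]

lemma inner_whitened {T : L2 →L[ℝ] L2} {S : Matrix (Fin m) (Fin m) ℝ} (hS : S.PosDef)
    (hSA : S * S * opMatrix T m = 1) (v w : Fin m → ℝ) :
    ⟪T (poly (S.mulVec v)), poly (S.mulVec w)⟫ = v ⬝ᵥ w := by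
  have h1 : S * (opMatrix T m * S) = 1 := by
    have : (S * opMatrix T m) * S = 1 := by
      rw [mul_eq_one_comm, ← mul_assoc]; exact hSA
    rwa [mul_assoc] at this
  rw [← dotProduct_opMatrix_mulVec, PosDef.mulVec_dotProduct hS, Matrix.mulVec_mulVec,
    Matrix.mulVec_mulVec, mul_assoc, h1, Matrix.one_mulVec, dotProduct_comm]

lemma isotropicMoment_whitened (hK : 1 ≤ K) (hη : 0 ≤ η) (hμ : μ ∈ modelClass υ d (4 * K) η)
    {S : Matrix (Fin m) (Fin m) ℝ} (hS : S.PosDef)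
    (hSA : S * S * opMatrix (covarianceOperator (μ.map Prod.fst)) m = 1) :
    IsotropicMoment μ K η (whitened S) where
  moment w hw := by
    have := hasMoment_inner hK hη hμ (poly (S.mulVec w))
    rw [inner_whitened hS hSA, hw, one_pow, mul_one] at this
    simpa only [dotProduct_whitened hS] using this
  isotropic v w := by
    simp only [dotProduct_whitened hS]
    rw [integral_inner_mul_inner hμ, inner_whitened hS hSA]

/-- The residual of a Galerkin approximation is uncorrelated with the first `m` coefficients of the
regressor. -/
lemma integral_residual_mul_whitened (hμ : μ ∈ modelClass υ d (4 * K) η)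
    {S : Matrix (Fin m) (Fin m) ℝ} (hS : S.PosDef) {r : L2}
    (hr : ∀ w : Fin m → ℝ, ⟪covarianceOperator (μ.map Prod.fst) r, poly w⟫ = 0) (w : Fin m → ℝ) :
    ∫ z, residual r σ z * (w ⬝ᵥ whitened S z) ∂μ = 0 := by
  simp only [dotProduct_whitened hS, residual, add_mul, mul_assoc]
  obtain ⟨h1, h2⟩ := integral_error_mul_inner hμ (poly (S.mulVec w))
  rw [integral_add (integrable_inner_mul_inner hμ _ _) (h1.const_mul σ), integral_const_mul, h2,
    integral_inner_mul_inner hμ, hr]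
  simp

/-- The deviation matrix of the whitened coefficients is the empirical matrix, conjugated by
`S = [T]_m^{-1/2}`, minus the identity. -/
lemma devMatrix_whitened {n : ℕ} (β : L2) {S : Matrix (Fin m) (Fin m) ℝ} (hS : S.PosDef)
    (z : Fin n → L2 × ℝ) :
    Matrix.of (devMatrix (whitened S) z)
      = S * empMatrix m (fun i => observe β σ (z i)) * S - 1 := by
  have hSt : S.transpose = S := by
    have := hS.isHermitian
    rwa [Matrix.IsHermitian, Matrix.conjTranspose_eq_transpose_of_trivial] at this
  have he : empMatrix m (fun i => observe β σ (z i)) = (n : ℝ)⁻¹ • ∑ i, Matrix.vecMulVec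
      (fun j : Fin m => coef (z i).1 (j + 1)) (fun j : Fin m => coef (z i).1 (j + 1)) := by
    ext j l
    simp [empMatrix, observe, Matrix.sum_apply, Matrix.vecMulVec_apply]
  rw [he, mul_smul_comm, smul_mul_assoc, Finset.mul_sum, Finset.sum_mul]
  simp only [Matrix.mul_vecMulVec, Matrix.vecMulVec_mul]
  ext j l
  rw [Matrix.of_apply, devMatrix, Matrix.sub_apply, Matrix.smul_apply, Matrix.sum_apply,
    Matrix.one_apply, smul_eq_mul]
  congr 2
  refine Finset.sum_congr rfl fun i _ => ?_
  rw [Matrix.vecMulVec_apply, whitened, ← Matrix.mulVec_transpose, hSt]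

/-- The empirical normal equations hold at `b` up to the empirical mean of residual times regressor. -/
lemma empVector_sub_mulVec {n : ℕ} (β : L2) (b : Fin m → ℝ) (z : Fin n → L2 × ℝ) (j : Fin m) :
    (empVector m (fun i => observe β σ (z i)) -
        (empMatrix m (fun i => observe β σ (z i))).mulVec b) j
      = (n : ℝ)⁻¹ * ∑ i, residual (β - poly b) σ (z i) * coef (z i).1 (j + 1) := by
  have h1 : (empMatrix m (fun i => observe β σ (z i))).mulVec b j
      = (n : ℝ)⁻¹ * ∑ i, ⟪poly b, (z i).1⟫ * coef (z i).1 (j + 1) := by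
    simp only [Matrix.mulVec, dotProduct, empMatrix, Matrix.of_apply, observe, inner_poly,
      Finset.mul_sum, Finset.sum_mul]
    rw [Finset.sum_comm]
    refine Finset.sum_congr rfl fun i _ => Finset.sum_congr rfl fun l _ => ?_
    ring
  rw [Pi.sub_apply, h1, empVector, ← mul_sub, ← Finset.sum_sub_distrib]
  congr 1
  refine Finset.sum_congr rfl fun i _ => ?_
  rw [observe, residual, inner_sub_left]
  ring

lemma meanVector_whitened {n : ℕ} (β : L2) (S : Matrix (Fin m) (Fin m) ℝ) (b : Fin m → ℝ)
    (z : Fin n → L2 × ℝ) :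
    meanVector (whitened S) (residual (β - poly b) σ) z
      = S.mulVec (empVector m (fun i => observe β σ (z i)) -
          (empMatrix m (fun i => observe β σ (z i))).mulVec b) := by
  funext l
  simp only [meanVector, whitened, Matrix.mulVec, dotProduct]
  rw [Finset.sum_congr rfl fun j _ => congrArg (S l j * ·) (empVector_sub_mulVec β b z j)]
  simp only [Finset.mul_sum]
  rw [Finset.sum_comm]
  refine Finset.sum_congr rfl fun i _ => Finset.sum_congr rfl fun j _ => ?_
  ring

end Model

/-! ### The upper bound -/

section Kappa

variable {γ υ : ℕ → ℝ} {k : ℕ → ℕ}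

lemma balance_nonneg (hγ : IsWeight γ) (hυ : IsWeight υ) (n : ℕ) {m : ℕ} (hm : 1 ≤ m) :
    0 ≤ balance γ υ n m := by
  have := hγ.2 m hm
  have := hυ.2 m hm
  unfold balance
  positivity

lemma kappa_le_balance (hγ : IsWeight γ) (hυ : IsWeight υ) (hk : IsOptimalDim γ υ k) {n : ℕ}
    (hn : 1 ≤ n) : kappa γ υ k ≤ balance γ υ n (k n) := by
  refine csInf_le ⟨0, ?_⟩ ⟨n, hn, ?_⟩
  · rintro _ ⟨i, hi, rfl⟩
    have h := balance_nonneg hγ hυ i (hk i hi).1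
    unfold balance at h
    simpa only [alphaStar, inv_mul_eq_div] using h
  · simp only [alphaStar, inv_mul_eq_div, balance]

/-- If `κ > 0`, the ratio `υ_k / γ_k` at the optimal dimension and `1 / n` are of the same order. -/
lemma kappa_mul_alphaStar_le (hγ : IsWeight γ) (hυ : IsWeight υ) (hk : IsOptimalDim γ υ k) {n : ℕ}
    (hn : 1 ≤ n) :
    kappa γ υ k * alphaStar γ υ k n ≤ min (υ (k n) / γ (k n)) (n : ℝ)⁻¹ := by
  have h := kappa_le_balance hγ hυ hk hn
  have hn0 : (0 : ℝ) < (n : ℝ)⁻¹ := by positivity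
  rw [balance, le_div_iff₀ (lt_of_lt_of_le hn0 (le_max_right _ _))] at h
  exact h

lemma inv_le_alphaStar (n : ℕ) : (n : ℝ)⁻¹ ≤ alphaStar γ υ k n := le_max_right _ _

lemma headSum_mul_le_deltaStar (h : ℕ → ℝ) (n : ℕ) :
    alphaStar γ υ k n * headSum υ h (k n) ≤ deltaStar γ υ k h n := le_max_left _ _

lemma tailSum_le_deltaStar (h : ℕ → ℝ) (n : ℕ) : tailSum γ h (k n) ≤ deltaStar γ υ k h n :=
  le_max_right _ _

/-- The threshold is large enough not to be active when the empirical matrix is close to its mean. -/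
lemma two_mul_div_le_threshold {d : ℝ} (hd : 1 ≤ d) (hγ : IsWeight γ) (hυ : IsWeight υ)
    (hk : IsOptimalDim γ υ k) (hκ : 0 < kappa γ υ k) {n : ℕ} (hn : 1 ≤ n) :
    2 * d / υ (k n) ≤ threshold γ υ k d n * n := by
  have hm := (hk n hn).1
  have h1 := (kappa_mul_alphaStar_le hγ hυ hk hn).trans (min_le_left _ _)
  have h2 := hυ.2 _ hm
  have h3 := hγ.2 _ hm
  have hn0 : (0 : ℝ) < n := by exact_mod_cast hn
  have h4 : kappa γ υ k * (n : ℝ)⁻¹ ≤ υ (k n) / γ (k n) :=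
    (mul_le_mul_of_nonneg_left (inv_le_alphaStar n) hκ.le).trans h1
  have h5 : kappa γ υ k * γ (k n) ≤ υ (k n) * n := by
    rw [le_div_iff₀ h3, mul_assoc, mul_comm, mul_assoc, inv_mul_le_iff₀ hn0] at h4
    linarith
  calc 2 * d / υ (k n) ≤ 8 * d ^ 3 / (kappa γ υ k * γ (k n)) * n := by
        rw [div_mul_eq_mul_div, div_le_div_iff₀ h2 (by positivity)]
        have hd3 : 2 * d ≤ 8 * d ^ 3 := by nlinarith [sq_nonneg d, mul_self_nonneg (d - 1)]
        calc 2 * d * (kappa γ υ k * γ (k n)) ≤ 8 * d ^ 3 * (υ (k n) * n) := by gcongr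
          _ = _ := by ring
    _ ≤ _ := by gcongr; exact le_max_left _ _

lemma threshold_le {d : ℝ} (hd : 1 ≤ d) (hγ : IsWeight γ) (hmono : MonotoneOn γ (Set.Ici 1))
    (hk : IsOptimalDim γ υ k) (hκ : 0 < kappa γ υ k) {n : ℕ} (hn : 1 ≤ n) :
    threshold γ υ k d n ≤ max (8 * d ^ 3 / kappa γ υ k) 1 := by
  have h1 := hγ.one_le hmono (hk n hn).1
  refine max_le_max ?_ le_rfl
  gcongr
  exact le_mul_of_one_le_right hκ.le h1

end Kappa

section Pointwise

variable {m n : ℕ}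

/-- Pointwise bound for the squared error.  When the whitened deviation matrix is small, the error
consists of a bias, a linear term and a remainder.  Otherwise (which has to be paid for by the power
`(4 F) ^ q ≥ 1`) the estimator is either `0` or controlled by the threshold and the residuals, whose
mean square `R` satisfies `R ≤ √n + R⁵ / n²`. -/
lemma plugIn_error_sq_le {T : L2 →L[ℝ] L2} {S : Matrix (Fin m) (Fin m) ℝ} (hS : S.PosDef)
    (hSA : S * S * opMatrix T m = 1) {c α : ℝ} (hc : 0 < c) (hn : 1 ≤ n)
    (hA : ∀ v : Fin m → ℝ, c * (v ⬝ᵥ v) ≤ v ⬝ᵥ (opMatrix T m).mulVec v) (hα : 2 / c ≤ α * n)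
    (β : L2) (σ : ℝ) (b : Fin m → ℝ) (h : ℕ → ℝ) (v : ℝ) (q : ℕ) (z : Fin n → L2 × ℝ)
    {u : Fin m → ℝ} (hu : S.mulVec (fun j : Fin m => h (j + 1)) = u)
    {F R : ℝ} (hF : ∑ j, ∑ l, devMatrix (whitened S) z j l ^ 2 = F)
    (hR : (n : ℝ)⁻¹ * ∑ i, residual (β - poly b) σ (z i) ^ 2 = R) :
    |plugIn h m α (fun i => observe β σ (z i)) - v| ^ 2
      ≤ 2 * ((fun j : Fin m => h (j + 1)) ⬝ᵥ b - v) ^ 2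
        + 4 * (u ⬝ᵥ meanVector (whitened S) (residual (β - poly b) σ) z) ^ 2
        + 16 * ((∑ j, (∑ l, devMatrix (whitened S) z j l * u l) ^ 2) *
            ∑ l, meanVector (whitened S) (residual (β - poly b) σ) z l ^ 2)
        + (2 * (α * n * ∑ j : Fin m, h (j + 1) ^ 2) * √n + v ^ 2) * (4 * F) ^ q
        + 2 * (α * n * ∑ j : Fin m, h (j + 1) ^ 2) / n ^ 2 * R ^ 5 := by
  have hn0 : (0 : ℝ) < n := by exact_mod_cast hn
  have hα0 : 0 ≤ α * n := le_trans (by positivity) hα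
  set x := fun i => observe β σ (z i) with hx
  set B := empMatrix m x with hB
  set D : Matrix (Fin m) (Fin m) ℝ := Matrix.of (devMatrix (whitened S) z) with hDdef
  have hD : D = S * B * S - 1 := devMatrix_whitened β hS z
  have hDt : D.transpose = D := by
    ext j l
    simp only [hDdef, Matrix.transpose_apply, Matrix.of_apply, devMatrix]
    congr 1
    · congr 1; exact Finset.sum_congr rfl fun i _ => mul_comm _ _
    · simp only [eq_comm]
  have hF' : ∑ j, ∑ l, D j l ^ 2 = F := hF
  have hF0 : 0 ≤ F := by rw [← hF]; positivity
  have hR0 : 0 ≤ R := by rw [← hR]; positivity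
  set hv : Fin m → ℝ := fun j => h (j + 1) with hhv
  have hhh : hv ⬝ᵥ hv = ∑ j : Fin m, h (j + 1) ^ 2 :=
    Finset.sum_congr rfl fun j _ => (sq _).symm
  set V := empVector m x - B.mulVec b with hV
  have hSV : meanVector (whitened S) (residual (β - poly b) σ) z = S.mulVec V :=
    meanVector_whitened β S b z
  have e1 : ∑ l, meanVector (whitened S) (residual (β - poly b) σ) z l ^ 2
      = S.mulVec V ⬝ᵥ S.mulVec V := by
    rw [hSV]; exact Finset.sum_congr rfl fun j _ => sq _
  have e2 : ∑ j, (∑ l, devMatrix (whitened S) z j l * u l) ^ 2 = D.mulVec u ⬝ᵥ D.mulVec u :=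
    Finset.sum_congr rfl fun j _ => sq _
  rw [e1, e2, hSV, sq_abs, ← hhh]
  set G := 4 * (u ⬝ᵥ S.mulVec V) ^ 2 with hG
  set G' := 16 * ((D.mulVec u ⬝ᵥ D.mulVec u) * (S.mulVec V ⬝ᵥ S.mulVec V)) with hG'
  have hG0 : 0 ≤ G := by positivity
  have hG'0 : 0 ≤ G' := mul_nonneg (by norm_num)
    (mul_nonneg (dotProduct_self_nonneg' _) (dotProduct_self_nonneg' _))
  have hhh0 : 0 ≤ hv ⬝ᵥ hv := dotProduct_self_nonneg' _
  have hP1 : 0 ≤ (2 * (α * n * (hv ⬝ᵥ hv)) * √n + v ^ 2) * (4 * F) ^ q := by positivity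
  have hP2 : 0 ≤ 2 * (α * n * (hv ⬝ᵥ hv)) / n ^ 2 * R ^ 5 := by positivity
  have hplug : ∀ y : ℝ, (hu : IsUnit B.det) → y = hv ⬝ᵥ B⁻¹.mulVec (empVector m x) →
      y - v = (hv ⬝ᵥ b - v) + hv ⬝ᵥ B⁻¹.mulVec V := by
    intro y hu hy
    rw [hy, hV, Matrix.mulVec_sub, Matrix.mulVec_mulVec, Matrix.nonsing_inv_mul _ hu,
      Matrix.one_mulVec, dotProduct_sub]
    ring
  -- on the event `F ≤ 1 / 4` the empirical matrix inherits a lower bound, so that the threshold is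
  -- not active
  by_cases hsmall : F ≤ 1 / 4
  · have hlow : ∀ w : Fin m → ℝ, c / 2 * (w ⬝ᵥ w) ≤ w ⬝ᵥ B.mulVec w := fun w => by
      have := dotProduct_mulVec_ge_of_small hS hSA hD (hF'.le.trans hsmall) w
      have := hA w
      linarith
    obtain ⟨hdet, hnorm⟩ := isUnit_det_and_spectralNorm_inv_le (by positivity) hlow
    have hcond : IsUnit (empMatrix m x).det ∧ spectralNorm (empMatrix m x)⁻¹ ≤ α * n :=
      ⟨hdet, hnorm.trans (le_trans (le_of_eq (by field_simp)) hα)⟩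
    rw [plugIn, if_pos hcond, hplug _ hdet rfl]
    have hθ : B.mulVec (B⁻¹.mulVec V) = V := by
      rw [Matrix.mulVec_mulVec, Matrix.mul_nonsing_inv _ hdet, Matrix.one_mulVec]
    have key := dotProduct_sq_le_of_small hS hSA hD hDt (hF'.le.trans hsmall) hθ hv
    rw [hu] at key
    nlinarith [sq_nonneg ((hv ⬝ᵥ b - v) - hv ⬝ᵥ B⁻¹.mulVec V)]
  · have hone : 1 ≤ (4 * F) ^ q := one_le_pow₀ (by linarith)
    -- the factor `(4 F) ^ q ≥ 1` turns a bound on the exceptional event into one that holds everywhere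
    by_cases hcond : IsUnit (empMatrix m x).det ∧ spectralNorm (empMatrix m x)⁻¹ ≤ α * n
    · rw [plugIn, if_pos hcond, hplug _ hcond.1 rfl]
      have key := dotProduct_inv_mulVec_sq_le (B := B) (V := V)
        (fun i => fun j : Fin m => coef (z i).1 (j + 1))
        (fun i => residual (β - poly b) σ (z i)) (fun j l => rfl)
        (empVector_sub_mulVec β b z) hcond.1 hv
      rw [hR] at key
      -- either `R ≤ √n`, or `R ≤ R (R / √n)⁴`
      have hRle : R ≤ √n * (4 * F) ^ q + R ^ 5 / n ^ 2 := by
        have hs : 0 < √(n : ℝ) := Real.sqrt_pos.2 hn0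
        have hs4 : √(n : ℝ) ^ 4 = n ^ 2 := by
          rw [show 4 = 2 * 2 by norm_num, pow_mul, Real.sq_sqrt hn0.le]
        rcases le_total R (√n) with hRn | hRn
        · have : √(n : ℝ) ≤ √n * (4 * F) ^ q := le_mul_of_one_le_right hs.le hone
          have : 0 ≤ R ^ 5 / (n : ℝ) ^ 2 := by positivity
          linarith
        · have : R ≤ R ^ 5 / (n : ℝ) ^ 2 := by
            rw [le_div_iff₀ (by positivity), ← hs4]
            calc R * √(n : ℝ) ^ 4 ≤ R * R ^ 4 := by gcongr
              _ = R ^ 5 := by ring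
          have : 0 ≤ √(n : ℝ) * (4 * F) ^ q := by positivity
          linarith
      have h1 : (hv ⬝ᵥ B⁻¹.mulVec V) ^ 2
          ≤ (√n * (4 * F) ^ q + R ^ 5 / n ^ 2) * (α * n * (hv ⬝ᵥ hv)) := by
        refine key.trans (mul_le_mul hRle ?_ ?_ (hR0.trans hRle))
        · exact mul_le_mul_of_nonneg_right hcond.2 hhh0
        · exact mul_nonneg (norm_nonneg _) hhh0
      have h2 : 0 ≤ v ^ 2 * (4 * F) ^ q := by positivity
      have h3 : (2 * (α * n * (hv ⬝ᵥ hv)) * √n + v ^ 2) * (4 * F) ^ q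
          + 2 * (α * n * (hv ⬝ᵥ hv)) / n ^ 2 * R ^ 5
          = 2 * ((√n * (4 * F) ^ q + R ^ 5 / n ^ 2) * (α * n * (hv ⬝ᵥ hv))) + v ^ 2 * (4 * F) ^ q := by
        ring
      nlinarith [sq_nonneg ((hv ⬝ᵥ b - v) - hv ⬝ᵥ B⁻¹.mulVec V)]
    · rw [plugIn, if_neg hcond]
      have h1 : v ^ 2 ≤ v ^ 2 * (4 * F) ^ q := le_mul_of_one_le_right (sq_nonneg v) hone
      have h2 : 0 ≤ 2 * (α * n * (hv ⬝ᵥ hv)) * √n * (4 * F) ^ q := by positivity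
      nlinarith [sq_nonneg (hv ⬝ᵥ b - v)]

end Pointwise

/-- Integration of a pointwise bound by a linear combination of non-negative random variables. -/
lemma lintegral_ofReal_le_of_le {Ω : Type*} [MeasurableSpace Ω] {μ : Measure Ω}
    [IsProbabilityMeasure μ] {f : Ω → ℝ} {N : ℕ} {a₀ : ℝ} {a e : Fin N → ℝ} {T : Fin N → Ω → ℝ}
    (ha₀ : 0 ≤ a₀) (ha : ∀ i, 0 ≤ a i) (hb : ∀ i, 0 ≤ e i) (hT : ∀ i ω, 0 ≤ T i ω)
    (hTm : ∀ i, Measurable (T i)) (hTb : ∀ i, ∫⁻ ω, ENNReal.ofReal (T i ω) ∂μ ≤ ENNReal.ofReal (e i))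
    (hf : ∀ ω, f ω ≤ a₀ + ∑ i, a i * T i ω) :
    ∫⁻ ω, ENNReal.ofReal (f ω) ∂μ ≤ ENNReal.ofReal (a₀ + ∑ i, a i * e i) := by
  calc ∫⁻ ω, ENNReal.ofReal (f ω) ∂μ
      ≤ ∫⁻ ω, (ENNReal.ofReal a₀ + ∑ i, ENNReal.ofReal (a i) * ENNReal.ofReal (T i ω)) ∂μ := by
        refine lintegral_mono fun ω => (ENNReal.ofReal_le_ofReal (hf ω)).trans (le_of_eq ?_)
        rw [ENNReal.ofReal_add ha₀ (Finset.sum_nonneg fun i _ => mul_nonneg (ha i) (hT i ω)),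
          ENNReal.ofReal_sum_of_nonneg fun i _ => mul_nonneg (ha i) (hT i ω)]
        simp only [ENNReal.ofReal_mul (ha _)]
    _ = ENNReal.ofReal a₀ + ∑ i, ENNReal.ofReal (a i) * ∫⁻ ω, ENNReal.ofReal (T i ω) ∂μ := by
        rw [lintegral_add_left measurable_const, lintegral_const, measure_univ, mul_one,
          lintegral_finsetSum _ fun i _ => (hTm i).ennreal_ofReal.const_mul _]
        simp only [lintegral_const_mul' _ _ ENNReal.ofReal_ne_top]
    _ ≤ ENNReal.ofReal a₀ + ∑ i, ENNReal.ofReal (a i) * ENNReal.ofReal (e i) := by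
        gcongr with i _
        exact hTb i
    _ = _ := by
        rw [ENNReal.ofReal_add ha₀ (Finset.sum_nonneg fun i _ => mul_nonneg (ha i) (hb i)),
          ENNReal.ofReal_sum_of_nonneg fun i _ => mul_nonneg (ha i) (hb i)]
        simp only [ENNReal.ofReal_mul (ha _)]

lemma exists_unit_direction {m : ℕ} (hm : 1 ≤ m) (u : Fin m → ℝ) :
    ∃ (r : ℝ) (w : Fin m → ℝ), w ⬝ᵥ w = 1 ∧ u = r • w ∧ r ^ 2 = u ⬝ᵥ u := by
  by_cases hu : u = 0
  · exact ⟨0, Pi.single ⟨0, by omega⟩ 1, single_dotProduct_self _, by simp [hu], by simp [hu]⟩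
  · have hpos : 0 < u ⬝ᵥ u := lt_of_le_of_ne (dotProduct_self_nonneg' u)
      fun h => hu (dotProduct_self_eq_zero.1 h.symm)
    have hr : 0 < √(u ⬝ᵥ u) := Real.sqrt_pos.2 hpos
    have hrr : √(u ⬝ᵥ u) ^ 2 = u ⬝ᵥ u := Real.sq_sqrt hpos.le
    refine ⟨√(u ⬝ᵥ u), (√(u ⬝ᵥ u))⁻¹ • u, ?_, ?_, hrr⟩
    · rw [smul_dotProduct, dotProduct_smul, smul_eq_mul, smul_eq_mul]
      nth_rewrite 3 [← hrr]
      field_simp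
    · rw [smul_smul, mul_inv_cancel₀ hr.ne', one_smul]

lemma measurable_whitened {m : ℕ} (S : Matrix (Fin m) (Fin m) ℝ) (j : Fin m) :
    Measurable fun z : L2 × ℝ => whitened S z j := by
  have h : ∀ l, Measurable fun z : L2 × ℝ => coef z.1 l := fun l =>
    (measurable_coef l).comp measurable_fst
  simp only [whitened, Matrix.mulVec, dotProduct]
  exact Finset.measurable_fun_sum _ fun l _ => (h _).const_mul _

lemma measurable_residual (r : L2) (σ : ℝ) : Measurable (residual r σ) :=
  ((measurable_inner_const r).comp measurable_fst).add (measurable_snd.const_mul σ)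

section UpperBound

variable {γ υ : ℕ → ℝ} {k : ℕ → ℕ}

lemma deltaStar_nonneg (hγ : IsWeight γ) (h : ℕ → ℝ) (n : ℕ) : 0 ≤ deltaStar γ υ k h n :=
  (tailSum_nonneg hγ _).trans (tailSum_le_deltaStar h n)

lemma headSum_div_le_deltaStar (hυ : IsWeight υ) (h : ℕ → ℝ) (n : ℕ) :
    headSum υ h (k n) / n ≤ deltaStar γ υ k h n := by
  refine le_trans ?_ (headSum_mul_le_deltaStar h n)
  rw [div_eq_inv_mul]
  exact mul_le_mul_of_nonneg_right (inv_le_alphaStar n) (headSum_nonneg hυ _)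

lemma sum_sq_le_headSum (hυ : IsWeight υ) (hanti : AntitoneOn υ (Set.Ici 1)) (h : ℕ → ℝ) (m : ℕ) :
    ∑ j : Fin m, h (j + 1) ^ 2 ≤ headSum υ h m := by
  rw [headSum_eq]
  refine Finset.sum_le_sum fun j _ => ?_
  rw [le_div_iff₀ (hυ.2 _ (by omega))]
  exact mul_le_of_le_one_right (sq_nonneg _) (hυ.le_one hanti (by omega))

set_option maxHeartbeats 1600000 in
/-- The mean squared error of the plug-in estimator with the optimal dimension is of the order
`δ_n^*`, uniformly over the model, the slopes and the representers, as soon as the moments control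
the probability that the empirical matrix is far from its mean.  That probability is of the order
`(m² / n) ^ q`, whereas the error on the exceptional event can exceed `δ_n^* ≥ n⁻¹ ∑ h_j² / υ_j` by
a factor `√n n²`; this is the meaning of `hC₀`. -/
theorem exists_mse_plugIn_le {d η ρ σ : ℝ} (hd : 1 ≤ d) (hη : 1 ≤ η) (hρ : 0 < ρ)
    {K : ℕ} (hK : 3 ≤ K) (hγ : IsWeight γ) (hmono : MonotoneOn γ (Set.Ici 1))
    (hυ : IsWeight υ) (hanti : AntitoneOn υ (Set.Ici 1)) (hk : IsOptimalDim γ υ k)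
    (hκ : 0 < kappa γ υ k) {q : ℕ} (hq : 1 ≤ q) (hqK : q ≤ K) {C₀ : ℝ}
    (hC₀ : ∀ n : ℕ, 1 ≤ n → √n * n ^ 2 * ((k n : ℝ) ^ 2 / n) ^ q ≤ C₀) :
    ∃ C : ℝ, 0 < C ∧ ∀ n, 1 ≤ n → ∀ μ ∈ modelClass υ d (4 * K) η, ∀ h, IsRepresenter γ h →
      ∀ β ∈ slopes γ ρ, mse n μ σ β (plugIn h (k n) (threshold γ υ k d n)) (functional h β)
        ≤ ENNReal.ofReal (C * deltaStar γ υ k h n) := by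
  have hη0 : (0 : ℝ) ≤ η := by linarith
  have hC₀0 : 0 ≤ C₀ := le_trans (by positivity) (hC₀ 1 le_rfl)
  set M' : ℝ := 2 ^ (4 * K) * (η * (d * ρ) ^ (2 * K) + σ ^ (4 * K) * η) with hM'
  have hσK : 0 ≤ σ ^ (4 * K) := Even.pow_nonneg ⟨2 * K, by ring⟩ σ
  have hM'0 : 0 ≤ M' := by positivity
  set αm : ℝ := max (8 * d ^ 3 / kappa γ υ k) 1 with hαm
  have hαm1 : 1 ≤ αm := le_max_right _ _
  set c1 : ℝ := momentConst 1 * (4 ^ 1 * (M' + η + 3)) with hc1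
  set c2 : ℝ := momentConst 2 * (4 ^ 2 * (M' + 2 * η + 3)) with hc2
  set c3 : ℝ := momentConst q * (4 ^ q * (η + η + 3)) with hc3
  have hc10 : 0 ≤ c1 := mul_nonneg (momentConst_nonneg _) (by positivity)
  have hc20 : 0 ≤ c2 := mul_nonneg (momentConst_nonneg _) (by positivity)
  have hc30 : 0 ≤ c3 := mul_nonneg (momentConst_nonneg _) (by positivity)
  refine ⟨2 * (2 * (d ^ 2 * ρ) + 2 * ρ) + 4 * d * c1 + 16 * d * c2 * (1 + C₀)
    + 4 ^ q * c3 * (2 * αm * C₀ + ρ * (2 * C₀)) + 2 * αm * (1 + M'), by positivity, ?_⟩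
  intro n hn μ hμ h hh β hβ
  have := modelClass.isProbabilityMeasure hμ
  set T := covarianceOperator (μ.map Prod.fst) with hTdef
  have hT : T ∈ linkClass υ d := hμ.1.2
  set m := k n with hmdef
  have hm : 1 ≤ m := (hk n hn).1
  have hυm := hυ.2 m hm
  have hγm := hγ.2 m hm
  have hn0 : (0 : ℝ) < n := by exact_mod_cast hn
  have hn1 : (1 : ℝ) ≤ n := by exact_mod_cast hn
  obtain ⟨S, hS, hSA⟩ := exists_posDef_inv_sqrt (opMatrix_posDef hT.1 hT.2.1 m)
  obtain ⟨b, hb1, hb2, hb3⟩ := exists_galerkin hd hγ hmono hυ hanti hT hm hβ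
  -- the moments of the residual are bounded because `⟪T r, r⟫` is
  have hr1 : υ m / γ m ≤ 1 :=
    div_le_one_of_le₀ ((hυ.le_one hanti hm).trans (hγ.one_le hmono hm)) hγm.le
  have hW : HasMoment μ K M' (residual (β - poly b) σ) :=
    hasMoment_residual (by omega) hη0 hμ (hb2.trans (mul_le_of_le_one_right (by positivity) hr1))
  have hX : IsotropicMoment μ K η (whitened S) := isotropicMoment_whitened (by omega) hη0 hμ hS hSA
  have hWX := integral_residual_mul_whitened (σ := σ) hμ hS hb1
  have hlink : ∀ v : Fin m → ℝ, ∑ j : Fin m, υ (j + 1) * v j ^ 2 ≤ d * (v ⬝ᵥ (opMatrix T m).mulVec v) := by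
    intro v
    have := sum_le_inner_of_link hd hυ hanti hT m (poly v)
    rw [dotProduct_opMatrix_mulVec]
    refine le_trans (le_of_eq ?_) this
    rw [Finset.sum_range]
    simp only [coef_poly]
  set u := S.mulVec (fun j : Fin m => h (j + 1)) with hu
  have huu : u ⬝ᵥ u ≤ d * headSum υ h m := by
    rw [headSum_eq]
    exact mulVec_sqrt_dotProduct_self_le hS hSA (fun j => hυ.2 _ (by omega)) (by linarith) hlink _
  obtain ⟨r, w, hw, hur, hrr⟩ := exists_unit_direction hm u
  have hA : ∀ v : Fin m → ℝ, υ m / d * (v ⬝ᵥ v) ≤ v ⬝ᵥ (opMatrix T m).mulVec v := by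
    intro v
    rw [div_mul_eq_mul_div, div_le_iff₀ (by linarith), mul_comm _ d]
    refine le_trans ?_ (hlink v)
    rw [dotProduct, Finset.mul_sum]
    refine Finset.sum_le_sum fun j _ => ?_
    rw [← sq]
    exact mul_le_mul_of_nonneg_right
      (hanti (show (1 : ℕ) ≤ j + 1 by omega) hm (by omega)) (sq_nonneg _)
  set α := threshold γ υ k d n with hα
  have hα2 : 2 / (υ m / d) ≤ α * n := by
    have := two_mul_div_le_threshold hd hγ hυ hk hκ hn
    rwa [div_div_eq_mul_div]
  have hα1 : 1 ≤ α := le_max_right _ _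
  have hαle : α ≤ αm := threshold_le hd hγ hmono hk hκ hn
  have hmw := fun j => measurable_whitened S j
  have hmr := measurable_residual (β - poly b) σ
  have hmV : ∀ l, Measurable fun z : Fin n → L2 × ℝ =>
      meanVector (whitened S) (residual (β - poly b) σ) z l := fun l => by
    simp only [meanVector]
    exact (Finset.measurable_fun_sum _ fun i _ => (hmr.comp (measurable_pi_apply i)).mul
      ((hmw l).comp (measurable_pi_apply i))).const_mul _
  have hmD : ∀ j l, Measurable fun z : Fin n → L2 × ℝ => devMatrix (whitened S) z j l :=
    fun j l => by
      simp only [devMatrix]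
      exact ((Finset.measurable_fun_sum _ fun i _ => ((hmw j).comp (measurable_pi_apply i)).mul
        ((hmw l).comp (measurable_pi_apply i))).const_mul _).sub_const _
  set H := headSum υ h m with hH
  have hH0 : 0 ≤ H := headSum_nonneg hυ m
  set δ := deltaStar γ υ k h n with hδ
  have hδ0 : 0 ≤ δ := deltaStar_nonneg hγ h n
  have hHn : H / n ≤ δ := headSum_div_le_deltaStar hυ h n
  have hτ : tailSum γ h m ≤ δ := tailSum_le_deltaStar h n
  set hh2 := ∑ j : Fin m, h (j + 1) ^ 2 with hhh2
  have hh20 : 0 ≤ hh2 := by positivity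
  have hh2H : hh2 ≤ H := sum_sq_le_headSum hυ hanti h m
  set x : ℝ := ((m : ℝ) ^ 2 / n) with hx
  have hx0 : 0 ≤ x := by positivity
  have hxC := hC₀ n hn
  rw [← hmdef, ← hx] at hxC
  have hsn : 1 ≤ √(n : ℝ) := Real.one_le_sqrt.2 hn1
  -- the four random terms: the linear leading term, the remainder, the exceptional event, and the
  -- empirical second moment of the residuals; `u = r w` with a unit vector `w`
  have hmain := lintegral_ofReal_le_of_le (μ := Measure.pi fun _ : Fin n => μ) (N := 4)
    (a₀ := 2 * ((fun j : Fin m => h (j + 1)) ⬝ᵥ b - functional h β) ^ 2)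
    (a := ![4 * r ^ 2, 16 * r ^ 2, 4 ^ q * (2 * (α * n * hh2) * √n + functional h β ^ 2),
      2 * (α * n * hh2) / n ^ 2])
    (e := ![c1 / n ^ 1, c2 * ((m : ℝ) ^ 2 / n ^ 2), c3 * x ^ q, 1 + M'])
    (T := ![fun z => (w ⬝ᵥ meanVector (whitened S) (residual (β - poly b) σ) z) ^ 2,
      fun z => (∑ j, (∑ l, devMatrix (whitened S) z j l * w l) ^ 2) *
        ∑ l, meanVector (whitened S) (residual (β - poly b) σ) z l ^ 2,
      fun z => (∑ j, ∑ l, devMatrix (whitened S) z j l ^ 2) ^ q,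
      fun z => ((n : ℝ)⁻¹ * ∑ i, residual (β - poly b) σ (z i) ^ 2) ^ 5])
    (f := fun z => |plugIn h m α (fun i => observe β σ (z i)) - functional h β| ^ 2)
    (by positivity)
    (by
      intro i; fin_cases i
      · show 0 ≤ 4 * r ^ 2; positivity
      · show 0 ≤ 16 * r ^ 2; positivity
      · show 0 ≤ 4 ^ q * (2 * (α * n * hh2) * √n + functional h β ^ 2); positivity
      · show 0 ≤ 2 * (α * n * hh2) / (n : ℝ) ^ 2; positivity)
    (by
      intro i; fin_cases i
      · show 0 ≤ c1 / (n : ℝ) ^ 1; positivity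
      · show 0 ≤ c2 * ((m : ℝ) ^ 2 / n ^ 2); positivity
      · show 0 ≤ c3 * x ^ q; positivity
      · show 0 ≤ 1 + M'; positivity)
    (by
      intro i z; fin_cases i
      · exact sq_nonneg _
      · show 0 ≤ _ * _; positivity
      · show 0 ≤ _ ^ q; positivity
      · show 0 ≤ _ ^ 5; positivity)
    (by
      intro i; fin_cases i
      · show Measurable fun z => (w ⬝ᵥ meanVector (whitened S) (residual (β - poly b) σ) z) ^ 2
        simp only [dotProduct]
        exact (Finset.measurable_fun_sum _ fun l _ => (hmV l).const_mul _).pow_const 2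
      · exact (Finset.measurable_fun_sum _ fun j _ => (Finset.measurable_fun_sum _
          fun l _ => (hmD j l).mul_const _).pow_const 2).mul
          (Finset.measurable_fun_sum _ fun l _ => (hmV l).pow_const 2)
      · exact (Finset.measurable_fun_sum _ fun j _ => Finset.measurable_fun_sum _
          fun l _ => (hmD j l).pow_const 2).pow_const q
      · exact ((Finset.measurable_fun_sum _ fun i _ =>
          (hmr.comp (measurable_pi_apply i)).pow_const 2).const_mul _).pow_const 5)
    (by
      intro i; fin_cases i
      · exact lintegral_dotProduct_meanVector_sq_le hX hW hWX (by omega) hn hw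
      · exact lintegral_remainder_le hX hW hWX (by omega) hm hn hw
      · exact lintegral_devMatrix_pow_le hX hm hq hqK hn
      · exact lintegral_mean_sq_pow_le hW hK hn)
    (by
      intro z
      refine (plugIn_error_sq_le hS hSA (div_pos hυm (by linarith)) hn hA hα2 β σ b h
        (functional h β) q z (u := u) rfl rfl rfl).trans (le_of_eq ?_)
      simp only [Fin.sum_univ_four, Matrix.cons_val]
      rw [hur, smul_dotProduct, smul_eq_mul]
      have e : ∀ j, ∑ l, devMatrix (whitened S) z j l * (r • w) l
          = r * ∑ l, devMatrix (whitened S) z j l * w l := fun j => by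
        rw [Finset.mul_sum]
        exact Finset.sum_congr rfl fun l _ => by simp only [Pi.smul_apply, smul_eq_mul]; ring
      simp only [e, mul_pow, ← Finset.mul_sum]
      ring)
  refine hmain.trans (ENNReal.ofReal_le_ofReal ?_)
  simp only [Fin.sum_univ_four, Matrix.cons_val]
  have hrH : r ^ 2 ≤ d * H := hrr.trans_le huu
  -- each of the five terms is at most a constant times `δ`
  have b0 : 2 * ((fun j : Fin m => h (j + 1)) ⬝ᵥ b - functional h β) ^ 2
      ≤ 2 * (2 * (d ^ 2 * ρ) + 2 * ρ) * δ := by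
    have h1 := galerkin_bias_sq_le hγ hυ hh hβ hb3
    have h2 : υ m / γ m * H ≤ δ :=
      (mul_le_mul_of_nonneg_right (le_max_left _ _) hH0).trans (headSum_mul_le_deltaStar h n)
    have h3 : d ^ 2 * ρ * (υ m / γ m * H) ≤ d ^ 2 * ρ * δ := by gcongr
    have h4 : tailSum γ h m * ρ ≤ δ * ρ := by gcongr
    linarith
  have b1 : 4 * r ^ 2 * (c1 / n ^ 1) ≤ 4 * d * c1 * δ := by
    calc 4 * r ^ 2 * (c1 / n ^ 1) ≤ 4 * (d * H) * (c1 / n ^ 1) := by gcongr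
      _ = 4 * d * c1 * (H / n) := by ring
      _ ≤ _ := by gcongr
  have hxle : x ≤ 1 + C₀ := by
    rcases le_total x 1 with h1 | h1
    · linarith
    · have h2 : x ≤ x ^ q := le_self_pow₀ h1 (by omega)
      have h3 : (1 : ℝ) * 1 ≤ √n * n ^ 2 := by gcongr; exact one_le_pow₀ hn1
      have h4 : 1 * x ^ q ≤ √n * n ^ 2 * x ^ q := by
        gcongr; linarith
      linarith
  have b2 : 16 * r ^ 2 * (c2 * ((m : ℝ) ^ 2 / n ^ 2)) ≤ 16 * d * c2 * (1 + C₀) * δ := by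
    calc 16 * r ^ 2 * (c2 * ((m : ℝ) ^ 2 / n ^ 2)) ≤ 16 * (d * H) * (c2 * ((m : ℝ) ^ 2 / n ^ 2)) := by
          gcongr
      _ = 16 * d * c2 * x * (H / n) := by rw [hx]; ring
      _ ≤ _ := by gcongr
  have b3 : 4 ^ q * (2 * (α * n * hh2) * √n + functional h β ^ 2) * (c3 * x ^ q)
      ≤ 4 ^ q * c3 * (2 * αm * C₀ + ρ * (2 * C₀)) * δ := by
    have h1 := functional_sq_le hγ hmono hυ hanti hh hβ m
    have h2 : hh2 * n * √n * x ^ q ≤ C₀ * δ := by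
      calc hh2 * n * √n * x ^ q ≤ H * n * √n * x ^ q := by gcongr
        _ = (√n * n ^ 2 * x ^ q) * (H / n) := by field_simp
        _ ≤ C₀ * δ := by gcongr
    have h3 : (H + tailSum γ h m) * x ^ q ≤ 2 * C₀ * δ := by
      have h5 : (n : ℝ) * x ^ q ≤ C₀ := by
        refine le_trans ?_ hxC
        gcongr
        calc (n : ℝ) = 1 * (n : ℝ) ^ 1 := by ring
          _ ≤ √n * n ^ 2 := by gcongr; norm_num
      have h6 : x ^ q ≤ C₀ := le_trans (le_mul_of_one_le_left (by positivity) hn1) h5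
      have h7 : H * x ^ q ≤ C₀ * δ := by
        calc H * x ^ q = (n * x ^ q) * (H / n) := by field_simp
          _ ≤ C₀ * δ := by gcongr
      have h8 : tailSum γ h m * x ^ q ≤ δ * C₀ := by
        gcongr
      nlinarith
    calc 4 ^ q * (2 * (α * n * hh2) * √n + functional h β ^ 2) * (c3 * x ^ q)
        = 4 ^ q * c3 * (2 * α * (hh2 * n * √n * x ^ q) + functional h β ^ 2 * x ^ q) := by ring
      _ ≤ 4 ^ q * c3 * (2 * αm * (C₀ * δ) + ρ * (H + tailSum γ h m) * x ^ q) := by gcongr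
      _ = 4 ^ q * c3 * (2 * αm * (C₀ * δ) + ρ * ((H + tailSum γ h m) * x ^ q)) := by ring
      _ ≤ 4 ^ q * c3 * (2 * αm * (C₀ * δ) + ρ * (2 * C₀ * δ)) := by gcongr
      _ = _ := by ring
  have b4 : 2 * (α * n * hh2) / n ^ 2 * (1 + M') ≤ 2 * αm * (1 + M') * δ := by
    calc 2 * (α * n * hh2) / n ^ 2 * (1 + M') ≤ 2 * (αm * n * H) / n ^ 2 * (1 + M') := by gcongr
      _ = 2 * αm * (1 + M') * (H / n) := by field_simp
      _ ≤ _ := by gcongr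
  linarith

end UpperBound

/-! ### Shifts of Gaussian errors and the two-point bound -/

lemma pi_withDensity_const {Ω : Type*} [MeasurableSpace Ω] {μ : Measure Ω} [IsProbabilityMeasure μ]
    {w : Ω → ℝ≥0∞} (hw : Measurable w) [IsProbabilityMeasure (μ.withDensity w)] (n : ℕ) :
    (Measure.pi fun _ : Fin n => μ.withDensity w)
      = (Measure.pi fun _ : Fin n => μ).withDensity fun z => ∏ i, w (z i) := by
  refine Measure.pi_eq fun s hs => ?_
  rw [withDensity_apply _ (MeasurableSet.univ_pi hs), ← lintegral_indicator (MeasurableSet.univ_pi hs)]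
  have e : (univ.pi s).indicator (fun z : Fin n → Ω => ∏ i, w (z i))
      = fun z => ∏ i, (s i).indicator w (z i) := by
    ext z
    by_cases hz : z ∈ univ.pi s
    · rw [indicator_of_mem hz]
      exact Finset.prod_congr rfl fun i _ => (indicator_of_mem (hz i trivial) w).symm
    · rw [indicator_of_notMem hz]
      obtain ⟨i, hi⟩ : ∃ i, z i ∉ s i := by
        by_contra! hcon
        exact hz fun i _ => hcon i
      exact (Finset.prod_eq_zero (Finset.mem_univ i) (indicator_of_notMem hi w)).symm
  have hm : ∀ i, Measurable ((s i).indicator w) := fun i => hw.indicator (hs i)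
  rw [e, lintegral_prod_eq_prod_lintegral_of_indepFun Finset.univ
    (fun i (z : Fin n → Ω) => (s i).indicator w (z i))
    (iIndepFun_pi fun i => (hm i).aemeasurable) fun i => (hm i).comp (measurable_pi_apply i)]
  refine Finset.prod_congr rfl fun i _ => ?_
  rw [(measurePreserving_eval (fun _ : Fin n => μ) i).lintegral_comp (hm i),
    lintegral_indicator (hs i), withDensity_apply _ (hs i)]

/-- The density `e ↦ exp (b e - b² / 2)` of `N(b, 1)` with respect to `N(0, 1)`. -/
def shiftDensity (b e : ℝ) : ℝ≥0∞ := ENNReal.ofReal (Real.exp (b * e - b ^ 2 / 2))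

lemma measurable_shiftDensity {Ω : Type*} [MeasurableSpace Ω] {b e : Ω → ℝ} (hb : Measurable b)
    (he : Measurable e) : Measurable fun ω => shiftDensity (b ω) (e ω) := by
  unfold shiftDensity
  fun_prop

lemma gaussianReal_map_add_eq (b : ℝ) :
    (gaussianReal 0 1).map (· + b) = (gaussianReal 0 1).withDensity (shiftDensity b) := by
  have hm : Measurable (shiftDensity b) := measurable_shiftDensity measurable_const measurable_id
  rw [gaussianReal_map_add_const, gaussianReal_of_var_ne_zero _ one_ne_zero,
    gaussianReal_of_var_ne_zero _ one_ne_zero, ← withDensity_mul _ (measurable_gaussianPDF _ _) hm]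
  congr 1
  ext e
  simp only [Pi.mul_apply, gaussianPDF_def, gaussianPDFReal_def, shiftDensity]
  rw [← ENNReal.ofReal_mul (by positivity), mul_assoc _ (Real.exp _), ← Real.exp_add]
  congr 3
  push_cast
  ring

section Shift

variable {ν : Measure L2} {b : L2 → ℝ}

lemma prod_gaussian_map_shift (hb : Measurable b) :
    (ν.prod (gaussianReal 0 1)).map (fun z => (z.1, z.2 + b z.1))
      = (ν.prod (gaussianReal 0 1)).withDensity fun z => shiftDensity (b z.1) z.2 := by
  have hs : Measurable fun z : L2 × ℝ => (z.1, z.2 + b z.1) :=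
    measurable_fst.prodMk (measurable_snd.add (hb.comp measurable_fst))
  have hd : Measurable fun z : L2 × ℝ => shiftDensity (b z.1) z.2 :=
    measurable_shiftDensity (hb.comp measurable_fst) measurable_snd
  ext A hA
  rw [Measure.map_apply hs hA, withDensity_apply _ hA, ← lintegral_indicator hA,
    Measure.prod_apply (hs hA), lintegral_prod _ (hd.indicator hA).aemeasurable]
  refine lintegral_congr fun x => ?_
  have hAx : MeasurableSet (Prod.mk x ⁻¹' A) := measurable_prodMk_left hA
  have h1 : Prod.mk x ⁻¹' ((fun z : L2 × ℝ => (z.1, z.2 + b z.1)) ⁻¹' A)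
      = (· + b x) ⁻¹' (Prod.mk x ⁻¹' A) := rfl
  rw [h1, ← Measure.map_apply (measurable_add_const (b x)) hAx, gaussianReal_map_add_eq,
    withDensity_apply _ hAx, ← lintegral_indicator hAx]
  rfl

/-- Change of variables: shifting all errors amounts to multiplication with the likelihood ratio. -/
lemma lintegral_shift [IsProbabilityMeasure ν] (hb : Measurable b) {n : ℕ} {Φ : (Fin n → L2 × ℝ) → ℝ≥0∞}
    (hΦ : Measurable Φ) :
    ∫⁻ z, Φ (fun i => ((z i).1, (z i).2 + b (z i).1))
        ∂(Measure.pi fun _ : Fin n => ν.prod (gaussianReal 0 1))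
      = ∫⁻ z, ENNReal.ofReal (Real.exp (∑ i, b (z i).1 * (z i).2 - (∑ i, b (z i).1 ^ 2) / 2)) * Φ z
        ∂(Measure.pi fun _ : Fin n => ν.prod (gaussianReal 0 1)) := by
  set μ := ν.prod (gaussianReal 0 1)
  have hs : Measurable fun z : L2 × ℝ => (z.1, z.2 + b z.1) :=
    measurable_fst.prodMk (measurable_snd.add (hb.comp measurable_fst))
  have hd : Measurable fun z : L2 × ℝ => shiftDensity (b z.1) z.2 :=
    measurable_shiftDensity (hb.comp measurable_fst) measurable_snd
  have hp : IsProbabilityMeasure (μ.map fun z => (z.1, z.2 + b z.1)) :=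
    Measure.isProbabilityMeasure_map hs.aemeasurable
  have hmap := prod_gaussian_map_shift (ν := ν) hb
  have hp' : IsProbabilityMeasure (μ.withDensity fun z => shiftDensity (b z.1) z.2) := hmap ▸ hp
  have hS : Measurable fun (z : Fin n → L2 × ℝ) i => ((z i).1, (z i).2 + b (z i).1) :=
    measurable_pi_lambda _ fun i => hs.comp (measurable_pi_apply i)
  have hD : Measurable fun z : Fin n → L2 × ℝ => ∏ i, shiftDensity (b (z i).1) (z i).2 :=
    Finset.measurable_prod _ fun i _ => hd.comp (measurable_pi_apply i)
  rw [← lintegral_map (μ := Measure.pi fun _ : Fin n => μ) hΦ hS,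
    Measure.pi_map_pi (μ := fun _ : Fin n => μ) (f := fun _ z => (z.1, z.2 + b z.1))
      (fun i => hs.aemeasurable)]
  rw [hmap, pi_withDensity_const hd, lintegral_withDensity_eq_lintegral_mul _ hD hΦ]
  refine lintegral_congr fun z => ?_
  rw [Pi.mul_apply]
  congr 1
  simp only [shiftDensity]
  rw [← ENNReal.ofReal_prod_of_nonneg fun i _ => (Real.exp_pos _).le, ← Real.exp_sum,
    Finset.sum_sub_distrib, Finset.sum_div]

end Shift

/-- The likelihood ratios of the two shifts `±b` cannot both be small. -/
lemma le_lintegral_exp {ν : Measure L2} [IsProbabilityMeasure ν] {b : L2 → ℝ} (hb : Measurable b)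
    (hb2 : Integrable (fun x => b x ^ 2) ν) {n : ℕ} {B : ℝ} (hB : n * ∫ x, b x ^ 2 ∂ν ≤ B) :
    ENNReal.ofReal (Real.exp (-(1 / 2 + 3 / 2 * B)))
      ≤ ∫⁻ z, ENNReal.ofReal (Real.exp (-|∑ i, b (z i).1 * (z i).2| - (∑ i, b (z i).1 ^ 2) / 2))
        ∂(Measure.pi fun _ : Fin n => ν.prod (gaussianReal 0 1)) := by
  set μ := ν.prod (gaussianReal 0 1) with hμ
  set P := Measure.pi fun _ : Fin n => μ
  have hg1 : MemLp (id : ℝ → ℝ) 1 (gaussianReal 0 1) := memLp_id_gaussianReal 1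
  have hg2 : MemLp (id : ℝ → ℝ) 2 (gaussianReal 0 1) := memLp_id_gaussianReal 2
  have hg2' : Integrable (fun e : ℝ => e ^ 2) (gaussianReal 0 1) := hg2.integrable_sq
  have hge : ∫ e, e ^ 2 ∂(gaussianReal 0 1) = 1 := by
    have := variance_id_gaussianReal (μ := 0) (v := 1)
    rw [variance_of_integral_eq_zero aemeasurable_id (by simp)] at this
    simpa using this
  have hbm : MemLp b 2 ν := (memLp_two_iff_integrable_sq hb.aestronglyMeasurable).2 hb2
  set c := 1 / 2 + 3 / 2 * B
  set Z : L2 × ℝ → ℝ := fun z => b z.1 * z.2 with hZ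
  have hZm : Measurable Z := (hb.comp measurable_fst).mul measurable_snd
  have hZ2 : (fun z => Z z ^ 2) = fun z : L2 × ℝ => b z.1 ^ 2 * z.2 ^ 2 := by
    ext z; rw [hZ]; ring
  have hZi : Integrable (fun z => Z z ^ (2 * 1)) μ := by
    rw [mul_one, hZ2]
    exact hb2.mul_prod hg2'
  have hZ0 : ∫ z, Z z ∂μ = 0 := by
    rw [hZ, hμ, integral_prod_mul b (fun e : ℝ => e), integral_id_gaussianReal, mul_zero]
  have hZv : ∫ z, Z z ^ (2 * 1) ∂μ = ∫ x, b x ^ 2 ∂ν := by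
    rw [mul_one, hZ2, hμ, integral_prod_mul (fun x => b x ^ 2) (fun e : ℝ => e ^ 2), hge, mul_one]
  obtain ⟨i1, i2⟩ := integral_sum_pow_le μ le_rfl hZm.aestronglyMeasurable hZi hZ0 n
  rw [hZv] at i2
  have hbi : Integrable (fun z : L2 × ℝ => b z.1 ^ 2) μ := hb2.comp_fst _
  have hbv : ∫ z : L2 × ℝ, b z.1 ^ 2 ∂μ = ∫ x, b x ^ 2 ∂ν := by
    rw [hμ, integral_fun_fst (fun x => b x ^ 2)]
    simp
  have j1 : ∀ i : Fin n, Integrable (fun z : Fin n → L2 × ℝ => b (z i).1 ^ 2) P := fun i =>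
    ((measurePreserving_eval (fun _ : Fin n => μ) i).integrable_comp hbi.aestronglyMeasurable).2 hbi
  have j2 : ∫ z, ∑ i, b (z i).1 ^ 2 ∂P = n * ∫ x, b x ^ 2 ∂ν := by
    rw [integral_finsetSum _ fun i _ => j1 i]
    have : ∀ i : Fin n, ∫ z, b (z i).1 ^ 2 ∂P = ∫ x, b x ^ 2 ∂ν := fun i => by
      rw [← hbv]
      exact integral_comp_eval (μ := fun _ : Fin n => μ) (i := i) hbi.aestronglyMeasurable
    simp [this]
  have j3 : Integrable (fun z => ∑ i, b (z i).1 ^ 2) P := integrable_finsetSum _ fun i _ => j1 i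
  -- the minorant `e^{-c} (1 + c - x)` of `e^{-x}` with `|s| ≤ (1 + s²) / 2` in the exponent; the value
  -- of `c` makes its integral at least `e^{-c}`
  set g : (Fin n → L2 × ℝ) → ℝ := fun z =>
    Real.exp (-c) * (1 + c - ((1 + (∑ i, Z (z i)) ^ (2 * 1)) / 2 + (∑ i, b (z i).1 ^ 2) / 2)) with hg
  have i1' : Integrable (fun z => 1 + (∑ i, Z (z i)) ^ (2 * 1)) P := (integrable_const 1).add i1
  have hint : Integrable (fun z =>
      (1 + (∑ i, Z (z i)) ^ (2 * 1)) / 2 + (∑ i, b (z i).1 ^ 2) / 2) P :=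
    (i1'.div_const 2).add (j3.div_const 2)
  have hgi : Integrable g P := ((integrable_const _).sub hint).const_mul _
  have hgv : Real.exp (-c) ≤ ∫ z, g z ∂P := by
    rw [hg, integral_const_mul, integral_sub (integrable_const _) hint,
      integral_add (i1'.div_const 2) (j3.div_const 2),
      integral_div, integral_div, integral_add (integrable_const 1) i1, j2]
    simp only [integral_const, probReal_univ, smul_eq_mul, one_mul]
    refine le_mul_of_one_le_right (Real.exp_pos _).le ?_
    have hmc : momentConst 1 = 2 := by norm_num [momentConst]
    rw [hmc] at i2
    have : (1 : ℝ) / 2 + 3 / 2 * B = c := rfl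
    norm_num at i2 ⊢
    nlinarith
  calc ENNReal.ofReal (Real.exp (-c)) ≤ ENNReal.ofReal (∫ z, g z ∂P) := ENNReal.ofReal_le_ofReal hgv
    _ ≤ ∫⁻ z, ENNReal.ofReal (g z) ∂P := by
        have h1 : ∀ z, ENNReal.ofReal (g z) = ENNReal.ofReal (max (g z) 0) := fun z => by
          rcases le_total (g z) 0 with h | h
          · rw [max_eq_right h, ENNReal.ofReal_of_nonpos h, ENNReal.ofReal_zero]
          · rw [max_eq_left h]
        simp only [h1]
        rw [← ofReal_integral_eq_lintegral_ofReal hgi.pos_part (ae_of_all _ fun z => le_max_right _ _)]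
        exact ENNReal.ofReal_le_ofReal
          (integral_mono hgi hgi.pos_part fun z => le_max_left _ _)
    _ ≤ _ := by
        refine lintegral_mono fun z => ENNReal.ofReal_le_ofReal ?_
        set s := ∑ i, Z (z i)
        set t := ∑ i, b (z i).1 ^ 2
        have h1 : |s| ≤ (1 + s ^ 2) / 2 := by
          rw [← sq_abs s]; nlinarith [sq_nonneg (|s| - 1)]
        have h2 := Real.add_one_le_exp (c - |s| - t / 2)
        have h3 : Real.exp (-|s| - t / 2) = Real.exp (-c) * Real.exp (c - |s| - t / 2) := by
          rw [← Real.exp_add]; ring_nf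
        show Real.exp (-c) * (1 + c - ((1 + s ^ (2 * 1)) / 2 + t / 2)) ≤ Real.exp (-|s| - t / 2)
        rw [h3]
        refine mul_le_mul_of_nonneg_left ?_ (Real.exp_pos _).le
        rw [mul_one]
        linarith

/-- Two-point lower bound: `f` and `-f` cannot be distinguished if `n ⟪T f, f⟫` is bounded. -/
lemma two_point_le {γ h : ℕ → ℝ} {ρ σ B : ℝ} (hσ : 0 < σ) {ν : Measure L2} [IsProbabilityMeasure ν]
    (hν : MemLp id 2 ν) {n : ℕ} {f : L2} (hf : f ∈ slopes γ ρ)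
    (hB : n * ⟪covarianceOperator ν f, f⟫ ≤ B)
    {est : (Fin n → L2 × ℝ) → ℝ} (hest : Measurable est) :
    ENNReal.ofReal (Real.exp (-(1 / 2 + 3 / 2 * (B / σ ^ 2))) * functional h f ^ 2)
      ≤ ⨆ β ∈ slopes γ ρ, mse n (ν.prod (gaussianReal 0 1)) σ β est (functional h β) := by
  set b : L2 → ℝ := fun x => ⟪f, x⟫ / σ with hb
  have hbm : Measurable b := (measurable_inner_const f).div_const σ
  have hfi : MemLp (fun x : L2 => ⟪f, x⟫) 2 ν := hν.const_inner f
  have hb2 : Integrable (fun x => b x ^ 2) ν := by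
    simp only [hb, div_pow]
    exact hfi.integrable_sq.div_const _
  have hbv : n * ∫ x, b x ^ 2 ∂ν ≤ B / σ ^ 2 := by
    simp only [hb, div_pow]
    rw [integral_div, ← mul_div_assoc]
    rw [covarianceOperator_inner hν] at hB
    simp only [← sq] at hB
    gcongr
  have hexp := le_lintegral_exp hbm hb2 hbv
  set μ := ν.prod (gaussianReal 0 1)
  set P := Measure.pi fun _ : Fin n => μ
  have hnf : -f ∈ slopes γ ρ := by
    have : ∀ j, coef (-f) j ^ 2 = coef f j ^ 2 := fun j => by rw [coef_neg, neg_sq]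
    simpa only [slopes, ellipsoid, Set.mem_ofPred_eq, this] using hf
  have hnl : functional h (-f) = -functional h f := by
    simp only [functional, coef_neg, mul_neg, tsum_neg]
  set ℓ := functional h f
  set R := ⨆ β ∈ slopes γ ρ, mse n μ σ β est (functional h β)
  -- `S z` is the sample that is observed if the slope is zero
  set S : (Fin n → L2 × ℝ) → Fin n → L2 × ℝ := fun z i => ((z i).1, σ * (z i).2) with hS
  have hSm : Measurable S := measurable_pi_lambda _ fun i =>
    (measurable_fst.comp (measurable_pi_apply i)).prodMk
      ((measurable_snd.comp (measurable_pi_apply i)).const_mul σ)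
  have hΦ : ∀ v, Measurable fun z => ENNReal.ofReal (|est (S z) - v| ^ 2) := fun v =>
    (((hest.comp hSm).sub_const v).abs.pow_const 2).ennreal_ofReal
  have h1 : mse n μ σ f est ℓ ≤ R := le_iSup₂_of_le f hf le_rfl
  have h2 : mse n μ σ (-f) est (-ℓ) ≤ R := le_iSup₂_of_le (-f) hnf (by rw [hnl])
  have e1 : mse n μ σ f est ℓ = ∫⁻ z, ENNReal.ofReal (Real.exp (∑ i, b (z i).1 * (z i).2
      - (∑ i, b (z i).1 ^ 2) / 2)) * ENNReal.ofReal (|est (S z) - ℓ| ^ 2) ∂P := by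
    rw [← lintegral_shift hbm (hΦ ℓ), mse]
    refine lintegral_congr fun z => ?_
    have : (fun i => observe f σ (z i)) = S fun i => ((z i).1, (z i).2 + b (z i).1) := by
      ext i : 1
      simp only [observe, hS, hb]
      congr 1
      field_simp
      ring
    rw [this]
  have e2 : mse n μ σ (-f) est (-ℓ) = ∫⁻ z, ENNReal.ofReal (Real.exp (-∑ i, b (z i).1 * (z i).2
      - (∑ i, b (z i).1 ^ 2) / 2)) * ENNReal.ofReal (|est (S z) - -ℓ| ^ 2) ∂P := by
    have := lintegral_shift (ν := ν) (b := fun x => -b x) hbm.neg (hΦ (-ℓ))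
    simp only [neg_mul, Finset.sum_neg_distrib, neg_sq] at this
    rw [← this, mse]
    refine lintegral_congr fun z => ?_
    have : (fun i => observe (-f) σ (z i)) = S fun i => ((z i).1, (z i).2 + -b (z i).1) := by
      ext i : 1
      simp only [observe, hS, hb, inner_neg_left]
      congr 1
      field_simp
      ring
    rw [this]
  -- `e^{-|s| - t/2}` is a common minorant of the two densities, and
  -- `|y - ℓ|² + |y + ℓ|² ≥ 2 ℓ²` for every value `y` of the estimator
  have hsum : 2 * ENNReal.ofReal (Real.exp (-(1 / 2 + 3 / 2 * (B / σ ^ 2))) * ℓ ^ 2) ≤ 2 * R := by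
    calc 2 * ENNReal.ofReal (Real.exp (-(1 / 2 + 3 / 2 * (B / σ ^ 2))) * ℓ ^ 2)
        = ENNReal.ofReal (2 * ℓ ^ 2) * ENNReal.ofReal (Real.exp (-(1 / 2 + 3 / 2 * (B / σ ^ 2)))) := by
          rw [← ENNReal.ofReal_mul (by positivity), show (2 : ℝ≥0∞) = ENNReal.ofReal 2 by simp,
            ← ENNReal.ofReal_mul (by norm_num)]
          ring_nf
      _ ≤ ENNReal.ofReal (2 * ℓ ^ 2) * ∫⁻ z, ENNReal.ofReal (Real.exp
            (-|∑ i, b (z i).1 * (z i).2| - (∑ i, b (z i).1 ^ 2) / 2)) ∂P := by gcongr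
      _ = ∫⁻ z, ENNReal.ofReal (2 * ℓ ^ 2) * ENNReal.ofReal (Real.exp
            (-|∑ i, b (z i).1 * (z i).2| - (∑ i, b (z i).1 ^ 2) / 2)) ∂P :=
          (lintegral_const_mul' _ _ ENNReal.ofReal_ne_top).symm
      _ ≤ mse n μ σ f est ℓ + mse n μ σ (-f) est (-ℓ) := by
          rw [e1, e2, ← lintegral_add_left]
          · refine lintegral_mono fun z => ?_
            simp only
            rw [← ENNReal.ofReal_mul (by positivity), ← ENNReal.ofReal_mul (by positivity),
              ← ENNReal.ofReal_mul (by positivity), ← ENNReal.ofReal_add (by positivity) (by positivity)]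
            refine ENNReal.ofReal_le_ofReal ?_
            set s := ∑ i, b (z i).1 * (z i).2
            set t := ∑ i, b (z i).1 ^ 2
            set y := est (S z)
            have g1 : Real.exp (-|s| - t / 2) ≤ Real.exp (s - t / 2) :=
              Real.exp_le_exp.2 (by linarith [neg_abs_le s])
            have g2 : Real.exp (-|s| - t / 2) ≤ Real.exp (-s - t / 2) :=
              Real.exp_le_exp.2 (by linarith [le_abs_self s])
            have g3 := (Real.exp_pos (-|s| - t / 2)).le
            calc 2 * ℓ ^ 2 * Real.exp (-|s| - t / 2)
                ≤ Real.exp (-|s| - t / 2) * |y - ℓ| ^ 2 + Real.exp (-|s| - t / 2) * |y - -ℓ| ^ 2 := by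
                  rw [← mul_add, mul_comm, sq_abs, sq_abs]
                  refine mul_le_mul_of_nonneg_left ?_ g3
                  nlinarith [sq_nonneg y]
              _ ≤ _ := by gcongr
          · have hb' : ∀ i : Fin n, Measurable fun z : Fin n → L2 × ℝ => b (z i).1 := fun i =>
              hbm.comp (measurable_fst.comp (measurable_pi_apply i))
            have he' : ∀ i : Fin n, Measurable fun z : Fin n → L2 × ℝ => (z i).2 := fun i =>
              measurable_snd.comp (measurable_pi_apply i)
            refine Measurable.mul ?_ (hΦ ℓ)
            exact (((Finset.measurable_fun_sum _ fun i _ => (hb' i).mul (he' i)).sub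
              ((Finset.measurable_fun_sum _ fun i _ => (hb' i).pow_const 2).div_const 2)).exp).ennreal_ofReal
      _ ≤ R + R := add_le_add h1 h2
      _ = 2 * R := (two_mul R).symm
  exact (ENNReal.mul_le_mul_iff_right (by norm_num) (by norm_num)).1 hsum

/-! ### The lower bound -/

section LowerBound

variable {γ υ h : ℕ → ℝ} {k : ℕ → ℕ} {d ρ : ℝ} {T : L2 →L[ℝ] L2}

lemma kappa_le_one (hγ : IsWeight γ) (hυ : IsWeight υ) (hk : IsOptimalDim γ υ k) :
    kappa γ υ k ≤ 1 := by
  refine (kappa_le_balance hγ hυ hk le_rfl).trans ?_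
  exact div_le_one_of_le₀ min_le_max (le_max_of_le_right (by positivity))

/-- A slope in the span of `ψ_1, …, ψ_m` on which the functional is large.  Its coefficients are
proportional to `h_j / υ_j`, the case of equality in the Cauchy–Schwarz inequality. -/
lemma exists_slope_head (hd : 1 ≤ d) (hγ : IsWeight γ) (hmono : MonotoneOn γ (Set.Ici 1))
    (hυ : IsWeight υ) (hanti : AntitoneOn υ (Set.Ici 1)) (hT : T ∈ linkClass υ d) (h : ℕ → ℝ)
    {m : ℕ} {s : ℝ} (hρ : 0 ≤ ρ) (hs0 : 0 ≤ s)
    (hs : s * (γ m / υ m) ≤ ρ) :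
    ∃ f ∈ slopes γ ρ, ⟪T f, f⟫ ≤ d * s ∧ functional h f ^ 2 = s * headSum υ h m := by
  rcases (headSum_nonneg (h := h) hυ m).eq_or_lt with h0 | hpos
  · refine ⟨0, ⟨by simp [coef], by simpa [coef] using hρ⟩, ?_, by simp [← h0, functional, coef]⟩
    simp only [map_zero, inner_zero_left]
    positivity
  · set H := headSum υ h m with hH
    set a := √(s / H) with ha
    have haH : a ^ 2 * H = s := by
      rw [ha, Real.sq_sqrt (by positivity), div_mul_cancel₀ _ hpos.ne']
    set v : Fin m → ℝ := fun j => a * (h (j + 1) / υ (j + 1)) with hv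
    have hυp : ∀ j : Fin m, 0 < υ (j + 1) := fun j => hυ.2 _ (by omega)
    have hzero : ∀ j ∉ Finset.range m, coef (poly v) (j + 1) = 0 := fun j hj =>
      coef_poly_of_le v (by simpa using hj)
    have hsupp : HasSum (fun j => γ (j + 1) * coef (poly v) (j + 1) ^ 2)
        (∑ j ∈ Finset.range m, γ (j + 1) * coef (poly v) (j + 1) ^ 2) :=
      hasSum_sum_of_ne_finset_zero fun j hj => by rw [hzero j hj]; ring
    have hsum : ∑ j ∈ Finset.range m, γ (j + 1) * coef (poly v) (j + 1) ^ 2 ≤ ρ := by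
      refine le_trans ?_ hs
      rw [← haH, hH, headSum_eq, Finset.sum_range, mul_assoc, Finset.sum_mul, Finset.mul_sum]
      refine Finset.sum_le_sum fun j _ => ?_
      have hm : 1 ≤ m := by have := j.2; omega
      have h1 : γ (j + 1) ≤ γ m := hmono (Set.mem_Ici.2 (by omega)) hm (by omega)
      have h2 : υ m ≤ υ (j + 1) := hanti (Set.mem_Ici.2 (by omega)) hm (by omega)
      have h3 := hυp j
      have h4 := hυ.2 m hm
      have h5 := hγ.2 m hm
      have h6 := hγ.2 (j + 1) (by omega)
      rw [coef_poly]
      calc γ (j + 1) * v j ^ 2 = a ^ 2 * (h (j + 1) ^ 2 / υ (j + 1) * (γ (j + 1) / υ (j + 1))) := by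
            simp only [hv]; field_simp
        _ ≤ _ := by gcongr
    refine ⟨poly v, ⟨hsupp.summable, hsupp.tsum_eq.trans_le hsum⟩, ?_, ?_⟩
    · refine (inner_poly_le_of_link hd hυ hanti hT v).trans (mul_le_mul_of_nonneg_left ?_ (by linarith))
      rw [← haH, hH, headSum_eq, Finset.mul_sum]
      refine Finset.sum_le_sum fun j _ => le_of_eq ?_
      have := (hυp j).ne'
      simp only [hv]; field_simp
    · have : functional h (poly v) = a * H := by
        rw [functional, tsum_eq_sum (s := Finset.range m) fun j hj => by rw [hzero j hj]; ring,
          Finset.sum_range, hH, headSum_eq, Finset.mul_sum]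
        refine Finset.sum_congr rfl fun j _ => ?_
        rw [coef_poly]
        have := (hυp j).ne'
        simp only [hv]; field_simp
      rw [this, ← haH]; ring

/-- A slope orthogonal to `ψ_1, …, ψ_m` on which the functional is large.  Its coefficients are
proportional to `h_j / γ_j`. -/
lemma exists_slope_tail (hd : 1 ≤ d) (hγ : IsWeight γ) (hmono : MonotoneOn γ (Set.Ici 1))
    (hυ : IsWeight υ) (hanti : AntitoneOn υ (Set.Ici 1)) (hT : T ∈ linkClass υ d)
    (hh : IsRepresenter γ h) {m : ℕ} (hm : 1 ≤ m) (hρ : 0 ≤ ρ) :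
    ∃ f ∈ slopes γ ρ, ⟪T f, f⟫ ≤ d * (υ m / γ m) * ρ ∧ functional h f ^ 2 = ρ * tailSum γ h m := by
  have hυm := hυ.2 m hm
  have hγm := hγ.2 m hm
  rcases (tailSum_nonneg (h := h) hγ m).eq_or_lt with h0 | hpos
  · refine ⟨0, ⟨by simp [coef], by simpa [coef] using hρ⟩, ?_, by simp [← h0, functional, coef]⟩
    simp only [map_zero, inner_zero_left]
    positivity
  · set H := tailSum γ h m with hH
    set a := √(ρ / H) with ha
    have haH : a ^ 2 * H = ρ := by
      rw [ha, Real.sq_sqrt (by positivity), div_mul_cancel₀ _ hpos.ne']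
    set g : ℕ → ℝ := fun j => if j ≤ m then 0 else a * (h j / γ j) with hg
    have hs := hh.summable_tail m
    have hg2 : ∀ j, γ (m + 1 + j) * g (m + 1 + j) ^ 2 = a ^ 2 * (h (m + 1 + j) ^ 2 / γ (m + 1 + j)) := by
      intro j
      have := (hγ.2 (m + 1 + j) (by omega)).ne'
      simp only [hg, if_neg (show ¬ m + 1 + j ≤ m by omega)]
      field_simp
    have hgs : Summable fun j => γ (m + 1 + j) * g (m + 1 + j) ^ 2 := by
      simp only [hg2]
      exact hs.mul_left _
    have hgs' : Summable fun j => γ (j + 1) * g (j + 1) ^ 2 := by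
      rw [← summable_nat_add_iff m]
      exact hgs.congr fun j => by rw [show j + m + 1 = m + 1 + j by ring]
    have hgv : ∑' j, γ (j + 1) * g (j + 1) ^ 2 = ρ := by
      rw [← hgs'.sum_add_tsum_nat_add m, Finset.sum_eq_zero, zero_add, ← haH, hH, tailSum,
        ← tsum_mul_left]
      · refine tsum_congr fun j => ?_
        rw [← hg2, show j + m + 1 = m + 1 + j by ring]
      · intro j hj
        have := Finset.mem_range.1 hj
        simp [hg, show j + 1 ≤ m by omega]
    have hg1 : Summable fun j => g (j + 1) ^ 2 :=
      Summable.of_nonneg_of_le (fun j => sq_nonneg _) (fun j =>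
        le_mul_of_one_le_left (sq_nonneg _) (hγ.one_le hmono (by omega))) hgs'
    obtain ⟨f, hf⟩ := exists_coef_eq g hg1
    have hf' : (fun j => γ (j + 1) * coef f (j + 1) ^ 2) = fun j => γ (j + 1) * g (j + 1) ^ 2 := by
      ext j; rw [hf]
    have hfs : f ∈ slopes γ ρ := by
      refine ⟨?_, ?_⟩
      · rw [hf']; exact hgs'
      · rw [hf', hgv]
    refine ⟨f, hfs, ?_, ?_⟩
    · refine (inner_tail_le_of_link hd hυ hanti hγ hmono hT hm (fun j hj => ?_) hfs.1).trans ?_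
      · rw [hf]; simp [hg, show j + 1 ≤ m by omega]
      · rw [hf', hgv]
    · have : functional h f = a * H := by
        rw [functional_split hγ hh hfs m, Finset.sum_eq_zero, zero_add, hH, tailSum, ← tsum_mul_left]
        · refine tsum_congr fun j => ?_
          have e : coef f (m + 1 + j) = g (m + 1 + j) := by
            have := hf (m + j)
            rwa [show m + j + 1 = m + 1 + j by ring] at this
          have := (hγ.2 (m + 1 + j) (by omega)).ne'
          rw [e]
          simp only [hg, if_neg (show ¬ m + 1 + j ≤ m by omega)]
          field_simp
        · intro j _
          rw [hf]; simp [hg]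
      rw [this, ← haH]; ring

/-- No estimator has a maximal mean squared error of smaller order than `δ_n^*`. -/
theorem exists_le_iSup_mse {σ : ℝ} (hd : 1 ≤ d) (hρ : 0 < ρ) (hσ : 0 < σ) (hγ : IsWeight γ)
    (hmono : MonotoneOn γ (Set.Ici 1)) (hυ : IsWeight υ) (hanti : AntitoneOn υ (Set.Ici 1))
    (hk : IsOptimalDim γ υ k) (hκ : 0 < kappa γ υ k) (q : ℕ) (η : ℝ) :
    ∃ c : ℝ, 0 < c ∧ ∀ n, 1 ≤ n → ∀ ν ∈ linkedRegressors υ d q η, ∀ h, IsRepresenter γ h →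
      ∀ est : (Fin n → L2 × ℝ) → ℝ, Measurable est →
      ENNReal.ofReal (c * deltaStar γ υ k h n)
        ≤ ⨆ β ∈ slopes γ ρ, mse n (ν.prod (gaussianReal 0 1)) σ β est (functional h β) := by
  set κ := kappa γ υ k with hκdef
  set B := d * ρ / κ with hB
  have hκ1 : κ ≤ 1 := kappa_le_one hγ hυ hk
  have hdρ : 0 < d * ρ := by positivity
  set E := Real.exp (-(1 / 2 + 3 / 2 * (B / σ ^ 2))) with hE
  refine ⟨E * (ρ * κ), by positivity, fun n hn ν hν h hh est hest => ?_⟩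
  have : IsProbabilityMeasure ν := hν.1.1
  have hn0 : (0 : ℝ) < n := by exact_mod_cast hn
  have hm := (hk n hn).1
  have hυm := hυ.2 _ hm
  have hγm := hγ.2 _ hm
  have hα := kappa_mul_alphaStar_le hγ hυ hk hn
  rw [← hκdef] at hα
  have hα0 : 0 < alphaStar γ υ k n := lt_of_lt_of_le (by positivity) (inv_le_alphaStar n)
  set α := alphaStar γ υ k n
  have hαr : κ * α ≤ υ (k n) / γ (k n) := hα.trans (min_le_left _ _)
  have hαn : κ * α ≤ (n : ℝ)⁻¹ := hα.trans (min_le_right _ _)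
  have hrα : υ (k n) / γ (k n) ≤ α := le_max_left _ _
  -- slopes in the span of the first `k n` basis functions give the variance part of `δ_n^*`, slopes
  -- orthogonal to it the bias part
  rw [deltaStar, mul_max_of_nonneg _ _ (by positivity), ENNReal.ofReal_max]
  refine max_le ?_ ?_
  · obtain ⟨f, hf, hTf, hl⟩ := exists_slope_head (ρ := ρ) hd hγ hmono hυ hanti hν.2 h (m := k n)
      (s := ρ * (κ * α)) hρ.le (by positivity) (by
        calc ρ * (κ * α) * (γ (k n) / υ (k n))
            ≤ ρ * (υ (k n) / γ (k n)) * (γ (k n) / υ (k n)) := by gcongr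
          _ = ρ := by field_simp)
    refine le_trans (ENNReal.ofReal_le_ofReal ?_) (two_point_le (h := h) hσ hν.1.2.1 hf
      (B := B) ?_ hest)
    · rw [hl, headSum, ← hE]
      exact le_of_eq (by ring)
    · calc (n : ℝ) * ⟪covarianceOperator ν f, f⟫ ≤ n * (d * (ρ * (κ * α))) := by gcongr
        _ ≤ n * (d * (ρ * (n : ℝ)⁻¹)) := by gcongr
        _ = d * ρ := by field_simp
        _ ≤ B := by rw [hB, le_div_iff₀ hκ]; exact mul_le_of_le_one_right hdρ.le hκ1
  · obtain ⟨f, hf, hTf, hl⟩ := exists_slope_tail (ρ := ρ) hd hγ hmono hυ hanti hν.2 hh hm hρ.le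
    refine le_trans (ENNReal.ofReal_le_ofReal ?_) (two_point_le (h := h) hσ hν.1.2.1 hf
      (B := B) ?_ hest)
    · rw [hl, ← hE]
      have h0 := tailSum_nonneg (h := h) hγ (k n)
      calc E * (ρ * κ) * tailSum γ h (k n) ≤ E * (ρ * 1) * tailSum γ h (k n) := by gcongr
        _ = _ := by ring
    · calc (n : ℝ) * ⟪covarianceOperator ν f, f⟫ ≤ n * (d * (υ (k n) / γ (k n)) * ρ) := by gcongr
        _ ≤ n * (d * α * ρ) := by gcongr
        _ ≤ B := by
          rw [hB, le_div_iff₀ hκ]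
          calc n * (d * α * ρ) * κ = d * ρ * (n * (κ * α)) := by ring
            _ ≤ d * ρ * (n * (n : ℝ)⁻¹) := by gcongr
            _ = d * ρ := by field_simp

end LowerBound

/-! ### Optimal rates for one representer and uniformly over an ellipsoid -/

section Attains

variable {γ υ : ℕ → ℝ} {k : ℕ → ℕ} {d η ρ σ τ : ℝ} {K q : ℕ} {C₀ : ℝ}

/-- Upper and lower bounds combined: apart from the order of `δ_n^*`, only the bound `hC₀` on the
dimension remains to be checked. -/
theorem attainsPointwise_of_isTheta (hd : 1 ≤ d) (hη : 1 ≤ η) (hρ : 0 < ρ) (hσ : 0 < σ)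
    (hK : 3 ≤ K) (hγ : IsWeight γ) (hmono : MonotoneOn γ (Set.Ici 1))
    (hυ : IsWeight υ) (hanti : AntitoneOn υ (Set.Ici 1)) (hk : IsOptimalDim γ υ k)
    (hκ : 0 < kappa γ υ k) (hq : 1 ≤ q) (hqK : q ≤ K)
    (hC₀ : ∀ n : ℕ, 1 ≤ n → √n * n ^ 2 * ((k n : ℝ) ^ 2 / n) ^ q ≤ C₀) {h : ℕ → ℝ}
    (hh : IsRepresenter γ h) {rate : ℕ → ℝ}
    (hrate : (fun n => deltaStar γ υ k h n) =Θ[atTop] rate) :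
    AttainsPointwise γ υ k d η ρ σ (4 * K) h rate := by
  obtain ⟨C, hC, hup⟩ := exists_mse_plugIn_le (σ := σ) hd hη hρ hK hγ hmono hυ hanti hk hκ hq hqK hC₀
  obtain ⟨c, hc, hlow⟩ := exists_le_iSup_mse hd hρ hσ hγ hmono hυ hanti hk hκ (4 * K) η
  exact ⟨hh, ⟨C, hC, fun n hn μ hμ => iSup₂_le fun β hβ => hup n hn μ hμ h hh β hβ⟩,
    ⟨c, hc, fun n hn ν hν est hest => hlow n hn ν hν h hh est hest⟩, hrate⟩

lemma le_DeltaStar {ω : ℕ → ℝ} {n j : ℕ} (hj : j ∈ Icc 1 (k n)) :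
    1 / (υ j * ω j) * alphaStar γ υ k n ≤ DeltaStar γ υ k ω n := by
  refine mul_le_mul_of_nonneg_right (le_csSup ?_ ⟨j, hj, rfl⟩)
    (le_max_of_le_right (by positivity))
  exact ((Set.finite_Icc 1 (k n)).image _).bddAbove

lemma exists_DeltaStar_eq {ω : ℕ → ℝ} {n : ℕ} (hn : 1 ≤ k n) :
    ∃ j ∈ Icc 1 (k n), DeltaStar γ υ k ω n = 1 / (υ j * ω j) * alphaStar γ υ k n := by
  have hne : ((fun j => 1 / (υ j * ω j)) '' Icc 1 (k n)).Nonempty := ⟨_, 1, ⟨le_rfl, hn⟩, rfl⟩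
  obtain ⟨j, hj, hjeq⟩ := hne.csSup_mem ((Set.finite_Icc 1 (k n)).image _)
  exact ⟨j, hj, by rw [DeltaStar, ← hjeq]⟩

/-- If `γ ω` is increasing up to a constant, then `F_ω^τ ⊆ F_{1/γ}`. -/
lemma isRepresenter_of_mem_ellipsoid {ω : ℕ → ℝ} (hγ : IsWeight γ) (hω : IsWeight ω) {C : ℝ}
    (hC : ∀ m j, 1 ≤ m → m ≤ j → γ m * ω m ≤ C * (γ j * ω j)) {h : ℕ → ℝ}
    (hh : h ∈ ellipsoid ω τ) : IsRepresenter γ h := by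
  refine Summable.of_nonneg_of_le (fun j => ?_) (fun j => ?_) (hh.1.mul_left C)
  · have := hγ.2 (j + 1) (by omega)
    positivity
  · have h1 := hC 1 (j + 1) le_rfl (by omega)
    rw [hγ.1, hω.1, mul_one] at h1
    rw [div_le_iff₀ (hγ.2 (j + 1) (by omega))]
    calc h (j + 1) ^ 2 = 1 * h (j + 1) ^ 2 := (one_mul _).symm
      _ ≤ C * (γ (j + 1) * ω (j + 1)) * h (j + 1) ^ 2 := by gcongr
      _ = _ := by ring

/-- Over the ellipsoid `F_ω^τ`, the rates `δ_n^*` are dominated by `Δ_n^*`. -/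
lemma deltaStar_le_DeltaStar {ω : ℕ → ℝ} (hγ : IsWeight γ) (hυ : IsWeight υ) (hω : IsWeight ω)
    (hk : IsOptimalDim γ υ k) {C : ℝ} (hC1 : 1 ≤ C)
    (hC : ∀ m j, 1 ≤ m → m ≤ j → γ m * ω m ≤ C * (γ j * ω j)) {h : ℕ → ℝ}
    (hh : h ∈ ellipsoid ω τ) {n : ℕ} (hn : 1 ≤ n) :
    deltaStar γ υ k h n ≤ C * τ * DeltaStar γ υ k ω n := by
  have hm := (hk n hn).1
  set m := k n with hmdef
  have hα0 : 0 ≤ alphaStar γ υ k n := le_max_of_le_right (by positivity)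
  have hpos : ∀ j, 0 ≤ ω (j + 1) * h (j + 1) ^ 2 := fun j => by
    have := hω.2 (j + 1) (by omega)
    positivity
  have hτ : 0 ≤ τ := (tsum_nonneg hpos).trans hh.2
  have hD0 : 0 ≤ DeltaStar γ υ k ω n := by
    refine le_trans ?_ (le_DeltaStar (j := m) ⟨hm, le_rfl⟩)
    have := hω.2 m hm
    have := hυ.2 m hm
    positivity
  refine max_le ?_ ?_
  · have h1 : ∑ j ∈ Finset.Icc 1 m, ω j * h j ^ 2 ≤ τ := by
      refine le_trans ?_ hh.2
      rw [← Finset.Ico_add_one_right_eq_Icc, Finset.sum_Ico_eq_sum_range]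
      simp only [Nat.add_sub_cancel, add_comm 1]
      exact hh.1.sum_le_tsum _ fun j _ => hpos j
    calc alphaStar γ υ k n * ∑ j ∈ Finset.Icc 1 m, h j ^ 2 / υ j
        = ∑ j ∈ Finset.Icc 1 m, (1 / (υ j * ω j) * alphaStar γ υ k n) * (ω j * h j ^ 2) := by
          rw [Finset.mul_sum]
          refine Finset.sum_congr rfl fun j hj => ?_
          have := (hυ.2 j (Finset.mem_Icc.1 hj).1).ne'
          have := (hω.2 j (Finset.mem_Icc.1 hj).1).ne'
          field_simp
      _ ≤ ∑ j ∈ Finset.Icc 1 m, DeltaStar γ υ k ω n * (ω j * h j ^ 2) := by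
          refine Finset.sum_le_sum fun j hj => mul_le_mul_of_nonneg_right
            (le_DeltaStar (Finset.mem_Icc.1 hj)) ?_
          have := hω.2 j (Finset.mem_Icc.1 hj).1
          positivity
      _ ≤ DeltaStar γ υ k ω n * τ := by
          rw [← Finset.mul_sum]; gcongr
      _ ≤ C * (τ * DeltaStar γ υ k ω n) := by
          rw [mul_comm _ τ]
          exact le_mul_of_one_le_left (by positivity) hC1
      _ = _ := by ring
  · have hγm := hγ.2 m hm
    have hωm := hω.2 m hm
    have hυm := hυ.2 m hm
    have hs := (summable_nat_add_iff m).2 hh.1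
    have hr : Summable fun j => h (m + 1 + j) ^ 2 / γ (m + 1 + j) :=
      (isRepresenter_of_mem_ellipsoid hγ hω hC hh).summable_tail m
    have hle : ∀ j, h (m + 1 + j) ^ 2 / γ (m + 1 + j)
        ≤ C / (γ m * ω m) * (ω (j + m + 1) * h (j + m + 1) ^ 2) := by
      intro j
      rw [show m + 1 + j = j + m + 1 by ring]
      have h1 := hC m (j + m + 1) hm (by omega)
      have h2 := hγ.2 (j + m + 1) (by omega)
      rw [div_mul_eq_mul_div, div_le_div_iff₀ h2 (by positivity)]
      calc h (j + m + 1) ^ 2 * (γ m * ω m)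
          ≤ h (j + m + 1) ^ 2 * (C * (γ (j + m + 1) * ω (j + m + 1))) := by gcongr
        _ = _ := by ring
    have h3 : ∑' j, ω (j + m + 1) * h (j + m + 1) ^ 2 ≤ τ := by
      refine le_trans ?_ hh.2
      rw [← hh.1.sum_add_tsum_nat_add m]
      exact le_add_of_nonneg_left (Finset.sum_nonneg fun j _ => hpos j)
    calc ∑' j, h (m + 1 + j) ^ 2 / γ (m + 1 + j)
        ≤ ∑' j, C / (γ m * ω m) * (ω (j + m + 1) * h (j + m + 1) ^ 2) :=
          hr.tsum_le_tsum hle (hs.mul_left _)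
      _ ≤ C / (γ m * ω m) * τ := by
          rw [tsum_mul_left]; gcongr
      _ = C * τ * (1 / (υ m * ω m) * (υ m / γ m)) := by field_simp
      _ ≤ C * τ * (1 / (υ m * ω m) * alphaStar γ υ k n) := by
          gcongr
          exact le_max_left _ _
      _ ≤ C * τ * DeltaStar γ υ k ω n := by
          gcongr
          exact le_DeltaStar ⟨hm, le_rfl⟩

/-- The uniform upper bound is the pointwise one together with `δ_n^* ≤ C τ Δ_n^*`.  For the lower
bound it suffices to consider a representer that is supported on one coordinate. -/
theorem attainsUniform_of_isTheta (hd : 1 ≤ d) (hη : 1 ≤ η) (hρ : 0 < ρ) (hσ : 0 < σ) (hτ : 0 < τ)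
    (hK : 3 ≤ K) (hγ : IsWeight γ) (hmono : MonotoneOn γ (Set.Ici 1))
    (hυ : IsWeight υ) (hanti : AntitoneOn υ (Set.Ici 1)) (hk : IsOptimalDim γ υ k)
    (hκ : 0 < kappa γ υ k) (hq : 1 ≤ q) (hqK : q ≤ K)
    (hC₀ : ∀ n : ℕ, 1 ≤ n → √n * n ^ 2 * ((k n : ℝ) ^ 2 / n) ^ q ≤ C₀) {ω : ℕ → ℝ}
    (hω : IsWeight ω) {C₁ : ℝ} (hC1 : 1 ≤ C₁)
    (hC₁ : ∀ m j, 1 ≤ m → m ≤ j → γ m * ω m ≤ C₁ * (γ j * ω j)) {rate : ℕ → ℝ}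
    (hrate : (fun n => DeltaStar γ υ k ω n) =Θ[atTop] rate) :
    AttainsUniform γ υ k d η ρ σ τ (4 * K) ω rate := by
  obtain ⟨C, hC, hup⟩ := exists_mse_plugIn_le (σ := σ) hd hη hρ hK hγ hmono hυ hanti hk hκ hq hqK hC₀
  obtain ⟨c, hc, hlow⟩ := exists_le_iSup_mse hd hρ hσ hγ hmono hυ hanti hk hκ (4 * K) η
  have hrep : ∀ h ∈ ellipsoid ω τ, IsRepresenter γ h := fun h hh =>
    isRepresenter_of_mem_ellipsoid hγ hω hC₁ hh
  refine ⟨hrep, ⟨C * (C₁ * τ), by positivity, fun n hn μ hμ =>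
    iSup₂_le fun β hβ => iSup₂_le fun h hh => (hup n hn μ hμ h (hrep h hh) β hβ).trans
      (ENNReal.ofReal_le_ofReal ?_)⟩, ⟨c * τ, by positivity, fun n hn ν hν est hest => ?_⟩, hrate⟩
  · rw [mul_assoc C]
    exact mul_le_mul_of_nonneg_left (deltaStar_le_DeltaStar hγ hυ hω hk hC1 hC₁ hh hn) hC.le
  · obtain ⟨j, hj, hjeq⟩ := exists_DeltaStar_eq (γ := γ) (υ := υ) (ω := ω) (hk n hn).1
    -- the representer on the coordinate where the maximum in `Δ_n^*` is attained
    set h : ℕ → ℝ := fun i => if i = j then √(τ / ω j) else 0 with hh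
    have hωj := hω.2 j hj.1
    have hυj := hυ.2 j hj.1
    have hsq : h j ^ 2 = τ / ω j := by
      simp only [hh, if_true]
      exact Real.sq_sqrt (by positivity)
    have hsum : HasSum (fun i => ω (i + 1) * h (i + 1) ^ 2) τ := by
      have e : τ = ω (j - 1 + 1) * h (j - 1 + 1) ^ 2 := by
        rw [Nat.sub_add_cancel hj.1, hsq]; field_simp
      rw [e]
      exact hasSum_single (j - 1) fun i hi => by
        simp [hh, show i + 1 ≠ j by omega]
    have hmem : h ∈ ellipsoid ω τ := ⟨hsum.summable, hsum.tsum_eq.le⟩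
    have hδ : τ * DeltaStar γ υ k ω n ≤ deltaStar γ υ k h n := by
      refine le_trans ?_ (headSum_mul_le_deltaStar h n)
      have h1 : h j ^ 2 / υ j ≤ headSum υ h (k n) :=
        Finset.single_le_sum (f := fun i => h i ^ 2 / υ i) (fun i hi => by
          have := hυ.2 i (Finset.mem_Icc.1 hi).1
          positivity) (Finset.mem_Icc.2 hj)
      calc τ * DeltaStar γ υ k ω n = alphaStar γ υ k n * (h j ^ 2 / υ j) := by
            rw [hjeq, hsq]; field_simp
        _ ≤ _ := mul_le_mul_of_nonneg_left h1 (le_max_of_le_right (by positivity))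
    calc ENNReal.ofReal (c * τ * DeltaStar γ υ k ω n)
        ≤ ENNReal.ofReal (c * deltaStar γ υ k h n) := by
          refine ENNReal.ofReal_le_ofReal ?_
          rw [mul_assoc]
          gcongr
      _ ≤ _ := hlow n hn ν hν h (hrep h hmem) (est h) (hest h)
      _ ≤ _ := iSup₂_mono fun β _ => le_iSup₂_of_le (f := fun h _ => mse n (ν.prod (gaussianReal 0 1))
          σ β (est h) (functional h β)) h hmem le_rfl

end Attains

/-! ### Orders of logarithms, sums of powers and exponentials -/

lemma isTheta_comp_tendsto {α β : Type*} {l : Filter α} {l' : Filter β} {f g : β → ℝ}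
    (h : f =Θ[l'] g) {φ : α → β} (hφ : Tendsto φ l l') :
    (fun x => f (φ x)) =Θ[l] fun x => g (φ x) :=
  ⟨h.1.comp_tendsto hφ, h.2.comp_tendsto hφ⟩

lemma isBigO_of_le_mul {α : Type*} {l : Filter α} {f g : α → ℝ} {C : ℝ}
    (h : ∀ᶠ x in l, 0 ≤ f x ∧ f x ≤ C * g x) : f =O[l] g := by
  refine IsBigO.of_bound |C| (h.mono fun x hx => ?_)
  rw [Real.norm_of_nonneg hx.1, Real.norm_eq_abs, ← abs_mul]
  exact hx.2.trans (le_abs_self _)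

/-- Logarithms of positive functions of the same order differ by a bounded function. -/
lemma log_sub_log_isBigO_one {α : Type*} {l : Filter α} {f g : α → ℝ} (hf : ∀ᶠ x in l, 0 < f x)
    (hg : ∀ᶠ x in l, 0 < g x) (h : f =Θ[l] g) :
    (fun x => Real.log (f x) - Real.log (g x)) =O[l] fun _ => (1 : ℝ) := by
  obtain ⟨A, hA, hA'⟩ := h.1.exists_pos
  obtain ⟨B, hB, hB'⟩ := h.2.exists_pos
  rw [IsBigOWith] at hA' hB'
  refine IsBigO.of_bound (|Real.log A| + |Real.log B|) ?_
  filter_upwards [hf, hg, hA', hB'] with x h1 h2 h3 h4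
  rw [Real.norm_of_nonneg h1.le, Real.norm_of_nonneg h2.le] at h3 h4
  have h5 := Real.log_le_log h1 h3
  have h6 := Real.log_le_log h2 h4
  rw [Real.log_mul hA.ne' h2.ne'] at h5
  rw [Real.log_mul hB.ne' h1.ne'] at h6
  rw [norm_one, mul_one, Real.norm_eq_abs, abs_le]
  constructor <;> linarith [le_abs_self (Real.log A), le_abs_self (Real.log B),
    abs_nonneg (Real.log A), abs_nonneg (Real.log B)]

lemma isLittleO_one_of_tendsto {α : Type*} {l : Filter α} {g : α → ℝ} (hg : Tendsto g l atTop) :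
    (fun _ : α => (1 : ℝ)) =o[l] g := by
  rw [isLittleO_one_left_iff]
  exact tendsto_norm_atTop_atTop.comp hg

lemma isTheta_log {α : Type*} {l : Filter α} {f g : α → ℝ} (hf : ∀ᶠ x in l, 0 < f x)
    (hg : Tendsto g l atTop) (h : f =Θ[l] g) :
    (fun x => Real.log (f x)) =Θ[l] fun x => Real.log (g x) := by
  have h1 := log_sub_log_isBigO_one hf (hg.eventually_gt_atTop 0) h
  have h2 : (fun x => Real.log (f x)) ~[l] fun x => Real.log (g x) :=
    IsLittleO.isEquivalent
      (h1.trans_isLittleO (isLittleO_one_of_tendsto (Real.tendsto_log_atTop.comp hg)))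
  exact h2.isTheta

lemma tendsto_natCast_rpow {r : ℝ} (hr : 0 < r) :
    Tendsto (fun m : ℕ => (m : ℝ) ^ r) atTop atTop :=
  (tendsto_rpow_atTop hr).comp tendsto_natCast_atTop_atTop

lemma natCast_sub_isTheta (c : ℕ) : (fun m : ℕ => ((m - c : ℕ) : ℝ)) =Θ[atTop] fun m => (m : ℝ) := by
  refine ⟨isBigO_of_le_mul (C := 1) (Eventually.of_forall fun m => ⟨by positivity, ?_⟩),
    isBigO_of_le_mul (C := 2) ?_⟩
  · rw [one_mul]; exact_mod_cast Nat.sub_le m c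
  · filter_upwards [eventually_ge_atTop (2 * c)] with m hm
    refine ⟨by positivity, ?_⟩
    exact_mod_cast (by omega : m ≤ 2 * (m - c))

/-! #### Sums of powers -/

/-- `∑_{1 ≤ j ≤ m} j ^ r`. -/
def powerSum (r : ℝ) (m : ℕ) : ℝ := ∑ j ∈ Finset.Icc 1 m, (j : ℝ) ^ r

lemma powerSum_nonneg (r : ℝ) (m : ℕ) : 0 ≤ powerSum r m :=
  Finset.sum_nonneg fun _ _ => by positivity

lemma powerSum_succ (r : ℝ) (m : ℕ) : powerSum r (m + 1) = powerSum r m + ((m : ℝ) + 1) ^ r := by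
  rw [powerSum, Finset.sum_Icc_succ_top (by omega), powerSum]
  push_cast
  rfl

/-- By the Bernoulli inequality, `t (m + 1) ^ (t - 1) ≤ (m + 1) ^ t - m ^ t`, and these differences
telescope. -/
lemma mul_powerSum_le {t : ℝ} (ht : 0 < t) (ht1 : t ≤ 1) (m : ℕ) :
    t * powerSum (t - 1) m ≤ (m : ℝ) ^ t := by
  induction m with
  | zero => simp [powerSum]; positivity
  | succ m ih =>
    rw [powerSum_succ, mul_add]
    have hx : (0 : ℝ) < (m : ℝ) + 1 := by positivity
    have h1 := rpow_one_add_le_one_add_mul_self (s := -1 / ((m : ℝ) + 1))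
      (by rw [le_div_iff₀ hx]; nlinarith) ht.le ht1
    have h2 : (m : ℝ) ^ t ≤ ((m : ℝ) + 1) ^ t * (1 + t * (-1 / ((m : ℝ) + 1))) := by
      have e : (m : ℝ) = ((m : ℝ) + 1) * (1 + -1 / ((m : ℝ) + 1)) := by field_simp; ring
      calc (m : ℝ) ^ t = ((m : ℝ) + 1) ^ t * (1 + -1 / ((m : ℝ) + 1)) ^ t := by
            rw [← Real.mul_rpow hx.le, ← e]
            have : (1 + -1 / ((m : ℝ) + 1)) = (m : ℝ) / (m + 1) := by field_simp; ring
            rw [this]; positivity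
        _ ≤ _ := by gcongr
    have h3 : ((m : ℝ) + 1) ^ (t - 1) = ((m : ℝ) + 1) ^ t / (m + 1) := by
      rw [Real.rpow_sub_one hx.ne']
    rw [h3]
    push_cast
    calc t * powerSum (t - 1) m + t * (((m : ℝ) + 1) ^ t / (m + 1))
        ≤ ((m : ℝ) + 1) ^ t * (1 + t * (-1 / ((m : ℝ) + 1))) + t * (((m : ℝ) + 1) ^ t / (m + 1)) := by
          linarith
      _ = _ := by field_simp; ring

lemma powerSum_isTheta_rpow {r : ℝ} (hr : -1 < r) :
    powerSum r =Θ[atTop] fun m => (m : ℝ) ^ (r + 1) := by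
  constructor
  · rcases le_or_gt r 0 with h0 | h0
    · refine isBigO_of_le_mul (C := (r + 1)⁻¹) (Eventually.of_forall fun m =>
        ⟨powerSum_nonneg _ _, ?_⟩)
      have := mul_powerSum_le (t := r + 1) (by linarith) (by linarith) m
      rw [add_sub_cancel_right] at this
      rw [inv_mul_eq_div, le_div_iff₀ (by linarith)]
      linarith
    · refine isBigO_of_le_mul (C := 1) ((eventually_ge_atTop 1).mono fun m hm =>
        ⟨powerSum_nonneg _ _, ?_⟩)
      have hm0 : (0 : ℝ) < m := by exact_mod_cast hm
      rw [one_mul, Real.rpow_add_one hm0.ne', mul_comm]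
      refine (Finset.sum_le_card_nsmul _ _ ((m : ℝ) ^ r) fun j hj => ?_).trans (by simp)
      have := (Finset.mem_Icc.1 hj).2
      gcongr
  · refine isBigO_of_le_mul (C := 2 * 2 ^ |r|) ((eventually_ge_atTop 1).mono fun m hm =>
      ⟨by positivity, ?_⟩)
    have hm0 : (0 : ℝ) < m := by exact_mod_cast hm
    -- the terms with `m / 2 ≤ j ≤ m` are of the order of the last one
    have h1 : ∀ j ∈ Finset.Icc (m - m / 2) m, (m : ℝ) ^ r ≤ 2 ^ |r| * (j : ℝ) ^ r := by
      intro j hj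
      obtain ⟨hj1, hj2⟩ := Finset.mem_Icc.1 hj
      have hj0 : (0 : ℝ) < j := by exact_mod_cast (by omega : 0 < j)
      have hjm : (m : ℝ) ≤ 2 * j := by exact_mod_cast (by omega : m ≤ 2 * j)
      have hjm' : (j : ℝ) ≤ m := by exact_mod_cast hj2
      rcases le_total 0 r with h0 | h0
      · rw [abs_of_nonneg h0, ← Real.mul_rpow (by norm_num) hj0.le]
        gcongr
      · have h2 : (m : ℝ) ^ r ≤ (j : ℝ) ^ r := Real.rpow_le_rpow_of_nonpos hj0 hjm' h0
        refine h2.trans (le_mul_of_one_le_left (by positivity) ?_)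
        exact Real.one_le_rpow (by norm_num) (abs_nonneg r)
    have h2 : (m / 2 + 1 : ℕ) * (m : ℝ) ^ r ≤ 2 ^ |r| * powerSum r m := by
      calc (m / 2 + 1 : ℕ) * (m : ℝ) ^ r = ∑ j ∈ Finset.Icc (m - m / 2) m, (m : ℝ) ^ r := by
            rw [Finset.sum_const, Nat.card_Icc, nsmul_eq_mul]
            congr 2; omega
        _ ≤ ∑ j ∈ Finset.Icc (m - m / 2) m, 2 ^ |r| * (j : ℝ) ^ r := Finset.sum_le_sum h1
        _ ≤ 2 ^ |r| * powerSum r m := by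
          rw [← Finset.mul_sum]
          refine mul_le_mul_of_nonneg_left ?_ (by positivity)
          exact Finset.sum_le_sum_of_subset_of_nonneg
            (Finset.Icc_subset_Icc (by omega) le_rfl) fun _ _ _ => by positivity
    have h3 : (m : ℝ) ≤ 2 * (m / 2 + 1 : ℕ) := by exact_mod_cast (by omega : m ≤ 2 * (m / 2 + 1))
    rw [Real.rpow_add_one hm0.ne']
    calc (m : ℝ) ^ r * m ≤ (m : ℝ) ^ r * (2 * (m / 2 + 1 : ℕ)) := by gcongr
      _ = 2 * ((m / 2 + 1 : ℕ) * (m : ℝ) ^ r) := by ring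
      _ ≤ 2 * (2 ^ |r| * powerSum r m) := by gcongr
      _ = _ := by ring

lemma powerSum_neg_one (m : ℕ) : powerSum (-1) m = (harmonic m : ℝ) := by
  rw [harmonic_eq_sum_Icc, powerSum]
  push_cast
  exact Finset.sum_congr rfl fun j _ => Real.rpow_neg_one _

lemma powerSum_isTheta_log : powerSum (-1) =Θ[atTop] fun m => Real.log m := by
  constructor
  · refine isBigO_of_le_mul (C := 2) ?_
    have : ∀ᶠ m : ℕ in atTop, 1 ≤ Real.log m :=
      (Real.tendsto_log_atTop.comp tendsto_natCast_atTop_atTop).eventually_ge_atTop 1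
    filter_upwards [this] with m hm
    refine ⟨powerSum_nonneg _ _, ?_⟩
    rw [powerSum_neg_one]
    linarith [harmonic_le_one_add_log m]
  · refine isBigO_of_le_mul (C := 1) ((eventually_ge_atTop 1).mono fun m hm =>
      ⟨Real.log_nonneg (by exact_mod_cast hm), ?_⟩)
    rw [powerSum_neg_one, one_mul]
    refine le_trans (Real.log_le_log (by exact_mod_cast hm) ?_) (log_add_one_le_harmonic m)
    exact_mod_cast Nat.le_succ m

lemma one_le_powerSum (r : ℝ) {m : ℕ} (hm : 1 ≤ m) : 1 ≤ powerSum r m := by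
  have := Finset.single_le_sum (f := fun j : ℕ => (j : ℝ) ^ r) (s := Finset.Icc 1 m)
    (fun _ _ => by positivity) (Finset.mem_Icc.2 ⟨le_rfl, hm⟩)
  simpa [powerSum] using this

lemma powerSum_isTheta_one {r : ℝ} (hr : r < -1) : powerSum r =Θ[atTop] fun _ => (1 : ℝ) := by
  constructor
  · refine isBigO_of_le_mul (C := ∑' j : ℕ, (j : ℝ) ^ r) (Eventually.of_forall fun m =>
      ⟨powerSum_nonneg _ _, ?_⟩)
    rw [mul_one]
    exact (Real.summable_nat_rpow.2 hr).sum_le_tsum _ fun _ _ => by positivity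
  · refine isBigO_of_le_mul (C := 1) ((eventually_ge_atTop 1).mono fun m hm => ⟨zero_le_one, ?_⟩)
    rw [one_mul]
    exact one_le_powerSum r hm

/-! #### Tails of sums of powers -/

lemma summable_tail_rpow {t : ℝ} (ht : 1 < t) (m : ℕ) :
    Summable fun i : ℕ => ((m + 1 + i : ℕ) : ℝ) ^ (-t) := by
  have := (summable_nat_add_iff (m + 1)).2 (Real.summable_nat_rpow.2 (show -t < -1 by linarith))
  exact this.congr fun i => by rw [add_comm]

/-- Comparison with the telescoping differences `x ^ (1 - t) - (x + 1) ^ (1 - t)`. -/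
lemma tsum_tail_rpow_le {t : ℝ} (ht : 1 < t) {m : ℕ} (hm : 1 ≤ m) :
    ∑' i : ℕ, ((m + 1 + i : ℕ) : ℝ) ^ (-t) ≤ (t - 1)⁻¹ * (m : ℝ) ^ (1 - t) := by
  have ht0 : 0 < t - 1 := by linarith
  have step : ∀ x : ℝ, 1 ≤ x → (t - 1) * (x + 1) ^ (-t) ≤ x ^ (1 - t) - (x + 1) ^ (1 - t) := by
    intro x hx
    have hx0 : 0 < x := by linarith
    have h1 : 1 + (t - 1) / (x + 1) ≤ (x / (x + 1)) ^ (1 - t) := by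
      rw [Real.rpow_def_of_pos (by positivity)]
      have h2 := Real.log_le_sub_one_of_pos (show 0 < x / (x + 1) by positivity)
      have h3 : x / (x + 1) - 1 = -(1 / (x + 1)) := by field_simp; ring
      rw [h3] at h2
      have h4 := Real.add_one_le_exp (Real.log (x / (x + 1)) * (1 - t))
      have h5 : (t - 1) / (x + 1) ≤ Real.log (x / (x + 1)) * (1 - t) := by
        have : (t - 1) / (x + 1) = (t - 1) * (1 / (x + 1)) := by ring
        rw [this]; nlinarith
      linarith
    rw [Real.div_rpow hx0.le (by positivity), le_div_iff₀ (by positivity)] at h1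
    have h6 : (x + 1) ^ (-t) = (x + 1) ^ (1 - t) / (x + 1) := by
      rw [← Real.rpow_sub_one (by positivity)]; ring_nf
    rw [h6]
    have h7 : (1 + (t - 1) / (x + 1)) * (x + 1) ^ (1 - t)
      = (x + 1) ^ (1 - t) + (t - 1) * ((x + 1) ^ (1 - t) / (x + 1)) := by ring
    linarith
  refine Real.tsum_le_of_sum_range_le (fun i => by positivity) fun N => ?_
  rw [inv_mul_eq_div, le_div_iff₀ ht0]
  have key : ∀ N : ℕ, (∑ i ∈ Finset.range N, ((m + 1 + i : ℕ) : ℝ) ^ (-t)) * (t - 1)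
      ≤ (m : ℝ) ^ (1 - t) - ((m + N : ℕ) : ℝ) ^ (1 - t) := by
    intro N
    induction N with
    | zero => simp
    | succ N ih =>
      have h1 := step ((m + N : ℕ) : ℝ) (by exact_mod_cast (by omega : 1 ≤ m + N))
      rw [Finset.sum_range_succ, add_mul]
      have e1 : ((m + 1 + N : ℕ) : ℝ) = ((m + N : ℕ) : ℝ) + 1 := by push_cast; ring
      have e2 : ((m + (N + 1) : ℕ) : ℝ) = ((m + N : ℕ) : ℝ) + 1 := by push_cast; ring
      rw [e1, e2]
      linarith
  have h0 : 0 ≤ ((m + N : ℕ) : ℝ) ^ (1 - t) := by positivity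
  linarith [key N]

/-! #### Exponentials of powers -/

lemma rpow_le_mul_exp {s y : ℝ} (hs : 0 < s) (hy : 0 ≤ y) : y ^ s ≤ s ^ s * Real.exp y := by
  have h1 : y / s ≤ Real.exp (y / s) := by linarith [Real.add_one_le_exp (y / s)]
  have h2 : (y / s) ^ s ≤ Real.exp (y / s) ^ s := by gcongr
  rw [← Real.exp_mul, div_mul_cancel₀ _ hs.ne', Real.div_rpow hy hs.le,
    div_le_iff₀ (by positivity)] at h2
  linarith

/-- The function `x ^ r exp (- x ^ q)` is decreasing up to a constant. -/
lemma exists_rpow_mul_exp_le (r : ℝ) {q : ℝ} (hq : 0 < q) :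
    ∃ C : ℝ, 1 ≤ C ∧ ∀ k j : ℕ, 1 ≤ k → k ≤ j →
      (j : ℝ) ^ r * Real.exp (-(j : ℝ) ^ q) ≤ C * ((k : ℝ) ^ r * Real.exp (-(k : ℝ) ^ q)) := by
  obtain ⟨C, hC1, hC⟩ : ∃ C : ℝ, 1 ≤ C ∧ ∀ x : ℝ, 1 ≤ x → x ^ r * Real.exp (1 - x ^ q) ≤ C := by
    rcases le_or_gt r 0 with hr | hr
    · refine ⟨1, le_rfl, fun x hx => ?_⟩
      have h1 : x ^ r ≤ 1 := Real.rpow_le_one_of_one_le_of_nonpos hx hr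
      have h2 : Real.exp (1 - x ^ q) ≤ 1 := by
        rw [Real.exp_le_one_iff]
        linarith [Real.one_le_rpow hx hq.le]
      exact mul_le_one₀ h1 (Real.exp_pos _).le h2
    · refine ⟨max 1 ((r / q) ^ (r / q) * Real.exp 1), le_max_left _ _, fun x hx => ?_⟩
      refine le_trans ?_ (le_max_right _ _)
      have h1 := rpow_le_mul_exp (div_pos hr hq) (show 0 ≤ x ^ q by positivity)
      rw [← Real.rpow_mul (by linarith), mul_div_cancel₀ _ hq.ne'] at h1
      rw [Real.exp_sub, ← mul_div_assoc, div_le_iff₀ (Real.exp_pos _)]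
      calc x ^ r * Real.exp 1 ≤ (r / q) ^ (r / q) * Real.exp (x ^ q) * Real.exp 1 := by gcongr
        _ = _ := by ring
  refine ⟨C, hC1, fun k j hk hkj => ?_⟩
  have hk1 : (1 : ℝ) ≤ k := by exact_mod_cast hk
  have hk0 : (0 : ℝ) < k := by linarith
  have hj0 : (0 : ℝ) ≤ j := by positivity
  set x : ℝ := j / k with hx
  have hx1 : 1 ≤ x := by rw [hx, one_le_div₀ hk0]; exact_mod_cast hkj
  have hj : (j : ℝ) = k * x := by rw [hx]; field_simp
  have h1 := hC x hx1
  have hkq : 1 ≤ (k : ℝ) ^ q := Real.one_le_rpow hk1 hq.le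
  have hxq : 1 ≤ x ^ q := Real.one_le_rpow hx1 hq.le
  -- `u v ≥ u + v - 1` for `u, v ≥ 1` separates the factors of `j ^ q = k ^ q x ^ q`
  have h2 : -((k : ℝ) ^ q * x ^ q) ≤ (1 - x ^ q) + -(k : ℝ) ^ q := by nlinarith
  rw [hj, Real.mul_rpow hk0.le (by linarith), Real.mul_rpow hk0.le (by linarith)]
  calc (k : ℝ) ^ r * x ^ r * Real.exp (-((k : ℝ) ^ q * x ^ q))
      ≤ (k : ℝ) ^ r * x ^ r * Real.exp ((1 - x ^ q) + -(k : ℝ) ^ q) := by gcongr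
    _ = (x ^ r * Real.exp (1 - x ^ q)) * ((k : ℝ) ^ r * Real.exp (-(k : ℝ) ^ q)) := by
        rw [Real.exp_add]; ring
    _ ≤ _ := by gcongr

/-- The same for the reciprocal: `x ^ r exp (x ^ q)` is increasing up to a constant. -/
lemma exists_rpow_mul_exp_le_of_le (r : ℝ) {q : ℝ} (hq : 0 < q) :
    ∃ C : ℝ, 1 ≤ C ∧ ∀ k j : ℕ, 1 ≤ k → k ≤ j →
      (k : ℝ) ^ r * Real.exp ((k : ℝ) ^ q) ≤ C * ((j : ℝ) ^ r * Real.exp ((j : ℝ) ^ q)) := by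
  obtain ⟨C, hC1, hC⟩ := exists_rpow_mul_exp_le (-r) hq
  refine ⟨C, hC1, fun k j hk hkj => ?_⟩
  have h := hC k j hk hkj
  have hk0 : (0 : ℝ) < k := by exact_mod_cast hk
  have hj0 : (0 : ℝ) < j := by exact_mod_cast hk.trans hkj
  rw [Real.rpow_neg hk0.le, Real.rpow_neg hj0.le, Real.exp_neg, Real.exp_neg, ← mul_inv, ← mul_inv,
    inv_le_iff_one_le_mul₀ (by positivity)] at h
  have h2 : 0 < (k : ℝ) ^ r * Real.exp ((k : ℝ) ^ q) := by positivity
  rw [mul_assoc, mul_comm, ← div_eq_inv_mul, div_mul_eq_mul_div, one_le_div₀ h2] at h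
  linarith

/-! #### Windows -/

/-- A lower bound for the sums over five consecutive terms gives a lower bound for partial sums. -/
lemma sum_le_of_window {a b : ℕ → ℝ} (ha : ∀ j, 1 ≤ j → 0 ≤ a j)
    (hb : ∀ j, 1 ≤ j → b j ≤ ∑ l ∈ Finset.range 5, a (j + l)) {m N : ℕ} (hm : 1 ≤ m) :
    ∑ j ∈ Finset.Ico m N, b j ≤ 5 * ∑ j ∈ Finset.Ico m (N + 4), a j := by
  calc ∑ j ∈ Finset.Ico m N, b j
      ≤ ∑ j ∈ Finset.Ico m N, ∑ l ∈ Finset.range 5, a (j + l) :=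
        Finset.sum_le_sum fun j hj => hb j (hm.trans (Finset.mem_Ico.1 hj).1)
    _ = ∑ l ∈ Finset.range 5, ∑ j ∈ Finset.Ico m N, a (j + l) := Finset.sum_comm
    _ ≤ ∑ l ∈ Finset.range 5, ∑ j ∈ Finset.Ico m (N + 4), a j := by
        refine Finset.sum_le_sum fun l hl => ?_
        rw [Finset.sum_Ico_add' a m N l]
        have := Finset.mem_range.1 hl
        exact Finset.sum_le_sum_of_subset_of_nonneg (Finset.Ico_subset_Ico (by omega) (by omega))
          fun j hj _ => ha j (hm.trans (Finset.mem_Ico.1 hj).1)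
    _ = _ := by simp

/-! ### Orders of the two sums in the rates -/

lemma SameOrder.isTheta {u v : ℕ → ℝ} (h : SameOrder u v) (hv : ∀ j, 1 ≤ j → 0 ≤ v j) :
    u =Θ[atTop] v := by
  obtain ⟨C, hC, h⟩ := h
  have hC0 : 0 < C := by linarith
  refine ⟨isBigO_of_le_mul (C := C) ((eventually_ge_atTop 1).mono fun j hj => ⟨?_, (h j hj).2⟩),
    isBigO_of_le_mul (C := C) ((eventually_ge_atTop 1).mono fun j hj => ⟨hv j hj, ?_⟩)⟩
  · exact le_trans (div_nonneg (hv j hj) hC0.le) (h j hj).1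
  · have := (h j hj).1
    rw [div_le_iff₀ hC0] at this
    linarith

/-- The squares `h_j²` are at most of the order `j ^ (-2 s)`. -/
def UpperOrder (h : ℕ → ℝ) (s : ℝ) : Prop :=
  ∃ C : ℝ, 0 < C ∧ ∀ j : ℕ, 1 ≤ j → h j ^ 2 ≤ C * (j : ℝ) ^ (-(2 * s))

/-- The sums of `h_j²` over windows of five consecutive indices are at least of the order
`j ^ (-2 s)`.  (The coefficients of point evaluation and of averages satisfy such a bound although
single coefficients may vanish.) -/
def WindowOrder (h : ℕ → ℝ) (s : ℝ) : Prop :=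
  ∃ C : ℝ, 0 < C ∧ ∀ j : ℕ, 1 ≤ j →
    (j : ℝ) ^ (-(2 * s)) ≤ C * ∑ l ∈ Finset.range 5, h (j + l) ^ 2

lemma SameOrder.upperOrder {h : ℕ → ℝ} {s : ℝ}
    (hh : SameOrder (fun j => h j ^ 2) fun j => (j : ℝ) ^ (-(2 * s))) : UpperOrder h s := by
  obtain ⟨C, hC, hh⟩ := hh
  exact ⟨C, by linarith, fun j hj => (hh j hj).2⟩

lemma SameOrder.windowOrder {h : ℕ → ℝ} {s : ℝ}
    (hh : SameOrder (fun j => h j ^ 2) fun j => (j : ℝ) ^ (-(2 * s))) : WindowOrder h s := by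
  obtain ⟨C, hC, hh⟩ := hh
  have hC0 : 0 < C := by linarith
  refine ⟨C, hC0, fun j hj => ?_⟩
  have h1 := (hh j hj).1
  rw [div_le_iff₀ hC0] at h1
  refine h1.trans ?_
  rw [mul_comm]
  refine mul_le_mul_of_nonneg_left ?_ hC0.le
  exact Finset.single_le_sum (f := fun l => h (j + l) ^ 2) (fun l _ => sq_nonneg _)
    (Finset.mem_range.2 (by norm_num : 0 < 5))

section Sums

variable {γ υ h : ℕ → ℝ} {p a s q : ℝ}

lemma headSum_le_powerSum (hυ : IsWeight υ) (hυo : SameOrder υ fun j => (j : ℝ) ^ (-(2 * a)))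
    (hh : UpperOrder h s) : ∃ C : ℝ, 0 < C ∧ ∀ m, headSum υ h m ≤ C * powerSum (2 * a - 2 * s) m := by
  obtain ⟨A, hA, hυo⟩ := hυo
  obtain ⟨C, hC, hh⟩ := hh
  refine ⟨A * C, by positivity, fun m => ?_⟩
  rw [headSum, powerSum, Finset.mul_sum]
  refine Finset.sum_le_sum fun j hj => ?_
  have hj1 := (Finset.mem_Icc.1 hj).1
  have hj0 : (0 : ℝ) < j := by exact_mod_cast hj1
  have h1 := (hυo j hj1).1
  have h2 := hh j hj1
  have e : (j : ℝ) ^ (2 * a - 2 * s) * (j : ℝ) ^ (-(2 * a)) = (j : ℝ) ^ (-(2 * s)) := by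
    rw [← Real.rpow_add hj0]; ring_nf
  rw [div_le_iff₀ (hυ.2 j hj1)]
  calc h j ^ 2 ≤ C * (j : ℝ) ^ (-(2 * s)) := h2
    _ = A * C * (j : ℝ) ^ (2 * a - 2 * s) * ((j : ℝ) ^ (-(2 * a)) / A) := by
        rw [← e]; field_simp
    _ ≤ _ := by gcongr

/-- Windows starting at `j ≤ m - 4` stay below `m`.  As `υ` is decreasing, `1 / υ_j` may be replaced
with `1 / υ_{j+l}` within a window. -/
lemma powerSum_le_headSum (hυ : IsWeight υ) (hanti : AntitoneOn υ (Set.Ici 1))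
    (hυo : SameOrder υ fun j => (j : ℝ) ^ (-(2 * a))) (hh : WindowOrder h s) :
    ∃ C : ℝ, 0 < C ∧ ∀ m, powerSum (2 * a - 2 * s) (m - 4) ≤ C * headSum υ h m := by
  obtain ⟨A, hA, hυo⟩ := hυo
  obtain ⟨C, hC, hh⟩ := hh
  refine ⟨5 * (C * A), by positivity, fun m => ?_⟩
  have hpos : ∀ j, 1 ≤ j → 0 ≤ h j ^ 2 / υ j := fun j hj => by
    have := hυ.2 j hj
    positivity
  have hwin : ∀ j : ℕ, 1 ≤ j → (j : ℝ) ^ (2 * a - 2 * s)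
      ≤ ∑ l ∈ Finset.range 5, C * A * (h (j + l) ^ 2 / υ (j + l)) := by
    intro j hj
    have hj0 : (0 : ℝ) < j := by exact_mod_cast hj
    have h1 := (hυo j hj).2
    have hυj := hυ.2 j hj
    have e : (j : ℝ) ^ (2 * a - 2 * s) = (j : ℝ) ^ (-(2 * s)) / (j : ℝ) ^ (-(2 * a)) := by
      rw [← Real.rpow_sub hj0]; ring_nf
    calc (j : ℝ) ^ (2 * a - 2 * s) ≤ (j : ℝ) ^ (-(2 * s)) * (A / υ j) := by
          rw [e, div_le_iff₀ (by positivity), mul_assoc]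
          refine le_mul_of_one_le_right (by positivity) ?_
          rw [div_mul_eq_mul_div, one_le_div₀ hυj]
          exact h1
      _ ≤ (C * ∑ l ∈ Finset.range 5, h (j + l) ^ 2) * (A / υ j) := by gcongr; exact hh j hj
      _ = ∑ l ∈ Finset.range 5, C * A * (h (j + l) ^ 2 / υ j) := by
          rw [Finset.mul_sum, Finset.sum_mul]
          exact Finset.sum_congr rfl fun l _ => by ring
      _ ≤ _ := by
          refine Finset.sum_le_sum fun l _ => ?_
          have h2 := hυ.2 (j + l) (by omega)
          have h3 : υ (j + l) ≤ υ j := hanti hj (Set.mem_Ici.2 (by omega)) (by omega)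
          gcongr
  rcases le_or_gt m 3 with hm | hm
  · have h0 := headSum_nonneg (h := h) hυ m
    rw [show m - 4 = 0 by omega]
    simp only [powerSum]
    simp
    positivity
  · have h1 := sum_le_of_window (a := fun j => C * A * (h j ^ 2 / υ j)) (N := m - 4 + 1)
      (fun j hj => mul_nonneg (by positivity) (hpos j hj)) hwin
      le_rfl
    rw [show m - 4 + 1 + 4 = m + 1 by omega, ← Finset.mul_sum, Finset.Ico_add_one_right_eq_Icc,
      Finset.Ico_add_one_right_eq_Icc] at h1
    rw [powerSum, headSum]
    linarith

/-- Polynomial `γ`: summability and an upper bound for the bias part of `δ_n^*`. -/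
lemma isRepresenter_of_poly (hγ : IsWeight γ) (hγo : SameOrder γ fun j => (j : ℝ) ^ (2 * p))
    (hh : UpperOrder h s) (hs : 1 < 2 * s + 2 * p) : IsRepresenter γ h ∧
      ∃ C : ℝ, 0 < C ∧ ∀ m, 1 ≤ m → tailSum γ h m ≤ C * (m : ℝ) ^ (1 - 2 * s - 2 * p) := by
  obtain ⟨A, hA, hγo⟩ := hγo
  obtain ⟨C, hC, hh⟩ := hh
  have hbd : ∀ j : ℕ, 1 ≤ j → h j ^ 2 / γ j ≤ A * C * (j : ℝ) ^ (-(2 * s + 2 * p)) := by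
    intro j hj
    have hj0 : (0 : ℝ) < j := by exact_mod_cast hj
    have h1 := (hγo j hj).1
    have e : (j : ℝ) ^ (-(2 * s + 2 * p)) * (j : ℝ) ^ (2 * p) = (j : ℝ) ^ (-(2 * s)) := by
      rw [← Real.rpow_add hj0]; ring_nf
    rw [div_le_iff₀ (hγ.2 j hj)]
    calc h j ^ 2 ≤ C * (j : ℝ) ^ (-(2 * s)) := hh j hj
      _ = A * C * (j : ℝ) ^ (-(2 * s + 2 * p)) * ((j : ℝ) ^ (2 * p) / A) := by
          rw [← e]; field_simp
      _ ≤ _ := by gcongr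
  have hrep : IsRepresenter γ h := by
    refine Summable.of_nonneg_of_le (fun j => ?_) (fun j => hbd (j + 1) (by omega))
      (((summable_nat_add_iff 1).2 (Real.summable_nat_rpow.2
        (show -(2 * s + 2 * p) < -1 by linarith))).mul_left (A * C))
    have := hγ.2 (j + 1) (by omega)
    positivity
  refine ⟨hrep, A * C * (2 * s + 2 * p - 1)⁻¹, ?_, fun m hm => ?_⟩
  · have : 0 < 2 * s + 2 * p - 1 := by linarith
    positivity
  · calc tailSum γ h m ≤ ∑' i : ℕ, A * C * ((m + 1 + i : ℕ) : ℝ) ^ (-(2 * s + 2 * p)) :=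
          (hrep.summable_tail m).tsum_le_tsum (fun i => hbd _ (by omega))
            ((summable_tail_rpow hs m).mul_left _)
      _ ≤ A * C * ((2 * s + 2 * p - 1)⁻¹ * (m : ℝ) ^ (1 - (2 * s + 2 * p))) := by
          rw [tsum_mul_left]
          gcongr
          exact tsum_tail_rpow_le hs hm
      _ = _ := by ring_nf

/-- The matching lower bound for the bias part; the block `m < j ≤ 2 m` suffices. -/
lemma rpow_le_tailSum (hγ : IsWeight γ) (hγo : SameOrder γ fun j => (j : ℝ) ^ (2 * p))
    (hp : 0 ≤ p) (hh : WindowOrder h s) (hs : 0 < 2 * s + 2 * p) (hrep : IsRepresenter γ h) :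
    ∃ C : ℝ, 0 < C ∧ ∀ m : ℕ, 1 ≤ m → (m : ℝ) ^ (1 - 2 * s - 2 * p) ≤ C * tailSum γ h m := by
  obtain ⟨A, hA, hγo⟩ := hγo
  obtain ⟨C, hC, hh⟩ := hh
  have hA0 : 0 < A := by linarith
  set D : ℝ := C * (A * 5 ^ (2 * p)) with hD
  have hD0 : 0 < D := by positivity
  have hpos : ∀ j, 1 ≤ j → 0 ≤ h j ^ 2 / γ j := fun j hj => by
    have := hγ.2 j hj
    positivity
  have hwin : ∀ j : ℕ, 1 ≤ j → (j : ℝ) ^ (-(2 * s + 2 * p))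
      ≤ ∑ l ∈ Finset.range 5, D * (h (j + l) ^ 2 / γ (j + l)) := by
    intro j hj
    have hj0 : (0 : ℝ) < j := by exact_mod_cast hj
    have e : (j : ℝ) ^ (-(2 * s + 2 * p)) = (j : ℝ) ^ (-(2 * s)) / (j : ℝ) ^ (2 * p) := by
      rw [← Real.rpow_sub hj0]; ring_nf
    calc (j : ℝ) ^ (-(2 * s + 2 * p))
        ≤ (C * ∑ l ∈ Finset.range 5, h (j + l) ^ 2) / (j : ℝ) ^ (2 * p) := by
          rw [e]; gcongr; exact hh j hj
      _ = ∑ l ∈ Finset.range 5, C * (h (j + l) ^ 2 / (j : ℝ) ^ (2 * p)) := by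
          rw [Finset.mul_sum, Finset.sum_div]
          exact Finset.sum_congr rfl fun l _ => by ring
      _ ≤ _ := by
          refine Finset.sum_le_sum fun l hl => ?_
          have hl5 := Finset.mem_range.1 hl
          have h2 := hγ.2 (j + l) (by omega)
          have h3 := (hγo (j + l) (by omega)).2
          have h4 : ((j + l : ℕ) : ℝ) ^ (2 * p) ≤ 5 ^ (2 * p) * (j : ℝ) ^ (2 * p) := by
            rw [← Real.mul_rpow (by norm_num) hj0.le]
            have : ((j + l : ℕ) : ℝ) ≤ 5 * j := by exact_mod_cast (by omega : j + l ≤ 5 * j)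
            gcongr
          have h5 : γ (j + l) ≤ A * 5 ^ (2 * p) * (j : ℝ) ^ (2 * p) := by
            rw [mul_assoc]
            exact h3.trans (mul_le_mul_of_nonneg_left h4 hA0.le)
          rw [hD, mul_assoc]
          refine mul_le_mul_of_nonneg_left ?_ hC.le
          rw [div_le_iff₀ (by positivity), mul_assoc, div_mul_eq_mul_div, ← mul_div_assoc,
            le_div_iff₀ h2]
          calc h (j + l) ^ 2 * γ (j + l)
              ≤ h (j + l) ^ 2 * (A * 5 ^ (2 * p) * (j : ℝ) ^ (2 * p)) := by gcongr
            _ = _ := by ring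
  set t := 2 * s + 2 * p with ht
  refine ⟨2 ^ t * (5 * D), by positivity, fun m hm => ?_⟩
  have hm0 : (0 : ℝ) < m := by exact_mod_cast hm
  have h1 := sum_le_of_window (a := fun j => D * (h j ^ 2 / γ j)) (m := m + 1) (N := 2 * m + 1)
    (fun j hj => mul_nonneg (by positivity) (hpos j hj)) hwin (by omega)
  have h2 : m * (2 * (m : ℝ)) ^ (-t) ≤ ∑ j ∈ Finset.Ico (m + 1) (2 * m + 1), (j : ℝ) ^ (-t) := by
    calc m * (2 * (m : ℝ)) ^ (-t) = ∑ j ∈ Finset.Ico (m + 1) (2 * m + 1), (2 * (m : ℝ)) ^ (-t) := by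
          rw [Finset.sum_const, Nat.card_Ico, nsmul_eq_mul]
          congr 2; omega
      _ ≤ _ := by
          refine Finset.sum_le_sum fun j hj => ?_
          obtain ⟨hj1, hj2⟩ := Finset.mem_Ico.1 hj
          have hj0 : (0 : ℝ) < j := by exact_mod_cast (by omega : 0 < j)
          refine Real.rpow_le_rpow_of_nonpos hj0 ?_ (by linarith)
          exact_mod_cast (by omega : j ≤ 2 * m)
  have h3 : ∑ j ∈ Finset.Ico (m + 1) (2 * m + 1 + 4), h j ^ 2 / γ j ≤ tailSum γ h m := by
    rw [Finset.sum_Ico_eq_sum_range]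
    exact (hrep.summable_tail m).sum_le_tsum _ fun i _ => hpos _ (by omega)
  rw [← Finset.mul_sum] at h1
  have h4 : (m : ℝ) ^ (1 - 2 * s - 2 * p) = 2 ^ t * (m * (2 * (m : ℝ)) ^ (-t)) := by
    rw [Real.mul_rpow (by norm_num) hm0.le, show 1 - 2 * s - 2 * p = -t + 1 by rw [ht]; ring,
      Real.rpow_add_one hm0.ne', Real.rpow_neg (by norm_num : (0 : ℝ) ≤ 2)]
    field_simp
  rw [h4, mul_assoc]
  refine mul_le_mul_of_nonneg_left ?_ (by positivity)
  refine h2.trans (h1.trans ?_)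
  rw [mul_assoc 5]
  exact mul_le_mul_of_nonneg_left (mul_le_mul_of_nonneg_left h3 hD0.le) (by norm_num)

/-- Exponential `γ`: summability and an upper bound for the bias part of `δ_n^*`. -/
lemma isRepresenter_of_exp (hγ : IsWeight γ) (hq : 0 < q)
    (hγo : SameOrder γ fun j => Real.exp ((j : ℝ) ^ q)) (hh : UpperOrder h s) : IsRepresenter γ h ∧
      ∃ C : ℝ, 0 < C ∧ ∀ m : ℕ, 1 ≤ m →
        tailSum γ h m ≤ C * ((m : ℝ) ^ (1 - 2 * s) * Real.exp (-(m : ℝ) ^ q)) := by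
  obtain ⟨A, hA, hγo⟩ := hγo
  obtain ⟨C, hC, hh⟩ := hh
  -- a factor `j ^ (-2)` is split off for summability; the rest is decreasing up to a constant
  obtain ⟨D, hD, hkey⟩ := exists_rpow_mul_exp_le (2 - 2 * s) hq
  have hbd : ∀ m j : ℕ, 1 ≤ m → m ≤ j → h j ^ 2 / γ j
      ≤ A * C * D * ((m : ℝ) ^ (2 - 2 * s) * Real.exp (-(m : ℝ) ^ q)) * (j : ℝ) ^ (-2 : ℝ) := by
    intro m j hm hmj
    have hj : 1 ≤ j := hm.trans hmj
    have hj0 : (0 : ℝ) < j := by exact_mod_cast hj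
    have h1 := (hγo j hj).1
    have e : (j : ℝ) ^ (-(2 * s)) = (j : ℝ) ^ (2 - 2 * s) * (j : ℝ) ^ (-2 : ℝ) := by
      rw [← Real.rpow_add hj0]; ring_nf
    have e2 : Real.exp (-(j : ℝ) ^ q) * Real.exp ((j : ℝ) ^ q) = 1 := by
      rw [← Real.exp_add]; simp
    calc h j ^ 2 / γ j ≤ A * C * ((j : ℝ) ^ (2 - 2 * s) * Real.exp (-(j : ℝ) ^ q)) * (j : ℝ) ^ (-2 : ℝ) := by
          rw [div_le_iff₀ (hγ.2 j hj)]
          calc h j ^ 2 ≤ C * (j : ℝ) ^ (-(2 * s)) := hh j hj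
            _ = C * (j : ℝ) ^ (-(2 * s)) * (Real.exp (-(j : ℝ) ^ q) * Real.exp ((j : ℝ) ^ q)) := by
                rw [e2, mul_one]
            _ = A * C * ((j : ℝ) ^ (2 - 2 * s) * Real.exp (-(j : ℝ) ^ q)) * (j : ℝ) ^ (-2 : ℝ)
                * (Real.exp ((j : ℝ) ^ q) / A) := by
                rw [e]; field_simp
            _ ≤ _ := by gcongr
      _ ≤ A * C * (D * ((m : ℝ) ^ (2 - 2 * s) * Real.exp (-(m : ℝ) ^ q))) * (j : ℝ) ^ (-2 : ℝ) := by
          refine mul_le_mul_of_nonneg_right ?_ (by positivity)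
          exact mul_le_mul_of_nonneg_left (hkey m j hm hmj) (by positivity)
      _ = _ := by ring
  have hrep : IsRepresenter γ h := by
    refine Summable.of_nonneg_of_le (fun j => ?_) (fun j => hbd 1 (j + 1) le_rfl (by omega))
      (((summable_nat_add_iff 1).2 (Real.summable_nat_rpow.2
        (show (-2 : ℝ) < -1 by norm_num))).mul_left _)
    have := hγ.2 (j + 1) (by omega)
    positivity
  refine ⟨hrep, A * C * D, by positivity, fun m hm => ?_⟩
  have hm0 : (0 : ℝ) < m := by exact_mod_cast hm
  have hsum := tsum_tail_rpow_le (t := 2) (by norm_num) hm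
  norm_num at hsum
  calc tailSum γ h m
      ≤ ∑' i : ℕ, A * C * D * ((m : ℝ) ^ (2 - 2 * s) * Real.exp (-(m : ℝ) ^ q))
          * ((m + 1 + i : ℕ) : ℝ) ^ (-2 : ℝ) :=
        (hrep.summable_tail m).tsum_le_tsum (fun i => hbd _ _ hm (by omega))
          ((summable_tail_rpow (by norm_num) m).mul_left _)
    _ ≤ A * C * D * ((m : ℝ) ^ (2 - 2 * s) * Real.exp (-(m : ℝ) ^ q)) * (m : ℝ) ^ (-1 : ℝ) := by
        rw [tsum_mul_left]
        have := tsum_tail_rpow_le (t := 2) (by norm_num) hm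
        norm_num at this ⊢
        gcongr
    _ = A * C * D * ((m : ℝ) ^ (1 - 2 * s) * Real.exp (-(m : ℝ) ^ q)) := by
        have e : (m : ℝ) ^ (1 - 2 * s) = (m : ℝ) ^ (2 - 2 * s) * (m : ℝ) ^ (-1 : ℝ) := by
          rw [← Real.rpow_add hm0]; ring_nf
        rw [e]; ring

/-- Exponential `υ`: the variance part is at most of the order of `m` times its last term.  This
crude bound is good enough because the bias dominates in this case. -/
lemma headSum_le_of_exp (hυ : IsWeight υ) (hq : 0 < q)
    (hυo : SameOrder υ fun j => Real.exp (-(j : ℝ) ^ q)) (hh : UpperOrder h s) :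
    ∃ C : ℝ, 0 < C ∧ ∀ m : ℕ, 1 ≤ m →
      headSum υ h m ≤ C * ((m : ℝ) ^ (1 - 2 * s) * Real.exp ((m : ℝ) ^ q)) := by
  obtain ⟨A, hA, hυo⟩ := hυo
  obtain ⟨C, hC, hh⟩ := hh
  obtain ⟨D, hD, hkey⟩ := exists_rpow_mul_exp_le_of_le (-(2 * s)) hq
  refine ⟨A * C * D, by positivity, fun m hm => ?_⟩
  have hm0 : (0 : ℝ) < m := by exact_mod_cast hm
  have hbd : ∀ j ∈ Finset.Icc 1 m, h j ^ 2 / υ j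
      ≤ A * C * D * ((m : ℝ) ^ (-(2 * s)) * Real.exp ((m : ℝ) ^ q)) := by
    intro j hj
    obtain ⟨hj1, hjm⟩ := Finset.mem_Icc.1 hj
    have h1 := (hυo j hj1).1
    have e2 : Real.exp ((j : ℝ) ^ q) * Real.exp (-(j : ℝ) ^ q) = 1 := by
      rw [← Real.exp_add]; simp
    calc h j ^ 2 / υ j ≤ A * C * ((j : ℝ) ^ (-(2 * s)) * Real.exp ((j : ℝ) ^ q)) := by
          rw [div_le_iff₀ (hυ.2 j hj1)]
          calc h j ^ 2 ≤ C * (j : ℝ) ^ (-(2 * s)) := hh j hj1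
            _ = C * (j : ℝ) ^ (-(2 * s)) * (Real.exp ((j : ℝ) ^ q) * Real.exp (-(j : ℝ) ^ q)) := by
                rw [e2, mul_one]
            _ = A * C * ((j : ℝ) ^ (-(2 * s)) * Real.exp ((j : ℝ) ^ q))
                * (Real.exp (-(j : ℝ) ^ q) / A) := by field_simp
            _ ≤ _ := by gcongr
      _ ≤ A * C * (D * ((m : ℝ) ^ (-(2 * s)) * Real.exp ((m : ℝ) ^ q))) := by
          exact mul_le_mul_of_nonneg_left (hkey j m hj1 hjm) (by positivity)
      _ = _ := by ring
  refine (Finset.sum_le_card_nsmul _ _ _ hbd).trans (le_of_eq ?_)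
  rw [Nat.card_Icc, Nat.add_sub_cancel, nsmul_eq_mul, show 1 - 2 * s = -(2 * s) + 1 by ring,
    Real.rpow_add_one hm0.ne']
  ring

end Sums

/-! ### The order of the optimal dimension -/

section Dimension

variable {γ υ : ℕ → ℝ} {k : ℕ → ℕ}

lemma ratio_antitone (hγ : IsWeight γ) (hmono : MonotoneOn γ (Set.Ici 1)) (hυ : IsWeight υ)
    (hanti : AntitoneOn υ (Set.Ici 1)) {i j : ℕ} (hi : 1 ≤ i) (hij : i ≤ j) :
    υ j / γ j ≤ υ i / γ i := by
  have h1 : υ j ≤ υ i := hanti hi (hi.trans hij) hij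
  have h2 : γ i ≤ γ j := hmono hi (hi.trans hij) hij
  have h3 := hγ.2 i hi
  have h4 := hυ.2 i hi
  gcongr

/-- If `υ_m / γ_m` tends to zero and does not drop by more than a constant factor in one step, then
the optimal dimension balances `υ_m / γ_m` and `1 / n`. -/
lemma kappa_pos (hγ : IsWeight γ) (hυ : IsWeight υ) (hk : IsOptimalDim γ υ k)
    (hr : Tendsto (fun m => υ m / γ m) atTop (nhds 0)) {c : ℝ} (hc : 0 < c)
    (hstep : ∀ m, 1 ≤ m → c * (υ m / γ m) ≤ υ (m + 1) / γ (m + 1)) : 0 < kappa γ υ k := by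
  have hpos : ∀ m, 1 ≤ m → 0 < υ m / γ m := fun m hm => div_pos (hυ.2 m hm) (hγ.2 m hm)
  refine lt_of_lt_of_le hc (le_csInf ⟨_, 1, Set.self_mem_Ici, rfl⟩ ?_)
  rintro _ ⟨n, hn, rfl⟩
  have hn : 1 ≤ n := hn
  have hn0 : (0 : ℝ) < n := by exact_mod_cast hn
  have hn1 : (n : ℝ)⁻¹ ≤ 1 := inv_le_one_of_one_le₀ (by exact_mod_cast hn)
  -- `m + 1` is the first index at which `υ_m / γ_m` falls below `1 / n`
  have hex : ∃ m, 1 ≤ m ∧ υ m / γ m < (n : ℝ)⁻¹ :=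
    ((hr.eventually_lt_const (inv_pos.2 hn0)).and (eventually_ge_atTop 1)).exists.imp
      fun m hm => ⟨hm.2, hm.1⟩
  classical
  obtain ⟨hM1, hM2⟩ := Nat.find_spec hex
  set M := Nat.find hex with hM
  have hM3 : 2 ≤ M := by
    rcases Nat.lt_or_ge M 2 with h | h
    · have : M = 1 := by omega
      rw [this, hγ.1, hυ.1, div_one] at hM2
      linarith
    · exact h
  have hm1 : 1 ≤ M - 1 := by omega
  have hm : (n : ℝ)⁻¹ ≤ υ (M - 1) / γ (M - 1) := by
    by_contra! hcon
    exact Nat.find_min hex (show M - 1 < M by omega) ⟨hm1, hcon⟩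
  have h1 : c ≤ balance γ υ n (M - 1) := by
    rw [balance, min_eq_right hm, max_eq_left hm, le_div_iff₀ (hpos _ hm1)]
    have := hstep (M - 1) hm1
    rw [show M - 1 + 1 = M by omega] at this
    linarith
  have h2 := h1.trans ((hk n hn).2 _ hm1)
  simp only [alphaStar, inv_mul_eq_div]
  exact h2

variable (hγ : IsWeight γ) (hυ : IsWeight υ) (hk : IsOptimalDim γ υ k) (hκ : 0 < kappa γ υ k)

include hγ hυ hk hκ

/-- If `κ > 0`, then `α_n^*` is of the order `1 / n`. -/
lemma alphaStar_isTheta : alphaStar γ υ k =Θ[atTop] fun n => (n : ℝ)⁻¹ := by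
  constructor
  · refine isBigO_of_le_mul (C := (kappa γ υ k)⁻¹) ((eventually_ge_atTop 1).mono fun n hn =>
      ⟨le_max_of_le_right (by positivity), ?_⟩)
    rw [inv_mul_eq_div, le_div_iff₀ hκ, mul_comm]
    exact (kappa_mul_alphaStar_le hγ hυ hk hn).trans (min_le_right _ _)
  · refine isBigO_of_le_mul (C := 1) (Eventually.of_forall fun n => ⟨by positivity, ?_⟩)
    rw [one_mul]
    exact inv_le_alphaStar n

/-- If `κ > 0`, then `υ_m / γ_m` is of the order `1 / n` at the optimal dimension.  All orders of the
dimension are derived from this relation. -/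
lemma ratio_isTheta : (fun n => υ (k n) / γ (k n)) =Θ[atTop] fun n => (n : ℝ)⁻¹ := by
  have hpos : ∀ n, 1 ≤ n → 0 < υ (k n) / γ (k n) := fun n hn =>
    div_pos (hυ.2 _ (hk n hn).1) (hγ.2 _ (hk n hn).1)
  refine IsTheta.trans ⟨?_, ?_⟩ (alphaStar_isTheta hγ hυ hk hκ)
  · refine isBigO_of_le_mul (C := 1) ((eventually_ge_atTop 1).mono fun n hn =>
      ⟨(hpos n hn).le, ?_⟩)
    rw [one_mul]
    exact le_max_left _ _
  · refine isBigO_of_le_mul (C := (kappa γ υ k)⁻¹) ((eventually_ge_atTop 1).mono fun n hn =>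
      ⟨le_max_of_le_right (by positivity), ?_⟩)
    rw [inv_mul_eq_div, le_div_iff₀ hκ, mul_comm]
    exact (kappa_mul_alphaStar_le hγ hυ hk hn).trans (min_le_left _ _)

lemma tendsto_dim (hmono : MonotoneOn γ (Set.Ici 1)) (hanti : AntitoneOn υ (Set.Ici 1)) :
    Tendsto k atTop atTop := by
  refine tendsto_atTop.2 fun M => ?_
  set r := υ (M + 1) / γ (M + 1)
  have hr : 0 < r := div_pos (hυ.2 _ (by omega)) (hγ.2 _ (by omega))
  have h1 : ∀ᶠ n : ℕ in atTop, (n : ℝ)⁻¹ < kappa γ υ k * r :=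
    tendsto_inv_atTop_nhds_zero_nat.eventually_lt_const (by positivity)
  filter_upwards [h1, eventually_ge_atTop 1] with n hn1 hn
  by_contra! hcon
  have h2 := (kappa_mul_alphaStar_le hγ hυ hk hn).trans (min_le_right _ _)
  have h3 : r ≤ alphaStar γ υ k n :=
    (ratio_antitone hγ hmono hυ hanti (hk n hn).1 (by omega)).trans (le_max_left _ _)
  have h4 : kappa γ υ k * r ≤ kappa γ υ k * alphaStar γ υ k n := by gcongr
  linarith

lemma dim_isTheta_of_poly (hmono : MonotoneOn γ (Set.Ici 1)) (hanti : AntitoneOn υ (Set.Ici 1))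
    {θ : ℝ} (hθ : 0 < θ) (hr : (fun m => υ m / γ m) =Θ[atTop] fun m => (m : ℝ) ^ (-θ)) :
    (fun n => (k n : ℝ)) =Θ[atTop] fun n : ℕ => (n : ℝ) ^ (1 / θ) := by
  have h1 : (fun n => (k n : ℝ) ^ (-θ)) =Θ[atTop] fun n : ℕ => (n : ℝ)⁻¹ :=
    (isTheta_comp_tendsto hr (tendsto_dim hγ hυ hk hκ hmono hanti)).symm.trans
      (ratio_isTheta hγ hυ hk hκ)
  have h2 := IsTheta.rpow (r := -(1 / θ)) (Eventually.of_forall fun n => by positivity)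
    (Eventually.of_forall fun n => by positivity) h1
  convert h2 using 2 with n n
  · rw [← Real.rpow_mul (by positivity), show -θ * -(1 / θ) = 1 by field_simp, Real.rpow_one]
  · rw [← Real.rpow_neg_one, ← Real.rpow_mul (by positivity)]
    ring_nf

/-- The logarithm of the relation `k_n ^ (-θ) exp (- k_n ^ q) ≍ 1 / n`. -/
lemma dim_rpow_isTheta_log (hmono : MonotoneOn γ (Set.Ici 1)) (hanti : AntitoneOn υ (Set.Ici 1))
    {θ q : ℝ} (hq : 0 < q)
    (hr : (fun m => υ m / γ m) =Θ[atTop] fun m => (m : ℝ) ^ (-θ) * Real.exp (-(m : ℝ) ^ q)) :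
    (fun n => (k n : ℝ) ^ q) =Θ[atTop] fun n : ℕ => Real.log n := by
  have hlim := tendsto_dim hγ hυ hk hκ hmono hanti
  have h1 : (fun n => (k n : ℝ) ^ (-θ) * Real.exp (-(k n : ℝ) ^ q)) =Θ[atTop]
      fun n : ℕ => (n : ℝ)⁻¹ :=
    (isTheta_comp_tendsto hr hlim).symm.trans (ratio_isTheta hγ hυ hk hκ)
  have hk0 : ∀ᶠ n in atTop, (0 : ℝ) < k n := (eventually_ge_atTop 1).mono fun n hn => by
    exact_mod_cast (hk n hn).1
  have h2 := log_sub_log_isBigO_one (hk0.mono fun n hn => by positivity)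
    ((eventually_ge_atTop 1).mono fun n hn => by
      have : (0 : ℝ) < n := by exact_mod_cast hn
      positivity) h1
  have hkR : Tendsto (fun n => (k n : ℝ)) atTop atTop := tendsto_natCast_atTop_atTop.comp hlim
  have hkq : Tendsto (fun n => (k n : ℝ) ^ q) atTop atTop := (tendsto_rpow_atTop hq).comp hkR
  have h3 : (fun n => Real.log (k n)) =o[atTop] fun n => (k n : ℝ) ^ q :=
    (isLittleO_log_rpow_atTop hq).comp_tendsto hkR
  have h4 : (fun n : ℕ => Real.log n) ~[atTop] fun n => (k n : ℝ) ^ q := by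
    refine IsLittleO.isEquivalent ?_
    have h5 := (h3.const_mul_left θ).add (h2.trans_isLittleO (isLittleO_one_of_tendsto hkq))
    refine h5.congr' ?_ EventuallyEq.rfl
    filter_upwards [hk0] with n hn
    rw [Real.log_mul (by positivity) (by positivity), Real.log_exp, Real.log_rpow hn, Real.log_inv,
      Pi.sub_apply]
    ring
  exact h4.isTheta.symm

lemma dim_isTheta_of_exp (hmono : MonotoneOn γ (Set.Ici 1)) (hanti : AntitoneOn υ (Set.Ici 1))
    {θ q : ℝ} (hq : 0 < q)
    (hr : (fun m => υ m / γ m) =Θ[atTop] fun m => (m : ℝ) ^ (-θ) * Real.exp (-(m : ℝ) ^ q)) :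
    (fun n => (k n : ℝ)) =Θ[atTop] fun n : ℕ => Real.log n ^ (1 / q) := by
  have h2 := IsTheta.rpow (r := 1 / q) (Eventually.of_forall fun n => by positivity)
    (Eventually.of_forall fun n : ℕ => Real.log_natCast_nonneg n)
    (dim_rpow_isTheta_log hγ hυ hk hκ hmono hanti hq hr)
  convert h2 using 2 with n
  rw [← Real.rpow_mul (by positivity), mul_one_div_cancel hq.ne', Real.rpow_one]

omit hγ hυ hk hκ in
/-- An iterated logarithmic correction does not change the order: `log (n (log n) ^ x) ∼ log n`. -/
lemma log_mul_log_rpow_isTheta (x : ℝ) {y : ℝ} :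
    (fun n : ℕ => Real.log n ^ y) =Θ[atTop] fun n : ℕ => Real.log (n * Real.log n ^ x) ^ y := by
  have hlog : Tendsto (fun n : ℕ => Real.log n) atTop atTop :=
    Real.tendsto_log_atTop.comp tendsto_natCast_atTop_atTop
  have h1 : (fun n : ℕ => Real.log (Real.log n)) =o[atTop] fun n : ℕ => Real.log n :=
    Real.isLittleO_log_id_atTop.comp_tendsto hlog
  have h2 : (fun n : ℕ => Real.log (n * Real.log n ^ x)) ~[atTop] fun n : ℕ => Real.log n := by
    refine IsLittleO.isEquivalent ((h1.const_mul_left x).congr' ?_ EventuallyEq.rfl)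
    filter_upwards [hlog.eventually_gt_atTop 0, eventually_ge_atTop 1] with n hn hn1
    have : (0 : ℝ) < n := by exact_mod_cast hn1
    rw [Pi.sub_apply, Real.log_mul this.ne' (by positivity), Real.log_rpow hn]
    ring
  refine IsTheta.rpow (Eventually.of_forall fun n : ℕ => Real.log_natCast_nonneg n) ?_ h2.isTheta.symm
  exact (h2.symm.tendsto_atTop hlog).eventually_ge_atTop 0

end Dimension

/-! #### Positivity of `κ` -/

section Kappa

variable {γ υ : ℕ → ℝ} {k : ℕ → ℕ}

/-- The hypothesis of `kappa_pos` is invariant under passing to a sequence of the same order. -/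
lemma ratio_step_of_sameOrder {r v : ℕ → ℝ} (h : SameOrder r v) {c : ℝ} (hc : 0 < c)
    (hv : ∀ m, 1 ≤ m → c * v m ≤ v (m + 1)) :
    ∃ c' : ℝ, 0 < c' ∧ ∀ m, 1 ≤ m → c' * r m ≤ r (m + 1) := by
  obtain ⟨C, hC, h⟩ := h
  have hC0 : 0 < C := by linarith
  refine ⟨c / C ^ 2, by positivity, fun m hm => ?_⟩
  have h1 := (h m hm).2
  have h2 := (h (m + 1) (by omega)).1
  have h3 := hv m hm
  calc c / C ^ 2 * r m ≤ c / C ^ 2 * (C * v m) := by gcongr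
    _ = c * v m / C := by field_simp
    _ ≤ v (m + 1) / C := by gcongr
    _ ≤ _ := h2

lemma SameOrder.div {u₁ v₁ u₂ v₂ : ℕ → ℝ} (h₁ : SameOrder u₁ v₁) (h₂ : SameOrder u₂ v₂)
    (hv₁ : ∀ j, 1 ≤ j → 0 < v₁ j) (hv₂ : ∀ j, 1 ≤ j → 0 < v₂ j) :
    SameOrder (fun j => u₁ j / u₂ j) fun j => v₁ j / v₂ j := by
  obtain ⟨C, hC, h₁⟩ := h₁
  obtain ⟨D, hD, h₂⟩ := h₂
  have hC0 : 0 < C := by linarith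
  have hD0 : 0 < D := by linarith
  refine ⟨C * D, by nlinarith, fun j hj => ?_⟩
  have a1 := hv₁ j hj
  have a2 := hv₂ j hj
  have b1 := h₁ j hj
  have b2 := h₂ j hj
  have c1 : 0 < v₁ j / C := by positivity
  have c2 : 0 < v₂ j / D := by positivity
  have c3 : 0 < u₂ j := c2.trans_le b2.1
  have c4 : 0 < u₁ j := c1.trans_le b1.1
  constructor
  · calc v₁ j / v₂ j / (C * D) = (v₁ j / C) / (D * v₂ j) := by field_simp
      _ ≤ u₁ j / u₂ j := div_le_div₀ c4.le b1.1 c3 b2.2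
  · calc u₁ j / u₂ j ≤ (C * v₁ j) / (v₂ j / D) := div_le_div₀ (by positivity) b1.2 c2 b2.1
      _ = C * D * (v₁ j / v₂ j) := by field_simp

lemma two_rpow_mul_le {θ : ℝ} (hθ : 0 ≤ θ) {m : ℕ} (hm : 1 ≤ m) :
    2 ^ (-θ) * (m : ℝ) ^ (-θ) ≤ ((m + 1 : ℕ) : ℝ) ^ (-θ) := by
  have hm0 : (0 : ℝ) < m := by exact_mod_cast hm
  rw [← Real.mul_rpow (by norm_num) hm0.le]
  refine Real.rpow_le_rpow_of_nonpos (by positivity) ?_ (by linarith)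
  exact_mod_cast (by omega : m + 1 ≤ 2 * m)

lemma kappa_pos_of_poly (hγ : IsWeight γ) (hυ : IsWeight υ) (hk : IsOptimalDim γ υ k) {θ : ℝ}
    (hθ : 0 < θ) (hr : SameOrder (fun m => υ m / γ m) fun m => (m : ℝ) ^ (-θ)) :
    0 < kappa γ υ k := by
  obtain ⟨c, hc, hstep⟩ := ratio_step_of_sameOrder hr (c := 2 ^ (-θ)) (by positivity)
    fun m hm => two_rpow_mul_le hθ.le hm
  refine kappa_pos hγ hυ hk ?_ hc hstep
  exact (hr.isTheta fun j _ => by positivity).1.trans_tendsto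
    ((tendsto_rpow_neg_atTop hθ).comp tendsto_natCast_atTop_atTop)

/-- For `q ≤ 1`, `(m + 1) ^ q ≤ m ^ q + 1`, so the exponential drops by at most a factor `e` in one
step.  (For `q > 1` the factor is unbounded and `κ` may vanish.) -/
lemma kappa_pos_of_exp (hγ : IsWeight γ) (hυ : IsWeight υ) (hk : IsOptimalDim γ υ k) {θ q : ℝ}
    (hθ : 0 ≤ θ) (hq : 0 < q) (hq1 : q ≤ 1)
    (hr : SameOrder (fun m => υ m / γ m) fun m => (m : ℝ) ^ (-θ) * Real.exp (-(m : ℝ) ^ q)) :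
    0 < kappa γ υ k := by
  obtain ⟨c, hc, hstep⟩ := ratio_step_of_sameOrder hr (c := 2 ^ (-θ) * Real.exp (-1))
    (by positivity) fun m hm => by
      have h1 := two_rpow_mul_le hθ hm
      have h2 : Real.exp (-1) * Real.exp (-(m : ℝ) ^ q) ≤ Real.exp (-((m + 1 : ℕ) : ℝ) ^ q) := by
        rw [← Real.exp_add, Real.exp_le_exp]
        have := Real.rpow_add_le_add_rpow (show (0 : ℝ) ≤ m by positivity) zero_le_one hq.le hq1
        rw [Real.one_rpow] at this
        push_cast
        linarith
      calc 2 ^ (-θ) * Real.exp (-1) * ((m : ℝ) ^ (-θ) * Real.exp (-(m : ℝ) ^ q))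
          = (2 ^ (-θ) * (m : ℝ) ^ (-θ)) * (Real.exp (-1) * Real.exp (-(m : ℝ) ^ q)) := by ring
        _ ≤ _ := by gcongr
  refine kappa_pos hγ hυ hk ?_ hc hstep
  refine (hr.isTheta fun j _ => by positivity).1.trans_tendsto ?_
  have h1 : Tendsto (fun m : ℕ => Real.exp (-(m : ℝ) ^ q)) atTop (nhds 0) :=
    Real.tendsto_exp_neg_atTop_nhds_zero.comp (tendsto_natCast_rpow hq)
  refine squeeze_zero' (Eventually.of_forall fun m => by positivity)
    ((eventually_ge_atTop 1).mono fun m hm => ?_) h1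
  refine mul_le_of_le_one_left (Real.exp_pos _).le ?_
  exact Real.rpow_le_one_of_one_le_of_nonpos (by exact_mod_cast hm) (by linarith)

end Kappa

/-! ### The order of `δ_n^*` and `Δ_n^*` -/

section Orders

variable {γ υ h ω : ℕ → ℝ} {k : ℕ → ℕ} {p a s q θ : ℝ}

lemma tendsto_log_natCast : Tendsto (fun n : ℕ => Real.log n) atTop atTop :=
  Real.tendsto_log_atTop.comp tendsto_natCast_atTop_atTop

lemma rpow_isTheta_of_poly (hθ : (fun n => (k n : ℝ)) =Θ[atTop] fun n : ℕ => (n : ℝ) ^ (1 / θ))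
    (r : ℝ) : (fun n => (k n : ℝ) ^ r) =Θ[atTop] fun n : ℕ => (n : ℝ) ^ (r / θ) := by
  have h2 := IsTheta.rpow (r := r) (Eventually.of_forall fun n => by positivity)
    (Eventually.of_forall fun n => by positivity) hθ
  convert h2 using 2 with n
  rw [← Real.rpow_mul (by positivity)]
  ring_nf

lemma rpow_isTheta_of_log (hθ : (fun n => (k n : ℝ)) =Θ[atTop] fun n : ℕ => Real.log n ^ (1 / q))
    (r : ℝ) : (fun n => (k n : ℝ) ^ r) =Θ[atTop] fun n : ℕ => Real.log n ^ (r / q) := by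
  have h2 := IsTheta.rpow (r := r) (Eventually.of_forall fun n => by positivity)
    (Eventually.of_forall fun n : ℕ => Real.rpow_nonneg (Real.log_natCast_nonneg n) _) hθ
  convert h2 using 2 with n
  rw [← Real.rpow_mul (Real.log_natCast_nonneg n)]
  ring_nf

/-- If `υ` is polynomial, the variance part is of the order of a sum of powers `j ^ (2a - 2s)`, as soon
as the order `g` of these sums is not affected by the index shift coming from windows. -/
lemma headSum_isTheta (hυ : IsWeight υ) (hanti : AntitoneOn υ (Set.Ici 1))
    (hυo : SameOrder υ fun j => (j : ℝ) ^ (-(2 * a))) (hu : UpperOrder h s) (hw : WindowOrder h s)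
    {g : ℕ → ℝ} (hg : powerSum (2 * a - 2 * s) =Θ[atTop] g)
    (hgs : (fun m => g (m - 4)) =Θ[atTop] g) : headSum υ h =Θ[atTop] g := by
  obtain ⟨C, hC, h1⟩ := headSum_le_powerSum hυ hυo hu
  obtain ⟨D, hD, h2⟩ := powerSum_le_headSum hυ hanti hυo hw
  refine ⟨?_, ?_⟩
  · exact (isBigO_of_le_mul (Eventually.of_forall fun m => ⟨headSum_nonneg hυ m, h1 m⟩)).trans hg.1
  · refine (hgs.2.trans (isTheta_comp_tendsto hg (tendsto_sub_atTop_nat 4)).2).trans ?_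
    exact isBigO_of_le_mul (Eventually.of_forall fun m => ⟨powerSum_nonneg _ _, h2 m⟩)

lemma natCast_sub_rpow_isTheta (c : ℕ) (r : ℝ) :
    (fun m : ℕ => ((m - c : ℕ) : ℝ) ^ r) =Θ[atTop] fun m : ℕ => (m : ℝ) ^ r :=
  IsTheta.rpow (Eventually.of_forall fun m => by positivity)
    (Eventually.of_forall fun m => by positivity) (natCast_sub_isTheta c)

lemma natCast_sub_log_isTheta (c : ℕ) :
    (fun m : ℕ => Real.log ((m - c : ℕ) : ℝ)) =Θ[atTop] fun m : ℕ => Real.log m :=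
  isTheta_log ((eventually_gt_atTop c).mono fun m hm => by exact_mod_cast (by omega : 0 < m - c))
    tendsto_natCast_atTop_atTop (natCast_sub_isTheta c)

section HeadTail

variable (hγ : IsWeight γ) (hυ : IsWeight υ) (hk : IsOptimalDim γ υ k) (hκ : 0 < kappa γ υ k)

include hγ hυ hk hκ

lemma alphaStar_mul_headSum_isTheta :
    (fun n => alphaStar γ υ k n * headSum υ h (k n)) =Θ[atTop]
      fun n : ℕ => (n : ℝ)⁻¹ * headSum υ h (k n) :=
  (alphaStar_isTheta hγ hυ hk hκ).mul (isTheta_refl _ _)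

lemma deltaStar_isBigO {rate : ℕ → ℝ}
    (hH : (fun n : ℕ => (n : ℝ)⁻¹ * headSum υ h (k n)) =O[atTop] rate)
    (hT : (fun n => tailSum γ h (k n)) =O[atTop] rate) :
    (fun n => deltaStar γ υ k h n) =O[atTop] rate := by
  have h1 := (alphaStar_mul_headSum_isTheta hγ hυ hk hκ).1.trans hH
  refine IsBigO.trans (isBigO_of_le_mul (C := 1) (Eventually.of_forall fun n =>
    ⟨deltaStar_nonneg hγ h n, ?_⟩)) (h1.add hT)
  rw [one_mul]
  have h2 : 0 ≤ alphaStar γ υ k n * headSum υ h (k n) :=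
    mul_nonneg (le_max_of_le_right (by positivity)) (headSum_nonneg hυ _)
  exact max_le (le_add_of_nonneg_right (tailSum_nonneg hγ _)) (le_add_of_nonneg_left h2)

lemma headSum_isBigO_deltaStar :
    (fun n : ℕ => (n : ℝ)⁻¹ * headSum υ h (k n)) =O[atTop] fun n => deltaStar γ υ k h n := by
  refine (alphaStar_mul_headSum_isTheta hγ hυ hk hκ).2.trans ?_
  refine isBigO_of_le_mul (C := 1) (Eventually.of_forall fun n => ⟨?_, ?_⟩)
  · exact mul_nonneg (le_max_of_le_right (by positivity)) (headSum_nonneg hυ _)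
  · rw [one_mul]
    exact headSum_mul_le_deltaStar h n

omit hυ hk hκ in
lemma tailSum_isBigO_deltaStar :
    (fun n => tailSum γ h (k n)) =O[atTop] fun n => deltaStar γ υ k h n :=
  isBigO_of_le_mul (C := 1) (Eventually.of_forall fun n =>
    ⟨tailSum_nonneg hγ _, by rw [one_mul]; exact tailSum_le_deltaStar h n⟩)

lemma deltaStar_isTheta_of_head {rate : ℕ → ℝ}
    (hH : (fun n : ℕ => (n : ℝ)⁻¹ * headSum υ h (k n)) =Θ[atTop] rate)
    (hT : (fun n => tailSum γ h (k n)) =O[atTop] rate) :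
    (fun n => deltaStar γ υ k h n) =Θ[atTop] rate :=
  ⟨deltaStar_isBigO hγ hυ hk hκ hH.1 hT, hH.2.trans (headSum_isBigO_deltaStar hγ hυ hk hκ)⟩

lemma deltaStar_isTheta_of_tail {rate : ℕ → ℝ}
    (hH : (fun n : ℕ => (n : ℝ)⁻¹ * headSum υ h (k n)) =O[atTop] rate)
    (hT : (fun n => tailSum γ h (k n)) =Θ[atTop] rate) :
    (fun n => deltaStar γ υ k h n) =Θ[atTop] rate :=
  ⟨deltaStar_isBigO hγ hυ hk hκ hH hT.1, hT.2.trans (tailSum_isBigO_deltaStar hγ)⟩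

/-- If `G m` is of the order of `max_{j ≤ m} 1 / (υ_j ω_j)`, then `Δ_n^*` is of the order
`G (k_n) / n`. -/
lemma DeltaStar_isTheta (hω : IsWeight ω) {G : ℕ → ℝ} {C : ℝ}
    (h1 : ∀ m, 1 ≤ m → ∀ j ∈ Icc 1 m, 1 / (υ j * ω j) ≤ C * G m)
    (h2 : ∀ m, 1 ≤ m → ∃ j ∈ Icc 1 m, G m ≤ C * (1 / (υ j * ω j)))
    (hG : ∀ m, 1 ≤ m → 0 ≤ G m) :
    (fun n => DeltaStar γ υ k ω n) =Θ[atTop] fun n : ℕ => (n : ℝ)⁻¹ * G (k n) := by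
  refine IsTheta.trans ?_ ((alphaStar_isTheta hγ hυ hk hκ).mul (isTheta_refl (fun n => G (k n)) _))
  have hα : ∀ n, 0 ≤ alphaStar γ υ k n := fun n => le_max_of_le_right (by positivity)
  constructor
  · refine isBigO_of_le_mul (C := C) ((eventually_ge_atTop 1).mono fun n hn => ?_)
    obtain ⟨j, hj, hjeq⟩ := exists_DeltaStar_eq (γ := γ) (υ := υ) (ω := ω) (hk n hn).1
    rw [hjeq]
    have a1 := hυ.2 j hj.1
    have a2 := hω.2 j hj.1
    refine ⟨mul_nonneg (by positivity) (hα n), ?_⟩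
    have := mul_le_mul_of_nonneg_right (h1 _ (hk n hn).1 j hj) (hα n)
    linarith
  · refine isBigO_of_le_mul (C := C) ((eventually_ge_atTop 1).mono fun n hn => ?_)
    obtain ⟨j, hj, hjle⟩ := h2 _ (hk n hn).1
    refine ⟨mul_nonneg (hα n) (hG _ (hk n hn).1), ?_⟩
    have a1 := hυ.2 j hj.1
    have a2 := hω.2 j hj.1
    have hC : 0 ≤ C := by
      by_contra! hcon
      have b1 : 0 < 1 / (υ j * ω j) := by positivity
      have b2 := hG _ (hk n hn).1
      nlinarith
    calc alphaStar γ υ k n * G (k n) ≤ alphaStar γ υ k n * (C * (1 / (υ j * ω j))) :=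
          mul_le_mul_of_nonneg_left hjle (hα n)
      _ = C * (1 / (υ j * ω j) * alphaStar γ υ k n) := by ring
      _ ≤ _ := mul_le_mul_of_nonneg_left (le_DeltaStar hj) hC

end HeadTail

/-! #### The sample size dominates the dimension -/

/-- For dimensions of logarithmic order the exponent `3` suffices: up to powers of `log n`, the left
side is `n ^ (-1/2)`. -/
lemma exists_sample_bound_of_log
    (hθ : (fun n => (k n : ℝ)) =Θ[atTop] fun n : ℕ => Real.log n ^ (1 / q)) :
    ∃ C₀ : ℝ, ∀ n : ℕ, 1 ≤ n → √n * n ^ 2 * ((k n : ℝ) ^ 2 / n) ^ 3 ≤ C₀ := by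
  have h1 := (rpow_isTheta_of_log hθ 6).1
  have h2 : (fun n : ℕ => Real.log n ^ (6 / q)) =o[atTop] fun n : ℕ => (n : ℝ) ^ (1 / 2 : ℝ) :=
    (isLittleO_log_rpow_rpow_atTop (6 / q) (by norm_num)).comp_tendsto tendsto_natCast_atTop_atTop
  have h3 : (fun n : ℕ => √n * n ^ 2 * ((k n : ℝ) ^ 2 / n) ^ 3) =O[atTop] fun _ => (1 : ℝ) := by
    have h4 := (h1.trans h2.isBigO).mul (isBigO_refl (fun n : ℕ => (n : ℝ) ^ (-(1 / 2) : ℝ)) atTop)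
    refine h4.congr' ?_ ?_
    · filter_upwards [eventually_ge_atTop 1] with n hn
      have hn0 : (0 : ℝ) < n := by exact_mod_cast hn
      have e : (n : ℝ) ^ (-(1 / 2) : ℝ) = √n / n := by
        rw [Real.sqrt_eq_rpow, ← Real.rpow_sub_one hn0.ne']; norm_num
      have e6 : (k n : ℝ) ^ (6 : ℝ) = (k n : ℝ) ^ 6 := by norm_cast
      rw [e, e6]
      field_simp
    · filter_upwards [eventually_ge_atTop 1] with n hn
      have hn0 : (0 : ℝ) < n := by exact_mod_cast hn
      rw [← Real.rpow_add hn0]; norm_num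
  obtain ⟨C, hC⟩ := isBigO_one_nat_atTop_iff.1 h3
  exact ⟨C, fun n _ => (le_abs_self _).trans (hC n)⟩

/-- For dimensions of the order `n ^ (1/θ)` with `θ ≥ 3` the exponent `8` suffices, since
`16 / θ ≤ 16 / 3 ≤ 8 - 5 / 2`. -/
lemma exists_sample_bound_of_poly (hθ3 : 3 ≤ θ)
    (hθ : (fun n => (k n : ℝ)) =Θ[atTop] fun n : ℕ => (n : ℝ) ^ (1 / θ)) :
    ∃ C₀ : ℝ, ∀ n : ℕ, 1 ≤ n → √n * n ^ 2 * ((k n : ℝ) ^ 2 / n) ^ 8 ≤ C₀ := by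
  have h1 := (rpow_isTheta_of_poly hθ 16).1
  have h2 : (fun n : ℕ => (n : ℝ) ^ (16 / θ)) =O[atTop] fun n : ℕ => (n : ℝ) ^ (11 / 2 : ℝ) := by
    refine isBigO_of_le_mul (C := 1) ((eventually_ge_atTop 1).mono fun n hn => ⟨by positivity, ?_⟩)
    rw [one_mul]
    refine Real.rpow_le_rpow_of_exponent_le (by exact_mod_cast hn) ?_
    rw [div_le_iff₀ (by linarith)]
    linarith
  have h3 : (fun n : ℕ => √n * n ^ 2 * ((k n : ℝ) ^ 2 / n) ^ 8) =O[atTop] fun _ => (1 : ℝ) := by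
    have h4 := (h1.trans h2).mul (isBigO_refl (fun n : ℕ => (n : ℝ) ^ (-(11 / 2) : ℝ)) atTop)
    refine h4.congr' ?_ ?_
    · filter_upwards [eventually_ge_atTop 1] with n hn
      have hn0 : (0 : ℝ) < n := by exact_mod_cast hn
      have e : (n : ℝ) ^ (-(11 / 2) : ℝ) = √n / n ^ 6 := by
        rw [Real.sqrt_eq_rpow, ← Real.rpow_natCast, ← Real.rpow_sub hn0]; norm_num
      have e6 : (k n : ℝ) ^ (16 : ℝ) = (k n : ℝ) ^ 16 := by norm_cast
      rw [e, e6]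
      field_simp
    · filter_upwards [eventually_ge_atTop 1] with n hn
      have hn0 : (0 : ℝ) < n := by exact_mod_cast hn
      rw [← Real.rpow_add hn0]; norm_num
  obtain ⟨C, hC⟩ := isBigO_one_nat_atTop_iff.1 h3
  exact ⟨C, fun n _ => (le_abs_self _).trans (hC n)⟩

/-! #### Orders for each type of sequence -/

section Cases

variable (hγ : IsWeight γ) (hυ : IsWeight υ) (hk : IsOptimalDim γ υ k) (hκ : 0 < kappa γ υ k)
  (hlim : Tendsto k atTop atTop)

include hγ hυ hk hκ hlim

omit hγ hκ in
/-- Polynomial `υ`: the order of the variance part of `δ_n^*`, where the dimension is of order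
`g n`. -/
lemma head_isTheta_of_poly (hanti : AntitoneOn υ (Set.Ici 1))
    (hυo : SameOrder υ fun j => (j : ℝ) ^ (-(2 * a))) (hu : UpperOrder h s) (hw : WindowOrder h s)
    {g : ℕ → ℝ} (hg : Tendsto g atTop atTop) (hkg : (fun n => (k n : ℝ)) =Θ[atTop] g) :
    (s - a < 1 / 2 → (fun n => headSum υ h (k n)) =Θ[atTop] fun n => g n ^ (2 * a - 2 * s + 1)) ∧
    (s - a = 1 / 2 → (fun n => headSum υ h (k n)) =Θ[atTop] fun n => Real.log (g n)) ∧
    (1 / 2 < s - a → (fun n => headSum υ h (k n)) =Θ[atTop] fun _ => (1 : ℝ)) := by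
  refine ⟨fun hs => ?_, fun hs => ?_, fun hs => ?_⟩
  · have h1 := headSum_isTheta hυ hanti hυo hu hw
      (powerSum_isTheta_rpow (r := 2 * a - 2 * s) (by linarith)) (natCast_sub_rpow_isTheta 4 _)
    exact (isTheta_comp_tendsto h1 hlim).trans (IsTheta.rpow
      (Eventually.of_forall fun n => by positivity) (hg.eventually_ge_atTop 0) hkg)
  · have h0 : powerSum (2 * a - 2 * s) =Θ[atTop] fun m => Real.log m := by
      rw [show 2 * a - 2 * s = -1 by linarith]; exact powerSum_isTheta_log
    have h1 := headSum_isTheta hυ hanti hυo hu hw h0 (natCast_sub_log_isTheta 4)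
    refine (isTheta_comp_tendsto h1 hlim).trans (isTheta_log ?_ hg hkg)
    filter_upwards [eventually_ge_atTop 1] with n hn
    exact_mod_cast (hk n hn).1
  · have h1 := headSum_isTheta hυ hanti hυo hu hw
      (powerSum_isTheta_one (r := 2 * a - 2 * s) (by linarith)) (isTheta_refl _ _)
    exact isTheta_comp_tendsto h1 hlim

/-- Polynomial `γ` and `υ`: the variance part dominates, or is of the order of the bias part. -/
lemma deltaStar_isTheta_ppp (ha : 0 < a) (hp : 0 ≤ p) (hanti : AntitoneOn υ (Set.Ici 1))
    (hγo : SameOrder γ fun j => (j : ℝ) ^ (2 * p)) (hυo : SameOrder υ fun j => (j : ℝ) ^ (-(2 * a)))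
    (hu : UpperOrder h s) (hw : WindowOrder h s) (hs : 1 < 2 * s + 2 * p)
    (hθ : (fun n => (k n : ℝ)) =Θ[atTop] fun n : ℕ => (n : ℝ) ^ (1 / (2 * p + 2 * a))) :
    (fun n => deltaStar γ υ k h n) =Θ[atTop] ratePPP p a s := by
  have hpa : 0 < 2 * p + 2 * a := by linarith
  have hg : Tendsto (fun n : ℕ => (n : ℝ) ^ (1 / (2 * p + 2 * a))) atTop atTop :=
    tendsto_natCast_rpow (by positivity)
  obtain ⟨h1, h2, h3⟩ := head_isTheta_of_poly hυ hk hlim hanti hυo hu hw hg hθ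
  obtain ⟨-, C, hC, hT⟩ := isRepresenter_of_poly hγ hγo hu hs
  have hT' : (fun n => tailSum γ h (k n)) =O[atTop]
      fun n : ℕ => (n : ℝ) ^ ((1 - 2 * s - 2 * p) / (2 * p + 2 * a)) :=
    (isBigO_of_le_mul ((eventually_ge_atTop 1).mono fun n hn =>
      ⟨tailSum_nonneg hγ _, hT _ (hk n hn).1⟩)).trans (rpow_isTheta_of_poly hθ _).1
  have hn : (fun n : ℕ => (n : ℝ)⁻¹) =Θ[atTop] fun n : ℕ => (n : ℝ)⁻¹ := isTheta_refl _ _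
  rcases lt_trichotomy (s - a) (1 / 2) with hsa | hsa | hsa
  · have e : ratePPP p a s = fun n : ℕ => (n : ℝ) ^ (-(2 * p + 2 * s - 1) / (2 * p + 2 * a)) := by
      ext n; rw [ratePPP, if_pos hsa]
    rw [e]
    refine deltaStar_isTheta_of_head hγ hυ hk hκ ((hn.mul (h1 hsa)).trans_eventuallyEq ?_) ?_
    · filter_upwards [eventually_ge_atTop 1] with n hn
      have hn0 : (0 : ℝ) < n := by exact_mod_cast hn
      rw [← Real.rpow_mul hn0.le, ← Real.rpow_neg_one, ← Real.rpow_add hn0]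
      congr 1
      field_simp
      ring
    · convert hT' using 4
      ring
  · have e : ratePPP p a s = fun n : ℕ => (n : ℝ)⁻¹ * Real.log n := by
      ext n; rw [ratePPP, if_neg (by linarith), if_pos hsa]
    rw [e]
    have hlog : (fun n : ℕ => Real.log ((n : ℝ) ^ (1 / (2 * p + 2 * a)))) =Θ[atTop]
        fun n : ℕ => Real.log n := by
      have : (fun n : ℕ => 1 / (2 * p + 2 * a) * Real.log n) =Θ[atTop] fun n : ℕ => Real.log n :=
        (isTheta_const_mul_left (by positivity)).2 (isTheta_refl _ _)
      refine IsTheta.trans (EventuallyEq.isTheta ?_) this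
      filter_upwards [eventually_ge_atTop 1] with n hn
      rw [Real.log_rpow (by exact_mod_cast hn)]
    refine deltaStar_isTheta_of_head hγ hυ hk hκ (hn.mul ((h2 hsa).trans hlog)) (hT'.trans ?_)
    have e2 : (1 - 2 * s - 2 * p) / (2 * p + 2 * a) = -1 := by
      rw [div_eq_iff hpa.ne']; linarith
    rw [e2]
    refine isBigO_of_le_mul (C := 1) ?_
    filter_upwards [tendsto_log_natCast.eventually_ge_atTop 1] with n hn
    rw [Real.rpow_neg_one, one_mul]
    exact ⟨by positivity, le_mul_of_one_le_right (by positivity) hn⟩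
  · have e : ratePPP p a s = fun n : ℕ => (n : ℝ)⁻¹ := by
      ext n; rw [ratePPP, if_neg (by linarith), if_neg hsa.ne']
    rw [e]
    refine deltaStar_isTheta_of_head hγ hυ hk hκ ?_ (hT'.trans ?_)
    · simpa using hn.mul (h3 hsa)
    · refine isBigO_of_le_mul (C := 1) ((eventually_ge_atTop 1).mono fun n hn => ⟨by positivity, ?_⟩)
      rw [one_mul, ← Real.rpow_neg_one]
      refine Real.rpow_le_rpow_of_exponent_le (by exact_mod_cast hn) ?_
      rw [div_le_iff₀ hpa]
      linarith

/-- If the squared coefficients of `h` are small, the parametric rate `1 / n` is attained. -/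
lemma deltaStar_isTheta_inv (ha : 0 < a) (hp : 0 ≤ p)
    (hγo : SameOrder γ fun j => (j : ℝ) ^ (2 * p)) (hυo : SameOrder υ fun j => (j : ℝ) ^ (-(2 * a)))
    (hu : UpperOrder h s) (hs : 1 < 2 * s + 2 * p) (hsa : 1 / 2 < s - a) (h1 : 0 < h 1 ^ 2)
    (hθ : (fun n => (k n : ℝ)) =Θ[atTop] fun n : ℕ => (n : ℝ) ^ (1 / (2 * p + 2 * a))) :
    (fun n => deltaStar γ υ k h n) =Θ[atTop] fun n : ℕ => (n : ℝ)⁻¹ := by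
  have hpa : 0 < 2 * p + 2 * a := by linarith
  obtain ⟨-, C, hC, hT⟩ := isRepresenter_of_poly hγ hγo hu hs
  have hT' : (fun n => tailSum γ h (k n)) =O[atTop]
      fun n : ℕ => (n : ℝ) ^ ((1 - 2 * s - 2 * p) / (2 * p + 2 * a)) :=
    (isBigO_of_le_mul ((eventually_ge_atTop 1).mono fun n hn =>
      ⟨tailSum_nonneg hγ _, hT _ (hk n hn).1⟩)).trans (rpow_isTheta_of_poly hθ _).1
  obtain ⟨D, hD, hH⟩ := headSum_le_powerSum hυ hυo hu
  have hH1 : headSum υ h =Θ[atTop] fun _ => (1 : ℝ) := by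
    refine ⟨(isBigO_of_le_mul (Eventually.of_forall fun m => ⟨headSum_nonneg hυ m, hH m⟩)).trans
      (powerSum_isTheta_one (by linarith)).1, ?_⟩
    refine isBigO_of_le_mul (C := (h 1 ^ 2)⁻¹) ((eventually_ge_atTop 1).mono fun m hm =>
      ⟨zero_le_one, ?_⟩)
    rw [inv_mul_eq_div, one_le_div₀ h1]
    have := Finset.single_le_sum (f := fun i => h i ^ 2 / υ i) (s := Finset.Icc 1 m) (fun i hi => by
      have := hυ.2 i (Finset.mem_Icc.1 hi).1
      positivity) (Finset.mem_Icc.2 ⟨le_rfl, hm⟩)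
    simp only [hυ.1, div_one] at this
    exact this
  refine deltaStar_isTheta_of_head hγ hυ hk hκ ?_ (hT'.trans ?_)
  · simpa using (isTheta_refl (fun n : ℕ => (n : ℝ)⁻¹) atTop).mul (isTheta_comp_tendsto hH1 hlim)
  · refine isBigO_of_le_mul (C := 1) ((eventually_ge_atTop 1).mono fun n hn => ⟨by positivity, ?_⟩)
    rw [one_mul, ← Real.rpow_neg_one]
    refine Real.rpow_le_rpow_of_exponent_le (by exact_mod_cast hn) ?_
    rw [div_le_iff₀ hpa]
    linarith

/-- Polynomial `γ` and exponential `υ`: the bias part dominates, or is of the order of the variance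
part. -/
lemma deltaStar_isTheta_pep (hq : 0 < q) (hp : 0 ≤ p)
    (hγo : SameOrder γ fun j => (j : ℝ) ^ (2 * p))
    (hυo : SameOrder υ fun j => Real.exp (-(j : ℝ) ^ q))
    (hu : UpperOrder h s) (hw : WindowOrder h s) (hs : 1 < 2 * s + 2 * p)
    (hr : (fun m => υ m / γ m) =Θ[atTop] fun m => (m : ℝ) ^ (-(2 * p)) * Real.exp (-(m : ℝ) ^ q))
    (hθ : (fun n => (k n : ℝ)) =Θ[atTop] fun n : ℕ => Real.log n ^ (1 / q)) :
    (fun n => deltaStar γ υ k h n) =Θ[atTop]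
      fun n : ℕ => Real.log n ^ (-(2 * p + 2 * s - 1) / q) := by
  obtain ⟨hrep, C, hC, hT⟩ := isRepresenter_of_poly hγ hγo hu hs
  obtain ⟨D, hD, hT2⟩ := rpow_le_tailSum hγ hγo hp hw (by linarith) hrep
  obtain ⟨E, hE, hH⟩ := headSum_le_of_exp hυ hq hυo hu
  have hrate := rpow_isTheta_of_log hθ (1 - 2 * s - 2 * p)
  rw [show 1 - 2 * s - 2 * p = -(2 * p + 2 * s - 1) by ring] at hrate
  have hrate' : (fun n => (k n : ℝ) ^ (1 - 2 * s - 2 * p)) =Θ[atTop]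
      fun n : ℕ => Real.log n ^ (-(2 * p + 2 * s - 1) / q) := by
    rw [show 1 - 2 * s - 2 * p = -(2 * p + 2 * s - 1) by ring]; exact hrate
  refine deltaStar_isTheta_of_tail hγ hυ hk hκ ?_ (IsTheta.trans ⟨?_, ?_⟩ hrate')
  · refine IsBigO.trans ?_ hrate'.1
    have h1 : (fun n : ℕ => (n : ℝ)⁻¹) =O[atTop]
        fun n => (k n : ℝ) ^ (-(2 * p)) * Real.exp (-(k n : ℝ) ^ q) :=
      ((ratio_isTheta hγ hυ hk hκ).symm.trans (isTheta_comp_tendsto hr hlim)).1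
    have h2 : (fun n => headSum υ h (k n)) =O[atTop]
        fun n => (k n : ℝ) ^ (1 - 2 * s) * Real.exp ((k n : ℝ) ^ q) :=
      isBigO_of_le_mul ((eventually_ge_atTop 1).mono fun n hn =>
        ⟨headSum_nonneg hυ _, hH _ (hk n hn).1⟩)
    refine (h1.mul h2).trans_eventuallyEq ?_
    filter_upwards [eventually_ge_atTop 1] with n hn
    have hk0 : (0 : ℝ) < k n := by exact_mod_cast (hk n hn).1
    rw [show 1 - 2 * s - 2 * p = -(2 * p) + (1 - 2 * s) by ring, Real.rpow_add hk0, Real.exp_neg]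
    field_simp
  · exact isBigO_of_le_mul ((eventually_ge_atTop 1).mono fun n hn =>
      ⟨tailSum_nonneg hγ _, hT _ (hk n hn).1⟩)
  · exact isBigO_of_le_mul ((eventually_ge_atTop 1).mono fun n hn =>
      ⟨by positivity, hT2 _ (hk n hn).1⟩)

/-- Exponential `γ` and polynomial `υ`: the variance part dominates, or is of the order of the bias
part. -/
lemma deltaStar_isTheta_epp (hp : 0 < p) (hanti : AntitoneOn υ (Set.Ici 1))
    (hγo : SameOrder γ fun j => Real.exp ((j : ℝ) ^ (2 * p)))
    (hυo : SameOrder υ fun j => (j : ℝ) ^ (-(2 * a)))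
    (hu : UpperOrder h s) (hw : WindowOrder h s)
    (hr : (fun m => υ m / γ m) =Θ[atTop]
      fun m => (m : ℝ) ^ (-(2 * a)) * Real.exp (-(m : ℝ) ^ (2 * p)))
    (hθ : (fun n => (k n : ℝ)) =Θ[atTop] fun n : ℕ => Real.log n ^ (1 / (2 * p))) :
    (fun n => deltaStar γ υ k h n) =Θ[atTop] rateEPP p a s := by
  have hp2 : 0 < 2 * p := by linarith
  have hg : Tendsto (fun n : ℕ => Real.log n ^ (1 / (2 * p))) atTop atTop :=
    (tendsto_rpow_atTop (by positivity)).comp tendsto_log_natCast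
  obtain ⟨h1, h2, h3⟩ := head_isTheta_of_poly hυ hk hlim hanti hυo hu hw hg hθ
  obtain ⟨-, C, hC, hT⟩ := isRepresenter_of_exp hγ hp2 hγo hu
  have hn : (fun n : ℕ => (n : ℝ)⁻¹) =Θ[atTop] fun n : ℕ => (n : ℝ)⁻¹ := isTheta_refl _ _
  have hT1 : (fun n => tailSum γ h (k n)) =O[atTop]
      fun n : ℕ => (n : ℝ)⁻¹ * Real.log n ^ ((2 * a - 2 * s + 1) / (2 * p)) := by
    have a1 : (fun n => (k n : ℝ) ^ (-(2 * a)) * Real.exp (-(k n : ℝ) ^ (2 * p))) =O[atTop]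
        fun n : ℕ => (n : ℝ)⁻¹ :=
      ((ratio_isTheta hγ hυ hk hκ).symm.trans (isTheta_comp_tendsto hr hlim)).2
    refine IsBigO.trans ?_ (a1.mul (rpow_isTheta_of_log hθ (2 * a - 2 * s + 1)).1)
    refine isBigO_of_le_mul (C := C) ((eventually_ge_atTop 1).mono fun n hn =>
      ⟨tailSum_nonneg hγ _, (hT _ (hk n hn).1).trans (le_of_eq ?_)⟩)
    have hk0 : (0 : ℝ) < k n := by exact_mod_cast (hk n hn).1
    rw [show 1 - 2 * s = -(2 * a) + (2 * a - 2 * s + 1) by ring, Real.rpow_add hk0]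
    ring
  rcases lt_trichotomy (s - a) (1 / 2) with hsa | hsa | hsa
  · have e : rateEPP p a s
        = fun n : ℕ => (n : ℝ)⁻¹ * Real.log n ^ ((2 * a - 2 * s + 1) / (2 * p)) := by
      ext n; rw [rateEPP, if_pos hsa]
    rw [e]
    refine deltaStar_isTheta_of_head hγ hυ hk hκ ((hn.mul (h1 hsa)).trans_eventuallyEq ?_) hT1
    filter_upwards [eventually_ge_atTop 1] with n hn
    rw [← Real.rpow_mul (Real.log_natCast_nonneg n)]
    congr 2
    ring
  · have e : rateEPP p a s = fun n : ℕ => (n : ℝ)⁻¹ * Real.log (Real.log n) := by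
      ext n; rw [rateEPP, if_neg (by linarith), if_pos hsa]
    rw [e]
    have hlog : (fun n : ℕ => Real.log (Real.log n ^ (1 / (2 * p)))) =Θ[atTop]
        fun n : ℕ => Real.log (Real.log n) := by
      have : (fun n : ℕ => 1 / (2 * p) * Real.log (Real.log n)) =Θ[atTop]
          fun n : ℕ => Real.log (Real.log n) :=
        (isTheta_const_mul_left (by positivity)).2 (isTheta_refl _ _)
      refine IsTheta.trans (EventuallyEq.isTheta ?_) this
      filter_upwards [tendsto_log_natCast.eventually_gt_atTop 0] with n hn
      rw [Real.log_rpow hn]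
    refine deltaStar_isTheta_of_head hγ hυ hk hκ (hn.mul ((h2 hsa).trans hlog))
      (hT1.trans (IsBigO.mul (isBigO_refl _ _) ?_))
    rw [show 2 * a - 2 * s + 1 = 0 by linarith, zero_div]
    simp only [Real.rpow_zero]
    exact (isLittleO_one_of_tendsto (Real.tendsto_log_atTop.comp tendsto_log_natCast)).isBigO
  · have e : rateEPP p a s = fun n : ℕ => (n : ℝ)⁻¹ := by
      ext n; rw [rateEPP, if_neg (by linarith), if_neg hsa.ne']
    rw [e]
    refine deltaStar_isTheta_of_head hγ hυ hk hκ ?_ (hT1.trans ?_)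
    · simpa using hn.mul (h3 hsa)
    · refine isBigO_of_le_mul (C := 1) ?_
      filter_upwards [tendsto_log_natCast.eventually_ge_atTop 1] with n hn
      refine ⟨by positivity, ?_⟩
      rw [one_mul]
      refine mul_le_of_le_one_right (by positivity) ?_
      exact Real.rpow_le_one_of_one_le_of_nonpos hn
        (div_nonpos_of_nonpos_of_nonneg (by linarith) hp2.le)

end Cases

end Orders

/-! #### Calculus of sequences of the same order -/

section SameOrder

variable {u u' v v' : ℕ → ℝ}

lemma SameOrder.congr (h : SameOrder u v) (hu : ∀ j, 1 ≤ j → u j = u' j)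
    (hv : ∀ j, 1 ≤ j → v j = v' j) : SameOrder u' v' := by
  obtain ⟨C, hC, h⟩ := h
  exact ⟨C, hC, fun j hj => by rw [← hu j hj, ← hv j hj]; exact h j hj⟩

lemma SameOrder.inv (h : SameOrder u v) (hv : ∀ j, 1 ≤ j → 0 < v j) :
    SameOrder (fun j => (u j)⁻¹) fun j => (v j)⁻¹ := by
  have h1 : SameOrder (fun _ => (1 : ℝ)) fun _ => 1 := ⟨1, le_rfl, fun j _ => by simp⟩
  exact (h1.div h (fun _ _ => one_pos) hv).congr (fun j _ => one_div _) (fun j _ => one_div _)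

lemma SameOrder.mul (h : SameOrder u v) (h' : SameOrder u' v') (hv : ∀ j, 1 ≤ j → 0 < v j)
    (hv' : ∀ j, 1 ≤ j → 0 < v' j) : SameOrder (fun j => u j * u' j) fun j => v j * v' j :=
  (h.div (h'.inv hv') hv fun j hj => inv_pos.2 (hv' j hj)).congr (fun j _ => by simp)
    (fun j _ => by simp)

/-- A sequence of the same order as one that is increasing up to a constant has this property. -/
lemma SameOrder.exists_le_mul (h : SameOrder u v) {D : ℝ} (hD : 1 ≤ D)
    (hv : ∀ m j : ℕ, 1 ≤ m → m ≤ j → v m ≤ D * v j) :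
    ∃ C : ℝ, 1 ≤ C ∧ ∀ m j : ℕ, 1 ≤ m → m ≤ j → u m ≤ C * u j := by
  obtain ⟨C, hC, h⟩ := h
  have hC0 : 0 < C := by linarith
  refine ⟨C * (D * C), ?_, fun m j hm hmj => ?_⟩
  · exact one_le_mul_of_one_le_of_one_le hC (one_le_mul_of_one_le_of_one_le hD hC)
  · have h1 := (h j (hm.trans hmj)).1
    rw [div_le_iff₀ hC0] at h1
    calc u m ≤ C * v m := (h m hm).2
      _ ≤ C * (D * v j) := by gcongr; exact hv m j hm hmj
      _ ≤ C * (D * (u j * C)) := by gcongr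
      _ = _ := by ring

lemma natCast_rpow_le {r : ℝ} (hr : 0 ≤ r) {m j : ℕ} (hmj : m ≤ j) :
    (m : ℝ) ^ r ≤ 1 * (j : ℝ) ^ r := by
  rw [one_mul]
  gcongr

/-- An exponentially decreasing sequence is at most of any polynomial order. -/
lemma upperOrder_of_exp {h : ℕ → ℝ} {q : ℝ} (hq : 0 < q)
    (hh : SameOrder (fun j => h j ^ 2) fun j => Real.exp (-(j : ℝ) ^ q)) (s : ℝ) :
    UpperOrder h s := by
  obtain ⟨C, hC, hh⟩ := hh
  obtain ⟨D, hD, hkey⟩ := exists_rpow_mul_exp_le (2 * s) hq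
  refine ⟨C * D, by positivity, fun j hj => ?_⟩
  have hj0 : (0 : ℝ) < j := by exact_mod_cast hj
  have h1 := hkey 1 j le_rfl hj
  have h2 : (j : ℝ) ^ (2 * s) * Real.exp (-(j : ℝ) ^ q) ≤ D := by
    refine h1.trans (mul_le_of_le_one_right (by linarith) ?_)
    simp
  calc h j ^ 2 ≤ C * Real.exp (-(j : ℝ) ^ q) := (hh j hj).2
    _ = C * (((j : ℝ) ^ (2 * s) * Real.exp (-(j : ℝ) ^ q)) * (j : ℝ) ^ (-(2 * s))) := by
        rw [Real.rpow_neg hj0.le]; field_simp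
    _ ≤ C * (D * (j : ℝ) ^ (-(2 * s))) := by gcongr
    _ = _ := by ring

end SameOrder

section Uniform

variable {γ υ ω : ℕ → ℝ} {k : ℕ → ℕ} {p a s q : ℝ}

lemma isTheta_max {f f' g : ℕ → ℝ} (h : f =Θ[atTop] f') (hf : ∀ n, 0 ≤ f n) (hf' : ∀ n, 0 ≤ f' n)
    (hg : ∀ n, 0 ≤ g n) : (fun n => max (f n) (g n)) =Θ[atTop] fun n => max (f' n) (g n) := by
  have key : ∀ {f f' : ℕ → ℝ}, f =O[atTop] f' → (∀ n, 0 ≤ f n) → (∀ n, 0 ≤ f' n) →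
      (fun n => max (f n) (g n)) =O[atTop] fun n => max (f' n) (g n) := by
    intro f f' h hf hf'
    obtain ⟨C, hC⟩ := h.bound
    refine isBigO_of_le_mul (C := max C 1) (hC.mono fun n hn => ?_)
    rw [Real.norm_of_nonneg (hf n), Real.norm_of_nonneg (hf' n)] at hn
    refine ⟨le_max_of_le_right (hg n), max_le ?_ ?_⟩
    · refine hn.trans (mul_le_mul (le_max_left _ _) (le_max_left _ _) (hf' n) ?_)
      exact le_max_of_le_right zero_le_one
    · refine (le_max_right (f' n) (g n)).trans (le_mul_of_one_le_left ?_ (le_max_right _ _))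
      exact le_max_of_le_right (hg n)
  exact ⟨key h.1 hf hf', key h.2 hf' hf⟩

lemma one_div_mul_sameOrder {v w : ℕ → ℝ} (hυ : SameOrder υ v) (hω : SameOrder ω w)
    (hv : ∀ j, 1 ≤ j → 0 < v j) (hw : ∀ j, 1 ≤ j → 0 < w j) :
    SameOrder (fun j => 1 / (υ j * ω j)) fun j => (v j * w j)⁻¹ :=
  ((hυ.mul hω hv hw).inv fun _ hj => mul_pos (hv _ hj) (hw _ hj)).congr
    (fun _ _ => (one_div _).symm) fun _ _ => rfl

variable (hγ : IsWeight γ) (hυ : IsWeight υ) (hk : IsOptimalDim γ υ k) (hκ : 0 < kappa γ υ k)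
  (hω : IsWeight ω)

include hγ hυ hk hκ hω

/-- Powers are monotone, so the maximum over `j ≤ m` is attained at `j = m` or at `j = 1` up to a
constant. -/
lemma DeltaStar_isTheta_of_poly (hυo : SameOrder υ fun j => (j : ℝ) ^ (-(2 * a)))
    (hωo : SameOrder ω fun j => (j : ℝ) ^ (2 * s)) :
    (fun n => DeltaStar γ υ k ω n) =Θ[atTop]
      fun n : ℕ => (n : ℝ)⁻¹ * max ((k n : ℝ) ^ (2 * a - 2 * s)) 1 := by
  have hpos : ∀ (x : ℝ) (j : ℕ), 1 ≤ j → 0 < (j : ℝ) ^ x := fun x j hj => by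
    have : (0 : ℝ) < j := by exact_mod_cast hj
    positivity
  obtain ⟨C, hC, hCo⟩ := (one_div_mul_sameOrder hυo hωo (hpos _) (hpos _)).congr (fun _ _ => rfl)
    (v' := fun j => (j : ℝ) ^ (2 * a - 2 * s)) fun j hj => by
      have : (0 : ℝ) < j := by exact_mod_cast hj
      rw [← Real.rpow_add this, ← Real.rpow_neg this.le]; ring_nf
  have hC0 : 0 < C := by linarith
  refine DeltaStar_isTheta hγ hυ hk hκ hω (G := fun m => max ((m : ℝ) ^ (2 * a - 2 * s)) 1) (C := C)
    (fun m hm j hj => ?_) (fun m hm => ?_) fun m _ => le_max_of_le_right zero_le_one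
  · refine (hCo j hj.1).2.trans (mul_le_mul_of_nonneg_left ?_ hC0.le)
    rcases le_total 0 (2 * a - 2 * s) with h0 | h0
    · have : (j : ℝ) ≤ m := by exact_mod_cast hj.2
      exact le_max_of_le_left (Real.rpow_le_rpow (by positivity) this h0)
    · exact le_max_of_le_right (Real.rpow_le_one_of_one_le_of_nonpos (by exact_mod_cast hj.1) h0)
  · rcases le_total 0 (2 * a - 2 * s) with h0 | h0
    · refine ⟨m, ⟨hm, le_rfl⟩, ?_⟩
      rw [max_eq_left (Real.one_le_rpow (by exact_mod_cast hm) h0)]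
      have := (hCo m hm).1
      rw [div_le_iff₀ hC0] at this
      linarith
    · refine ⟨1, ⟨le_rfl, hm⟩, ?_⟩
      rw [max_eq_right (Real.rpow_le_one_of_one_le_of_nonpos (by exact_mod_cast hm) h0), hυ.1, hω.1]
      linarith

lemma DeltaStar_isTheta_ppp (hpa : 0 < 2 * p + 2 * a)
    (hυo : SameOrder υ fun j => (j : ℝ) ^ (-(2 * a))) (hωo : SameOrder ω fun j => (j : ℝ) ^ (2 * s))
    (hθ : (fun n => (k n : ℝ)) =Θ[atTop] fun n : ℕ => (n : ℝ) ^ (1 / (2 * p + 2 * a))) :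
    (fun n => DeltaStar γ υ k ω n) =Θ[atTop]
      fun n : ℕ => max ((n : ℝ) ^ (-(p + s) / (p + a))) (n : ℝ)⁻¹ := by
  have h1 := isTheta_max (g := fun _ => 1) (rpow_isTheta_of_poly hθ (2 * a - 2 * s))
    (fun n => by positivity) (fun n => by positivity) fun _ => zero_le_one
  refine (DeltaStar_isTheta_of_poly hγ hυ hk hκ hω hυo hωo).trans
    (((isTheta_refl (fun n : ℕ => (n : ℝ)⁻¹) atTop).mul h1).trans_eventuallyEq ?_)
  filter_upwards [eventually_ge_atTop 1] with n hn
  have hn0 : (0 : ℝ) < n := by exact_mod_cast hn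
  rw [mul_max_of_nonneg _ _ (by positivity), mul_one]
  congr 1
  rw [← Real.rpow_neg_one, ← Real.rpow_add hn0]
  congr 1
  have : p + a ≠ 0 := by intro h; linarith
  have h2 : 2 * p + 2 * a ≠ 0 := hpa.ne'
  rw [div_eq_mul_inv, div_eq_mul_inv, show 2 * p + 2 * a = 2 * (p + a) by ring]
  field_simp
  ring

lemma DeltaStar_isTheta_epp (hυo : SameOrder υ fun j => (j : ℝ) ^ (-(2 * a)))
    (hωo : SameOrder ω fun j => (j : ℝ) ^ (2 * s))
    (hθ : (fun n => (k n : ℝ)) =Θ[atTop] fun n : ℕ => Real.log n ^ (1 / (2 * p))) :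
    (fun n => DeltaStar γ υ k ω n) =Θ[atTop]
      fun n : ℕ => max ((n : ℝ)⁻¹ * Real.log n ^ ((a - s) / p)) (n : ℝ)⁻¹ := by
  have h1 := isTheta_max (g := fun _ => 1) (rpow_isTheta_of_log hθ (2 * a - 2 * s))
    (fun n => by positivity) (fun n => Real.rpow_nonneg (Real.log_natCast_nonneg n) _)
    fun _ => zero_le_one
  refine (DeltaStar_isTheta_of_poly hγ hυ hk hκ hω hυo hωo).trans
    (((isTheta_refl (fun n : ℕ => (n : ℝ)⁻¹) atTop).mul h1).trans_eventuallyEq ?_)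
  filter_upwards with n
  rw [mul_max_of_nonneg _ _ (by positivity), mul_one, ← mul_sub, mul_div_mul_left _ _ two_ne_zero]

/-- The maximum over `j ≤ m` is attained at `j = 1` up to a constant. -/
lemma DeltaStar_isTheta_ppe (hq : 0 < q) (hυo : SameOrder υ fun j => (j : ℝ) ^ (-(2 * a)))
    (hωo : SameOrder ω fun j => Real.exp ((j : ℝ) ^ q)) :
    (fun n => DeltaStar γ υ k ω n) =Θ[atTop] fun n : ℕ => (n : ℝ)⁻¹ := by
  have hpos : ∀ (x : ℝ) (j : ℕ), 1 ≤ j → 0 < (j : ℝ) ^ x := fun x j hj => by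
    have : (0 : ℝ) < j := by exact_mod_cast hj
    positivity
  obtain ⟨C, hC, hCo⟩ := (one_div_mul_sameOrder hυo hωo (hpos _) fun _ _ => Real.exp_pos _).congr
    (fun _ _ => rfl) (v' := fun j => (j : ℝ) ^ (2 * a) * Real.exp (-(j : ℝ) ^ q)) fun j hj => by
      rw [mul_inv, Real.rpow_neg (by positivity), inv_inv, Real.exp_neg]
  obtain ⟨D, hD, hkey⟩ := exists_rpow_mul_exp_le (2 * a) hq
  have h1 := DeltaStar_isTheta hγ hυ hk hκ hω (G := fun _ => 1) (C := C * D)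
    (fun m hm j hj => ?_) (fun m hm => ⟨1, ⟨le_rfl, hm⟩, ?_⟩) fun _ _ => zero_le_one
  · simpa using h1
  · refine (hCo j hj.1).2.trans ?_
    rw [mul_one]
    refine mul_le_mul_of_nonneg_left ((hkey 1 j le_rfl hj.1).trans ?_) (by linarith)
    refine mul_le_of_le_one_right (by linarith) ?_
    simp
  · rw [hυ.1, hω.1, mul_one, div_one, mul_one]
    exact one_le_mul_of_one_le_of_one_le hC hD

/-- The maximum over `j ≤ m` is attained at `j = m` up to a constant. -/
lemma DeltaStar_isTheta_pep (hq : 0 < q) (hlim : Tendsto k atTop atTop)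
    (hυo : SameOrder υ fun j => Real.exp (-(j : ℝ) ^ q))
    (hωo : SameOrder ω fun j => (j : ℝ) ^ (2 * s))
    (hr : (fun m => υ m / γ m) =Θ[atTop] fun m => (m : ℝ) ^ (-(2 * p)) * Real.exp (-(m : ℝ) ^ q))
    (hθ : (fun n => (k n : ℝ)) =Θ[atTop] fun n : ℕ => Real.log n ^ (1 / q)) :
    (fun n => DeltaStar γ υ k ω n) =Θ[atTop]
      fun n : ℕ => Real.log n ^ (-(2 * p + 2 * s) / q) := by
  have hpos : ∀ (x : ℝ) (j : ℕ), 1 ≤ j → 0 < (j : ℝ) ^ x := fun x j hj => by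
    have : (0 : ℝ) < j := by exact_mod_cast hj
    positivity
  obtain ⟨C, hC, hCo⟩ := (one_div_mul_sameOrder hυo hωo (fun _ _ => Real.exp_pos _) (hpos _)).congr
    (fun _ _ => rfl) (v' := fun j => (j : ℝ) ^ (-(2 * s)) * Real.exp ((j : ℝ) ^ q)) fun j hj => by
      rw [mul_inv, ← Real.exp_neg, neg_neg, ← Real.rpow_neg (by positivity), mul_comm]
  have hC0 : 0 < C := by linarith
  obtain ⟨D, hD, hkey⟩ := exists_rpow_mul_exp_le_of_le (-(2 * s)) hq
  have h1 := DeltaStar_isTheta hγ hυ hk hκ hω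
    (G := fun m => (m : ℝ) ^ (-(2 * s)) * Real.exp ((m : ℝ) ^ q)) (C := C * D)
    (fun m hm j hj => ?_) (fun m hm => ⟨m, ⟨hm, le_rfl⟩, ?_⟩) fun _ _ => by positivity
  · have h2 : (fun n : ℕ => (n : ℝ)⁻¹) =Θ[atTop]
        fun n => (k n : ℝ) ^ (-(2 * p)) * Real.exp (-(k n : ℝ) ^ q) :=
      (ratio_isTheta hγ hυ hk hκ).symm.trans (isTheta_comp_tendsto hr hlim)
    refine h1.trans (IsTheta.trans ?_ (rpow_isTheta_of_log hθ (-(2 * p + 2 * s))))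
    refine (h2.mul (isTheta_refl _ _)).trans_eventuallyEq ?_
    filter_upwards [eventually_ge_atTop 1] with n hn
    have hk0 : (0 : ℝ) < k n := by exact_mod_cast (hk n hn).1
    rw [show -(2 * p + 2 * s) = -(2 * p) + -(2 * s) by ring, Real.rpow_add hk0, Real.exp_neg]
    field_simp
  · refine (hCo j hj.1).2.trans ?_
    rw [mul_assoc]
    exact mul_le_mul_of_nonneg_left (hkey j m hj.1 hj.2) hC0.le
  · have h2 := (hCo m hm).1
    rw [div_le_iff₀ hC0] at h2
    have hb : 0 < 1 / (υ m * ω m) := by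
      have := hυ.2 m hm
      have := hω.2 m hm
      positivity
    calc (m : ℝ) ^ (-(2 * s)) * Real.exp ((m : ℝ) ^ q) ≤ 1 / (υ m * ω m) * C := h2
      _ = C * 1 * (1 / (υ m * ω m)) := by ring
      _ ≤ C * D * (1 / (υ m * ω m)) := by gcongr

end Uniform

/-! ### Point evaluation and averages -/

lemma rpow_neg_two_mul_zero (j : ℕ) : (j : ℝ) ^ (-(2 * (0 : ℝ))) = 1 := by simp

lemma rpow_neg_two_mul_one (j : ℕ) : (j : ℝ) ^ (-(2 * (1 : ℝ))) = 1 / (j : ℝ) ^ 2 := by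
  rw [mul_one, Real.rpow_neg (by positivity), one_div]
  norm_cast

lemma trig_sq_le (j : ℕ) (t : ℝ) : trig j t ^ 2 ≤ 2 := by
  have h := abs_trig_le j t
  have h2 : √2 ^ 2 = (2 : ℝ) := Real.sq_sqrt (by norm_num)
  rw [← sq_abs, ← h2]
  gcongr

lemma upperOrder_pointRep (t₀ : ℝ) : UpperOrder (pointRep t₀) 0 :=
  ⟨2, by norm_num, fun j _ => by rw [rpow_neg_two_mul_zero, mul_one]; exact trig_sq_le j t₀⟩

/-- Every window of five indices starting at `j` contains `2 i, …, 2 i + 3` for `i = ⌈j / 2⌉`. -/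
lemma add_le_sum_window {f : ℕ → ℝ} (hf : ∀ j, 0 ≤ f j) {j i : ℕ} (hi : i = (j + 1) / 2) :
    f (2 * i) + f (2 * i + 1) + (f (2 * (i + 1)) + f (2 * (i + 1) + 1))
      ≤ ∑ l ∈ Finset.range 5, f (j + l) := by
  simp only [Finset.sum_range_succ, Finset.sum_range_zero]
  rcases Nat.even_or_odd' j with ⟨r, rfl | rfl⟩
  · have : i = r := by omega
    subst this
    have := hf (2 * i + 4)
    rw [show 2 * (i + 1) = 2 * i + 2 by ring]
    simp only [add_zero, zero_add, add_assoc]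
    norm_num
    linarith
  · have : i = r + 1 := by omega
    subst this
    have := hf (2 * r + 1)
    rw [show 2 * (r + 1) = 2 * r + 1 + 1 by ring, show 2 * (r + 1 + 1) = 2 * r + 1 + 3 by ring]
    simp only [add_zero, zero_add, add_assoc]
    norm_num
    linarith

/-- The two coefficients at one frequency have squares `2 cos² + 2 sin²`. -/
lemma windowOrder_pointRep (t₀ : ℝ) : WindowOrder (pointRep t₀) 0 := by
  refine ⟨1, one_pos, fun j hj => ?_⟩
  rw [rpow_neg_two_mul_zero, one_mul]
  refine le_trans ?_ (add_le_sum_window (f := fun j => pointRep t₀ j ^ 2) (fun _ => sq_nonneg _) rfl)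
  set i := (j + 1) / 2 with hi
  have hi1 : 1 ≤ i := by omega
  have h1 : pointRep t₀ (2 * i) ^ 2 + pointRep t₀ (2 * i + 1) ^ 2 = 2 := by
    simp only [pointRep, trig_even hi1, trig_odd hi1, mul_pow]
    rw [← mul_add, Real.cos_sq_add_sin_sq, mul_one]
    exact Real.sq_sqrt (by norm_num)
  have h2 : 0 ≤ pointRep t₀ (2 * (i + 1)) ^ 2 + pointRep t₀ (2 * (i + 1) + 1) ^ 2 := by positivity
  linarith

lemma averageRep_even {i : ℕ} (hi : 1 ≤ i) (b : ℝ) :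
    averageRep b (2 * i) = √2 * (Real.sin (2 * Real.pi * i * b) / (2 * Real.pi * i)) := by
  have hi0 : (0 : ℝ) < i := by exact_mod_cast hi
  have hc : 2 * Real.pi * i ≠ 0 := by positivity
  simp only [averageRep, trig_even hi]
  rw [intervalIntegral.integral_const_mul,
    intervalIntegral.integral_comp_mul_left (fun x => Real.cos x) hc, integral_cos]
  simp [div_eq_inv_mul]

lemma averageRep_odd {i : ℕ} (hi : 1 ≤ i) (b : ℝ) :
    averageRep b (2 * i + 1)
      = √2 * ((1 - Real.cos (2 * Real.pi * i * b)) / (2 * Real.pi * i)) := by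
  have hi0 : (0 : ℝ) < i := by exact_mod_cast hi
  have hc : 2 * Real.pi * i ≠ 0 := by positivity
  simp only [averageRep, trig_odd hi]
  rw [intervalIntegral.integral_const_mul,
    intervalIntegral.integral_comp_mul_left (fun x => Real.sin x) hc, integral_sin]
  simp [div_eq_inv_mul]

/-- The two coefficients of the indicator function at frequency `i`. -/
lemma averageRep_sq_add_sq {i : ℕ} (hi : 1 ≤ i) (b : ℝ) :
    averageRep b (2 * i) ^ 2 + averageRep b (2 * i + 1) ^ 2
      = 2 * Real.sin (Real.pi * i * b) ^ 2 / (Real.pi * i) ^ 2 := by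
  have hi0 : (0 : ℝ) < i := by exact_mod_cast hi
  have hpi := Real.pi_pos
  rw [averageRep_even hi, averageRep_odd hi, mul_pow, mul_pow, Real.sq_sqrt (by norm_num),
    show 2 * Real.pi * i * b = 2 * (Real.pi * i * b) by ring]
  set x := Real.pi * i * b
  have h1 : Real.sin (2 * x) ^ 2 + (1 - Real.cos (2 * x)) ^ 2 = 4 * Real.sin x ^ 2 := by
    rw [Real.sin_two_mul, Real.cos_two_mul']
    have h := Real.sin_sq_add_cos_sq x
    have h2 : Real.cos x ^ 2 = 1 - Real.sin x ^ 2 := by linarith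
    rw [mul_pow, mul_pow, h2]
    ring
  rw [div_pow, div_pow, ← mul_add, ← add_div, h1]
  field_simp
  ring

lemma upperOrder_averageRep {b : ℝ} (hb : b ∈ Ioo (0 : ℝ) 1) : UpperOrder (averageRep b) 1 := by
  refine ⟨18, by norm_num, fun j hj => ?_⟩
  rw [rpow_neg_two_mul_one]
  rcases hj.eq_or_lt with rfl | hj2
  · have : averageRep b 1 = b := by simp [averageRep, trig_one]
    rw [this]
    norm_num
    nlinarith [hb.1, hb.2]
  · have hj0 : (0 : ℝ) < j := by exact_mod_cast hj
    obtain ⟨i, hi, hij, hle⟩ : ∃ i : ℕ, 1 ≤ i ∧ j ≤ 3 * i ∧ averageRep b j ^ 2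
        ≤ averageRep b (2 * i) ^ 2 + averageRep b (2 * i + 1) ^ 2 := by
      rcases Nat.even_or_odd' j with ⟨r, rfl | rfl⟩
      · exact ⟨r, by omega, by omega, le_add_of_nonneg_right (sq_nonneg _)⟩
      · exact ⟨r, by omega, by omega, le_add_of_nonneg_left (sq_nonneg _)⟩
    have hi0 : (0 : ℝ) < i := by exact_mod_cast hi
    have hij' : (j : ℝ) ≤ 3 * i := by exact_mod_cast hij
    have hpi : 1 ≤ Real.pi := by linarith [Real.pi_gt_three]
    rw [averageRep_sq_add_sq hi] at hle
    refine hle.trans ?_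
    rw [mul_one_div, div_le_div_iff₀ (by positivity) (by positivity)]
    calc 2 * Real.sin (Real.pi * i * b) ^ 2 * (j : ℝ) ^ 2 ≤ 2 * 1 * (3 * i) ^ 2 := by
          gcongr
          exact Real.sin_sq_le_one _
      _ = 18 * (1 * (i : ℝ)) ^ 2 := by ring
      _ ≤ 18 * (Real.pi * i) ^ 2 := by gcongr

/-- The coefficients at one frequency may both vanish (if `i b` is an integer), but not those at two
consecutive frequencies. -/
lemma windowOrder_averageRep {b : ℝ} (hb : b ∈ Ioo (0 : ℝ) 1) : WindowOrder (averageRep b) 1 := by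
  have hpi := Real.pi_pos
  have hs : 0 < Real.sin (Real.pi * b) := Real.sin_pos_of_pos_of_lt_pi (by nlinarith [hb.1])
    (by nlinarith [hb.2])
  refine ⟨4 * Real.pi ^ 2 / Real.sin (Real.pi * b) ^ 2, by positivity, fun j hj => ?_⟩
  rw [rpow_neg_two_mul_one]
  have hj0 : (0 : ℝ) < j := by exact_mod_cast hj
  have hwin := add_le_sum_window (f := fun j => averageRep b j ^ 2) (fun _ => sq_nonneg _)
    (j := j) (i := (j + 1) / 2) rfl
  set i := (j + 1) / 2 with hi
  have hi1 : 1 ≤ i := by omega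
  have hi0 : (0 : ℝ) < i := by exact_mod_cast hi1
  rw [averageRep_sq_add_sq hi1, averageRep_sq_add_sq (by omega : 1 ≤ i + 1)] at hwin
  have hij : ((i + 1 : ℕ) : ℝ) ≤ 2 * j := by exact_mod_cast (by omega : i + 1 ≤ 2 * j)
  have hij' : (i : ℝ) ≤ 2 * j := by exact_mod_cast (by omega : i ≤ 2 * j)
  set A := Real.pi * ((i + 1 : ℕ) : ℝ) * b with hA
  set B := Real.pi * i * b with hB
  -- two consecutive frequencies cannot both be close to a multiple of `1 / b`
  have hAB : Real.sin (Real.pi * b) ^ 2 ≤ 2 * (Real.sin B ^ 2 + Real.sin A ^ 2) := by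
    have h1 : Real.pi * b = A - B := by rw [hA, hB]; push_cast; ring
    rw [h1, Real.sin_sub]
    have c1 := Real.cos_sq_le_one A
    have c2 := Real.cos_sq_le_one B
    nlinarith [sq_nonneg (Real.sin A * Real.cos B + Real.cos A * Real.sin B), sq_nonneg (Real.sin A),
      sq_nonneg (Real.sin B)]
  have h1 : 2 * Real.sin B ^ 2 / (Real.pi * (2 * j)) ^ 2 ≤ 2 * Real.sin B ^ 2 / (Real.pi * i) ^ 2 := by
    gcongr
  have h2 : 2 * Real.sin A ^ 2 / (Real.pi * (2 * j)) ^ 2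
      ≤ 2 * Real.sin A ^ 2 / (Real.pi * ((i + 1 : ℕ) : ℝ)) ^ 2 := by
    gcongr
  have h3 : Real.sin (Real.pi * b) ^ 2 / (Real.pi * (2 * j)) ^ 2
      ≤ ∑ l ∈ Finset.range 5, averageRep b (j + l) ^ 2 := by
    refine le_trans ?_ ((add_le_add h1 h2).trans hwin)
    rw [← add_div]
    gcongr
    linarith
  calc 1 / (j : ℝ) ^ 2 = 4 * Real.pi ^ 2 / Real.sin (Real.pi * b) ^ 2
        * (Real.sin (Real.pi * b) ^ 2 / (Real.pi * (2 * j)) ^ 2) := by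
        field_simp
        ring
    _ ≤ _ := by gcongr

/-- Parseval for the inner product of the indicator function of `[0, b]` with `β`. -/
lemma representsAverage {b : ℝ} (hb : b ∈ Ioo (0 : ℝ) 1) : RepresentsAverage b := by
  intro β
  have hsub : Icc 0 b ⊆ Icc (0 : ℝ) 1 := Icc_subset_Icc le_rfl hb.2.le
  set f : L2 := indicatorConstLp 2 (measurableSet_Icc (a := (0 : ℝ)) (b := b))
    (measure_ne_top unitVolume _) (1 : ℝ) with hf
  have hinner : ∀ g : L2, ⟪f, g⟫ = ∫ t in (0 : ℝ)..b, g t := by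
    intro g
    rw [hf, L2.inner_indicatorConstLp_one, Measure.restrict_restrict measurableSet_Icc,
      inter_eq_left.2 hsub, integral_Icc_eq_integral_Ioc, intervalIntegral.integral_of_le hb.1.le]
  have hcoef : ∀ j, coef f j = averageRep b j := by
    intro j
    rw [coef, hinner, averageRep, intervalIntegral.integral_of_le hb.1.le,
      intervalIntegral.integral_of_le hb.1.le]
    refine integral_congr_ae ?_
    have h1 : Ioc 0 b ⊆ Icc (0 : ℝ) 1 := Ioc_subset_Icc_self.trans hsub
    exact ae_restrict_of_ae_restrict_of_subset h1 (MemLp.coeFn_toLp (memLp_trig j))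
  have h := (hasSum_coef_mul f β).tsum_eq
  rw [hinner] at h
  rw [← h, functional]
  simp only [hcoef]

/-- If `∑_j 1 / γ_j` converges, the Fourier series of `β ∈ F_γ` converges uniformly. -/
lemma representsPointEval {γ : ℕ → ℝ} (hγ : IsWeight γ) (h1 : IsRepresenter γ fun _ => 1) (t₀ : ℝ) :
    RepresentsPointEval γ t₀ := by
  intro β hβ
  have habs : Summable fun j => |coef β (j + 1)| := by
    have := (tsum_mul_sq_le (a := fun _ => 1) (b := fun j => |coef β (j + 1)|)
      (w := fun j => γ (j + 1)) (fun j => hγ.2 _ (by omega)) h1 (by simpa using hβ)).1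
    simpa using this
  set F : ℕ → ℝ → ℝ := fun i t => coef β (i + 1) * trig (i + 1) t with hF
  have hFle : ∀ i t, ‖F i t‖ ≤ √2 * |coef β (i + 1)| := fun i t => by
    rw [Real.norm_eq_abs, abs_mul, mul_comm]
    exact mul_le_mul_of_nonneg_right (abs_trig_le _ _) (abs_nonneg _)
  have hbd : Summable fun i => √2 * |coef β (i + 1)| := habs.mul_left _
  have hFc : ∀ i, Continuous (F i) := fun i => continuous_const.mul (continuous_trig _)
  set f : ℝ → ℝ := fun t => ∑' i, F i t with hf
  have hfc : Continuous f := continuous_tsum hFc hbd hFle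
  refine ⟨f, hfc.continuousOn, ?_, ?_⟩
  · have hfm : MemLp f 2 unitVolume := MemLp.of_bound hfc.aestronglyMeasurable
      (∑' i, √2 * |coef β (i + 1)|) (Eventually.of_forall fun t =>
        tsum_of_norm_bounded hbd.hasSum fun i => hFle i t)
    have hae : hfm.toLp f =ᵐ[unitVolume] f := hfm.coeFn_toLp
    have heq : hfm.toLp f = β := by
      refine eq_of_coef_eq fun j => ?_
      have e1 : coef (hfm.toLp f) (j + 1) = ∫ t, trig (j + 1) t * f t ∂unitVolume := by
        rw [coef, L2.inner_def]
        refine integral_congr_ae ?_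
        filter_upwards [hae, (memLp_trig (j + 1)).coeFn_toLp] with t h1 h2
        rw [h1, psi, h2]
        simp
      have e2 : ∀ i, ∫ t, trig (j + 1) t * F i t ∂unitVolume
          = coef β (i + 1) * ⟪psi (i + 1), psi (j + 1)⟫ := by
        intro i
        rw [L2.inner_def, ← integral_const_mul]
        refine integral_congr_ae ?_
        filter_upwards [(memLp_trig (i + 1)).coeFn_toLp, (memLp_trig (j + 1)).coeFn_toLp] with t h1 h2
        rw [psi, psi, h1, h2]
        simp [hF]
        ring
      have hint : ∀ i, Integrable (fun t => trig (j + 1) t * F i t) unitVolume := fun i =>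
        (((continuous_trig (j + 1)).mul (hFc i)).continuousOn (s := Icc (0 : ℝ) 1)).integrableOn_Icc
      have hsum : Summable fun i => ∫ t, ‖trig (j + 1) t * F i t‖ ∂unitVolume := by
        refine Summable.of_nonneg_of_le (fun i => integral_nonneg fun t => norm_nonneg _)
          (fun i => ?_) (hbd.mul_left (√2))
        have : ∀ t, ‖trig (j + 1) t * F i t‖ ≤ √2 * (√2 * |coef β (i + 1)|) := fun t => by
          rw [norm_mul]
          exact mul_le_mul (abs_trig_le _ _) (hFle i t) (norm_nonneg _) (by positivity)
        refine (integral_mono (hint i).norm (integrable_const _) this).trans (le_of_eq ?_)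
        simp
      have h2 := hasSum_integral_of_summable_integral_norm hint hsum
      rw [e1]
      simp only [hf, ← tsum_mul_left]
      rw [← h2.tsum_eq]
      simp only [e2]
      rw [tsum_eq_single j fun i hi => ?_]
      · rw [inner_psi_eq_ite (by omega) (by omega)]
        simp
      · rw [inner_psi_eq_ite (by omega) (by omega), if_neg (by omega), mul_zero]
    rw [← heq]
    exact hae
  · rw [functional, hf]
    exact tsum_congr fun i => mul_comm _ _

lemma upperOrder_one : UpperOrder (fun _ => 1) 0 :=
  ⟨1, one_pos, fun j _ => by rw [rpow_neg_two_mul_zero]; norm_num⟩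

/-! ### The order of the ratio `υ / γ` -/

section Ratio

variable {γ υ : ℕ → ℝ} {p a q : ℝ}

lemma natCast_rpow_pos (x : ℝ) (j : ℕ) (hj : 1 ≤ j) : 0 < (j : ℝ) ^ x := by
  have : (0 : ℝ) < j := by exact_mod_cast hj
  positivity

lemma ratio_sameOrder_poly (hγo : SameOrder γ fun j => (j : ℝ) ^ (2 * p))
    (hυo : SameOrder υ fun j => (j : ℝ) ^ (-(2 * a))) :
    SameOrder (fun m => υ m / γ m) fun m => (m : ℝ) ^ (-(2 * p + 2 * a)) :=
  (hυo.div hγo (natCast_rpow_pos _) (natCast_rpow_pos _)).congr (fun _ _ => rfl) fun j hj => by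
    rw [← Real.rpow_sub (by exact_mod_cast hj)]
    ring_nf

lemma ratio_sameOrder_of_exp_num (hγo : SameOrder γ fun j => (j : ℝ) ^ (2 * p))
    (hυo : SameOrder υ fun j => Real.exp (-(j : ℝ) ^ q)) :
    SameOrder (fun m => υ m / γ m) fun m => (m : ℝ) ^ (-(2 * p)) * Real.exp (-(m : ℝ) ^ q) :=
  (hυo.div hγo (fun _ _ => Real.exp_pos _) (natCast_rpow_pos _)).congr (fun _ _ => rfl)
    fun j hj => by rw [Real.rpow_neg (by positivity), div_eq_inv_mul]

lemma ratio_sameOrder_of_exp_den (hγo : SameOrder γ fun j => Real.exp ((j : ℝ) ^ q))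
    (hυo : SameOrder υ fun j => (j : ℝ) ^ (-(2 * a))) :
    SameOrder (fun m => υ m / γ m) fun m => (m : ℝ) ^ (-(2 * a)) * Real.exp (-(m : ℝ) ^ q) :=
  (hυo.div hγo (natCast_rpow_pos _) fun _ _ => Real.exp_pos _).congr (fun _ _ => rfl)
    fun j hj => by rw [Real.exp_neg, div_eq_mul_inv]

end Ratio

end FunctionalLinearModel

end

open FunctionalLinearModel in
theorem mainTheorem4
    (d η ρ σ τ : ℝ) (hd : 1 ≤ d) (hη : 1 ≤ η) (hρ : 0 < ρ) (hσ : 0 < σ) (hτ : 0 < τ)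
    (K : ℕ) (hK : 3 ≤ K)
    (γ υ : ℕ → ℝ) (hγ : IsWeight γ) (hγ_mono : MonotoneOn γ (Set.Ici 1))
    (hυ : IsWeight υ) (hυ_anti : AntitoneOn υ (Set.Ici 1))
    (k : ℕ → ℕ) (hk : IsOptimalDim γ υ k) (p a : ℝ) :
    -- case (ppp)
    (0 ≤ p → 1 / 2 < a → 12 ≤ K → 3 / 2 ≤ p + a →
      SameOrder γ (fun j => (j : ℝ) ^ (2 * p)) →
      SameOrder υ (fun j => (j : ℝ) ^ (-(2 * a))) →
      0 < kappa γ υ k ∧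
      (fun n => (k n : ℝ)) =Θ[Filter.atTop] (fun n : ℕ => (n : ℝ) ^ (1 / (2 * p + 2 * a))) ∧
      (∀ (s : ℝ) (h : ℕ → ℝ), 1 / 2 - p < s →
        SameOrder (fun j => h j ^ 2) (fun j => (j : ℝ) ^ (-(2 * s))) →
        AttainsPointwise γ υ k d η ρ σ (4 * K) h (ratePPP p a s)) ∧
      (∀ (s : ℝ) (ω : ℕ → ℝ), -p < s → IsWeight ω →
        SameOrder ω (fun j => (j : ℝ) ^ (2 * s)) →
        AttainsUniform γ υ k d η ρ σ τ (4 * K) ω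
          (fun n => max ((n : ℝ) ^ (-(p + s) / (p + a))) (n : ℝ)⁻¹)) ∧
      (1 / 2 < p → ∀ t₀ ∈ Set.Icc (0 : ℝ) 1, RepresentsPointEval γ t₀ ∧
        AttainsPointwise γ υ k d η ρ σ (4 * K) (pointRep t₀)
          (fun n => (n : ℝ) ^ (-(2 * p - 1) / (2 * p + 2 * a)))) ∧
      (∀ b ∈ Set.Ioo (0 : ℝ) 1, RepresentsAverage b ∧
        AttainsPointwise γ υ k d η ρ σ (4 * K) (averageRep b)
          (fun n => (n : ℝ) ^ (-(2 * p + 1) / (2 * p + 2 * a))))) ∧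
    -- case (pep)
    (0 ≤ p → 0 < a →
      SameOrder γ (fun j => (j : ℝ) ^ (2 * p)) →
      SameOrder υ (fun j => Real.exp (-(j : ℝ) ^ (2 * a))) →
      (a ≤ 1 / 2 → 0 < kappa γ υ k) ∧
      (0 < kappa γ υ k →
        (fun n => (k n : ℝ)) =Θ[Filter.atTop]
          (fun n : ℕ => Real.log (n * Real.log n ^ (-p / a)) ^ (1 / (2 * a))) ∧
        (∀ (s : ℝ) (h : ℕ → ℝ), 1 / 2 - p < s →
          SameOrder (fun j => h j ^ 2) (fun j => (j : ℝ) ^ (-(2 * s))) →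
          AttainsPointwise γ υ k d η ρ σ (4 * K) h
            (fun n => Real.log n ^ (-(2 * p + 2 * s - 1) / (2 * a)))) ∧
        (∀ (s : ℝ) (ω : ℕ → ℝ), -p < s → IsWeight ω →
          SameOrder ω (fun j => (j : ℝ) ^ (2 * s)) →
          AttainsUniform γ υ k d η ρ σ τ (4 * K) ω
            (fun n => Real.log n ^ (-(p + s) / a))) ∧
        (1 / 2 < p → ∀ t₀ ∈ Set.Icc (0 : ℝ) 1, RepresentsPointEval γ t₀ ∧
          AttainsPointwise γ υ k d η ρ σ (4 * K) (pointRep t₀)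
            (fun n => Real.log n ^ (-(2 * p - 1) / (2 * a)))) ∧
        (∀ b ∈ Set.Ioo (0 : ℝ) 1, RepresentsAverage b ∧
          AttainsPointwise γ υ k d η ρ σ (4 * K) (averageRep b)
            (fun n => Real.log n ^ (-(2 * p + 1) / (2 * a)))))) ∧
    -- case (epp)
    (0 < p → 0 < a →
      SameOrder γ (fun j => Real.exp ((j : ℝ) ^ (2 * p))) →
      SameOrder υ (fun j => (j : ℝ) ^ (-(2 * a))) →
      (p ≤ 1 / 2 → 0 < kappa γ υ k) ∧
      (0 < kappa γ υ k →
        (fun n => (k n : ℝ)) =Θ[Filter.atTop]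
          (fun n : ℕ => Real.log (n * Real.log n ^ (-a / p)) ^ (1 / (2 * p))) ∧
        (∀ (s : ℝ) (h : ℕ → ℝ),
          SameOrder (fun j => h j ^ 2) (fun j => (j : ℝ) ^ (-(2 * s))) →
          AttainsPointwise γ υ k d η ρ σ (4 * K) h (rateEPP p a s)) ∧
        (∀ (s : ℝ) (ω : ℕ → ℝ), IsWeight ω →
          SameOrder ω (fun j => (j : ℝ) ^ (2 * s)) →
          AttainsUniform γ υ k d η ρ σ τ (4 * K) ω
            (fun n => max ((n : ℝ)⁻¹ * Real.log n ^ ((a - s) / p)) (n : ℝ)⁻¹)) ∧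
        (∀ t₀ ∈ Set.Icc (0 : ℝ) 1, RepresentsPointEval γ t₀ ∧
          AttainsPointwise γ υ k d η ρ σ (4 * K) (pointRep t₀)
            (fun n => (n : ℝ)⁻¹ * Real.log n ^ ((2 * a + 1) / (2 * p)))) ∧
        (1 / 2 < a → ∀ b ∈ Set.Ioo (0 : ℝ) 1, RepresentsAverage b ∧
          AttainsPointwise γ υ k d η ρ σ (4 * K) (averageRep b)
            (fun n => (n : ℝ)⁻¹ * Real.log n ^ ((2 * a - 1) / (2 * p)))))) ∧
    -- case (ppe)
    (0 ≤ p → 1 / 2 < a → 12 ≤ K → 3 / 2 ≤ p + a →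
      SameOrder γ (fun j => (j : ℝ) ^ (2 * p)) →
      SameOrder υ (fun j => (j : ℝ) ^ (-(2 * a))) →
      0 < kappa γ υ k ∧
      (fun n => (k n : ℝ)) =Θ[Filter.atTop] (fun n : ℕ => (n : ℝ) ^ (1 / (2 * p + 2 * a))) ∧
      (∀ (s : ℝ) (h : ℕ → ℝ), 0 < s →
        SameOrder (fun j => h j ^ 2) (fun j => Real.exp (-(j : ℝ) ^ (2 * s))) →
        AttainsPointwise γ υ k d η ρ σ (4 * K) h (fun n => (n : ℝ)⁻¹)) ∧
      (∀ (s : ℝ) (ω : ℕ → ℝ), 0 < s → IsWeight ω →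
        SameOrder ω (fun j => Real.exp ((j : ℝ) ^ (2 * s))) →
        AttainsUniform γ υ k d η ρ σ τ (4 * K) ω (fun n => (n : ℝ)⁻¹))) := by
  refine ⟨fun hp ha hK12 hpa hγo hυo => ?_, fun hp ha hγo hυo => ?_, fun hp ha hγo hυo => ?_,
    fun hp ha hK12 hpa hγo hυo => ?_⟩
  · have hr := ratio_sameOrder_poly hγo hυo
    have hκ := kappa_pos_of_poly hγ hυ hk (by linarith) hr
    have hlim := tendsto_dim hγ hυ hk hκ hγ_mono hυ_anti
    have hθ := dim_isTheta_of_poly hγ hυ hk hκ hγ_mono hυ_anti (by linarith)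
      (hr.isTheta fun j _ => by positivity)
    -- the exponent `8` of this bound has to be at most `K`
    obtain ⟨C₀, hC₀⟩ := exists_sample_bound_of_poly (by linarith) hθ
    have key : ∀ {s : ℝ} {h : ℕ → ℝ}, 1 < 2 * s + 2 * p → UpperOrder h s → WindowOrder h s →
        AttainsPointwise γ υ k d η ρ σ (4 * K) h (ratePPP p a s) := fun hs hu hw =>
      attainsPointwise_of_isTheta hd hη hρ hσ hK hγ hγ_mono hυ hυ_anti hk hκ (by norm_num)
        (by linarith) hC₀ (isRepresenter_of_poly hγ hγo hu hs).1
        (deltaStar_isTheta_ppp hγ hυ hk hκ hlim (by linarith) hp hυ_anti hγo hυo hu hw hs hθ)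
    -- point evaluation corresponds to `s = 0` and averages to `s = 1`
    refine ⟨hκ, hθ, fun s h hs hh => key (by linarith) hh.upperOrder hh.windowOrder,
      fun s ω hs hω hωo => ?_, fun hp1 t₀ _ => ⟨?_, ?_⟩, fun b hb => ⟨representsAverage hb, ?_⟩⟩
    · obtain ⟨C₁, hC1, hC₁⟩ := (hγo.mul hωo (natCast_rpow_pos _) (natCast_rpow_pos _)).congr
        (fun _ _ => rfl) (v' := fun j => (j : ℝ) ^ (2 * p + 2 * s)) (fun j hj => by
          rw [← Real.rpow_add (by exact_mod_cast hj)]) |>.exists_le_mul le_rfl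
        fun m j _ hmj => natCast_rpow_le (by linarith) hmj
      exact attainsUniform_of_isTheta hd hη hρ hσ hτ hK hγ hγ_mono hυ hυ_anti hk hκ (by norm_num)
        (by linarith) hC₀ hω hC1 hC₁
        (DeltaStar_isTheta_ppp hγ hυ hk hκ hω (by linarith) hυo hωo hθ)
    · exact representsPointEval hγ
        (isRepresenter_of_poly hγ hγo upperOrder_one (by linarith)).1 t₀
    · convert key (by linarith) (upperOrder_pointRep t₀) (windowOrder_pointRep t₀) using 2 with n
      rw [ratePPP, if_pos (by linarith), mul_zero, add_zero]
    · convert key (by linarith) (upperOrder_averageRep hb) (windowOrder_averageRep hb) using 2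
        with n
      rw [ratePPP, if_pos (by linarith)]
      ring_nf
  · have hr := ratio_sameOrder_of_exp_num hγo hυo
    refine ⟨fun ha2 => kappa_pos_of_exp hγ hυ hk (by linarith) (by linarith) (by linarith) hr,
      fun hκ => ?_⟩
    have hq : 0 < 2 * a := by linarith
    have hlim := tendsto_dim hγ hυ hk hκ hγ_mono hυ_anti
    have hrΘ := hr.isTheta fun j _ => by positivity
    have hθ := dim_isTheta_of_exp hγ hυ hk hκ hγ_mono hυ_anti hq hrΘ
    obtain ⟨C₀, hC₀⟩ := exists_sample_bound_of_log hθ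
    have key : ∀ {s : ℝ} {h : ℕ → ℝ}, 1 < 2 * s + 2 * p → UpperOrder h s → WindowOrder h s →
        AttainsPointwise γ υ k d η ρ σ (4 * K) h
          (fun n => Real.log n ^ (-(2 * p + 2 * s - 1) / (2 * a))) := fun hs hu hw =>
      attainsPointwise_of_isTheta hd hη hρ hσ hK hγ hγ_mono hυ hυ_anti hk hκ (by norm_num) hK hC₀
        (isRepresenter_of_poly hγ hγo hu hs).1
        (deltaStar_isTheta_pep hγ hυ hk hκ hlim hq hp hγo hυo hu hw hs hrΘ hθ)
    refine ⟨hθ.trans (log_mul_log_rpow_isTheta _),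
      fun s h hs hh => key (by linarith) hh.upperOrder hh.windowOrder,
      fun s ω hs hω hωo => ?_, fun hp1 t₀ _ => ⟨?_, ?_⟩, fun b hb => ⟨representsAverage hb, ?_⟩⟩
    · obtain ⟨C₁, hC1, hC₁⟩ := (hγo.mul hωo (natCast_rpow_pos _) (natCast_rpow_pos _)).congr
        (fun _ _ => rfl) (v' := fun j => (j : ℝ) ^ (2 * p + 2 * s)) (fun j hj => by
          rw [← Real.rpow_add (by exact_mod_cast hj)]) |>.exists_le_mul le_rfl
        fun m j _ hmj => natCast_rpow_le (by linarith) hmj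
      refine attainsUniform_of_isTheta hd hη hρ hσ hτ hK hγ hγ_mono hυ hυ_anti hk hκ (by norm_num)
        hK hC₀ hω hC1 hC₁ ?_
      rw [show -(p + s) / a = -(2 * p + 2 * s) / (2 * a) by field_simp]
      exact DeltaStar_isTheta_pep hγ hυ hk hκ hω hq hlim hυo hωo hrΘ hθ
    · exact representsPointEval hγ
        (isRepresenter_of_poly hγ hγo upperOrder_one (by linarith)).1 t₀
    · convert key (by linarith) (upperOrder_pointRep t₀) (windowOrder_pointRep t₀) using 4 with n
      ring
    · convert key (by linarith) (upperOrder_averageRep hb) (windowOrder_averageRep hb) using 4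
        with n
      ring
  · have hr := ratio_sameOrder_of_exp_den hγo hυo
    refine ⟨fun hp2 => kappa_pos_of_exp hγ hυ hk (by linarith) (by linarith) (by linarith) hr,
      fun hκ => ?_⟩
    have hq : 0 < 2 * p := by linarith
    have hlim := tendsto_dim hγ hυ hk hκ hγ_mono hυ_anti
    have hrΘ := hr.isTheta fun j _ => by positivity
    have hθ := dim_isTheta_of_exp hγ hυ hk hκ hγ_mono hυ_anti hq hrΘ
    obtain ⟨C₀, hC₀⟩ := exists_sample_bound_of_log hθ
    have key : ∀ {s : ℝ} {h : ℕ → ℝ}, UpperOrder h s → WindowOrder h s →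
        AttainsPointwise γ υ k d η ρ σ (4 * K) h (rateEPP p a s) := fun hu hw =>
      attainsPointwise_of_isTheta hd hη hρ hσ hK hγ hγ_mono hυ hυ_anti hk hκ (by norm_num) hK hC₀
        (isRepresenter_of_exp hγ hq hγo hu).1
        (deltaStar_isTheta_epp hγ hυ hk hκ hlim hp hυ_anti hγo hυo hu hw hrΘ hθ)
    refine ⟨hθ.trans (log_mul_log_rpow_isTheta _),
      fun s h hh => key hh.upperOrder hh.windowOrder,
      fun s ω hω hωo => ?_, fun t₀ _ => ⟨?_, ?_⟩, fun ha2 b hb => ⟨representsAverage hb, ?_⟩⟩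
    · obtain ⟨D, hD, hmon⟩ := exists_rpow_mul_exp_le_of_le (2 * s) hq
      obtain ⟨C₁, hC1, hC₁⟩ := (hγo.mul hωo (fun _ _ => Real.exp_pos _)
        (natCast_rpow_pos _)).exists_le_mul hD fun m j hm hmj => by
          simpa only [mul_comm (Real.exp _)] using hmon m j hm hmj
      exact attainsUniform_of_isTheta hd hη hρ hσ hτ hK hγ hγ_mono hυ hυ_anti hk hκ (by norm_num)
        hK hC₀ hω hC1 hC₁ (DeltaStar_isTheta_epp hγ hυ hk hκ hω hυo hωo hθ)
    · exact representsPointEval hγ (isRepresenter_of_exp hγ hq hγo upperOrder_one).1 t₀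
    · convert key (upperOrder_pointRep t₀) (windowOrder_pointRep t₀) using 2 with n
      rw [rateEPP, if_pos (by linarith), mul_zero, sub_zero]
    · convert key (upperOrder_averageRep hb) (windowOrder_averageRep hb) using 2 with n
      rw [rateEPP, if_pos (by linarith)]
      ring_nf
  · have hr := ratio_sameOrder_poly hγo hυo
    have hκ := kappa_pos_of_poly hγ hυ hk (by linarith) hr
    have hlim := tendsto_dim hγ hυ hk hκ hγ_mono hυ_anti
    have hθ := dim_isTheta_of_poly hγ hυ hk hκ hγ_mono hυ_anti (by linarith)
      (hr.isTheta fun j _ => by positivity)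
    obtain ⟨C₀, hC₀⟩ := exists_sample_bound_of_poly (by linarith) hθ
    refine ⟨hκ, hθ, fun s h hs hh => ?_, fun s ω hs hω hωo => ?_⟩
    · -- such an `h` decays faster than `j ^ (-(a + 1))`, so the parametric rate applies
      have hu := upperOrder_of_exp (by linarith) hh (a + 1)
      have h1 : 0 < h 1 ^ 2 := by
        obtain ⟨C, hC, hh⟩ := hh
        exact lt_of_lt_of_le (div_pos (Real.exp_pos _) (by linarith)) (hh 1 le_rfl).1
      exact attainsPointwise_of_isTheta hd hη hρ hσ hK hγ hγ_mono hυ hυ_anti hk hκ (by norm_num)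
        (by linarith) hC₀ (isRepresenter_of_poly hγ hγo hu (by linarith)).1
        (deltaStar_isTheta_inv hγ hυ hk hκ hlim (by linarith) hp hγo hυo hu (by linarith)
          (by linarith) h1 hθ)
    · have hq : 0 < 2 * s := by linarith
      obtain ⟨D, hD, hmon⟩ := exists_rpow_mul_exp_le_of_le (2 * p) hq
      obtain ⟨C₁, hC1, hC₁⟩ := (hγo.mul hωo (natCast_rpow_pos _)
        fun _ _ => Real.exp_pos _).exists_le_mul hD hmon
      exact attainsUniform_of_isTheta hd hη hρ hσ hτ hK hγ hγ_mono hυ hυ_anti hk hκ (by norm_num)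
        (by linarith) hC₀ hω hC1 hC₁ (DeltaStar_isTheta_ppe hγ hυ hk hκ hω hq hυo hωo)
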